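/- **Setting.** Write $x^\perp=(-x_2,x_1)$, $\mathbb T=\mathbb R/2\pi\mathbb Z$, and let $0<\alpha<\frac12$. The velocity generated by a bounded set $A\subset\mathbb R^2$ is $v_A(x)=\int_A \frac{(x-y)^\perp}{|x-y|^{2+2\alpha}}\,dy$. An *$\alpha$-patch* on $[0,T]$, $T>0$, is a family $(\Omega_t)_{t\in[0,T]}$ of bounded domains, each bounded by a simple closed curve, such that $\int_{\Omega_0}\varphi(\cdot,0)\,dx=-\int_0^T\int_{\Omega_t}(\partial_t\varphi+v_{\Omega_t}\cdot\nabla\varphi)\,dx\,dt$ for all $\varphi\in C_c^\infty(\mathbb R^2\times[0,T))$. It is a $W^{2,p}$ $\alpha$-patch if the arc-length parametrizations of $\partial\Omega_t$ are bounded in $W^{2,p}$ uniformly in $t\in[0,T]$. A *flow* of the patch is a map $\gamma:\mathbb T\times[0,T]\to\mathbb R^2$ such that each $\gamma(\cdot,t)$ is a counterclockwise $C^1$ parametrization of $\partial\Omega_t$ with $|\partial_x\gamma|>0$ (injective on $\mathbb T$), and $\partial_t\gamma=v_{\Omega_t}(\gamma,t)$. Put $g=|\partial_x\gamma|$, and let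 $\kappa(x,t)$ be the curvature of $\partial\Omega_t$ at $\gamma(x,t)$ (that is, $\partial_s\mathbf T=-\kappa\mathbf N$ with $\mathbf N=-\mathbf T^\perp$ the outer normal), which is an $L^p$ function of $x$ for each $t$. Let $\mathcal L_\alpha f=\sum_{k\in\mathbb Z}ik|k|^{2\alpha-1}\hat f_k e^{ikx}$, where $f=\sum_k\hat f_ke^{ikx}$. Fix an even $\psi\in C_c^\infty(\mathbb R)$ with $\psi=1$ on $\{|\xi|<\frac34\}$ and $\operatorname{supp}\psi\subset\{|\xi|<1\}$; put $\psi_{-1}(\xi)=\psi(\xi)$, $\psi_q(\xi)=\psi(2^{-q-1}\xi)-\psi(2^{-q}\xi)$ for $q\ge0$, $\Delta_qf=\sum_{k\in\mathbb Z}\psi_q(k)\hat f_ke^{ikx}$, and $|f|_{B^s_{r,1}}=\sum_{q\ge-1}2^{qs}|\Delta_qf|_{L^r(\mathbb T)}$. **Theorem.** Let $0<\alpha<\frac12$. There is a constant $c_\alpha>0$, depending only on $\alpha$, such that the following holds. Let $\frac1{1-2\alpha}<p\le\infty$, let $p'$ be the Hölder dual of $p$, and let $\sigma=1-\frac1p-2\alpha$.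 Let $s\ge\max(2\alpha-\sigma,0)$, with $s>0$ unless $2\alpha-\sigma<0$ (so $s=2\alpha-\sigma$ is allowed whenever $2\alpha-\sigma>0$). Let $\Omega_t$ be a $W^{2,p}$ $\alpha$-patch on $[0,T]$, and let $\gamma\in C([0,T];C^{1,\sigma}(\mathbb T))$ be a flow of it. Then there are linear functionals $\mathcal E_t:C^\infty(\mathbb T)\to\mathbb R$, $t\in[0,T]$, such that for all $\phi\in C^\infty(\mathbb T\times\mathbb R)$ $$\int_{\mathbb T}\kappa(\cdot,T)\phi(\cdot,T)g(\cdot,T)\,dx-\int_{\mathbb T}\kappa(\cdot,0)\phi(\cdot,0)g(\cdot,0)\,dx=\int_0^T\!\!\int_{\mathbb T}g\,\kappa\,\partial_t\phi\,dx\,dt-c_\alpha\int_0^T\!\!\int_{\mathbb T}g^{1-2\alpha}\kappa\,\mathcal L_\alpha\phi\,dx\,dt+\int_0^T\mathcal E_t(\phi(\cdot,t))\,dt,$$ where all the time integrands are integrable on $[0,T]$, and $$|\mathcal E_t(\phi)|\le C\,|\kappa(\cdot,t)|_{L^p}\,|\phi|_{B^{s}_{p',1}}\qquad\text{for all }\phi\in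 C^\infty(\mathbb T),\ t\in[0,T].$$ The constant $C$ depends only on $\alpha$, $p$, $s$, $\psi$, the patch $(\Omega_t)_{t\in[0,T]}$, an upper bound for $\sup_t|\gamma(\cdot,t)|_{C^{1,\sigma}}$ and a positive lower bound for $g$. -/

import Mathlib

open MeasureTheory Filter Topology
open scoped ENNReal NNReal ContDiff

noncomputable section

namespace AlphaPatch

/-- The Euclidean plane. -/
abbrev Plane : Type := EuclideanSpace ℝ (Fin 2)

/-- Counterclockwise rotation by a right angle, `(x₁, x₂) ↦ (-x₂, x₁)`. -/
def perp (x : Plane) : Plane := !₂[-x 1, x 0]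

/-! ### Domains, patches and their velocity -/

/-- A bounded domain (bounded connected open set, in particular nonempty) whose boundary is a
simple closed curve. -/
structure IsJordanDomain (A : Set Plane) : Prop where
  isOpen : IsOpen A
  isConnected : IsConnected A
  isBounded : Bornology.IsBounded A
  boundary : ∃ c : AddCircle (1 : ℝ) → Plane,
    Continuous c ∧ Function.Injective c ∧ Set.range c = frontier A

/-- The velocity `K_α * χ_A` generated by the set `A`, with
`K_α (z) = z^⊥ / |z|^(2 + 2 α)`; the integral converges absolutely for bounded `A` and
`α < 1/2`. -/
def velocity (α : ℝ) (A : Set Plane) (x : Plane) : Plane :=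
  ∫ y in A, (‖x - y‖ ^ (2 + 2 * α))⁻¹ • perp (x - y)

/-- `Ω` is an `α`-patch on `[0, T]`: a moving bounded domain whose characteristic function is a
weak solution of the `α`-SQG equation. Test functions in `C_c^∞(ℝ² × [0, T))` are the
restrictions of smooth compactly supported functions on `ℝ² × ℝ` whose support
lies in `{t < T}`. -/
structure IsAlphaPatch (α T : ℝ) (Ω : ℝ → Set Plane) : Prop where
  domain : ∀ t ∈ Set.Icc 0 T, IsJordanDomain (Ω t)
  measurable : NullMeasurableSet {z : Plane × ℝ | z.2 ∈ Set.Icc 0 T ∧ z.1 ∈ Ω z.2}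
  weak : ∀ φ : Plane × ℝ → ℝ, ContDiff ℝ ∞ φ → HasCompactSupport φ →
    (∀ z ∈ tsupport φ, z.2 < T) →
    ∫ x in Ω 0, φ (x, 0) =
      - ∫ t in (0 : ℝ)..T, ∫ x in Ω t,
          (deriv (fun τ => φ (x, τ)) t
            + fderiv ℝ (fun y => φ (y, t)) x (velocity α (Ω t) x))

/-! ### Parametrizations, Sobolev regularity and curvature of the boundary -/

/-- `γ` is a counterclockwise `C¹` parametrization with period `P` of the boundary of `A`, run
through once per period. Counterclockwise means that `A` lies to the left of the curve. -/
structure IsParam (A : Set Plane) (P : ℝ) (γ : ℝ → Plane) : Prop where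
  period_pos : 0 < P
  contDiff : ContDiff ℝ 1 γ
  periodic : Function.Periodic γ P
  deriv_ne_zero : ∀ x, deriv γ x ≠ 0
  injOn : Set.InjOn γ (Set.Ico 0 P)
  range_eq : Set.range γ = frontier A
  left : ∀ x, ∀ᶠ h in 𝓝[>] (0 : ℝ), γ x + h • perp (deriv γ x) ∈ A

/-- An arc-length parametrization; its period `L` is the length of the boundary. -/
structure IsArcParam (A : Set Plane) (L : ℝ) (Γ : ℝ → Plane) : Prop extends IsParam A L Γ where
  unit_speed : ∀ s, ‖deriv Γ s‖ = 1

/-- `w` is the weak derivative of the continuous function `f` on the line: `f` is a primitive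
of the locally integrable function `w`. -/
def IsWeakDeriv (f w : ℝ → Plane) : Prop :=
  ∀ a b : ℝ, IntervalIntegrable w volume a b ∧ f b - f a = ∫ s in a..b, w s

/-- The domain `A` has `W^{2,p}` norm at most `B`: some (equivalently, every) arc-length
parametrization `Γ` of its boundary satisfies
`|Γ|_{L^p} + |Γ'|_{L^p} + |Γ''|_{L^p} ≤ B` on `[-L/2, L/2]`. -/
def SobolevNormLE (p : ℝ≥0∞) (A : Set Plane) (B : ℝ≥0) : Prop :=
  ∃ (L : ℝ) (Γ w : ℝ → Plane), IsArcParam A L Γ ∧ IsWeakDeriv (deriv Γ) w ∧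
    eLpNorm Γ p (volume.restrict (Set.Icc (-(L / 2)) (L / 2)))
      + eLpNorm (deriv Γ) p (volume.restrict (Set.Icc (-(L / 2)) (L / 2)))
      + eLpNorm w p (volume.restrict (Set.Icc (-(L / 2)) (L / 2))) ≤ B

/-- A `W^{2,p}` `α`-patch: the `W^{2,p}` norms of the domains are bounded on `[0, T]`. -/
structure IsSobolevAlphaPatch (α : ℝ) (p : ℝ≥0∞) (T : ℝ) (Ω : ℝ → Set Plane) : Prop
    extends IsAlphaPatch α T Ω where
  bounded : ∃ B : ℝ≥0, ∀ t ∈ Set.Icc 0 T, SobolevNormLE p (Ω t) B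

/-- `κ x` is the curvature of the boundary of `A` at the point `γ x`. The curvature in
arc-length is the function `k` with `∂_s 𝐓 = - k 𝐍`, where `𝐓 = Γ'` and `𝐍 = - 𝐓^⊥` is the outer
normal; it is determined up to null sets, and any representative is allowed. -/
def IsCurvatureAlong (A : Set Plane) (γ : ℝ → Plane) (κ : ℝ → ℝ) : Prop :=
  ∃ (L : ℝ) (Γ : ℝ → Plane) (k : ℝ → ℝ), IsArcParam A L Γ ∧
    IsWeakDeriv (deriv Γ) (fun s => k s • perp (deriv Γ s)) ∧
    ∀ x s, γ x = Γ s → κ x = k s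

/-! ### The flow -/

/-- The `C^{1,σ}` norm of a periodic curve,
`sup |f| + sup |f'| + sup |f'(x) - f'(y)| / |x - y|^σ`. -/
def holderNorm (σ : ℝ) (f : ℝ → Plane) : ℝ≥0∞ :=
  (⨆ x, ‖f x‖ₑ) + (⨆ x, ‖deriv f x‖ₑ)
    + ⨆ (x : ℝ) (y : ℝ), ‖deriv f x - deriv f y‖ₑ / ‖x - y‖ₑ ^ σ

/-- `γ` (with `γ t x` the position at time `t` of the particle with label `x ∈ ℝ / 2πℤ`)
is a flow of the patch `Ω` on `[0, T]`. -/
structure IsFlow (α T : ℝ) (Ω : ℝ → Set Plane) (γ : ℝ → ℝ → Plane) : Prop where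
  param : ∀ t ∈ Set.Icc 0 T, IsParam (Ω t) (2 * Real.pi) (γ t)
  flow : ∀ x, ∀ t ∈ Set.Icc 0 T,
    HasDerivWithinAt (fun τ => γ τ x) (velocity α (Ω t) (γ t x)) (Set.Icc 0 T) t

/-- `γ ∈ C([0, T]; C^{1,σ})`. -/
def ContinuousInHolder (σ T : ℝ) (γ : ℝ → ℝ → Plane) : Prop :=
  ∀ t ∈ Set.Icc 0 T, holderNorm σ (γ t) < ⊤ ∧
    Tendsto (fun τ => holderNorm σ (fun x => γ τ x - γ t x)) (𝓝[Set.Icc 0 T] t) (𝓝 0)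

/-- The metric `g = |∂_x γ|`. -/
def metric (γ : ℝ → ℝ → Plane) (t x : ℝ) : ℝ := ‖deriv (γ t) x‖

/-! ### Fourier analysis on the torus `ℝ / 2πℤ` -/

/-- One period. -/
def torusMeasure : Measure ℝ := volume.restrict (Set.Ioc (-Real.pi) Real.pi)

/-- The test functions `C^∞(𝕋)`: smooth real `2π`-periodic functions. -/
def TestFun : Submodule ℝ (ℝ → ℝ) where
  carrier := {f | ContDiff ℝ ∞ f ∧ Function.Periodic f (2 * Real.pi)}
  add_mem' := fun hf hg => ⟨hf.1.add hg.1, hf.2.add hg.2⟩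
  zero_mem' := ⟨contDiff_const, fun _ => rfl⟩
  smul_mem' := fun c _ hf => ⟨contDiff_const.smul hf.1, fun x => by simp [hf.2 x]⟩

/-- The Fourier coefficients of `f`, normalized so that `f = ∑ f̂(k) e^{ikx}`. -/
def fourierHat (f : ℝ → ℝ) (k : ℤ) : ℂ :=
  (2 * Real.pi : ℂ)⁻¹ *
    ∫ x in (-Real.pi)..Real.pi, (f x : ℂ) * Complex.exp (-(Complex.I * k * x))

/-- The operator `ℒ_α`, the Fourier multiplier with symbol `i k |k|^(2 α - 1)` (zero for
`k = 0`). On real functions the sum is real. -/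
def dispersive (α : ℝ) (f : ℝ → ℝ) (x : ℝ) : ℝ :=
  (∑' k : ℤ, Complex.I * k * ((|(k : ℝ)| ^ (2 * α - 1) : ℝ) : ℂ) * fourierHat f k
    * Complex.exp (Complex.I * k * x)).re

/-- Admissible cutoffs for the Littlewood-Paley decomposition. -/
structure IsLPCutoff (ψ : ℝ → ℝ) : Prop where
  smooth : ContDiff ℝ ∞ ψ
  even : ∀ ξ, ψ (-ξ) = ψ ξ
  eq_one : ∀ ξ, |ξ| < 3 / 4 → ψ ξ = 1
  support : tsupport ψ ⊆ Set.Ioo (-1) 1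

/-- The dyadic cutoffs `ψ_q` for `q = n - 1 ≥ -1`: `ψ_{-1}(ξ) = ψ(ξ)` and
`ψ_q(ξ) = ψ(ξ / 2^(q+1)) - ψ(ξ / 2^q)` for `q ≥ 0`. -/
def dyadicCutoff (ψ : ℝ → ℝ) : ℕ → ℝ → ℝ
  | 0, ξ => ψ ξ
  | n + 1, ξ => ψ (ξ / 2 ^ (n + 1)) - ψ (ξ / 2 ^ n)

/-- The Littlewood-Paley block `Δ_q f` for `q = n - 1`. -/
def lpBlock (ψ : ℝ → ℝ) (n : ℕ) (f : ℝ → ℝ) (x : ℝ) : ℂ :=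
  ∑' k : ℤ, (dyadicCutoff ψ n k : ℂ) * fourierHat f k * Complex.exp (Complex.I * k * x)

/-- The norm of the Besov space `B^s_{r,1}(𝕋)`, namely `∑_{q ≥ -1} 2^(q s) |Δ_q f|_{L^r}`. -/
def besovNorm (ψ : ℝ → ℝ) (s : ℝ) (r : ℝ≥0∞) (f : ℝ → ℝ) : ℝ≥0∞ :=
  ∑' n : ℕ, ENNReal.ofReal ((2 : ℝ) ^ (((n : ℝ) - 1) * s)) * eLpNorm (lpBlock ψ n f) r torusMeasure

end AlphaPatch

end

/-! At a fixed label the unit tangent τ turns with an angular velocity ω, and gκ is the label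
derivative of the angle of τ. Formally ∂ₜ(gκ) = ∂ₓω, so testing with φ produces ∫gκ ∂ₜφ − ∫ω ∂ₓφ.
The claim is therefore that −∫ω ∂ₓφ equals −c∫g^(1−2α) κ ℒφ up to terms of lower order in φ. The
error functional is defined as the difference of the two (`errorTerm`), so that the evolution
equation is an identity and the analysis lies in the bound `exists_errorTerm_bound`.

Angular velocity. With the kernel regularized to (|x−y|²+e)^(−1−α), Green's formula `green` turns
the velocity into a boundary integral, whose increments along the boundary are integrals of
`velocityDeriv` (`RegularCurve.velocity_sub`). The factor cross(γ'(x), γ'(y)) vanishes on the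
diagonal to the order σ+2α = 1−1/p, the Hölder exponent that an L^p curvature gives to the tangent.
Against a kernel of size |z|^(−1−2α) this leaves |z|^(σ−1), integrable because σ > 0. Hence ω is
continuous in time and label. The tangent at (t,y) can be reached from (0,0) along the boundary or
in time, and comparing the two rotations gives ∂ₜ(gκ) = ∂ₓω in integrated form
(`RegularFlow.integral_curvature_eq`), with no derivative falling on κ.

Structure of ∂ₓω. Write τ(x) = (τ(x)−τ(y)) + τ(y) inside ω. The first part is quadratic in the
oscillation of τ and can be differentiated at the cost of one κ. In the second part ⟨γ(x)−γ(y),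
γ'(y)⟩ times the kernel is an exact y-derivative; integrating by parts in y brings out g(y)κ(y), and
integrating by parts in x leaves `mainKernel` against φ(x)−φ(y)
(`RegularCurve.integral_angularVelocity_mul_deriv`). All other terms are controlled by integrals of
|κ| against translates of |φ|.

The model. Near the diagonal `mainKernel` is g(y)^(−2α) z|z|^(−2−2α) with an error |z|^(σ−1−2α)
(`RegularCurve.abs_mainKernel_sub_le`). Convolution with the odd kernel z|z|^(−2−2α) on the line has
symbol ik|k|^(2α−1) times c = ∫ z|z|^(−2−2α) sin z dz > 0 (`symbolConst_mul_dispersive`,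
`symbolConst_pos`); this is the constant of the theorem.

The error. It remains to integrate |z|^(σ−1−2α) against the pairing of |κ| with |φ(y+z)−φ(y)|. On
the dyadic block of frequency 2^n, Bernstein's inequality bounds the pairing by 2 min(1, 2^n|z|)
times |κ|_p |Δφ|_{p'}, and the z-integral is then at most a constant times 2^(ns)
(`exists_lintegral_kernel_le`): by scaling if σ < 2α, trivially if σ > 2α, and with a logarithm
absorbed by s > 0 if σ = 2α. Summing absolutely over the blocks is the B^s_{p',1} norm, which is why
the endpoint s = 2α−σ is allowed. -/

noncomputable section

namespace AlphaPatch

/-! ### Planar algebra -/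

/-- The determinant of two plane vectors. -/
def cross (a b : Plane) : ℝ := a 0 * b 1 - a 1 * b 0

lemma inner_plane (a b : Plane) : inner ℝ a b = a 0 * b 0 + a 1 * b 1 := by
  simp [PiLp.inner_apply, Fin.sum_univ_two]; ring

@[simp] lemma perp_zero_apply (a : Plane) : perp a 0 = -a 1 := by simp [perp]
@[simp] lemma perp_one_apply (a : Plane) : perp a 1 = a 0 := by simp [perp]

lemma plane_ext {a b : Plane} (h0 : a 0 = b 0) (h1 : a 1 = b 1) : a = b := by
  ext i; fin_cases i <;> assumption

/-- Rotation by a right angle as a continuous linear map. -/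
def perpL : Plane →L[ℝ] Plane :=
  LinearMap.toContinuousLinearMap
    { toFun := perp
      map_add' := fun a b => plane_ext (by simp; ring) (by simp)
      map_smul' := fun c a => plane_ext (by simp) (by simp) }

lemma perp_add (a b : Plane) : perp (a + b) = perp a + perp b := perpL.map_add a b
lemma perp_sub (a b : Plane) : perp (a - b) = perp a - perp b := perpL.map_sub a b
lemma perp_smul (c : ℝ) (a : Plane) : perp (c • a) = c • perp a := perpL.map_smul c a
lemma continuous_perp : Continuous perp := perpL.continuous

lemma norm_sq_plane (a : Plane) : ‖a‖ ^ 2 = a 0 ^ 2 + a 1 ^ 2 := by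
  rw [← real_inner_self_eq_norm_sq, inner_plane]; ring

@[simp] lemma norm_perp (a : Plane) : ‖perp a‖ = ‖a‖ := by
  have : ‖perp a‖ ^ 2 = ‖a‖ ^ 2 := by
    rw [norm_sq_plane, norm_sq_plane]; simp; ring
  exact (sq_eq_sq₀ (norm_nonneg _) (norm_nonneg _)).1 this

@[simp] lemma perp_perp (a : Plane) : perp (perp a) = -a :=
  plane_ext (by simp) (by simp)

lemma inner_perp (a b : Plane) : inner ℝ (perp a) b = cross a b := by
  rw [inner_plane]; simp [cross]; ring

lemma cross_perp (a b : Plane) : cross a (perp b) = inner ℝ a b := by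
  rw [inner_plane]; simp [cross]

lemma cross_swap (a b : Plane) : cross a b = -cross b a := by simp [cross]; ring

@[simp] lemma cross_self (a : Plane) : cross a a = 0 := by simp [cross]; ring

lemma cross_smul_left (c : ℝ) (a b : Plane) : cross (c • a) b = c * cross a b := by
  simp [cross]; ring
lemma cross_smul_right (c : ℝ) (a b : Plane) : cross a (c • b) = c * cross a b := by
  simp [cross]; ring
lemma cross_sub_right (a b c : Plane) : cross a (b - c) = cross a b - cross a c := by
  simp [cross]; ring

lemma abs_cross_le (a b : Plane) : |cross a b| ≤ ‖a‖ * ‖b‖ := by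
  rw [← inner_perp]
  simpa using abs_real_inner_le_norm (perp a) b

lemma continuous_cross : Continuous fun z : Plane × Plane => cross z.1 z.2 := by
  unfold cross; fun_prop

lemma _root_.Continuous.cross {X : Type*} [TopologicalSpace X] {f g : X → Plane} (hf : Continuous f)
    (hg : Continuous g) : Continuous fun x => AlphaPatch.cross (f x) (g x) :=
  continuous_cross.comp (hf.prodMk hg)

/-- Cramer's rule in the plane. -/
lemma cross_smul_eq (a b e : Plane) : cross a b • e = cross e b • a - cross e a • b :=
  plane_ext (by simp [cross]; ring) (by simp [cross]; ring)

/-! ### Collars of a parametrized boundary -/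

variable {A : Set Plane} {P : ℝ} {γ : ℝ → Plane}

lemma IsParam.continuous (h : IsParam A P γ) : Continuous γ := h.contDiff.continuous

lemma IsParam.continuous_deriv (h : IsParam A P γ) : Continuous (deriv γ) :=
  h.contDiff.continuous_deriv le_rfl

lemma IsParam.hasDerivAt (h : IsParam A P γ) (x : ℝ) : HasDerivAt γ (deriv γ x) x :=
  (h.contDiff.differentiable one_ne_zero x).hasDerivAt

lemma IsParam.periodic_deriv (h : IsParam A P γ) : Function.Periodic (deriv γ) P := by
  intro x
  rw [← deriv_comp_add_const]
  exact congrArg (fun f => deriv f x) (funext h.periodic)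

lemma IsParam.eq_iff (h : IsParam A P γ) {x y : ℝ} :
    γ x = γ y ↔ ∃ k : ℤ, x = y + k * P := by
  constructor
  · intro hxy
    have hP := h.period_pos
    obtain ⟨x', hx', ex⟩ := h.periodic.exists_mem_Ico₀ hP x
    obtain ⟨y', hy', ey⟩ := h.periodic.exists_mem_Ico₀ hP y
    have hx2 : x = toIcoMod hP 0 x + toIcoDiv hP 0 x • P := (toIcoMod_add_toIcoDiv_zsmul hP 0 x).symm
    have hy2 : y = toIcoMod hP 0 y + toIcoDiv hP 0 y • P := (toIcoMod_add_toIcoDiv_zsmul hP 0 y).symm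
    have e1 : γ (toIcoMod hP 0 x) = γ x := by
      conv_rhs => rw [hx2]
      exact ((h.periodic.zsmul _) _).symm
    have e2 : γ (toIcoMod hP 0 y) = γ y := by
      conv_rhs => rw [hy2]
      exact ((h.periodic.zsmul _) _).symm
    have := h.injOn (by simpa using toIcoMod_mem_Ico hP 0 x) (by simpa using toIcoMod_mem_Ico hP 0 y)
      (e1.trans (hxy.trans e2.symm))
    refine ⟨toIcoDiv hP 0 x - toIcoDiv hP 0 y, ?_⟩
    rw [this] at hx2
    simp only [zsmul_eq_mul] at hx2 hy2
    push_cast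
    linarith
  · rintro ⟨k, rfl⟩
    simpa [zsmul_eq_mul] using (h.periodic.zsmul k) y

lemma IsParam.injOn_Ico (h : IsParam A P γ) (a : ℝ) : Set.InjOn γ (Set.Ico a (a + P)) := by
  intro x hx y hy hxy
  obtain ⟨k, hk⟩ := h.eq_iff.1 hxy
  have hP := h.period_pos
  have h1 : (k : ℝ) * P < 1 * P := by linarith [hx.2, hy.1]
  have h2 : (-1) * P < (k : ℝ) * P := by linarith [hx.1, hy.2]
  have h1' : k < 1 := by exact_mod_cast lt_of_mul_lt_mul_right h1 hP.le
  have h2' : -1 < k := by exact_mod_cast lt_of_mul_lt_mul_right h2 hP.le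
  have : k = 0 := by omega
  simpa [this] using hk

/-- The map `(x, u) ↦ γ x + u γ'(x₀)^⊥` straightening the curve near `x₀`. -/
def collarMap (γ : ℝ → Plane) (x₀ : ℝ) (z : ℝ × ℝ) : Plane := γ z.1 + z.2 • perp (deriv γ x₀)

lemma IsParam.hasStrictFDerivAt_collarMap (h : IsParam A P γ) (x₀ : ℝ) (z : ℝ × ℝ) :
    HasStrictFDerivAt (collarMap γ x₀)
      ((ContinuousLinearMap.fst ℝ ℝ ℝ).smulRight (deriv γ z.1)
        + (ContinuousLinearMap.snd ℝ ℝ ℝ).smulRight (perp (deriv γ x₀))) z := by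
  have h1 : HasStrictDerivAt γ (deriv γ z.1) z.1 :=
    h.contDiff.contDiffAt.hasStrictDerivAt one_ne_zero
  have h2 := h1.hasStrictFDerivAt.comp z
    (hasStrictFDerivAt_fst (𝕜 := ℝ) (E := ℝ) (F := ℝ) (p := z))
  have h3 := (hasStrictFDerivAt_snd (𝕜 := ℝ) (E := ℝ) (F := ℝ) (p := z)).smul_const
    (perp (deriv γ x₀))
  convert! h2.add h3 using 1

/-- Off the frontier the plane is the disjoint union of the open sets `A` and the complement of its
closure, so a connected set there lies in one of them. -/
lemma isPreconnected_subset_of_frontier {S A : Set Plane} (hS : IsPreconnected S) (hA : IsOpen A)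
    (hne : (S ∩ A).Nonempty) (hd : Disjoint S (frontier A)) : S ⊆ A := by
  refine hS.subset_left_of_subset_union hA isClosed_closure.isOpen_compl
    (disjoint_compl_right.mono_right (Set.compl_subset_compl.2 subset_closure)) ?_ hne
  intro x hx
  by_cases hxA : x ∈ closure A
  · left
    by_contra hn
    exact hd.le_bot ⟨hx, by rw [hA.frontier_eq]; exact ⟨hxA, hn⟩⟩
  · exact Or.inr hxA

/-- A collar of the boundary near `γ x₀`. -/
structure IsCollar (A : Set Plane) (P : ℝ) (γ : ℝ → Plane) (x₀ δ η : ℝ) : Prop where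
  δ_pos : 0 < δ
  η_pos : 0 < η
  δ_le : δ ≤ P / 2
  inner_pos : ∀ x ∈ Set.Icc (x₀ - δ) (x₀ + δ), 0 < inner ℝ (deriv γ x) (deriv γ x₀)
  injOn : Set.InjOn (collarMap γ x₀) (Set.Icc (x₀ - δ) (x₀ + δ) ×ˢ Set.univ)
  isOpen : IsOpen (collarMap γ x₀ '' (Set.Ioo (x₀ - δ) (x₀ + δ) ×ˢ Set.Ioo (-η) η))
  inter : ∀ x u, x ∈ Set.Ioo (x₀ - δ) (x₀ + δ) → u ∈ Set.Ioo (-η) η →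
    collarMap γ x₀ (x, u) ∈ frontier A → u = 0
  upper : ∀ x u, x ∈ Set.Ioo (x₀ - δ) (x₀ + δ) → u ∈ Set.Ioo 0 η → collarMap γ x₀ (x, u) ∈ A
  lower : (∀ x u, x ∈ Set.Ioo (x₀ - δ) (x₀ + δ) → u ∈ Set.Ioo (-η) 0 → collarMap γ x₀ (x, u) ∈ A) ∨
    (∀ x u, x ∈ Set.Ioo (x₀ - δ) (x₀ + δ) → u ∈ Set.Ioo (-η) 0 → collarMap γ x₀ (x, u) ∉ A)

/-- The component along γ'(x₀) does not see u and increases strictly with x, so it determines x;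
then u is read off the direction perp γ'(x₀). -/
lemma collarMap_injOn (h : IsParam A P γ) {x₀ δ : ℝ}
    (hpos : ∀ x ∈ Set.Icc (x₀ - δ) (x₀ + δ), 0 < inner ℝ (deriv γ x) (deriv γ x₀)) :
    Set.InjOn (collarMap γ x₀) (Set.Icc (x₀ - δ) (x₀ + δ) ×ˢ Set.univ) := by
  have hmono : StrictMonoOn (fun x => inner ℝ (γ x) (deriv γ x₀)) (Set.Icc (x₀ - δ) (x₀ + δ)) := by
    refine strictMonoOn_of_deriv_pos (convex_Icc _ _)
      (h.continuous.inner continuous_const).continuousOn fun x hx => ?_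
    rw [((h.hasDerivAt x).inner ℝ (hasDerivAt_const x (deriv γ x₀))).deriv]
    simpa using hpos x (interior_subset hx)
  rintro ⟨x, u⟩ hx ⟨y, v⟩ hy hxy
  simp only [Set.mem_prod, Set.mem_univ, and_true] at hx hy
  have key : ∀ a b, inner ℝ (collarMap γ x₀ (a, b)) (deriv γ x₀) = inner ℝ (γ a) (deriv γ x₀) := by
    intro a b
    simp [collarMap, inner_add_left, inner_smul_left, inner_perp]
  have h1 : x = y := hmono.injOn hx hy (by
    have := congrArg (fun w => inner ℝ w (deriv γ x₀)) hxy
    simpa [key] using this)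
  subst h1
  simp only [collarMap, add_right_inj] at hxy
  have hne : perp (deriv γ x₀) ≠ 0 := by
    rw [← norm_ne_zero_iff, norm_perp, norm_ne_zero_iff]; exact h.deriv_ne_zero x₀
  simpa using smul_left_injective ℝ hne hxy

/-- The straightened rectangle meets the nearby arc only on u = 0, by injectivity, and the rest of
the curve is a compact set that misses γ(x₀). Each half of the rectangle is thus connected and free
of frontier points, so it lies in `A` or avoids it. The field `left` decides the upper half; the
lower one stays undecided until boundedness of the domain is used. -/
lemma IsParam.exists_isCollar (hA : IsOpen A) (h : IsParam A P γ) (x₀ : ℝ) :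
    ∃ δ η, IsCollar A P γ x₀ δ η := by
  have hP := h.period_pos
  set N := perp (deriv γ x₀) with hN
  obtain ⟨δ₁, hδ₁, hpos⟩ : ∃ δ₁ > 0, ∀ x, |x - x₀| < δ₁ → 0 < inner ℝ (deriv γ x) (deriv γ x₀) := by
    have hc : Continuous fun x => inner ℝ (deriv γ x) (deriv γ x₀) :=
      h.continuous_deriv.inner continuous_const
    have h0 : 0 < inner ℝ (deriv γ x₀) (deriv γ x₀) := real_inner_self_pos.2 (h.deriv_ne_zero x₀)
    have := hc.continuousAt.eventually (lt_mem_nhds h0)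
    obtain ⟨ε, hε, hb⟩ := Metric.eventually_nhds_iff.1 this
    exact ⟨ε, hε, fun x hx => hb (by rwa [Real.dist_eq])⟩
  set δ₀ := min (δ₁ / 2) (P / 2) with hδ₀def
  have hδ₀ : 0 < δ₀ := lt_min (by linarith) (by linarith)
  have hδ₀P : δ₀ ≤ P / 2 := min_le_right _ _
  have hpos₀ : ∀ x ∈ Set.Icc (x₀ - δ₀) (x₀ + δ₀), 0 < inner ℝ (deriv γ x) (deriv γ x₀) := by
    intro x hx
    have : δ₀ ≤ δ₁ / 2 := min_le_left _ _
    exact hpos x (by rw [abs_lt]; constructor <;> linarith [hx.1, hx.2])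
  have hinj₀ := collarMap_injOn h hpos₀
  -- the remaining part of the curve stays away from `γ x₀`
  set C₁ := γ '' Set.Icc (x₀ + δ₀) (x₀ + P - δ₀) with hC₁
  have hC₁c : IsClosed C₁ := (isCompact_Icc.image h.continuous).isClosed
  have hnot : γ x₀ ∉ C₁ := by
    rintro ⟨x, hx, hxe⟩
    have := h.injOn_Ico x₀ (x₁ := x) (x₂ := x₀) ⟨by linarith [hx.1], by linarith [hx.2]⟩
      ⟨le_rfl, by linarith⟩ hxe
    linarith [hx.1]
  have hcont : Continuous (collarMap γ x₀) := by
    unfold collarMap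
    exact (h.continuous.comp continuous_fst).add (continuous_snd.smul continuous_const)
  have hev : ∀ᶠ z in 𝓝 (x₀, (0 : ℝ)), collarMap γ x₀ z ∈ C₁ᶜ :=
    hcont.continuousAt.eventually (hC₁c.isOpen_compl.mem_nhds (by simpa [collarMap] using hnot))
  obtain ⟨ρ, hρ, hball⟩ := Metric.eventually_nhds_iff.1 hev
  -- the size of the collar
  have hleft := h.left x₀
  have hδdef : ∃ δ, 0 < δ ∧ δ ≤ δ₀ ∧ δ < ρ := ⟨min δ₀ (ρ / 2), lt_min hδ₀ (by linarith),
    min_le_left _ _, lt_of_le_of_lt (min_le_right _ _) (by linarith)⟩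
  obtain ⟨δ, hδ, hδδ₀, hδρ⟩ := hδdef
  have hsub : Set.Icc (x₀ - δ) (x₀ + δ) ⊆ Set.Icc (x₀ - δ₀) (x₀ + δ₀) :=
    Set.Icc_subset_Icc (by linarith) (by linarith)
  set η := ρ / 2 with hη
  have hηρ : η < ρ := by rw [hη]; linarith
  have hη0 : 0 < η := by rw [hη]; linarith
  have hinter : ∀ x u, x ∈ Set.Ioo (x₀ - δ) (x₀ + δ) → u ∈ Set.Ioo (-η) η →
      collarMap γ x₀ (x, u) ∈ frontier A → u = 0 := by
    intro x u hx hu hf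
    rw [← h.range_eq] at hf
    obtain ⟨y, hy⟩ := hf
    have hC : collarMap γ x₀ (x, u) ∉ C₁ := by
      refine hball ?_
      rw [Prod.dist_eq, max_lt_iff]
      simp only [Real.dist_eq, abs_lt]
      refine ⟨⟨by linarith [hx.1], by linarith [hx.2]⟩, by linarith [hu.1], by linarith [hu.2]⟩
    have hy' := toIcoMod_mem_Ico hP (x₀ - δ₀) y
    have e1 : γ (toIcoMod hP (x₀ - δ₀) y) = γ y := by
      conv_rhs => rw [← toIcoMod_add_toIcoDiv_zsmul hP (x₀ - δ₀) y]
      exact ((h.periodic.zsmul _) _).symm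
    set y' := toIcoMod hP (x₀ - δ₀) y
    rw [← hy, ← e1] at hC
    have h1 : y' < x₀ + δ₀ := by
      by_contra hcon
      push Not at hcon
      exact hC ⟨y', ⟨hcon, by linarith [hy'.2]⟩, rfl⟩
    have e2 : collarMap γ x₀ (y', 0) = collarMap γ x₀ (x, u) := by
      rw [← hy, ← e1]; simp [collarMap]
    have := hinj₀ (x₁ := (y', 0)) (x₂ := (x, u)) ⟨⟨hy'.1, h1.le⟩, trivial⟩
      ⟨hsub ⟨hx.1.le, hx.2.le⟩, trivial⟩ e2
    exact (Prod.ext_iff.1 this).2.symm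
  have hconn : ∀ a b : ℝ, IsPreconnected (collarMap γ x₀ '' (Set.Ioo (x₀ - δ) (x₀ + δ) ×ˢ Set.Ioo a b)) :=
    fun a b => (isPreconnected_Ioo.prod isPreconnected_Ioo).image _ hcont.continuousOn
  refine ⟨δ, η, hδ, hη0, hδδ₀.trans hδ₀P, fun x hx => hpos₀ x (hsub hx),
    hinj₀.mono (Set.prod_mono hsub le_rfl), ?_, hinter, ?_, ?_⟩
  · rw [isOpen_iff_mem_nhds]
    rintro _ ⟨z, hz, rfl⟩
    have hs := h.hasStrictFDerivAt_collarMap x₀ z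
    have hsurj : ((ContinuousLinearMap.fst ℝ ℝ ℝ).smulRight (deriv γ z.1)
        + (ContinuousLinearMap.snd ℝ ℝ ℝ).smulRight (perp (deriv γ x₀))).range = ⊤ := by
      rw [LinearMap.range_eq_top]
      intro e
      have hJ : cross (deriv γ z.1) N ≠ 0 := by
        rw [hN, cross_perp]
        exact (hpos₀ z.1 (hsub ⟨hz.1.1.le, hz.1.2.le⟩)).ne'
      refine ⟨((cross (deriv γ z.1) N)⁻¹ * cross e N, -(cross (deriv γ z.1) N)⁻¹ * cross e (deriv γ z.1)), ?_⟩
      have := cross_smul_eq (deriv γ z.1) N e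
      have e3 : e = (cross (deriv γ z.1) N)⁻¹ • (cross e N • deriv γ z.1 - cross e (deriv γ z.1) • N) := by
        rw [← this, smul_smul, inv_mul_cancel₀ hJ, one_smul]
      conv_rhs => rw [e3]
      simp [smul_smul, sub_eq_add_neg, hN]
    rw [← hs.map_nhds_eq_of_surj hsurj]
    exact image_mem_map ((isOpen_Ioo.prod isOpen_Ioo).mem_nhds hz)
  · have hup : collarMap γ x₀ '' (Set.Ioo (x₀ - δ) (x₀ + δ) ×ˢ Set.Ioo 0 η) ⊆ A := by
      refine isPreconnected_subset_of_frontier (hconn 0 η) hA ?_ ?_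
      · obtain ⟨u, hu, hu'⟩ := (hleft.and (Ioo_mem_nhdsGT hη0)).exists
        exact ⟨_, ⟨(x₀, u), ⟨⟨by simp [hδ], by simp [hδ]⟩, hu'⟩, rfl⟩, hu⟩
      · rw [Set.disjoint_left]
        rintro _ ⟨⟨x, u⟩, ⟨hx, hu⟩, rfl⟩ hf
        have := hinter x u hx ⟨by linarith [hu.1], hu.2⟩ hf
        exact hu.1.ne' this
    exact fun x u hx hu => hup ⟨(x, u), ⟨hx, hu⟩, rfl⟩
  · by_cases hne : (collarMap γ x₀ '' (Set.Ioo (x₀ - δ) (x₀ + δ) ×ˢ Set.Ioo (-η) 0) ∩ A).Nonempty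
    · left
      have hlow := isPreconnected_subset_of_frontier (hconn (-η) 0) hA hne (by
        rw [Set.disjoint_left]
        rintro _ ⟨⟨x, u⟩, ⟨hx, hu⟩, rfl⟩ hf
        have := hinter x u hx ⟨hu.1, by linarith [hu.2]⟩ hf
        exact hu.2.ne this)
      exact fun x u hx hu => hlow ⟨(x, u), ⟨hx, hu⟩, rfl⟩
    · right
      exact fun x u hx hu hxA => hne ⟨_, ⟨(x, u), ⟨hx, hu⟩, rfl⟩, hxA⟩

lemma IsCollar.mem (h : IsCollar A P γ x₀ δ η) {x : ℝ} (hx : x ∈ Set.Ioo (x₀ - δ) (x₀ + δ)) :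
    γ x ∈ collarMap γ x₀ '' (Set.Ioo (x₀ - δ) (x₀ + δ) ×ˢ Set.Ioo (-η) η) :=
  ⟨(x, 0), ⟨hx, by simp [h.η_pos], by simp [h.η_pos]⟩, by simp [collarMap]⟩

/-- The domain lies on one side of its boundary only. -/
lemma IsParam.collar_lower_notMem (hA : IsJordanDomain A) (h : IsParam A P γ) {x₀ δ η : ℝ}
    (hc : IsCollar A P γ x₀ δ η) {x u : ℝ} (hx : x ∈ Set.Ioo (x₀ - δ) (x₀ + δ))
    (hu : u ∈ Set.Ioo (-η) 0) : collarMap γ x₀ (x, u) ∉ A := by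
  -- `W` collects the parameters at which the domain lies on both sides of the curve. It is open by
  -- definition and closed by the dichotomy for collars, hence empty or everything. If it were
  -- everything, the closure of `A` would be open and closed, so the whole plane, against
  -- boundedness.
  set W := {x | γ x ∈ interior (closure A)} with hW
  have hWo : IsOpen W := isOpen_interior.preimage h.continuous
  have hcl : ∀ x, γ x ∈ closure A := fun x =>
    frontier_subset_closure (h.range_eq ▸ Set.mem_range_self x)
  have htwo : ∀ {x₀ δ η : ℝ}, IsCollar A P γ x₀ δ η →
      (∀ x u, x ∈ Set.Ioo (x₀ - δ) (x₀ + δ) → u ∈ Set.Ioo (-η) 0 → collarMap γ x₀ (x, u) ∈ A) →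
      x₀ ∈ W := by
    intro x₀ δ η hc hl
    refine mem_interior.2 ⟨_, ?_, hc.isOpen, hc.mem ⟨by linarith [hc.δ_pos], by linarith [hc.δ_pos]⟩⟩
    rintro _ ⟨⟨x, u⟩, ⟨hx, hu⟩, rfl⟩
    rcases lt_trichotomy u 0 with h0 | h0 | h0
    · exact subset_closure (hl x u hx ⟨hu.1, h0⟩)
    · rw [h0]; simpa [collarMap] using hcl x
    · exact subset_closure (hc.upper x u hx ⟨h0, hu.2⟩)
  have hone : ∀ {x₀ δ η : ℝ}, IsCollar A P γ x₀ δ η →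
      (∀ x u, x ∈ Set.Ioo (x₀ - δ) (x₀ + δ) → u ∈ Set.Ioo (-η) 0 → collarMap γ x₀ (x, u) ∉ A) →
      ∀ x ∈ Set.Ioo (x₀ - δ) (x₀ + δ), x ∉ W := by
    intro x₀ δ η hc hl x hx hxW
    have hcts : ContinuousAt (fun u : ℝ => collarMap γ x₀ (x, u)) 0 := by
      simp only [collarMap]; fun_prop
    have h1 : ∀ᶠ u in 𝓝 (0 : ℝ), collarMap γ x₀ (x, u) ∈ interior (closure A) :=
      hcts.eventually (isOpen_interior.mem_nhds (by
        simp only [collarMap, zero_smul, add_zero]; exact hxW))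
    have h2 : ∀ᶠ u in 𝓝[<] (0 : ℝ), u ∈ Set.Ioo (-η) 0 :=
      Ioo_mem_nhdsLT (by linarith [hc.η_pos])
    obtain ⟨u, hu1, hu2⟩ := ((h1.filter_mono nhdsWithin_le_nhds).and h2).exists
    have hnA := hl x u hx hu2
    have : collarMap γ x₀ (x, u) ∈ frontier A := by
      rw [hA.isOpen.frontier_eq]; exact ⟨interior_subset hu1, hnA⟩
    exact hu2.2.ne (hc.inter x u hx ⟨hu2.1, by linarith [hu2.2, hc.η_pos]⟩ this)
  have hWc : IsClosed W := by
    rw [← isOpen_compl_iff, isOpen_iff_mem_nhds]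
    intro y hy
    obtain ⟨δ, η, hc⟩ := h.exists_isCollar hA.isOpen y
    rcases hc.lower with hl | hl
    · exact absurd (htwo hc hl) hy
    · filter_upwards [Ioo_mem_nhds (show y - δ < y by linarith [hc.δ_pos])
        (show y < y + δ by linarith [hc.δ_pos])] with z hz using hone hc hl z hz
  have hWne : W ≠ Set.univ := by
    intro hWu
    have hsub : closure A ⊆ interior (closure A) := by
      rw [closure_eq_self_union_frontier]
      rintro z (hz | hz)
      · exact interior_mono Set.subset_union_left (by rwa [hA.isOpen.interior_eq])
      · rw [← h.range_eq] at hz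
        obtain ⟨y, rfl⟩ := hz
        have : y ∈ W := by rw [hWu]; trivial
        rwa [hW, Set.mem_ofPred_eq, closure_eq_self_union_frontier] at this
    have hclopen : IsClopen (closure A) :=
      ⟨isClosed_closure, by rw [← subset_interior_iff_isOpen]; exact hsub⟩
    rcases isClopen_iff.1 hclopen with h0 | h0
    · exact hA.isConnected.nonempty.closure.ne_empty h0
    · have hb := hA.isBounded.closure
      rw [h0] at hb
      exact NormedSpace.unbounded_univ ℝ Plane hb
  have hWe : W = ∅ := (isClopen_iff.1 ⟨hWc, hWo⟩).resolve_right hWne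
  rcases hc.lower with hl | hl
  · have := htwo hc hl
    simp [hWe] at this
  · exact hl x u hx hu

/-- The counterpart of the field `left`; it is what rules out an orientation-reversing change of
parameter in `IsParam.exists_reparam`. -/
lemma IsParam.right (hA : IsJordanDomain A) (h : IsParam A P γ) (x : ℝ) :
    ∀ᶠ u in 𝓝[>] (0 : ℝ), γ x - u • perp (deriv γ x) ∉ A := by
  obtain ⟨δ, η, hc⟩ := h.exists_isCollar hA.isOpen x
  filter_upwards [Ioo_mem_nhdsGT hc.η_pos] with u hu
  have := h.collar_lower_notMem hA hc (x := x) (u := -u)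
    ⟨by linarith [hc.δ_pos], by linarith [hc.δ_pos]⟩ ⟨by linarith [hu.2], by linarith [hu.1]⟩
  simpa [collarMap, sub_eq_add_neg] using this

/-! ### Green's formula -/

/-- Cartesian coordinates on the plane. -/
def planeEquiv : (ℝ × ℝ) ≃ᵐ Plane :=
  (MeasurableEquiv.finTwoArrow (α := ℝ)).symm.trans (MeasurableEquiv.toLp 2 (Fin 2 → ℝ))

lemma measurePreserving_planeEquiv : MeasurePreserving planeEquiv :=
  (PiLp.volume_preserving_toLp (Fin 2)).comp (volume_preserving_finTwoArrow ℝ).symm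

/-- The Jacobian of the straightening map is the cross product of γ'(x) with perp γ'(x₀), that is,
the inner product of the two tangents. -/
lemma integral_image_collarMap {A : Set Plane} {P : ℝ} {γ : ℝ → Plane} (h : IsParam A P γ)
    {x₀ : ℝ} {s : Set (ℝ × ℝ)} (hs : MeasurableSet s) (hinj : Set.InjOn (collarMap γ x₀) s)
    (G : Plane → ℝ) :
    ∫ y in collarMap γ x₀ '' s, G y
      = ∫ z in s, |inner ℝ (deriv γ z.1) (deriv γ x₀)| * G (collarMap γ x₀ z) := by
  set N := perp (deriv γ x₀) with hN
  set f : ℝ × ℝ → ℝ × ℝ := fun z => (collarMap γ x₀ z 0, collarMap γ x₀ z 1) with hf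
  have hpf : ∀ z, planeEquiv (f z) = collarMap γ x₀ z := fun z => plane_ext rfl rfl
  set f' : ℝ × ℝ → (ℝ × ℝ →L[ℝ] ℝ × ℝ) := fun z =>
    LinearMap.toContinuousLinearMap (Matrix.toLin (Module.Basis.finTwoProd ℝ) (Module.Basis.finTwoProd ℝ)
      !![deriv γ z.1 0, N 0; deriv γ z.1 1, N 1]) with hf'
  have hdet : ∀ z, (f' z).det = inner ℝ (deriv γ z.1) (deriv γ x₀) := by
    intro z
    simp only [hf', LinearMap.det_toContinuousLinearMap, LinearMap.det_toLin, Matrix.det_fin_two_of]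
    rw [← cross_perp]; simp [cross, hN]; ring
  have hder : ∀ z ∈ s, HasFDerivWithinAt f (f' z) s z := by
    intro z _
    apply HasFDerivAt.hasFDerivWithinAt
    have hc := (h.hasStrictFDerivAt_collarMap x₀ z).hasFDerivAt
    simp only [hf', Matrix.toLin_finTwoProd_toContinuousLinearMap]
    have h0 := (EuclideanSpace.proj (𝕜 := ℝ) (0 : Fin 2)).hasFDerivAt.comp z hc
    have h1 := (EuclideanSpace.proj (𝕜 := ℝ) (1 : Fin 2)).hasFDerivAt.comp z hc
    convert! h0.prodMk h1 using 1
    ext <;> simp [hN]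
  have hinj' : Set.InjOn f s := fun a ha b hb hab => hinj ha hb (by
    rw [← hpf, ← hpf, hab])
  have himg : planeEquiv ⁻¹' (collarMap γ x₀ '' s) = f '' s := by
    ext w
    constructor
    · rintro ⟨z, hz, hzw⟩
      exact ⟨z, hz, planeEquiv.injective (by rw [hpf, hzw])⟩
    · rintro ⟨z, hz, rfl⟩
      exact ⟨z, hz, (hpf z).symm⟩
  rw [← measurePreserving_planeEquiv.setIntegral_preimage_emb planeEquiv.measurableEmbedding, himg,
    integral_image_eq_integral_abs_det_fderiv_smul volume hs hder hinj']
  simp only [hdet, hpf, smul_eq_mul]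

/-- Green's formula for functions supported in a collar. -/
lemma green_of_tsupport_subset {A : Set Plane} {P : ℝ} {γ : ℝ → Plane} (hA : IsJordanDomain A)
    (h : IsParam A P γ) {x₀ δ η : ℝ} (hc : IsCollar A P γ x₀ δ η) {F : Plane → ℝ}
    (hF : ContDiff ℝ 1 F)
    (hs : tsupport F ⊆ collarMap γ x₀ '' (Set.Ioo (x₀ - δ) (x₀ + δ) ×ˢ Set.Ioo (-η) η))
    (e : Plane) :
    ∫ y in A, fderiv ℝ F y e = ∫ x in (0 : ℝ)..P, F (γ x) * cross e (deriv γ x) := by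
  have hδ := hc.δ_pos
  have hη := hc.η_pos
  set N := perp (deriv γ x₀) with hN
  set I := Set.Ioo (x₀ - δ) (x₀ + δ) with hI
  have hFd : Differentiable ℝ F := hF.differentiable one_ne_zero
  have hcont : Continuous (collarMap γ x₀) := by
    unfold collarMap
    exact (h.continuous.comp continuous_fst).add (continuous_snd.smul continuous_const)
  have hF0 : ∀ y, y ∉ collarMap γ x₀ '' (I ×ˢ Set.Ioo (-η) η) → F y = 0 := fun y hy =>
    image_eq_zero_of_notMem_tsupport fun hy' => hy (hs hy')
  -- The support lies in the image of the open rectangle and the map is injective on the closed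
  -- strip, so F vanishes on every side of the half rectangle except u = 0, the arc itself.
  have hbdry : ∀ z : ℝ × ℝ, z ∈ Set.Icc (x₀ - δ) (x₀ + δ) ×ˢ Set.univ →
      z ∉ I ×ˢ Set.Ioo (-η) η → F (collarMap γ x₀ z) = 0 := by
    intro z hz hz'
    refine hF0 _ ?_
    rintro ⟨w, hw, hwz⟩
    have := hc.injOn (x₁ := w) (x₂ := z) ⟨⟨hw.1.1.le, hw.1.2.le⟩, trivial⟩ hz hwz
    exact hz' (this ▸ hw)
  -- the two sides of the collar
  have hup : ∫ y in A, fderiv ℝ F y e = ∫ y in collarMap γ x₀ '' (I ×ˢ Set.Ioo 0 η), fderiv ℝ F y e := by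
    refine setIntegral_eq_of_subset_of_forall_sdiff_eq_zero hA.isOpen.measurableSet ?_ ?_
    · rintro _ ⟨⟨x, u⟩, ⟨hx, hu⟩, rfl⟩
      exact hc.upper x u hx hu
    · rintro y ⟨hyA, hy⟩
      by_contra hne
      have hyt : y ∈ tsupport F := by
        by_contra hyt
        have : fderiv ℝ F y = 0 := by
          by_contra h0
          exact hyt (support_fderiv_subset ℝ h0)
        exact hne (by simp [this])
      obtain ⟨⟨x, u⟩, ⟨hx, hu⟩, rfl⟩ := hs hyt
      rcases lt_trichotomy u 0 with h0 | h0 | h0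
      · exact h.collar_lower_notMem hA hc hx ⟨hu.1, h0⟩ hyA
      · have : collarMap γ x₀ (x, u) ∈ frontier A := by
          rw [← h.range_eq, h0]; exact ⟨x, by simp [collarMap]⟩
        rw [hA.isOpen.frontier_eq] at this
        exact this.2 hyA
      · exact hy ⟨(x, u), ⟨hx, h0, hu.2⟩, rfl⟩
  have hinj : Set.InjOn (collarMap γ x₀) (I ×ˢ Set.Ioo 0 η) :=
    hc.injOn.mono (Set.prod_mono Set.Ioo_subset_Icc_self (Set.subset_univ _))
  have hDF : Continuous fun z : ℝ × ℝ => fderiv ℝ F (collarMap γ x₀ z) :=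
    (hF.continuous_fderiv one_ne_zero).comp hcont
  set a : ℝ × ℝ → ℝ := fun z => fderiv ℝ F (collarMap γ x₀ z) (deriv γ z.1) with ha
  set b : ℝ × ℝ → ℝ := fun z => fderiv ℝ F (collarMap γ x₀ z) N with hb
  have hac : Continuous a := hDF.clm_apply (h.continuous_deriv.comp continuous_fst)
  have hbc : Continuous b := hDF.clm_apply continuous_const
  have hda : ∀ x u, HasDerivAt (fun x => F (collarMap γ x₀ (x, u))) (a (x, u)) x := by
    intro x u
    have := (hFd (collarMap γ x₀ (x, u))).hasFDerivAt.comp_hasDerivAt x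
      ((h.hasDerivAt x).add_const (u • N))
    exact this
  have hdb : ∀ x u, HasDerivAt (fun u => F (collarMap γ x₀ (x, u))) (b (x, u)) u := by
    intro x u
    have h1 : HasDerivAt (fun u : ℝ => collarMap γ x₀ (x, u)) N u := by
      simpa [collarMap] using ((hasDerivAt_id u).smul_const N).const_add (γ x)
    exact (hFd (collarMap γ x₀ (x, u))).hasFDerivAt.comp_hasDerivAt u h1
  -- Cramer's rule writes the Jacobian times the directional derivative through the coordinate
  -- derivatives ∂ₓ and ∂ᵤ. The coefficient of ∂ₓ is constant and that of ∂ᵤ depends on x only, so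
  -- both terms integrate exactly although γ has only one derivative.
  have hpt : ∀ z ∈ I ×ˢ Set.Ioo (0 : ℝ) η,
      |inner ℝ (deriv γ z.1) (deriv γ x₀)| * fderiv ℝ F (collarMap γ x₀ z) e
        = cross e N * a z - cross e (deriv γ z.1) * b z := by
    intro z hz
    rw [abs_of_pos (hc.inner_pos z.1 (Set.Ioo_subset_Icc_self hz.1)), ← cross_perp, ← smul_eq_mul,
      ← map_smul, cross_smul_eq]
    simp [ha, hb, hN]
  have hint : ∀ f : ℝ × ℝ → ℝ, Continuous f →
      IntegrableOn f (I ×ˢ Set.Ioo (0 : ℝ) η) (volume.prod volume) := fun f hf =>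
    (hf.continuousOn.integrableOn_compact (isCompact_Icc.prod isCompact_Icc)).mono_set
      (Set.prod_mono Set.Ioo_subset_Icc_self Set.Ioo_subset_Icc_self)
  have hcr : Continuous fun z : ℝ × ℝ => cross e (deriv γ z.1) :=
    continuous_const.cross (h.continuous_deriv.comp continuous_fst)
  have hcb : Continuous fun z : ℝ × ℝ => cross e (deriv γ z.1) * b z := hcr.mul hbc
  have hA1 : ∫ z in I ×ˢ Set.Ioo (0 : ℝ) η, a z = 0 := by
    have hsw : ∫ z in I ×ˢ Set.Ioo (0 : ℝ) η, a z = ∫ u in Set.Ioo (0 : ℝ) η, ∫ x in I, a (x, u) := by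
      rw [Measure.volume_eq_prod, ← setIntegral_prod_swap, setIntegral_prod]
      · rfl
      · exact (hint a hac).swap
    rw [hsw]
    refine setIntegral_eq_zero_of_forall_eq_zero fun u hu => ?_
    rw [hI, ← integral_Ioc_eq_integral_Ioo, ← intervalIntegral.integral_of_le (by linarith),
      intervalIntegral.integral_eq_sub_of_hasDerivAt (fun x _ => hda x u)
        ((hac.comp (by fun_prop : Continuous fun x : ℝ => (x, u))).intervalIntegrable _ _),
      hbdry (x₀ + δ, u) ⟨⟨by linarith, le_rfl⟩, trivial⟩ (fun hz => (lt_irrefl _ hz.1.2)),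
      hbdry (x₀ - δ, u) ⟨⟨le_rfl, by linarith⟩, trivial⟩ (fun hz => (lt_irrefl _ hz.1.1)), sub_zero]
  have hB1 : ∫ z in I ×ˢ Set.Ioo (0 : ℝ) η, cross e (deriv γ z.1) * b z
      = - ∫ x in I, F (γ x) * cross e (deriv γ x) := by
    rw [Measure.volume_eq_prod, setIntegral_prod _ (hint _ hcb), ← integral_neg]
    refine setIntegral_congr_fun measurableSet_Ioo fun x hx => ?_
    simp only
    rw [integral_const_mul, ← integral_Ioc_eq_integral_Ioo, ← intervalIntegral.integral_of_le hη.le,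
      intervalIntegral.integral_eq_sub_of_hasDerivAt (fun u _ => hdb x u)
        ((hbc.comp (by fun_prop : Continuous fun u : ℝ => (x, u))).intervalIntegrable _ _),
      hbdry (x, η) ⟨Set.Ioo_subset_Icc_self hx, trivial⟩ (fun hz => (lt_irrefl _ hz.2.2))]
    simp [collarMap]; ring
  have hsplit := integral_sub (μ := (volume : Measure (ℝ × ℝ)).restrict (I ×ˢ Set.Ioo 0 η))
    ((hint a hac).const_mul (cross e N)) (hint _ hcb)
  rw [integral_const_mul, hA1, hB1, mul_zero, zero_sub, neg_neg] at hsplit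
  rw [hup, integral_image_collarMap h (measurableSet_Ioo.prod measurableSet_Ioo) hinj]
  refine ((setIntegral_congr_fun (measurableSet_Ioo.prod measurableSet_Ioo) hpt).trans hsplit).trans ?_
  -- the contribution of the rest of the period vanishes
  set k : ℝ → ℝ := fun x => F (γ x) * cross e (deriv γ x) with hk
  have hper : Function.Periodic k P := fun x => by
    simp only [hk, h.periodic x, h.periodic_deriv x]
  have h1 : ∫ x in (0 : ℝ)..P, k x = ∫ x in (x₀ - P / 2)..(x₀ - P / 2 + P), k x := by
    simpa using hper.intervalIntegral_add_eq 0 (x₀ - P / 2)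
  have hP := h.period_pos
  have hδP := hc.δ_le
  rw [h1, intervalIntegral.integral_of_le (by linarith), integral_Ioc_eq_integral_Ioo]
  symm
  refine setIntegral_eq_of_subset_of_forall_sdiff_eq_zero measurableSet_Ioo
    (Set.Ioo_subset_Ioo (by linarith) (by linarith)) ?_
  rintro x ⟨hx, hxI⟩
  have : F (γ x) = 0 := by
    refine hF0 _ ?_
    rintro ⟨⟨y, u⟩, ⟨hy, hu⟩, hyx⟩
    have hfr : collarMap γ x₀ (y, u) ∈ frontier A := by
      rw [hyx, ← h.range_eq]; exact Set.mem_range_self x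
    have hu0 := hc.inter y u hy hu hfr
    subst hu0
    have hyx' : γ y = γ x := by simpa [collarMap] using hyx
    have := h.injOn_Ico (x₀ - P / 2) ⟨by linarith [hy.1], by linarith [hy.2]⟩
      ⟨hx.1.le, hx.2⟩ hyx'
    exact hxI (this ▸ hy)
  simp [hk, this]

open scoped Manifold in
/-- **Green's formula** for a Jordan domain with `C¹` boundary. -/
theorem green {A : Set Plane} {P : ℝ} {γ : ℝ → Plane} (hA : IsJordanDomain A)
    (h : IsParam A P γ) {F : Plane → ℝ} (hF : ContDiff ℝ 1 F) (e : Plane) :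
    ∫ y in A, fderiv ℝ F y e = ∫ x in (0 : ℝ)..P, F (γ x) * cross e (deriv γ x) := by
  choose δ η hc using fun x => h.exists_isCollar hA.isOpen x
  -- The closure is covered by the collars and, under the index `none`, by the domain itself. A
  -- piece supported in the domain has zero boundary term, and the integral of its derivative over
  -- the plane vanishes; the other pieces fall under `green_of_tsupport_subset`.
  set U : Option ℝ → Set Plane := fun i => i.elim A fun x =>
    collarMap γ x '' (Set.Ioo (x - δ x) (x + δ x) ×ˢ Set.Ioo (-(η x)) (η x)) with hU
  have hUo : ∀ i, IsOpen (U i) := by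
    rintro (_ | x)
    · exact hA.isOpen
    · exact (hc x).isOpen
  have hK : IsCompact (closure A) := hA.isBounded.isCompact_closure
  have hcov : closure A ⊆ ⋃ i, U i := by
    rw [closure_eq_self_union_frontier]
    rintro y (hy | hy)
    · exact Set.mem_iUnion.2 ⟨none, hy⟩
    · rw [← h.range_eq] at hy
      obtain ⟨x, rfl⟩ := hy
      exact Set.mem_iUnion.2 ⟨some x, (hc x).mem ⟨by linarith [(hc x).δ_pos],
        by linarith [(hc x).δ_pos]⟩⟩
  obtain ⟨t, ht⟩ := hK.elim_finite_subcover U hUo hcov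
  have ht' : closure A ⊆ ⋃ i : t, U i := by
    intro y hy
    obtain ⟨i, hi, hyi⟩ := Set.mem_iUnion₂.1 (ht hy)
    exact Set.mem_iUnion.2 ⟨⟨i, hi⟩, hyi⟩
  obtain ⟨ρ, hρ⟩ := SmoothPartitionOfUnity.exists_isSubordinate 𝓘(ℝ, Plane) isClosed_closure
    (fun i : t => U i) (fun i => hUo i) ht'
  have hsum : ∀ y ∈ closure A, ∑ i : t, ρ i y = 1 := fun y hy => by
    rw [← finsum_eq_sum_of_fintype]; exact ρ.sum_eq_one hy
  have hρd : ∀ i : t, ContDiff ℝ 1 fun y => ρ i y * F y := fun i =>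
    (((ρ i).contMDiff.contDiff).of_le (by norm_cast)).mul hF
  have hloc : ∀ i : t, ∫ y in A, fderiv ℝ (fun y => ρ i y * F y) y e
      = ∫ x in (0 : ℝ)..P, ρ i (γ x) * F (γ x) * cross e (deriv γ x) := by
    intro i
    have hsup : tsupport (fun y => ρ i y * F y) ⊆ U i :=
      (closure_mono (Function.support_mul_subset_left _ _)).trans (hρ i)
    obtain ⟨(_ | x), hi⟩ := i
    · have hcs : HasCompactSupport (fun y => ρ ⟨none, hi⟩ y * F y) :=
        hK.of_isClosed_subset (isClosed_tsupport _) (hsup.trans subset_closure)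
      have hz : ∀ x, ρ ⟨none, hi⟩ (γ x) * F (γ x) = 0 := by
        intro x
        have : γ x ∉ A := by
          have hx : γ x ∈ frontier A := h.range_eq ▸ Set.mem_range_self x
          rw [hA.isOpen.frontier_eq] at hx
          exact hx.2
        exact image_eq_zero_of_notMem_tsupport (f := fun y => ρ ⟨none, hi⟩ y * F y)
          fun hx => this (hsup hx)
      simp only [hz, zero_mul, intervalIntegral.integral_zero]
      have hfull : ∫ y in A, fderiv ℝ (fun y => ρ ⟨none, hi⟩ y * F y) y e
          = ∫ y, fderiv ℝ (fun y => ρ ⟨none, hi⟩ y * F y) y e := by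
        refine setIntegral_eq_integral_of_forall_compl_eq_zero fun y hy => ?_
        have : fderiv ℝ (fun y => ρ ⟨none, hi⟩ y * F y) y = 0 := by
          by_contra h0
          exact hy (hsup (support_fderiv_subset ℝ h0))
        simp [this]
      rw [hfull]
      have hi1 : Integrable fun y => fderiv ℝ (fun y => ρ ⟨none, hi⟩ y * F y) y e :=
        (((hρd ⟨none, hi⟩).continuous_fderiv one_ne_zero).clm_apply
          continuous_const).integrable_of_hasCompactSupport
          ((hcs.fderiv ℝ).comp_left (g := fun L : Plane →L[ℝ] ℝ => L e) (by simp))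
      have hi2 : Integrable fun y => ρ ⟨none, hi⟩ y * F y :=
        (hρd ⟨none, hi⟩).continuous.integrable_of_hasCompactSupport hcs
      have := integral_mul_fderiv_eq_neg_fderiv_mul_of_integrable (𝕜 := ℝ) (μ := volume)
        (f := fun _ : Plane => (1 : ℝ)) (g := fun y => ρ ⟨none, hi⟩ y * F y) (v := e)
        (by simp) (by simpa using hi1) (by simpa using hi2) (by simp)
        (fun x _ => (hρd ⟨none, hi⟩).differentiable one_ne_zero x)
      simpa using this
    · exact green_of_tsupport_subset hA h (hc x) (hρd ⟨some x, hi⟩) hsup e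
  have hL : ∫ y in A, fderiv ℝ F y e = ∑ i : t, ∫ y in A, fderiv ℝ (fun y => ρ i y * F y) y e := by
    rw [← integral_finsetSum]
    · refine setIntegral_congr_fun hA.isOpen.measurableSet fun y hy => ?_
      have hev : F =ᶠ[𝓝 y] fun w => ∑ i : t, ρ i w * F w := by
        filter_upwards [hA.isOpen.mem_nhds hy] with w hw
        rw [← Finset.sum_mul, hsum w (subset_closure hw), one_mul]
      rw [hev.fderiv_eq, fderiv_fun_sum fun i _ => (hρd i).differentiable one_ne_zero y]
      simp
    · intro i _
      exact ((((hρd i).continuous_fderiv one_ne_zero).clm_apply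
        continuous_const).continuousOn.integrableOn_compact hK).mono_set subset_closure
  rw [hL, Finset.sum_congr rfl fun i _ => hloc i, ← intervalIntegral.integral_finsetSum]
  · refine intervalIntegral.integral_congr fun x _ => ?_
    have hx : γ x ∈ closure A := frontier_subset_closure (h.range_eq ▸ Set.mem_range_self x)
    rw [← Finset.sum_mul, ← Finset.sum_mul, hsum _ hx, one_mul]
  · intro i _
    exact ((((hρd i).continuous.comp h.continuous)).mul
      (continuous_const.cross h.continuous_deriv)).intervalIntegrable _ _

/-! ### The velocity as a limit of boundary integrals -/

/-- Up to a rotation the gradient of this potential is the regularized velocity kernel, which is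
what allows Green's formula to turn the velocity into a boundary integral. The shift e > 0 removes
the singularity on the boundary. -/
lemma hasFDerivAt_regPotential {α : ℝ} (hα : α ≠ 0) {e : ℝ} (he : 0 < e) (p y : Plane) :
    HasFDerivAt (fun y : Plane => (2 * α)⁻¹ * (‖p - y‖ ^ 2 + e) ^ (-α))
      ((‖p - y‖ ^ 2 + e) ^ (-1 - α) • innerSL ℝ (p - y)) y := by
  have h1 : HasFDerivAt (fun y : Plane => ‖p - y‖ ^ 2 + e) (-(2 • innerSL ℝ (p - y))) y := by
    have := ((hasFDerivAt_id (𝕜 := ℝ) y).const_sub p).norm_sq.add_const e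
    refine this.congr_fderiv ?_
    ext v; simp; ring
  have hq : 0 < ‖p - y‖ ^ 2 + e := by positivity
  have h2 := (h1.rpow_const (p := -α) (Or.inl hq.ne')).const_mul (2 * α)⁻¹
  refine h2.congr_fderiv ?_
  rw [show -α - 1 = -1 - α by ring]
  ext v
  simp
  field_simp

lemma contDiff_regPotential (α : ℝ) {e : ℝ} (he : 0 < e) (p : Plane) :
    ContDiff ℝ 1 (fun y : Plane => (2 * α)⁻¹ * (‖p - y‖ ^ 2 + e) ^ (-α)) := by
  refine contDiff_const.mul (ContDiff.rpow_const_of_ne ?_ fun y => ?_)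
  · exact ((contDiff_const.sub contDiff_id).norm_sq ℝ).add contDiff_const
  · positivity

lemma integral_plane_apply {X : Type*} [MeasurableSpace X] {μ : Measure X} {f : X → Plane}
    (hf : Integrable f μ) (i : Fin 2) : (∫ x, f x ∂μ) i = ∫ x, f x i ∂μ :=
  ((EuclideanSpace.proj (𝕜 := ℝ) i).integral_comp_comm hf).symm

/-- Green's formula for the regularized potential, one coordinate at a time: the first coordinate of
the rotated kernel is minus the derivative of the potential in the second direction, the second
coordinate is its derivative in the first direction. -/
lemma regVelocity_eq {A : Set Plane} {P : ℝ} {γ : ℝ → Plane} (hA : IsJordanDomain A)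
    (h : IsParam A P γ) {α : ℝ} (hα : α ≠ 0) {e : ℝ} (he : 0 < e) (p : Plane) :
    ∫ y in A, (‖p - y‖ ^ 2 + e) ^ (-1 - α) • perp (p - y)
      = (2 * α)⁻¹ • ∫ x in (0 : ℝ)..P, (‖p - γ x‖ ^ 2 + e) ^ (-α) • deriv γ x := by
  have hc1 : Continuous fun y : Plane => (‖p - y‖ ^ 2 + e) ^ (-1 - α) • perp (p - y) := by
    refine Continuous.smul (Continuous.rpow_const (by fun_prop) fun y => Or.inl ?_)
      (continuous_perp.comp (by fun_prop))
    positivity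
  have hc2 : Continuous fun x => (‖p - γ x‖ ^ 2 + e) ^ (-α) • deriv γ x := by
    have := h.continuous
    refine Continuous.smul (Continuous.rpow_const (by fun_prop) fun y => Or.inl ?_)
      h.continuous_deriv
    positivity
  have hi1 : IntegrableOn (fun y : Plane => (‖p - y‖ ^ 2 + e) ^ (-1 - α) • perp (p - y)) A :=
    (hc1.continuousOn.integrableOn_compact hA.isBounded.isCompact_closure).mono_set subset_closure
  have hgreen := fun v => green hA h (contDiff_regPotential α he p) v
  simp only [(hasFDerivAt_regPotential hα he p _).fderiv] at hgreen
  have hP := h.period_pos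
  have hi2 : Integrable (fun x => (‖p - γ x‖ ^ 2 + e) ^ (-α) • deriv γ x)
      (volume.restrict (Set.Ioc 0 P)) := (hc2.intervalIntegrable 0 P).1
  rw [intervalIntegral.integral_of_le hP.le]
  refine plane_ext ?_ ?_
  · rw [integral_plane_apply hi1, PiLp.smul_apply, integral_plane_apply hi2]
    have := hgreen (EuclideanSpace.single 1 1)
    rw [intervalIntegral.integral_of_le hP.le] at this
    rw [← neg_inj, smul_eq_mul, ← integral_const_mul, ← integral_neg, ← integral_neg]
    convert! this using 3 with y x
    · simp [inner_plane]; ring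
    · simp [cross]; ring
  · rw [integral_plane_apply hi1, PiLp.smul_apply, integral_plane_apply hi2]
    have := hgreen (EuclideanSpace.single 0 1)
    rw [intervalIntegral.integral_of_le hP.le] at this
    rw [smul_eq_mul, ← integral_const_mul]
    convert! this using 3 with y x
    · simp [inner_plane]
    · simp [cross]; ring

/-- In polar coordinates the integrand becomes r^(a+1), which explains the threshold `-2 < a`. -/
lemma integrableOn_rpow_norm_sub {A : Set Plane} (hA : Bornology.IsBounded A) {a : ℝ} (ha : -2 < a)
    (p : Plane) : IntegrableOn (fun y : Plane => ‖p - y‖ ^ a) A := by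
  obtain ⟨R, hR, hAR⟩ := hA.subset_ball_lt 0 p
  refine IntegrableOn.mono_set ?_ hAR
  have h0 : IntegrableOn (fun x : Plane => ‖x‖ ^ a) (Metric.ball 0 R) := by
    rw [integrableOn_fun_norm_addHaar volume (f := fun r : ℝ => r ^ a)]
    have h1 : IntegrableOn (fun r : ℝ => r ^ (a + 1)) (Set.Ioo 0 R) :=
      ((intervalIntegral.intervalIntegrable_rpow' (a := 0) (b := R) (by linarith)).1).mono_set
        Set.Ioo_subset_Ioc_self
    refine h1.congr_fun (fun r hr => ?_) measurableSet_Ioo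
    simp only [finrank_euclideanSpace, Fintype.card_fin, smul_eq_mul]
    rw [Real.rpow_add_one hr.1.ne']; ring
  rw [← integrable_indicator_iff measurableSet_ball] at h0 ⊢
  have h2 := h0.comp_sub_left p
  refine h2.congr (Eventually.of_forall fun y => ?_)
  simp only [Set.indicator, Metric.mem_ball, dist_eq_norm, sub_zero]
  rw [norm_sub_rev p y]

/-- Dominated convergence: every regularized kernel is bounded by |p−y|^(−1−2α), which is locally
integrable in the plane since α < 1/2. -/
lemma tendsto_regVelocity {A : Set Plane} (hA : IsJordanDomain A) {α : ℝ} (hα : 0 < α)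
    (hα' : α < 1 / 2) (p : Plane) :
    Tendsto (fun e : ℝ => ∫ y in A, (‖p - y‖ ^ 2 + e) ^ (-1 - α) • perp (p - y)) (𝓝[>] 0)
      (𝓝 (velocity α A p)) := by
  unfold velocity
  refine tendsto_integral_filter_of_dominated_convergence (fun y => ‖p - y‖ ^ (-1 - 2 * α)) ?_ ?_
    (integrableOn_rpow_norm_sub hA.isBounded (by linarith) p) ?_
  · filter_upwards [self_mem_nhdsWithin] with e he
    have he : 0 < e := he
    refine Continuous.aestronglyMeasurable (Continuous.smul (Continuous.rpow_const (by fun_prop)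
      fun y => Or.inl ?_) (continuous_perp.comp (by fun_prop)))
    positivity
  · filter_upwards [self_mem_nhdsWithin] with e he
    have he : 0 < e := he
    refine Eventually.of_forall fun y => ?_
    rw [norm_smul, norm_perp, Real.norm_of_nonneg (by positivity)]
    rcases eq_or_ne (‖p - y‖) 0 with h0 | h0
    · rw [h0, mul_zero]; positivity
    · have hr : 0 < ‖p - y‖ := lt_of_le_of_ne (norm_nonneg _) h0.symm
      calc (‖p - y‖ ^ 2 + e) ^ (-1 - α) * ‖p - y‖
          ≤ (‖p - y‖ ^ 2) ^ (-1 - α) * ‖p - y‖ := by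
            gcongr ?_ * _
            exact Real.rpow_le_rpow_of_nonpos (by positivity) (by linarith) (by linarith)
        _ = ‖p - y‖ ^ (-1 - 2 * α) := by
            rw [← Real.rpow_natCast, ← Real.rpow_mul hr.le, ← Real.rpow_add_one hr.ne']
            congr 1; push_cast; ring
  · refine Eventually.of_forall fun y => ?_
    rcases eq_or_ne (‖p - y‖) 0 with h0 | h0
    · have : p - y = 0 := norm_eq_zero.1 h0
      simp [this, show perp 0 = 0 from perpL.map_zero]
    · have hr : 0 < ‖p - y‖ := lt_of_le_of_ne (norm_nonneg _) h0.symm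
      refine Tendsto.smul_const ?_ _
      have h1 : Tendsto (fun e : ℝ => (‖p - y‖ ^ 2 + e) ^ (-1 - α)) (𝓝[>] 0)
          (𝓝 ((‖p - y‖ ^ 2 + 0) ^ (-1 - α))) := by
        refine tendsto_nhdsWithin_of_tendsto_nhds ?_
        refine Tendsto.rpow_const (tendsto_const_nhds.add tendsto_id) (Or.inl ?_)
        positivity
      convert h1 using 2
      rw [add_zero, ← Real.rpow_natCast, ← Real.rpow_mul hr.le, ← Real.rpow_neg hr.le]
      congr 1; push_cast; ring

/-! ### Changes of parametrization -/

/-- The second curve descends to an embedding of the circle of length P₂. Composing the first curve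
with its inverse gives a continuous map into that circle, which lifts to the line through the
covering. -/
lemma IsParam.exists_continuous_reparam {A : Set Plane} {P₁ P₂ : ℝ} {γ₁ γ₂ : ℝ → Plane}
    (h₁ : IsParam A P₁ γ₁) (h₂ : IsParam A P₂ γ₂) :
    ∃ S : ℝ → ℝ, Continuous S ∧ ∀ x, γ₁ x = γ₂ (S x) := by
  have : Fact (0 < P₂) := ⟨h₂.period_pos⟩
  set f : AddCircle P₂ → Plane := h₂.periodic.lift with hf
  have hfc : Continuous f := continuous_coinduced_dom.mpr h₂.continuous
  have hfi : Function.Injective f := by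
    intro a b
    induction a using QuotientAddGroup.induction_on with | _ a =>
    induction b using QuotientAddGroup.induction_on with | _ b =>
    intro hab
    obtain ⟨k, hk⟩ := h₂.eq_iff.1 (show γ₂ a = γ₂ b from hab)
    change (a : AddCircle P₂) = (b : AddCircle P₂)
    rw [hk, AddCircle.coe_add]
    simp [AddCircle.coe_period]
  have hemb : IsEmbedding f := (hfc.isClosedEmbedding hfi).isEmbedding
  have hex : ∀ x, ∃ q, f q = γ₁ x := by
    intro x
    have : γ₁ x ∈ Set.range γ₂ := by
      rw [h₂.range_eq, ← h₁.range_eq]; exact Set.mem_range_self x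
    obtain ⟨s, hs⟩ := this
    exact ⟨(s : AddCircle P₂), hs⟩
  choose q hq using hex
  have hqc : Continuous q := by
    rw [hemb.continuous_iff]
    exact h₁.continuous.congr fun x => (hq x).symm
  obtain ⟨s₀, hs₀⟩ := QuotientAddGroup.mk_surjective (q 0)
  obtain ⟨F, hF, -⟩ := (AddCircle.isCoveringMap_coe P₂).existsUnique_continuousMap_lifts
    ⟨q, hqc⟩ 0 s₀ hs₀
  refine ⟨F, F.continuous, fun x => ?_⟩
  rw [← hq x]
  have := congrFun hF.2 x
  simp only [Function.comp_apply, ContinuousMap.coe_mk] at this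
  rw [← this]
  rfl

/-- Two parametrizations of the same boundary differ by an increasing change of variables. -/
theorem IsParam.exists_reparam {A : Set Plane} {P₁ P₂ : ℝ} {γ₁ γ₂ : ℝ → Plane}
    (hA : IsJordanDomain A) (h₁ : IsParam A P₁ γ₁) (h₂ : IsParam A P₂ γ₂) :
    ∃ S : ℝ → ℝ, (∀ x, HasDerivAt S (‖deriv γ₁ x‖ / ‖deriv γ₂ (S x)‖) x) ∧
      (∀ x, γ₁ x = γ₂ (S x)) ∧
      (∀ x, deriv γ₁ x = (‖deriv γ₁ x‖ / ‖deriv γ₂ (S x)‖) • deriv γ₂ (S x)) ∧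
      StrictMono S ∧ ∀ x, S (x + P₁) = S x + P₂ := by
  obtain ⟨S, hSc, hS⟩ := h₁.exists_continuous_reparam h₂
  have key : ∀ x, ∃ d, 0 < d ∧ HasDerivAt S d x ∧ deriv γ₁ x = d • deriv γ₂ (S x) := by
    intro x
    set u := deriv γ₂ (S x) with hu
    have hu0 : u ≠ 0 := h₂.deriv_ne_zero _
    -- Projecting on u = γ₂'(S x) gives a scalar function with nonzero derivative at S x. Since S is
    -- continuous, near x it coincides with the local inverse of this function composed with ⟨u,
    -- γ₁⟩, and so it is differentiable.
    have hst : HasStrictDerivAt (fun s => inner ℝ u (γ₂ s)) (inner ℝ u u) (S x) := by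
      have h0 : HasStrictDerivAt γ₂ u (S x) :=
        h₂.contDiff.contDiffAt.hasStrictDerivAt one_ne_zero
      exact ((innerSL ℝ u).hasStrictFDerivAt.comp_hasStrictDerivAt (S x) h0)
    have hne : (inner ℝ u u : ℝ) ≠ 0 := (real_inner_self_pos.2 hu0).ne'
    have hg : HasDerivAt (fun y => inner ℝ u (γ₁ y)) (inner ℝ u (deriv γ₁ x)) x :=
      ((innerSL ℝ u).hasFDerivAt.comp_hasDerivAt x (h₁.hasDerivAt x))
    have hinv := (hst.to_localInverse hne).hasDerivAt
    rw [← hS x] at hinv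
    have hcomp := hinv.comp x hg
    have hev : S =ᶠ[𝓝 x] (hst.localInverse _ _ _ hne) ∘ fun y => inner ℝ u (γ₁ y) := by
      have := (hst.hasStrictFDerivAt_equiv hne).eventually_left_inverse
      filter_upwards [hSc.continuousAt.eventually this] with y hy
      simp only [Function.comp_apply]
      rw [hS y]
      exact hy.symm
    have hd := hcomp.congr_of_eventuallyEq hev
    set d := (inner ℝ u u : ℝ)⁻¹ * inner ℝ u (deriv γ₁ x) with hdd
    have hder : deriv γ₁ x = d • u := by
      have h1 : HasDerivAt γ₁ (d • u) x := by
        have := (h₂.hasDerivAt (S x)).scomp x hd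
        exact this.congr_of_eventuallyEq (Eventually.of_forall fun y => hS y)
      exact h1.deriv
    refine ⟨d, ?_, hd, hder⟩
    have hd0 : d ≠ 0 := by
      intro h0
      rw [h0, zero_smul] at hder
      exact h₁.deriv_ne_zero x hder
    -- With d negative, the left side of the first curve would be the right side of the second one,
    -- where the domain is absent.
    by_contra hneg
    have hdneg : 0 < -d := by
      rcases lt_or_gt_of_ne hd0 with h | h
      · linarith
      · exact absurd h hneg
    have hr := h₂.right hA (S x)
    have ht : Tendsto (fun h : ℝ => h * (-d)) (𝓝[>] 0) (𝓝[>] 0) := by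
      refine tendsto_nhdsWithin_iff.2 ⟨?_, ?_⟩
      · have : Tendsto (fun h : ℝ => h * (-d)) (𝓝 0) (𝓝 (0 * (-d))) :=
          tendsto_id.mul_const _
        rw [zero_mul] at this
        exact this.mono_left nhdsWithin_le_nhds
      · filter_upwards [self_mem_nhdsWithin] with h hh
        exact mul_pos hh hdneg
    obtain ⟨h, hh1, hh2⟩ := ((ht.eventually hr).and (h₁.left x)).exists
    apply hh1
    rw [hder, perp_smul, hS x, smul_smul] at hh2
    change γ₂ (S x) - (h * -d) • perp u ∈ A
    rwa [mul_neg, neg_smul, sub_neg_eq_add]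
  choose d hd0 hd hder using key
  have hdn : ∀ x, d x = ‖deriv γ₁ x‖ / ‖deriv γ₂ (S x)‖ := by
    intro x
    have : ‖deriv γ₂ (S x)‖ ≠ 0 := norm_ne_zero_iff.2 (h₂.deriv_ne_zero _)
    rw [hder x, norm_smul, Real.norm_of_nonneg (hd0 x).le, mul_div_assoc, div_self this, mul_one]
  have hmono : StrictMono S := strictMono_of_deriv_pos fun x => by rw [(hd x).deriv]; exact hd0 x
  refine ⟨S, fun x => hdn x ▸ hd x, hS, fun x => hdn x ▸ hder x, hmono, fun x => ?_⟩
  have hP₁ := h₁.period_pos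
  have hP₂ := h₂.period_pos
  -- One period of the first curve advances S by k > 0 periods of the second. If k were at least 2,
  -- S would pass through S x + P₂ strictly inside the period, and the first curve would not be
  -- injective.
  obtain ⟨k, hk⟩ := h₂.eq_iff.1 (show γ₂ (S (x + P₁)) = γ₂ (S x) by
    rw [← hS, ← hS, h₁.periodic])
  have hlt : S x < S (x + P₁) := hmono (by linarith)
  have hk0 : 0 < k := by
    have : 0 < (k : ℝ) * P₂ := by linarith
    exact_mod_cast pos_of_mul_pos_left this hP₂.le
  rcases (show k = 1 ∨ 2 ≤ k by omega) with h1 | h2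
  · rw [hk, h1]; simp
  · exfalso
    have h2' : (2 : ℝ) ≤ k := by exact_mod_cast h2
    have hin : S x + P₂ ∈ Set.Ioo (S x) (S (x + P₁)) := ⟨by linarith, by nlinarith⟩
    obtain ⟨y, hy, hyS⟩ := intermediate_value_Ioo (by linarith : x ≤ x + P₁) hSc.continuousOn hin
    have := h₁.injOn_Ico x ⟨hy.1.le, hy.2⟩ ⟨le_rfl, by linarith⟩
      (show γ₁ y = γ₁ x by rw [hS, hS, hyS, h₂.periodic])
    exact hy.1.ne' this

/-! ### Periodic functions and changes of variables -/

/-- Any two intervals of length T are fundamental domains for the translations by T, which serves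
both the integral norms and the essential supremum. -/
lemma eLpNorm_restrict_period {E : Type*} [NormedAddCommGroup E] {f : ℝ → E} {T : ℝ} (hT : 0 < T)
    (hf : Function.Periodic f T) (p : ℝ≥0∞) (a b : ℝ) :
    eLpNorm f p (volume.restrict (Set.Ioc a (a + T)))
      = eLpNorm f p (volume.restrict (Set.Ioc b (b + T))) := by
  have : VAddInvariantMeasure (AddSubgroup.zmultiples T) ℝ volume :=
    ⟨fun c s _ => measure_preimage_add _ _ _⟩
  have hinv : ∀ (g : AddSubgroup.zmultiples T) (x : ℝ), f (g +ᵥ x) = f x := hf.map_vadd_zmultiples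
  rcases eq_or_ne p 0 with rfl | hp0
  · simp
  rcases eq_or_ne p ⊤ with rfl | hp
  · have h1 : ∀ c, essSup (fun x => ‖f x‖ₑ) (volume.restrict (Set.Ioc c (c + T)))
        = essSup (fun x => ‖f x‖ₑ) volume := fun c =>
      IsAddFundamentalDomain.essSup_measure_restrict (G := AddSubgroup.zmultiples T)
        (μ := volume) (isAddFundamentalDomain_Ioc hT c) (f := fun x => ‖f x‖ₑ)
        (fun g x => congrArg (fun y : E => ‖y‖ₑ) (hinv g x))
    rw [eLpNorm_exponent_top, eLpNorm_exponent_top, eLpNormEssSup, eLpNormEssSup, h1, h1]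
  · have h1 := (isAddFundamentalDomain_Ioc hT a).setLIntegral_eq (isAddFundamentalDomain_Ioc hT b)
      (fun x => ‖f x‖ₑ ^ p.toReal) (fun g x => by rw [hinv])
    rw [eLpNorm_eq_lintegral_rpow_enorm_toReal hp0 hp, eLpNorm_eq_lintegral_rpow_enorm_toReal hp0 hp,
      h1]

lemma lintegral_restrict_period {f : ℝ → ℝ≥0∞} {T : ℝ} (hT : 0 < T)
    (hf : Function.Periodic f T) (a b : ℝ) :
    ∫⁻ x in Set.Ioc a (a + T), f x = ∫⁻ x in Set.Ioc b (b + T), f x := by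
  have : VAddInvariantMeasure (AddSubgroup.zmultiples T) ℝ volume :=
    ⟨fun c s _ => measure_preimage_add _ _ _⟩
  exact (isAddFundamentalDomain_Ioc hT a).setLIntegral_eq (isAddFundamentalDomain_Ioc hT b) _
    hf.map_vadd_zmultiples

section ChangeOfVariables

variable {S g : ℝ → ℝ} (hS : ∀ x, HasDerivAt S (g x) x) (hmono : StrictMono S)
include hS hmono

lemma image_Ioc_of_strictMono (a b : ℝ) : S '' Set.Ioc a b = Set.Ioc (S a) (S b) := by
  ext y
  constructor
  · rintro ⟨x, hx, rfl⟩
    exact ⟨hmono hx.1, hmono.monotone hx.2⟩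
  · intro hy
    have hab : a ≤ b := by
      by_contra h
      push Not at h
      exact absurd (hy.1.trans_le hy.2) (hmono h).le.not_gt
    have hc : ContinuousOn S (Set.Icc a b) := fun x _ => (hS x).continuousAt.continuousWithinAt
    obtain ⟨x, hx, rfl⟩ := intermediate_value_Icc hab hc ⟨hy.1.le, hy.2⟩
    exact ⟨x, ⟨hmono.lt_iff_lt.1 hy.1, hx.2⟩, rfl⟩

lemma intervalIntegral_comp_reparam {E : Type*} [NormedAddCommGroup E] [NormedSpace ℝ E]
    (hg : ∀ x, 0 ≤ g x) {f : ℝ → E} (hf : ∀ a b, IntervalIntegrable f volume a b) (a b : ℝ) :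
    IntervalIntegrable (fun x => g x • f (S x)) volume a b ∧
      ∫ x in a..b, g x • f (S x) = ∫ s in (S a)..(S b), f s := by
  wlog hab : a ≤ b generalizing a b
  · obtain ⟨h1, h2⟩ := this b a (not_le.1 hab).le
    refine ⟨h1.symm, ?_⟩
    rw [intervalIntegral.integral_symm, h2, ← intervalIntegral.integral_symm]
  have habs : (fun x => |g x| • f (S x)) = fun x => g x • f (S x) := by
    funext x; rw [abs_of_nonneg (hg x)]
  have hd : ∀ x ∈ Set.Ioc a b, HasDerivWithinAt S (g x) (Set.Ioc a b) x :=
    fun x _ => (hS x).hasDerivWithinAt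
  constructor
  · rw [intervalIntegrable_iff_integrableOn_Ioc_of_le hab, ← habs,
      ← integrableOn_image_iff_integrableOn_abs_deriv_smul measurableSet_Ioc hd hmono.injective.injOn,
      image_Ioc_of_strictMono hS hmono]
    exact (hf _ _).1
  · rw [intervalIntegral.integral_of_le hab, intervalIntegral.integral_of_le (hmono.monotone hab),
      ← image_Ioc_of_strictMono hS hmono,
      integral_image_eq_integral_abs_deriv_smul measurableSet_Ioc hd hmono.injective.injOn]
    exact congrArg (fun F : ℝ → E => ∫ x in Set.Ioc a b, F x) habs.symm

/-- As S has slope at least m, it maps Lebesgue measure to at most m⁻¹ times Lebesgue measure. The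
norm sees this factor to the power 1/p, which is 0 for p = ⊤. -/
lemma eLpNorm_comp_reparam_le {E : Type*} [NormedAddCommGroup E] {m : ℝ} (hm : 0 < m)
    (hg : ∀ x, m ≤ g x) (f : ℝ → E) (p : ℝ≥0∞) (a b : ℝ) :
    eLpNorm (f ∘ S) p (volume.restrict (Set.Ioc a b))
      ≤ ENNReal.ofReal m⁻¹ ^ (1 / p).toReal
        * eLpNorm f p (volume.restrict (Set.Ioc (S a) (S b))) := by
  have hSc : Continuous S := continuous_iff_continuousAt.2 fun x => (hS x).continuousAt
  have hemb : MeasurableEmbedding S := hSc.measurableEmbedding hmono.injective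
  have hle : (volume.restrict (Set.Ioc a b)).map S
      ≤ ENNReal.ofReal m⁻¹ • volume.restrict (Set.Ioc (S a) (S b)) := by
    refine Measure.le_iff.2 fun E hE => ?_
    rw [hemb.map_apply, Measure.restrict_apply (hSc.measurable hE), Measure.smul_apply,
      Measure.restrict_apply hE, smul_eq_mul]
    have hU : MeasurableSet (S ⁻¹' E ∩ Set.Ioc a b) :=
      (hSc.measurable hE).inter measurableSet_Ioc
    have h1 : S '' (S ⁻¹' E ∩ Set.Ioc a b) ⊆ E ∩ Set.Ioc (S a) (S b) := by
      rintro _ ⟨x, ⟨hx1, hx2⟩, rfl⟩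
      exact ⟨hx1, hmono hx2.1, hmono.monotone hx2.2⟩
    have h2 := lintegral_image_eq_lintegral_abs_deriv_mul hU
      (fun x _ => (hS x).hasDerivWithinAt) hmono.injective.injOn (fun _ => 1)
    simp only [lintegral_one, Measure.restrict_apply_univ, mul_one] at h2
    have h3 : ENNReal.ofReal m * volume (S ⁻¹' E ∩ Set.Ioc a b)
        ≤ volume (E ∩ Set.Ioc (S a) (S b)) := by
      calc ENNReal.ofReal m * volume (S ⁻¹' E ∩ Set.Ioc a b)
          = ∫⁻ x in S ⁻¹' E ∩ Set.Ioc a b, ENNReal.ofReal m := by simp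
        _ ≤ ∫⁻ x in S ⁻¹' E ∩ Set.Ioc a b, ENNReal.ofReal |g x| :=
            lintegral_mono fun x => ENNReal.ofReal_le_ofReal ((hg x).trans (le_abs_self _))
        _ ≤ _ := h2 ▸ measure_mono h1
    calc volume (S ⁻¹' E ∩ Set.Ioc a b)
        = ENNReal.ofReal m⁻¹ * (ENNReal.ofReal m * volume (S ⁻¹' E ∩ Set.Ioc a b)) := by
          rw [← mul_assoc, ← ENNReal.ofReal_mul (by positivity), inv_mul_cancel₀ hm.ne']
          simp
      _ ≤ _ := by gcongr
  calc eLpNorm (f ∘ S) p (volume.restrict (Set.Ioc a b))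
      = eLpNorm f p ((volume.restrict (Set.Ioc a b)).map S) := (hemb.eLpNorm_map_measure).symm
    _ ≤ eLpNorm f p (ENNReal.ofReal m⁻¹ • volume.restrict (Set.Ioc (S a) (S b))) :=
        eLpNorm_mono_measure _ hle
    _ = _ := by
        rw [eLpNorm_smul_measure_of_ne_zero (by simpa using hm)]; rfl

end ChangeOfVariables

/-- By Lebesgue's differentiation theorem both functions are almost everywhere the derivative of the
same primitive. -/
lemma ae_eq_of_intervalIntegral_eq {E : Type*} [NormedAddCommGroup E] [NormedSpace ℝ E]
    [CompleteSpace E] {f g : ℝ → E} (hf : ∀ a b, IntervalIntegrable f volume a b)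
    (hg : ∀ a b, IntervalIntegrable g volume a b)
    (h : ∀ a b, ∫ x in a..b, f x = ∫ x in a..b, g x) : f =ᵐ[volume] g := by
  have hloc : ∀ {u : ℝ → E}, (∀ a b, IntervalIntegrable u volume a b) → LocallyIntegrable u := by
    intro u hu x
    refine ⟨Set.Ioc (x - 1) (x + 1), Ioc_mem_nhds (by linarith) (by linarith), ?_⟩
    exact (hu _ _).1
  filter_upwards [LocallyIntegrable.ae_hasDerivAt_integral (hloc hf),
    LocallyIntegrable.ae_hasDerivAt_integral (hloc hg)] with x
    h1 h2
  have h3 := h1 0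
  simp only [h] at h3
  exact h3.unique (h2 0)

/-! ### The tangent and the curvature along a parametrization -/

/-- The unit tangent. -/
def tangent (γ : ℝ → Plane) (x : ℝ) : Plane := ‖deriv γ x‖⁻¹ • deriv γ x

section Tangent

variable {A : Set Plane} {P : ℝ} {γ : ℝ → Plane} (h : IsParam A P γ)
include h

lemma IsParam.norm_deriv_pos (x : ℝ) : 0 < ‖deriv γ x‖ := norm_pos_iff.2 (h.deriv_ne_zero x)

lemma IsParam.norm_tangent (x : ℝ) : ‖tangent γ x‖ = 1 := by
  rw [tangent, norm_smul, norm_inv, norm_norm, inv_mul_cancel₀ (h.norm_deriv_pos x).ne']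

lemma IsParam.continuous_tangent : Continuous (tangent γ) :=
  (h.continuous_deriv.norm.inv₀ fun x => (h.norm_deriv_pos x).ne').smul h.continuous_deriv

end Tangent

/-- The tangent in two parametrizations. -/
lemma tangent_reparam {A : Set Plane} {L : ℝ} {γ Γ : ℝ → Plane} (hΓ : IsArcParam A L Γ)
    {S : ℝ → ℝ} (hγ0 : ∀ x, deriv γ x ≠ 0)
    (hS : ∀ x, deriv γ x = (‖deriv γ x‖ / ‖deriv Γ (S x)‖) • deriv Γ (S x)) (x : ℝ) :
    tangent γ x = deriv Γ (S x) := by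
  have h1 := hS x
  rw [hΓ.unit_speed, div_one] at h1
  have h2 : ‖deriv γ x‖ ≠ 0 := norm_ne_zero_iff.2 (hγ0 x)
  rw [tangent]
  nth_rewrite 2 [h1]
  rw [smul_smul, inv_mul_cancel₀ h2, one_smul]

/-- Pairing with the continuous unit field perp v recovers u, which yields its measurability; the
norms agree pointwise. -/
lemma intervalIntegrable_of_smul_perp {u : ℝ → ℝ} {v : ℝ → Plane} (hv : Continuous v)
    (hv1 : ∀ x, ‖v x‖ = 1) {a b : ℝ} (hu : IntervalIntegrable (fun x => u x • perp (v x)) volume a b) :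
    IntervalIntegrable u volume a b := by
  have hcont : Continuous fun x => perp (v x) := continuous_perp.comp hv
  have heq : ∀ x, u x = inner ℝ (perp (v x)) (u x • perp (v x)) := by
    intro x
    rw [inner_smul_right, real_inner_self_eq_norm_sq, norm_perp, hv1]; simp
  have hnorm : ∀ x, ‖u x‖ = ‖u x • perp (v x)‖ := fun x => by
    rw [norm_smul, norm_perp, hv1, mul_one]
  rw [intervalIntegrable_iff] at hu ⊢
  refine Integrable.mono hu ?_ (Eventually.of_forall fun x => (hnorm x).le)
  have := (hcont.aestronglyMeasurable (μ := volume.restrict (Set.uIoc a b))).inner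
    (𝕜 := ℝ) hu.aestronglyMeasurable
  exact this.congr (Eventually.of_forall fun x => (heq x).symm)

section Curvature

variable {A : Set Plane} {γ : ℝ → Plane} {κ : ℝ → ℝ}

/-- The curvature is prescribed pointwise as a function of the boundary point, so periodicity is
exact and not merely almost everywhere. -/
lemma IsCurvatureAlong.periodic (h : IsParam A (2 * Real.pi) γ) (hκ : IsCurvatureAlong A γ κ) :
    Function.Periodic κ (2 * Real.pi) := by
  obtain ⟨L, Γ, k, hΓ, -, hk⟩ := hκ
  intro x
  have : γ x ∈ Set.range Γ := by
    rw [hΓ.range_eq, ← h.range_eq]; exact Set.mem_range_self x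
  obtain ⟨s, hs⟩ := this
  rw [hk x s hs.symm, hk _ s ((h.periodic x).trans hs.symm)]

/-- The Frenet equation `τ' = g κ τ^⊥` in a general parametrization. -/
lemma IsCurvatureAlong.isWeakDeriv (hA : IsJordanDomain A) (h : IsParam A (2 * Real.pi) γ)
    (hκ : IsCurvatureAlong A γ κ) :
    IsWeakDeriv (tangent γ) (fun x => (‖deriv γ x‖ * κ x) • perp (tangent γ x)) := by
  obtain ⟨L, Γ, k, hΓ, hw, hk⟩ := hκ
  obtain ⟨S, hSd, hS, hS', hmono, -⟩ := h.exists_reparam hA hΓ.toIsParam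
  have htan := tangent_reparam hΓ h.deriv_ne_zero hS'
  have hSg : ∀ x, HasDerivAt S (‖deriv γ x‖) x := fun x => by
    simpa [hΓ.unit_speed] using hSd x
  have := intervalIntegral_comp_reparam hSg hmono (fun x => norm_nonneg _)
    (fun a b => (hw a b).1)
  have heq : (fun x => ‖deriv γ x‖ • k (S x) • perp (deriv Γ (S x)))
      = fun x => (‖deriv γ x‖ * κ x) • perp (tangent γ x) := by
    funext x
    rw [htan x, hk x (S x) (hS x), smul_smul]
  intro a b
  obtain ⟨h1, h2⟩ := this a b
  rw [heq] at h1 h2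
  exact ⟨h1, by rw [htan, htan, (hw _ _).2, h2]⟩

lemma IsCurvatureAlong.intervalIntegrable (hA : IsJordanDomain A) (h : IsParam A (2 * Real.pi) γ)
    (hκ : IsCurvatureAlong A γ κ) (a b : ℝ) :
    IntervalIntegrable (fun x => ‖deriv γ x‖ * κ x) volume a b :=
  intervalIntegrable_of_smul_perp h.continuous_tangent h.norm_tangent
    ((hκ.isWeakDeriv hA h) a b).1

lemma IsCurvatureAlong.intervalIntegrable_self (hA : IsJordanDomain A)
    (h : IsParam A (2 * Real.pi) γ) (hκ : IsCurvatureAlong A γ κ) (a b : ℝ) :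
    IntervalIntegrable κ volume a b := by
  have h1 := (hκ.intervalIntegrable hA h a b).continuousOn_mul
    ((h.continuous_deriv.norm.inv₀ fun x => (h.norm_deriv_pos x).ne').continuousOn)
  refine h1.congr (fun x _ => ?_)
  change ‖deriv γ x‖⁻¹ * (‖deriv γ x‖ * κ x) = κ x
  rw [← mul_assoc, inv_mul_cancel₀ (h.norm_deriv_pos x).ne', one_mul]

/-- The Sobolev bound comes with its own arc-length parametrization, which need not be the one that
defines κ. Both describe the same weak derivative of the tangent, so |κ| = |w ∘ S| almost
everywhere, and the change of variables transports the norm. -/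
lemma eLpNorm_curvature_le (hA : IsJordanDomain A) (h : IsParam A (2 * Real.pi) γ)
    (hκ : IsCurvatureAlong A γ κ) {p : ℝ≥0∞} {B : ℝ≥0} (hB : SobolevNormLE p A B) {m : ℝ}
    (hm : 0 < m) (hg : ∀ x, m ≤ ‖deriv γ x‖) :
    eLpNorm κ p torusMeasure ≤ ENNReal.ofReal m⁻¹ ^ (1 / p).toReal * B := by
  have hper := hκ.periodic h
  have hwd := hκ.isWeakDeriv hA h
  obtain ⟨L, Γ, w, hΓ, hw, hBw⟩ := hB
  obtain ⟨S, hSd, hS, hS', hmono, hSP⟩ := h.exists_reparam hA hΓ.toIsParam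
  have htan := tangent_reparam hΓ h.deriv_ne_zero hS'
  have hSg : ∀ x, HasDerivAt S (‖deriv γ x‖) x := fun x => by
    simpa [hΓ.unit_speed] using hSd x
  have hch := intervalIntegral_comp_reparam hSg hmono (fun x => norm_nonneg _)
    (fun a b => (hw a b).1)
  have hae : (fun x => (‖deriv γ x‖ * κ x) • perp (tangent γ x))
      =ᵐ[volume] fun x => ‖deriv γ x‖ • w (S x) := by
    refine ae_eq_of_intervalIntegral_eq (fun a b => (hwd a b).1) (fun a b => (hch a b).1)
      fun a b => ?_
    rw [← (hwd a b).2, (hch a b).2, ← (hw _ _).2, htan, htan]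
  have hae' : ∀ᵐ x, ‖κ x‖ = ‖(w ∘ S) x‖ := by
    filter_upwards [hae] with x hx
    have hx := congrArg norm hx
    rw [norm_smul, norm_perp, h.norm_tangent, mul_one, norm_mul, norm_smul] at hx
    exact mul_left_cancel₀ (by simpa using h.deriv_ne_zero x) hx
  -- start the period at the point with arc-length parameter `-L/2`
  obtain ⟨x₀, hx₀⟩ : ∃ x₀, S x₀ = -(L / 2) := by
    have hL := hΓ.period_pos
    have hSc : Continuous S := continuous_iff_continuousAt.2 fun x => (hSg x).continuousAt
    have hn : ∀ n : ℤ, S (n * (2 * Real.pi)) = S 0 + n * L := by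
      intro n
      induction n using Int.induction_on with
      | zero => simp
      | succ n ih =>
        rw [show ((n + 1 : ℤ) : ℝ) * (2 * Real.pi) = (n : ℤ) * (2 * Real.pi) + 2 * Real.pi by
          push_cast; ring, hSP, ih]; push_cast; ring
      | pred n ih =>
        have := hSP (((-n - 1 : ℤ) : ℝ) * (2 * Real.pi))
        rw [show ((-n - 1 : ℤ) : ℝ) * (2 * Real.pi) + 2 * Real.pi = ((-n : ℤ) : ℝ) * (2 * Real.pi) by
          push_cast; ring, ih] at this
        push_cast at this ⊢; linarith
    obtain ⟨n, hn1⟩ := exists_int_gt ((-(L / 2) - S 0) / L)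
    obtain ⟨k, hk1⟩ := exists_int_lt ((-(L / 2) - S 0) / L)
    rw [div_lt_iff₀ hL] at hn1
    rw [lt_div_iff₀ hL] at hk1
    exact mem_range_of_exists_le_of_exists_ge hSc ⟨_, by rw [hn k]; linarith⟩
      ⟨_, by rw [hn n]; linarith⟩
  have hpi := Real.pi_pos
  have h1 : eLpNorm κ p torusMeasure
      = eLpNorm κ p (volume.restrict (Set.Ioc x₀ (x₀ + 2 * Real.pi))) := by
    rw [torusMeasure, ← eLpNorm_restrict_period (by positivity) hper p (-Real.pi) x₀]
    congr 3; ring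
  rw [h1, eLpNorm_congr_norm_ae (ae_restrict_of_ae hae')]
  refine (eLpNorm_comp_reparam_le hSg hmono hm hg w p _ _).trans ?_
  gcongr
  rw [hSP, hx₀, show -(L / 2) + L = L / 2 by ring]
  refine (eLpNorm_mono_measure w (Measure.restrict_mono Set.Ioc_subset_Icc_self le_rfl)).trans ?_
  exact le_add_self.trans hBw

lemma norm_tangent_sub_le (hwd : IsWeakDeriv (tangent γ)
    (fun x => (‖deriv γ x‖ * κ x) • perp (tangent γ x))) (ht : ∀ x, ‖tangent γ x‖ = 1) {x y : ℝ} :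
    ‖tangent γ y - tangent γ x‖ ≤ |∫ u in x..y, ‖deriv γ u‖ * ‖κ u‖| := by
  rw [(hwd x y).2]
  refine (intervalIntegral.norm_integral_le_abs_integral_norm).trans (le_of_eq ?_)
  congr 1
  refine intervalIntegral.integral_congr fun u _ => ?_
  simp only [norm_smul, norm_perp, ht, mul_one, norm_mul, norm_norm]

/-- Hölder's inequality on a short interval for a periodic function. -/
lemma abs_integral_abs_le_rpow {p : ℝ≥0∞} (hp : 1 ≤ p) (hper : Function.Periodic κ (2 * Real.pi))
    (hint : ∀ a b, IntervalIntegrable κ volume a b) {B : ℝ≥0} (hB : eLpNorm κ p torusMeasure ≤ B)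
    {x y : ℝ} (hxy : |x - y| ≤ Real.pi) :
    |∫ u in x..y, ‖κ u‖| ≤ B * |x - y| ^ (1 - (p⁻¹).toReal) := by
  wlog hle : x ≤ y generalizing x y
  · rw [intervalIntegral.integral_symm, abs_neg, abs_sub_comm]
    exact this (by rwa [abs_sub_comm]) (not_le.1 hle).le
  have hpi := Real.pi_pos
  have hlen : |x - y| = y - x := by rw [abs_sub_comm, abs_of_nonneg (by linarith)]
  have hi : IntegrableOn κ (Set.Ioc x y) := (hint x y).1
  have h1 : ∫ u in x..y, ‖κ u‖ = (eLpNorm κ 1 (volume.restrict (Set.Ioc x y))).toReal := by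
    rw [intervalIntegral.integral_of_le hle, eLpNorm_one_eq_lintegral_enorm,
      ← integral_norm_eq_lintegral_enorm hi.aestronglyMeasurable]
  have h2 : eLpNorm κ 1 (volume.restrict (Set.Ioc x y))
      ≤ B * ENNReal.ofReal (y - x) ^ (1 - (p⁻¹).toReal) := by
    refine (eLpNorm_le_eLpNorm_mul_rpow_measure_univ hp hi.aestronglyMeasurable).trans ?_
    rw [Measure.restrict_apply_univ, Real.volume_Ioc, ENNReal.toReal_one, div_one, ENNReal.toReal_inv,
      one_div]
    gcongr
    refine (eLpNorm_mono_measure κ (Measure.restrict_mono (Set.Ioc_subset_Ioc_right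
      (show y ≤ x + 2 * Real.pi by linarith)) le_rfl)).trans ?_
    rw [eLpNorm_restrict_period (by positivity) hper p x (-Real.pi)]
    convert! hB using 2
    rw [torusMeasure]; congr 2; ring
  rw [h1, abs_of_nonneg ENNReal.toReal_nonneg, hlen]
  have hβ : 0 ≤ 1 - (p⁻¹).toReal := by
    have : (p⁻¹).toReal ≤ 1 := by
      rw [← ENNReal.toReal_one]
      exact ENNReal.toReal_mono ENNReal.one_ne_top (ENNReal.inv_le_one.2 hp)
    linarith
  refine (ENNReal.toReal_mono ?_ h2).trans (le_of_eq ?_)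
  · exact ENNReal.mul_ne_top ENNReal.coe_ne_top (ENNReal.rpow_ne_top_of_nonneg hβ ENNReal.ofReal_ne_top)
  · rw [ENNReal.toReal_mul, ENNReal.coe_toReal, ← ENNReal.toReal_rpow,
      ENNReal.toReal_ofReal (by linarith)]

end Curvature

/-! ### Chord-arc bounds and joint continuity -/

/-- The change of parameter between the two curves has slope at least m/M₀, so a chord-arc bound
known for one parametrization passes to every other parametrization of the same boundary with a
speed bounded below. -/
lemma chord_of_reparam {A : Set Plane} {γ γ₀ : ℝ → Plane} (hA : IsJordanDomain A)
    (h : IsParam A (2 * Real.pi) γ) (h₀ : IsParam A (2 * Real.pi) γ₀) {m M₀ c₀ : ℝ} (hm : 0 < m)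
    (hM₀ : 0 < M₀) (hc₀ : 0 < c₀) (hg : ∀ x, m ≤ ‖deriv γ x‖) (hg₀ : ∀ x, ‖deriv γ₀ x‖ ≤ M₀)
    (hch : ∀ x y, |x - y| ≤ Real.pi → c₀ * |x - y| ≤ ‖γ₀ x - γ₀ y‖) (x y : ℝ)
    (hxy : |x - y| ≤ Real.pi) : c₀ * (m / M₀) * |x - y| ≤ ‖γ x - γ y‖ := by
  wlog hle : y ≤ x generalizing x y
  · rw [abs_sub_comm, norm_sub_rev]
    exact this y x (by rwa [abs_sub_comm]) (not_le.1 hle).le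
  obtain ⟨S, hSd, hS, -, hmono, hSP⟩ := h.exists_reparam hA h₀
  have hdiff : Differentiable ℝ S := fun x => (hSd x).differentiableAt
  have hder : ∀ x, m / M₀ ≤ deriv S x := fun x => by
    rw [(hSd x).deriv]
    exact div_le_div₀ (norm_nonneg _) (hg x) (h₀.norm_deriv_pos _) (hg₀ _)
  have hinc := fun a b (hab : a ≤ b) => mul_sub_le_image_sub_of_le_deriv hdiff hder hab
  rw [abs_of_nonneg (by linarith)] at hxy ⊢
  have h1 := hinc y x hle
  have hmM : 0 < m / M₀ := by positivity
  rw [mul_assoc]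
  have hSle := hmono.monotone hle
  rcases le_or_gt (S x - S y) Real.pi with hD | hD
  · rw [hS x, hS y]
    have h2 : |S x - S y| = S x - S y := abs_of_nonneg (by linarith)
    calc c₀ * (m / M₀ * (x - y)) ≤ c₀ * (S x - S y) := by gcongr
      _ = c₀ * |S x - S y| := by rw [h2]
      _ ≤ _ := hch _ _ (by rwa [h2])
  -- The new parameters are more than π apart, so the circle is traversed the other way, from S x to
  -- S y + 2π. In the old parameter this way has length y + 2π − x, which is at least x − y because
  -- x − y ≤ π.
  · have h3 := hinc x (y + 2 * Real.pi) (by linarith)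
    have h5 := hmono.monotone (show x ≤ y + 2 * Real.pi by linarith)
    rw [hSP] at h3 h5
    have h4 : γ y = γ₀ (S y + 2 * Real.pi) := by rw [h₀.periodic, hS y]
    have h2 : |S x - (S y + 2 * Real.pi)| = S y + 2 * Real.pi - S x := by
      rw [abs_sub_comm, abs_of_nonneg (by linarith)]
    rw [h4, hS x]
    have h6 : m / M₀ * (x - y) ≤ m / M₀ * (y + 2 * Real.pi - x) :=
      mul_le_mul_of_nonneg_left (by linarith) hmM.le
    calc c₀ * (m / M₀ * (x - y)) ≤ c₀ * (S y + 2 * Real.pi - S x) := by gcongr; linarith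
      _ = c₀ * |S x - (S y + 2 * Real.pi)| := by rw [h2]
      _ ≤ _ := hch _ _ (by rw [h2]; linarith)

/-- Written as the mean of the derivative over the segment, the difference quotient is continuous up
to z = 0. For |z| ≤ π it never vanishes, as the curves are immersed and injective modulo 2π.
Compactness in time, label and increment then gives both constants. -/
lemma exists_uniform_chord {γ : ℝ → ℝ → Plane} {Ω : ℝ → Set Plane}
    (h : ∀ t, IsParam (Ω t) (2 * Real.pi) (γ t))
    (hc : Continuous fun z : ℝ × ℝ => deriv (γ z.1) z.2) (T : ℝ) :
    ∃ c > 0, ∃ M > 0, ∀ t ∈ Set.Icc 0 T, (∀ x, ‖deriv (γ t) x‖ ≤ M) ∧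
      ∀ x y, |x - y| ≤ Real.pi → c * |x - y| ≤ ‖γ t x - γ t y‖ := by
  have hpi := Real.pi_pos
  set q : ℝ × ℝ × ℝ → Plane := fun w => ∫ u in (0 : ℝ)..1, deriv (γ w.1) (w.2.1 + u * w.2.2) with hq
  have hqc : Continuous q := by
    refine intervalIntegral.continuous_parametric_intervalIntegral_of_continuous' ?_ 0 1
    exact hc.comp (f := fun w : (ℝ × ℝ × ℝ) × ℝ => (w.1.1, w.1.2.1 + w.2 * w.1.2.2)) (by fun_prop)
  have hqz : ∀ t x z, z • q (t, x, z) = γ t (x + z) - γ t x := by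
    intro t x z
    simp only [hq]
    rw [← intervalIntegral.integral_smul]
    have hd : ∀ u ∈ Set.uIcc (0 : ℝ) 1, HasDerivAt (fun u => γ t (x + u * z))
        (z • deriv (γ t) (x + u * z)) u := by
      intro u _
      have h1 : HasDerivAt (fun u : ℝ => x + u * z) z u := by
        simpa using ((hasDerivAt_id u).mul_const z).const_add x
      exact ((h t).hasDerivAt (x + u * z)).scomp u h1
    rw [intervalIntegral.integral_eq_sub_of_hasDerivAt hd]
    · simp
    · refine Continuous.intervalIntegrable ?_ _ _
      exact ((h t).continuous_deriv.comp (by fun_prop)).const_smul z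
  have hq0 : ∀ t x z, |z| ≤ Real.pi → q (t, x, z) ≠ 0 := by
    intro t x z hz h0
    rcases eq_or_ne z 0 with rfl | hz0
    · simp only [hq, mul_zero, add_zero, intervalIntegral.integral_const, sub_zero, one_smul] at h0
      exact (h t).deriv_ne_zero x h0
    · have h1 := hqz t x z
      rw [h0, smul_zero] at h1
      obtain ⟨k, hk⟩ := (h t).eq_iff.1 (sub_eq_zero.1 h1.symm)
      have hk' : z = k * (2 * Real.pi) := by linarith
      rcases eq_or_ne k 0 with rfl | hk0
      · simp at hk'; exact hz0 hk'
      · have : (1 : ℝ) ≤ |(k : ℝ)| := by exact_mod_cast Int.one_le_abs hk0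
        rw [hk', abs_mul, abs_of_pos (by positivity : 0 < 2 * Real.pi)] at hz
        nlinarith
  set K : Set (ℝ × ℝ × ℝ) := Set.Icc 0 T ×ˢ Set.Icc 0 (2 * Real.pi) ×ˢ Set.Icc (-Real.pi) Real.pi
  have hK : IsCompact K := isCompact_Icc.prod (isCompact_Icc.prod isCompact_Icc)
  rcases Set.eq_empty_or_nonempty (Set.Icc 0 T) with hT | hT
  · exact ⟨1, one_pos, 1, one_pos, fun t ht => by simp [hT] at ht⟩
  have hKne : K.Nonempty := hT.prod ((Set.nonempty_Icc.2 (by positivity)).prod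
    (Set.nonempty_Icc.2 (by linarith)))
  obtain ⟨w, hw, hmin⟩ := hK.exists_isMinOn hKne hqc.norm.continuousOn
  obtain ⟨w', hw', hmax⟩ := hK.exists_isMaxOn hKne hqc.norm.continuousOn
  have hred : ∀ x, ∃ x' ∈ Set.Icc 0 (2 * Real.pi), ∃ n : ℤ, x = x' + n * (2 * Real.pi) := by
    intro x
    have h2 : (0 : ℝ) < 2 * Real.pi := by positivity
    have hm := toIcoMod_mem_Ico h2 0 x
    refine ⟨toIcoMod h2 0 x, ⟨hm.1, by linarith [hm.2]⟩, toIcoDiv h2 0 x, ?_⟩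
    have := toIcoMod_add_toIcoDiv_zsmul h2 0 x
    rw [zsmul_eq_mul] at this
    exact this.symm
  have hqper : ∀ t x (n : ℤ) z, q (t, x + n * (2 * Real.pi), z) = q (t, x, z) := by
    intro t x n z
    simp only [hq]
    congr 1
    funext u
    have := ((h t).periodic_deriv.int_mul n) (x + u * z)
    rw [← this]; congr 1; ring
  refine ⟨‖q w‖, norm_pos_iff.2 (hq0 _ _ _ (abs_le.2 hw.2.2)), ‖q w'‖,
    norm_pos_iff.2 (hq0 _ _ _ (abs_le.2 hw'.2.2)), fun t ht => ⟨fun x => ?_, fun x y hxy => ?_⟩⟩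
  · obtain ⟨x', hx', n, rfl⟩ := hred x
    have h1 : q (t, x', 0) = deriv (γ t) (x' + n * (2 * Real.pi)) := by
      have := ((h t).periodic_deriv.int_mul n) x'
      simp [hq, this]
    rw [← h1]
    exact hmax (show (t, x', (0 : ℝ)) ∈ K from ⟨ht, hx', by constructor <;> linarith⟩)
  · obtain ⟨y', hy', n, rfl⟩ := hred y
    set z := x - (y' + n * (2 * Real.pi)) with hz
    have h1 := hqz t (y' + n * (2 * Real.pi)) z
    rw [hqper, show y' + n * (2 * Real.pi) + z = x by rw [hz]; ring] at h1
    rw [← h1, norm_smul, Real.norm_eq_abs, mul_comm]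
    gcongr
    exact hmin (show (t, y', z) ∈ K from ⟨ht, hy', abs_le.1 hxy⟩)

/-- Joint continuity of a family that is continuous for the supremum norm. -/
lemma continuous_uncurry_of_tendsto_iSup {f : ℝ → ℝ → Plane} (hf : ∀ t, Continuous (f t))
    (h : ∀ t, Tendsto (fun τ => ⨆ x, ‖f τ x - f t x‖ₑ) (𝓝 t) (𝓝 0)) :
    Continuous fun z : ℝ × ℝ => f z.1 z.2 := by
  rw [continuous_iff_continuousAt]
  rintro ⟨t, x⟩
  have h1 : Tendsto (fun z : ℝ × ℝ => ‖f z.1 z.2 - f t z.2‖ₑ) (𝓝 (t, x)) (𝓝 0) := by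
    refine tendsto_of_tendsto_of_tendsto_of_le_of_le tendsto_const_nhds
      ((h t).comp (continuous_fst.tendsto (t, x))) (fun _ => bot_le) fun z => ?_
    exact le_iSup (fun x => ‖f z.1 x - f t x‖ₑ) z.2
  have h2 : Tendsto (fun z : ℝ × ℝ => f z.1 z.2 - f t z.2) (𝓝 (t, x)) (𝓝 0) := by
    rw [tendsto_zero_iff_norm_tendsto_zero]
    have := (ENNReal.tendsto_toReal ENNReal.zero_ne_top).comp h1
    simpa [Function.comp_def] using this
  have h3 : Tendsto (fun z : ℝ × ℝ => f t z.2) (𝓝 (t, x)) (𝓝 (f t x)) :=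
    ((hf t).comp continuous_snd).tendsto (t, x)
  have := h2.add h3
  simpa [ContinuousAt] using this

/-- Projection of time onto `[0, T]`. -/
def clamp (T t : ℝ) : ℝ := max 0 (min T t)

lemma clamp_mem {T : ℝ} (hT : 0 ≤ T) (t : ℝ) : clamp T t ∈ Set.Icc 0 T :=
  ⟨le_max_left _ _, max_le hT (min_le_left _ _)⟩

lemma clamp_of_mem {T t : ℝ} (ht : t ∈ Set.Icc 0 T) : clamp T t = t := by
  rw [clamp, min_eq_right ht.2, max_eq_right ht.1]

lemma continuous_clamp (T : ℝ) : Continuous (clamp T) := by unfold clamp; fun_prop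

lemma tendsto_clamp {T : ℝ} (hT : 0 ≤ T) (t : ℝ) :
    Tendsto (clamp T) (𝓝 t) (𝓝[Set.Icc 0 T] (clamp T t)) :=
  tendsto_nhdsWithin_iff.2 ⟨(continuous_clamp T).tendsto t, Eventually.of_forall (clamp_mem hT)⟩

section Flow

variable {α σ T : ℝ} {Ω : ℝ → Set Plane} {γ : ℝ → ℝ → Plane}

/-- Clamping the time extends the flow to the whole line, so that joint continuity needs no
restriction to [0,T] in what follows. -/
lemma continuous_flow (hT : 0 ≤ T) (hf : IsFlow α T Ω γ) (hγ : ContinuousInHolder σ T γ) :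
    (Continuous fun z : ℝ × ℝ => γ (clamp T z.1) z.2) ∧
      Continuous fun z : ℝ × ℝ => deriv (γ (clamp T z.1)) z.2 := by
  have hp : ∀ t, IsParam (Ω (clamp T t)) (2 * Real.pi) (γ (clamp T t)) :=
    fun t => hf.param _ (clamp_mem hT t)
  have hlim : ∀ t, Tendsto (fun τ => holderNorm σ (fun x => γ (clamp T τ) x - γ (clamp T t) x))
      (𝓝 t) (𝓝 0) := fun t =>
    ((hγ _ (clamp_mem hT t)).2).comp (tendsto_clamp hT t)
  constructor
  · refine continuous_uncurry_of_tendsto_iSup (f := fun t => γ (clamp T t))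
      (fun t => (hp t).continuous) fun t => ?_
    refine tendsto_of_tendsto_of_tendsto_of_le_of_le tendsto_const_nhds (hlim t)
      (fun _ => bot_le) fun τ => ?_
    exact le_add_right (le_add_right le_rfl)
  · refine continuous_uncurry_of_tendsto_iSup (f := fun t => deriv (γ (clamp T t)))
      (fun t => (hp t).continuous_deriv) fun t => ?_
    refine tendsto_of_tendsto_of_tendsto_of_le_of_le tendsto_const_nhds (hlim t)
      (fun _ => bot_le) fun τ => ?_
    have : ∀ x, deriv (fun x => γ (clamp T τ) x - γ (clamp T t) x) x
        = deriv (γ (clamp T τ)) x - deriv (γ (clamp T t)) x := fun x =>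
      (((hp τ).hasDerivAt x).sub ((hp t).hasDerivAt x)).deriv
    simp only [holderNorm, this]
    exact le_add_right (le_add_left le_rfl)

end Flow

/-! ### Calculus of absolutely continuous functions and rotating unit vectors -/

/-- `f` is a primitive of the locally integrable function `f'`. -/
def IsPrim (f f' : ℝ → ℝ) : Prop :=
  ∀ a b : ℝ, IntervalIntegrable f' volume a b ∧ f b - f a = ∫ s in a..b, f' s

namespace IsPrim

variable {f g f' g' : ℝ → ℝ}

lemma congr (h : IsPrim f f') {k : ℝ → ℝ} (hk : ∀ x, f' x = k x) : IsPrim f k := by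
  have : f' = k := funext hk
  rwa [← this]

lemma congr_left (h : IsPrim f f') {k : ℝ → ℝ} (hk : ∀ x, f x = k x) : IsPrim k f' := by
  have : f = k := funext hk
  rwa [← this]

lemma of_hasDerivAt (h : ∀ x, HasDerivAt f (f' x) x) (hc : Continuous f') : IsPrim f f' :=
  fun a b => ⟨hc.intervalIntegrable a b,
    (intervalIntegral.integral_eq_sub_of_hasDerivAt (fun x _ => h x)
      (hc.intervalIntegrable a b)).symm⟩

lemma add (hf : IsPrim f f') (hg : IsPrim g g') :
    IsPrim (fun x => f x + g x) fun x => f' x + g' x := fun a b => by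
  refine ⟨(hf a b).1.add (hg a b).1, ?_⟩
  rw [intervalIntegral.integral_add (hf a b).1 (hg a b).1, ← (hf a b).2, ← (hg a b).2]
  ring

lemma sub (hf : IsPrim f f') (hg : IsPrim g g') :
    IsPrim (fun x => f x - g x) fun x => f' x - g' x := fun a b => by
  refine ⟨(hf a b).1.sub (hg a b).1, ?_⟩
  rw [intervalIntegral.integral_sub (hf a b).1 (hg a b).1, ← (hf a b).2, ← (hg a b).2]
  ring

lemma absCont (hf : IsPrim f f') (a b : ℝ) : AbsolutelyContinuousOnInterval f a b := by
  have h1 : f = fun x => (∫ s in a..x, f' s) - (- f a) := by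
    funext x; rw [← (hf a x).2]; ring
  rw [h1]
  refine ((hf a b).1.absolutelyContinuousOnInterval_intervalIntegral (by simp)).fun_sub ?_
  exact LipschitzOnWith.absolutelyContinuousOnInterval
    ((LipschitzWith.const (- f a)).lipschitzOnWith)

lemma continuous (hf : IsPrim f f') : Continuous f := by
  have h1 : f = fun x => (∫ s in (0 : ℝ)..x, f' s) + f 0 := by
    funext x; rw [← (hf 0 x).2]; ring
  rw [h1]
  exact (intervalIntegral.continuous_primitive (fun a b => (hf a b).1) 0).add continuous_const

lemma ae_hasDerivAt (hf : IsPrim f f') (a b : ℝ) :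
    ∀ᵐ x, x ∈ Set.uIcc a b → HasDerivAt f (f' x) x := by
  filter_upwards [(hf a b).1.ae_hasDerivAt_integral] with x hx hxm
  have h1 : f = fun x => (∫ s in a..x, f' s) + f a := by
    funext x; rw [← (hf a x).2]; ring
  rw [h1]
  exact (hx hxm a (by simp)).add_const _

/-- Applied over a period, this product rule is the integration by parts used throughout, valid for
factors whose derivative is only integrable, such as the tangent. -/
lemma mul (hf : IsPrim f f') (hg : IsPrim g g') :
    IsPrim (fun x => f x * g x) fun x => f' x * g x + f x * g' x := fun a b => by
  refine ⟨((hf a b).1.mul_continuousOn hg.continuous.continuousOn).add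
    ((hg a b).1.continuousOn_mul hf.continuous.continuousOn), ?_⟩
  rw [← (hf.absCont a b).integral_deriv_mul_eq_sub (hg.absCont a b)]
  refine intervalIntegral.integral_congr_ae ?_
  filter_upwards [hf.ae_hasDerivAt a b, hg.ae_hasDerivAt a b] with x h1 h2 hx
  rw [(h1 (Set.uIoc_subset_uIcc hx)).deriv, (h2 (Set.uIoc_subset_uIcc hx)).deriv]

/-- A contraction preserves absolute continuity. Only sine and cosine are needed, whence the bound
1. -/
lemma comp_of_abs_le_one (hf : IsPrim f f') {F F' : ℝ → ℝ} (hF : ∀ x, HasDerivAt F (F' x) x)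
    (hF' : ∀ x, |F' x| ≤ 1) : IsPrim (fun x => F (f x)) fun x => F' (f x) * f' x := fun a b => by
  have hlip : ∀ x y, dist (F x) (F y) ≤ dist x y := fun x y => by
    have := Convex.norm_image_sub_le_of_norm_hasDerivWithin_le (s := Set.univ) (C := 1)
      (fun x _ => (hF x).hasDerivWithinAt) (fun x _ => hF' x) convex_univ
      (Set.mem_univ y) (Set.mem_univ x)
    rwa [one_mul, ← dist_eq_norm, ← dist_eq_norm] at this
  have hac : AbsolutelyContinuousOnInterval (fun x => F (f x)) a b :=
    squeeze_zero (fun _ => Finset.sum_nonneg fun _ _ => dist_nonneg)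
      (fun _ => Finset.sum_le_sum fun _ _ => hlip _ _) (hf.absCont a b)
  have hd : ∀ᵐ x, x ∈ Set.uIoc a b → deriv (fun x => F (f x)) x = F' (f x) * f' x := by
    filter_upwards [hf.ae_hasDerivAt a b] with x hx hxm
    exact ((hF (f x)).comp x (hx (Set.uIoc_subset_uIcc hxm))).deriv
  refine ⟨hac.intervalIntegrable_deriv.congr_ae ?_, ?_⟩
  · exact (ae_restrict_iff' measurableSet_uIoc).2 hd
  · rw [← hac.integral_deriv_eq_sub]
    exact intervalIntegral.integral_congr_ae hd

lemma eq_of_zero (hf : IsPrim f fun _ => 0) (a b : ℝ) : f b = f a := by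
  have := (hf a b).2
  rw [intervalIntegral.integral_zero] at this
  linarith

lemma of_intervalIntegrable (h : ∀ a b, IntervalIntegrable f' volume a b) (a : ℝ) :
    IsPrim (fun x => ∫ s in a..x, f' s) f' := fun b c =>
  ⟨h b c, intervalIntegral.integral_interval_sub_left (h a c) (h a b)⟩

lemma integral_eq_zero (hf : IsPrim f f') {P : ℝ} (h : Function.Periodic f P) (a : ℝ) :
    ∫ x in a..a + P, f' x = 0 := by
  rw [← (hf a (a + P)).2, h, sub_self]

end IsPrim

lemma IsWeakDeriv.isPrim_apply {f w : ℝ → Plane} (h : IsWeakDeriv f w) (i : Fin 2) :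
    IsPrim (fun x => f x i) fun x => w x i := fun a b => by
  have h1 : IntervalIntegrable (fun x => w x i) volume a b :=
    ⟨(EuclideanSpace.proj (𝕜 := ℝ) i).integrable_comp (h a b).1.1,
      (EuclideanSpace.proj (𝕜 := ℝ) i).integrable_comp (h a b).1.2⟩
  refine ⟨h1, ?_⟩
  have := (EuclideanSpace.proj (𝕜 := ℝ) i).intervalIntegral_comp_comm (h a b).1
  rw [← (h a b).2] at this
  exact this.symm

lemma IsWeakDeriv.inner {f w g v : ℝ → Plane} (hf : IsWeakDeriv f w) (hg : IsWeakDeriv g v) :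
    IsPrim (fun x => inner ℝ (f x) (g x)) fun x => inner ℝ (w x) (g x) + inner ℝ (f x) (v x) := by
  simp only [inner_plane]
  exact (((hf.isPrim_apply 0).mul (hg.isPrim_apply 0)).add
    ((hf.isPrim_apply 1).mul (hg.isPrim_apply 1))).congr fun x => by ring

lemma IsWeakDeriv.cross {f w g v : ℝ → Plane} (hf : IsWeakDeriv f w) (hg : IsWeakDeriv g v) :
    IsPrim (fun x => cross (f x) (g x)) fun x => cross (w x) (g x) + cross (f x) (v x) := by
  simp only [AlphaPatch.cross]
  exact (((hf.isPrim_apply 0).mul (hg.isPrim_apply 1)).sub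
    ((hf.isPrim_apply 1).mul (hg.isPrim_apply 0))).congr fun x => by ring

lemma IsWeakDeriv.of_hasDerivAt {f f' : ℝ → Plane} (h : ∀ x, HasDerivAt f (f' x) x)
    (hc : Continuous f') : IsWeakDeriv f f' :=
  fun a b => ⟨hc.intervalIntegrable a b,
    (intervalIntegral.integral_eq_sub_of_hasDerivAt (fun x _ => h x)
      (hc.intervalIntegrable a b)).symm⟩

lemma IsWeakDeriv.const (c : Plane) : IsWeakDeriv (fun _ => c) fun _ => 0 := fun a b => by simp

lemma IsWeakDeriv.sub_const {f w : ℝ → Plane} (h : IsWeakDeriv f w) (c : Plane) :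
    IsWeakDeriv (fun x => f x - c) w := fun a b => ⟨(h a b).1, by rw [← (h a b).2, sub_sub_sub_cancel_right]⟩

/-- A unit vector with angular velocity `μ` turns by the angle `∫ μ`. -/
lemma IsWeakDeriv.eq_rotation {τ : ℝ → Plane} {μ : ℝ → ℝ}
    (h : IsWeakDeriv τ fun x => μ x • perp (τ x)) (hμ : ∀ a b, IntervalIntegrable μ volume a b)
    (a b : ℝ) :
    τ b = Real.cos (∫ s in a..b, μ s) • τ a + Real.sin (∫ s in a..b, μ s) • perp (τ a) := by
  have hΘ := IsPrim.of_intervalIntegrable hμ a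
  have hc := hΘ.comp_of_abs_le_one (F := Real.cos) (F' := fun x => -Real.sin x)
    Real.hasDerivAt_cos (fun x => by rw [abs_neg]; exact Real.abs_sin_le_one x)
  have hs := hΘ.comp_of_abs_le_one (F := Real.sin) (F' := Real.cos)
    Real.hasDerivAt_sin Real.abs_cos_le_one
  have h0 := h.isPrim_apply 0
  have h1 := h.isPrim_apply 1
  -- The vector rotated back by the angle ∫μ has zero weak derivative, so both of its coordinates
  -- are constant.
  have e1 := (((h0.mul hc).add (h1.mul hs)).congr (k := fun _ => 0) fun x => by
    simp [perp]; ring).eq_of_zero a b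
  have e2 := (((h1.mul hc).sub (h0.mul hs)).congr (k := fun _ => 0) fun x => by
    simp [perp]; ring).eq_of_zero a b
  simp only [intervalIntegral.integral_same, Real.cos_zero, Real.sin_zero] at e1 e2
  have hcs := Real.sin_sq_add_cos_sq (∫ s in a..b, μ s)
  refine plane_ext ?_ ?_
  · simp only [PiLp.add_apply, PiLp.smul_apply, perp_zero_apply, smul_eq_mul]
    linear_combination (-(τ b).ofLp 0) * hcs + Real.cos (∫ s in a..b, μ s) * e1
      - Real.sin (∫ s in a..b, μ s) * e2
  · simp only [PiLp.add_apply, PiLp.smul_apply, perp_one_apply, smul_eq_mul]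
    linear_combination (-(τ b).ofLp 1) * hcs + Real.sin (∫ s in a..b, μ s) * e1
      + Real.cos (∫ s in a..b, μ s) * e2

/-! ### Integrals over a period -/

instance : IsFiniteMeasure torusMeasure := by unfold torusMeasure; infer_instance

lemma integral_torus_eq {E : Type*} [NormedAddCommGroup E] [NormedSpace ℝ E] (f : ℝ → E) :
    ∫ x in (-Real.pi)..Real.pi, f x = ∫ x, f x ∂torusMeasure :=
  intervalIntegral.integral_of_le (by linarith [Real.pi_pos])

lemma integral_torus_eq_period {E : Type*} [NormedAddCommGroup E] [NormedSpace ℝ E] {f : ℝ → E}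
    (hf : Function.Periodic f (2 * Real.pi)) (a : ℝ) :
    ∫ x in a..a + 2 * Real.pi, f x = ∫ x, f x ∂torusMeasure := by
  rw [← integral_torus_eq, hf.intervalIntegral_add_eq a (-Real.pi)]
  congr 1; ring

lemma integral_torus_shift {E : Type*} [NormedAddCommGroup E] [NormedSpace ℝ E] {f : ℝ → E}
    (hf : Function.Periodic f (2 * Real.pi)) (a : ℝ) :
    ∫ x, f (a + x) ∂torusMeasure = ∫ x, f x ∂torusMeasure := by
  rw [← integral_torus_eq, intervalIntegral.integral_comp_add_left (fun x => f x),
    ← integral_torus_eq_period hf (a + -Real.pi)]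
  congr 1; ring

lemma lintegral_torus_shift {f : ℝ → ℝ≥0∞} (hf : Function.Periodic f (2 * Real.pi)) (a : ℝ) :
    ∫⁻ x, f (a + x) ∂torusMeasure = ∫⁻ x, f x ∂torusMeasure := by
  have h2 : (0 : ℝ) < 2 * Real.pi := by positivity
  have h1 := lintegral_restrict_period h2 hf (a - Real.pi) (-Real.pi)
  rw [show -Real.pi + 2 * Real.pi = Real.pi by ring] at h1
  have h5 := (measurePreserving_add_left volume a).setLIntegral_comp_preimage_emb
    (measurableEmbedding_addLeft a) f (Set.Ioc (a - Real.pi) (a - Real.pi + 2 * Real.pi))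
  rw [torusMeasure, ← h1, ← h5]
  congr 2
  ext x
  simp only [Set.mem_preimage, Set.mem_Ioc]
  constructor <;> rintro ⟨h3, h4⟩ <;> constructor <;> linarith

lemma integrable_torus_of_continuous {E : Type*} [NormedAddCommGroup E] {f : ℝ → E}
    (hf : Continuous f) : Integrable f torusMeasure :=
  (hf.integrableOn_Icc (a := -Real.pi) (b := Real.pi)).mono_set Set.Ioc_subset_Icc_self

lemma integrable_torus_iff {E : Type*} [NormedAddCommGroup E] {f : ℝ → E} :
    Integrable f torusMeasure ↔ IntervalIntegrable f volume (-Real.pi) Real.pi :=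
  (intervalIntegrable_iff_integrableOn_Ioc_of_le (by linarith [Real.pi_pos])).symm

lemma ae_torus_mem : ∀ᵐ z ∂torusMeasure, z ≠ 0 ∧ |z| ≤ Real.pi := by
  have h0 : ∀ᵐ z ∂(volume : Measure ℝ), z ≠ 0 := by
    simp [ae_iff, measure_singleton]
  filter_upwards [ae_restrict_of_ae (s := Set.Ioc (-Real.pi) Real.pi) h0,
    ae_restrict_mem measurableSet_Ioc] with z hz h1
  exact ⟨hz, abs_le.2 ⟨h1.1.le, h1.2⟩⟩

lemma integrable_torus_rpow {s : ℝ} (hs : -1 < s) :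
    Integrable (fun z : ℝ => |z| ^ s) torusMeasure := by
  rw [integrable_torus_iff]
  have h1 : IntervalIntegrable (fun z : ℝ => |z| ^ s) volume 0 Real.pi := by
    refine (intervalIntegral.intervalIntegrable_rpow' hs).congr ?_
    intro z hz
    rw [Set.uIoc_of_le Real.pi_pos.le] at hz
    simp only [abs_of_pos hz.1]
  have h2 : IntervalIntegrable (fun z : ℝ => |z| ^ s) volume (-Real.pi) 0 := by
    have := (IntervalIntegrable.iff_comp_neg (by simp)).1 h1
    simpa using this.symm
  exact h2.trans h1

/-- Bound for the regularized singular kernels. -/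
lemma pow_mul_rpow_le {c r z e a : ℝ} (hc : 0 < c) (hz : z ≠ 0) (hr : c * |z| ≤ r) (he : 0 ≤ e)
    (j : ℕ) (hj : (j : ℝ) ≤ 2 * a) :
    r ^ j * (r ^ 2 + e) ^ (-a) ≤ c ^ (j - 2 * a) * |z| ^ (j - 2 * a) := by
  have hz' : 0 < |z| := abs_pos.2 hz
  have hr0 : 0 < r := lt_of_lt_of_le (by positivity) hr
  have ha : 0 ≤ a := by have : (0 : ℝ) ≤ j := Nat.cast_nonneg j; linarith
  calc r ^ j * (r ^ 2 + e) ^ (-a) ≤ r ^ j * (r ^ 2) ^ (-a) := by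
        gcongr ?_ * ?_
        exact Real.rpow_le_rpow_of_nonpos (by positivity) (by linarith) (by linarith)
    _ = r ^ (j - 2 * a) := by
        rw [← Real.rpow_natCast r j, ← Real.rpow_natCast r 2, ← Real.rpow_mul hr0.le,
          ← Real.rpow_add hr0]
        congr 1; push_cast; ring
    _ ≤ (c * |z|) ^ (j - 2 * a) :=
        Real.rpow_le_rpow_of_nonpos (by positivity) hr (by linarith)
    _ = _ := Real.mul_rpow hc.le (abs_nonneg z)

/-! ### Regular closed curves -/

/-- A closed `C^{1,σ}` curve with quantitative bounds, whose tangent turns with the curvature `κ`;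
the tangent is Hölder continuous with exponent `σ + 2 α`. -/
structure RegularCurve (α m M c H σ : ℝ) (γ : ℝ → Plane) (κ : ℝ → ℝ) : Prop where
  m_pos : 0 < m
  c_pos : 0 < c
  α_pos : 0 < α
  σ_pos : 0 < σ
  contDiff : ContDiff ℝ 1 γ
  periodic : Function.Periodic γ (2 * Real.pi)
  lower : ∀ x, m ≤ ‖deriv γ x‖
  upper : ∀ x, ‖deriv γ x‖ ≤ M
  chord : ∀ x y, |x - y| ≤ Real.pi → c * |x - y| ≤ ‖γ x - γ y‖
  holder : ∀ x y, ‖deriv γ x - deriv γ y‖ ≤ M * |x - y| ^ σ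
  tangent_holder : ∀ x y, |x - y| ≤ Real.pi →
    ‖tangent γ x - tangent γ y‖ ≤ H * |x - y| ^ (σ + 2 * α)
  measurable : Measurable κ
  curvature_periodic : Function.Periodic κ (2 * Real.pi)
  integrable : ∀ a b, IntervalIntegrable κ volume a b
  frenet : IsWeakDeriv (tangent γ) fun x => (‖deriv γ x‖ * κ x) • perp (tangent γ x)
  integral_le : ∫ x, |κ x| ∂torusMeasure ≤ H

/-- The derivative of the (regularized) velocity along the curve `γ`. -/
def velocityDeriv (α : ℝ) (γ : ℝ → Plane) (e x : ℝ) : Plane :=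
  -∫ z, ((‖γ x - γ (x + z)‖ ^ 2 + e) ^ (-1 - α) * cross (deriv γ x) (deriv γ (x + z))) •
    perp (γ x - γ (x + z)) ∂torusMeasure

/-- The angular velocity of the tangent of `γ` (regularized for `e > 0`). -/
def angularVelocity (α : ℝ) (γ : ℝ → Plane) (e x : ℝ) : ℝ :=
  -∫ z, (‖γ x - γ (x + z)‖ ^ 2 + e) ^ (-1 - α) * inner ℝ (γ x - γ (x + z)) (tangent γ x)
    * cross (tangent γ x) (deriv γ (x + z)) ∂torusMeasure

namespace RegularCurve

variable {α m M c H σ : ℝ} {γ : ℝ → Plane} {κ : ℝ → ℝ} (h : RegularCurve α m M c H σ γ κ)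
include h

lemma continuous : Continuous γ := h.contDiff.continuous

lemma continuous_deriv : Continuous (deriv γ) := h.contDiff.continuous_deriv le_rfl

lemma hasDerivAt (x : ℝ) : HasDerivAt γ (deriv γ x) x :=
  (h.contDiff.differentiable one_ne_zero x).hasDerivAt

lemma periodic_deriv : Function.Periodic (deriv γ) (2 * Real.pi) := fun x => by
  have h1 : (fun y => γ (y + 2 * Real.pi)) = γ := funext h.periodic
  rw [← deriv_comp_add_const, h1]

lemma speed_pos (x : ℝ) : 0 < ‖deriv γ x‖ := h.m_pos.trans_le (h.lower x)

lemma M_pos : 0 < M := (h.speed_pos 0).trans_le (h.upper 0)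

lemma H_nonneg : 0 ≤ H := (integral_nonneg fun _ => abs_nonneg _).trans h.integral_le

lemma deriv_eq (x : ℝ) : deriv γ x = ‖deriv γ x‖ • tangent γ x := by
  rw [tangent, smul_smul, mul_inv_cancel₀ (h.speed_pos x).ne', one_smul]

lemma norm_tangent (x : ℝ) : ‖tangent γ x‖ = 1 := by
  rw [tangent, norm_smul, norm_inv, norm_norm, inv_mul_cancel₀ (h.speed_pos x).ne']

lemma continuous_tangent : Continuous (tangent γ) :=
  (h.continuous_deriv.norm.inv₀ fun x => (h.speed_pos x).ne').smul h.continuous_deriv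

lemma periodic_tangent : Function.Periodic (tangent γ) (2 * Real.pi) := fun x => by
  rw [tangent, h.periodic_deriv, tangent]

lemma norm_sub_le (x y : ℝ) : ‖γ x - γ y‖ ≤ M * |x - y| :=
  Convex.norm_image_sub_le_of_norm_hasDerivWithin_le (s := Set.univ)
    (fun x _ => (h.hasDerivAt x).hasDerivWithinAt) (fun x _ => h.upper x) convex_univ
    (Set.mem_univ y) (Set.mem_univ x)

lemma chord_add {x z : ℝ} (hz : |z| ≤ Real.pi) : c * |z| ≤ ‖γ x - γ (x + z)‖ := by
  have := h.chord x (x + z) (by simpa using hz)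
  simpa using this

lemma norm_tangent_sub_add {x z : ℝ} (hz : |z| ≤ Real.pi) :
    ‖tangent γ x - tangent γ (x + z)‖ ≤ H * |z| ^ (σ + 2 * α) := by
  have := h.tangent_holder x (x + z) (by simpa using hz)
  simpa using this

/-- Subtracting the cross product of τ(x) with itself, which is zero, exposes the increment of the
tangent. -/
lemma abs_cross_tangent {x z : ℝ} (hz : |z| ≤ Real.pi) :
    |cross (tangent γ x) (tangent γ (x + z))| ≤ H * |z| ^ (σ + 2 * α) := by
  have h1 : cross (tangent γ x) (tangent γ (x + z))
      = cross (tangent γ x) (tangent γ (x + z) - tangent γ x) := by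
    rw [cross_sub_right, cross_self, sub_zero]
  rw [h1]
  refine (abs_cross_le _ _).trans ?_
  rw [h.norm_tangent, one_mul, norm_sub_rev]
  exact h.norm_tangent_sub_add hz

/-- The kernel times the chord is of size |z|^(−1−2α), and the cross product gains |z|^(σ+2α),
leaving an integrable singularity. The gain uses that only directions enter the cross product, up to
the bounded speeds: γ' itself is controlled in C^σ only, but τ in C^(σ+2α). -/
lemma norm_velocityDeriv_integrand_le {e x z : ℝ} (he : 0 ≤ e) (hz0 : z ≠ 0) (hz : |z| ≤ Real.pi) :
    ‖((‖γ x - γ (x + z)‖ ^ 2 + e) ^ (-1 - α) * cross (deriv γ x) (deriv γ (x + z))) •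
      perp (γ x - γ (x + z))‖ ≤ c ^ (-1 - 2 * α) * (M ^ 2 * H) * |z| ^ (σ - 1) := by
  have hz' : 0 < |z| := abs_pos.2 hz0
  have h1 := pow_mul_rpow_le h.c_pos hz0 (h.chord_add (x := x) hz) he 1 (a := 1 + α)
    (by have := h.α_pos; push_cast; linarith)
  rw [show -(1 + α) = -1 - α by ring,
    show ((1 : ℕ) : ℝ) - 2 * (1 + α) = -1 - 2 * α by push_cast; ring] at h1
  have h2 : |cross (deriv γ x) (deriv γ (x + z))| ≤ M ^ 2 * (H * |z| ^ (σ + 2 * α)) := by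
    rw [h.deriv_eq x, h.deriv_eq (x + z), cross_smul_left, cross_smul_right, abs_mul, abs_mul,
      abs_norm, abs_norm, ← mul_assoc, sq]
    have := h.abs_cross_tangent (x := x) hz
    have h3 := h.M_pos
    gcongr
    exacts [h.upper _, h.upper _]
  rw [norm_smul, norm_perp, norm_mul, Real.norm_eq_abs, Real.norm_eq_abs,
    abs_of_nonneg (by positivity)]
  calc _ = ‖γ x - γ (x + z)‖ ^ 1 * (‖γ x - γ (x + z)‖ ^ 2 + e) ^ (-1 - α)
        * |cross (deriv γ x) (deriv γ (x + z))| := by ring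
    _ ≤ c ^ (-1 - 2 * α) * |z| ^ (-1 - 2 * α) * (M ^ 2 * (H * |z| ^ (σ + 2 * α))) := by
      have := h.c_pos
      gcongr
    _ = c ^ (-1 - 2 * α) * (M ^ 2 * H) * (|z| ^ (-1 - 2 * α) * |z| ^ (σ + 2 * α)) := by ring
    _ = _ := by rw [← Real.rpow_add hz']; congr 2; ring

lemma continuous_kernel {e : ℝ} (he : 0 < e) (a : ℝ) :
    Continuous fun w : ℝ × ℝ => (‖γ w.1 - γ w.2‖ ^ 2 + e) ^ a := by
  have := h.continuous
  exact Continuous.rpow_const (by fun_prop) fun w => Or.inl (by positivity)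

lemma hasDerivAt_kernel {e : ℝ} (he : 0 < e) (a x y : ℝ) :
    HasDerivAt (fun x => (‖γ x - γ y‖ ^ 2 + e) ^ a)
      (2 * a * (‖γ x - γ y‖ ^ 2 + e) ^ (a - 1) * inner ℝ (γ x - γ y) (deriv γ x)) x := by
  have h1 := (((h.hasDerivAt x).sub_const (γ y)).norm_sq.add_const e).rpow_const (p := a)
    (Or.inl (by positivity))
  convert h1 using 1
  ring

lemma hasDerivAt_kernel_right {e : ℝ} (he : 0 < e) (a x y : ℝ) :
    HasDerivAt (fun y => (‖γ x - γ y‖ ^ 2 + e) ^ a)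
      (-(2 * a * (‖γ x - γ y‖ ^ 2 + e) ^ (a - 1) * inner ℝ (γ x - γ y) (deriv γ y))) y := by
  have h1 := (((h.hasDerivAt y).const_sub (γ x)).norm_sq.add_const e).rpow_const (p := a)
    (Or.inl (by positivity))
  convert h1 using 1
  rw [inner_neg_right]
  ring

/-- The increments of the regularized boundary velocity. -/
lemma integral_kernel_sub {e : ℝ} (he : 0 < e) (a b : ℝ) :
    (∫ y, (‖γ b - γ y‖ ^ 2 + e) ^ (-α) • deriv γ y ∂torusMeasure)
      - ∫ y, (‖γ a - γ y‖ ^ 2 + e) ^ (-α) • deriv γ y ∂torusMeasure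
      = (2 * α) • ∫ x in a..b, velocityDeriv α γ e x := by
  have hc := h.continuous
  have hc' := h.continuous_deriv
  have hK : ∀ s : ℝ, Continuous fun w : ℝ × ℝ => (‖γ w.1 - γ w.2‖ ^ 2 + e) ^ s :=
    h.continuous_kernel he
  have hKs : ∀ (s x : ℝ), Continuous fun y => (‖γ x - γ y‖ ^ 2 + e) ^ s := fun s x =>
    (hK s).comp (f := fun y : ℝ => (x, y)) (by fun_prop)
  set F : ℝ → ℝ → Plane := fun x y => ((‖γ x - γ y‖ ^ 2 + e) ^ (-1 - α) *
    inner ℝ (γ x - γ y) (deriv γ x)) • deriv γ y with hF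
  have hFc : Continuous (Function.uncurry F) := by
    refine Continuous.smul ((hK _).mul ?_) (by fun_prop)
    exact Continuous.inner (by fun_prop) (by fun_prop)
  have h1 : ∀ y, (‖γ b - γ y‖ ^ 2 + e) ^ (-α) • deriv γ y
      - (‖γ a - γ y‖ ^ 2 + e) ^ (-α) • deriv γ y = (-(2 * α)) • ∫ x in a..b, F x y := by
    intro y
    have h2 : ∫ x in a..b, (2 * -α * (‖γ x - γ y‖ ^ 2 + e) ^ (-α - 1) *
        inner ℝ (γ x - γ y) (deriv γ x)) = (‖γ b - γ y‖ ^ 2 + e) ^ (-α)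
          - (‖γ a - γ y‖ ^ 2 + e) ^ (-α) := by
      refine intervalIntegral.integral_eq_sub_of_hasDerivAt
        (fun x _ => h.hasDerivAt_kernel he (-α) x y) (Continuous.intervalIntegrable ?_ _ _)
      refine Continuous.mul (continuous_const.mul
        ((hK _).comp (f := fun x : ℝ => (x, y)) (by fun_prop))) ?_
      exact Continuous.inner (by fun_prop) (by fun_prop)
    rw [← sub_smul, ← h2, hF, ← intervalIntegral.integral_smul,
      ← intervalIntegral.integral_smul_const]
    refine intervalIntegral.integral_congr fun x _ => ?_
    simp only [smul_smul]
    rw [show -α - 1 = -1 - α by ring]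
    congr 1; ring
  have h8 : ∀ x, Integrable (fun y => (‖γ x - γ y‖ ^ 2 + e) ^ (-α) • deriv γ y) torusMeasure :=
    fun x => integrable_torus_of_continuous ((hKs _ _).smul hc')
  rw [← integral_sub (h8 b) (h8 a)]
  simp_rw [h1]
  rw [integral_smul, ← intervalIntegral_integral_swap, neg_smul, ← smul_neg,
    ← intervalIntegral.integral_neg]
  · congr 1
    refine intervalIntegral.integral_congr fun x _ => ?_
    change -∫ y, F x y ∂torusMeasure = velocityDeriv α γ e x
    -- Here the integrand is an exact y-derivative, so it integrates to zero over a period.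
    have h3 : ∫ y, (‖γ x - γ y‖ ^ 2 + e) ^ (-1 - α) * inner ℝ (γ x - γ y) (deriv γ y)
        ∂torusMeasure = 0 := by
      have h4 : IsPrim (fun y => (‖γ x - γ y‖ ^ 2 + e) ^ (-α)) fun y =>
          -(2 * -α * (‖γ x - γ y‖ ^ 2 + e) ^ (-α - 1) * inner ℝ (γ x - γ y) (deriv γ y)) := by
        refine IsPrim.of_hasDerivAt (h.hasDerivAt_kernel_right he (-α) x) ?_
        refine (Continuous.mul (continuous_const.mul (hKs _ _)) ?_).neg
        exact Continuous.inner (by fun_prop) (by fun_prop)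
      have h5 := h4.integral_eq_zero (P := 2 * Real.pi)
        (fun y => by simp only [h.periodic y]) (-Real.pi)
      rw [show -Real.pi + 2 * Real.pi = Real.pi by ring, integral_torus_eq] at h5
      have h6 : ∀ y, -(2 * -α * (‖γ x - γ y‖ ^ 2 + e) ^ (-α - 1) * inner ℝ (γ x - γ y) (deriv γ y))
          = (2 * α) * ((‖γ x - γ y‖ ^ 2 + e) ^ (-1 - α) * inner ℝ (γ x - γ y) (deriv γ y)) :=
        fun y => by rw [show -α - 1 = -1 - α by ring]; ring
      simp_rw [h6] at h5
      rw [integral_const_mul] at h5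
      have := h.α_pos
      exact (mul_eq_zero.1 h5).resolve_left (by positivity)
    -- The vanishing integral times γ'(x) is subtracted. The planar identity ⟨R,a⟩b − ⟨R,b⟩a =
    -- cross(a,b) perp R then produces the cross product, which is small near the diagonal.
    have h7 : ∫ y, F x y ∂torusMeasure = ∫ y, ((‖γ x - γ y‖ ^ 2 + e) ^ (-1 - α) *
        cross (deriv γ x) (deriv γ y)) • perp (γ x - γ y) ∂torusMeasure := by
      rw [← sub_zero (∫ y, F x y ∂torusMeasure), ← zero_smul ℝ (deriv γ x), ← h3,
        ← integral_smul_const, ← integral_sub]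
      · congr 1
        funext y
        simp only [hF, mul_smul, ← smul_sub]
        congr 1
        refine plane_ext ?_ ?_ <;> simp [inner_plane, cross] <;> ring
      · exact integrable_torus_of_continuous (hFc.comp (f := fun y : ℝ => (x, y)) (by fun_prop))
      · refine integrable_torus_of_continuous (((hKs _ _).mul ?_).smul continuous_const)
        exact Continuous.inner (by fun_prop) (by fun_prop)
    rw [h7, velocityDeriv, integral_torus_shift (f := fun y => ((‖γ x - γ y‖ ^ 2 + e) ^ (-1 - α) *
      cross (deriv γ x) (deriv γ y)) • perp (γ x - γ y))]
    intro y
    simp only [h.periodic y, h.periodic_deriv y]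
  · refine Integrable.mono_measure (ν := (volume.restrict (Set.uIcc a b)).prod
      (volume.restrict (Set.Icc (-Real.pi) Real.pi))) ?_ ?_
    · rw [Measure.prod_restrict]
      exact hFc.continuousOn.integrableOn_compact (isCompact_uIcc.prod isCompact_Icc)
    · exact Measure.prod_mono (Measure.restrict_mono_set _ Set.uIoc_subset_uIcc)
        (Measure.restrict_mono_set _ Set.Ioc_subset_Icc_self)

end RegularCurve

namespace RegularCurve

section

variable {α m M c H σ : ℝ} {γ : ℝ → Plane} {κ : ℝ → ℝ} (h : RegularCurve α m M c H σ γ κ)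
include h

lemma measurable_velocityDeriv_integrand (e x : ℝ) :
    Measurable fun z => ((‖γ x - γ (x + z)‖ ^ 2 + e) ^ (-1 - α) *
      cross (deriv γ x) (deriv γ (x + z))) • perp (γ x - γ (x + z)) := by
  have h1 := h.continuous
  have h2 := h.continuous_deriv
  have h3 : Continuous fun z => ‖γ x - γ (x + z)‖ ^ 2 + e := by fun_prop
  refine ((h3.measurable.pow_const _).mul ?_).smul ?_
  · exact (Continuous.cross (by fun_prop) (by fun_prop)).measurable
  · exact (continuous_perp.comp (by fun_prop)).measurable

lemma integrable_velocityDeriv_bound :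
    Integrable (fun z : ℝ => c ^ (-1 - 2 * α) * (M ^ 2 * H) * |z| ^ (σ - 1)) torusMeasure :=
  (integrable_torus_rpow (by linarith [h.σ_pos])).const_mul _

lemma ae_velocityDeriv_bound {e : ℝ} (he : 0 ≤ e) (x : ℝ) : ∀ᵐ z ∂torusMeasure,
    ‖((‖γ x - γ (x + z)‖ ^ 2 + e) ^ (-1 - α) * cross (deriv γ x) (deriv γ (x + z))) •
      perp (γ x - γ (x + z))‖ ≤ c ^ (-1 - 2 * α) * (M ^ 2 * H) * |z| ^ (σ - 1) := by
  filter_upwards [ae_torus_mem] with z hz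
  exact h.norm_velocityDeriv_integrand_le he hz.1 hz.2

lemma integrable_velocityDeriv {e : ℝ} (he : 0 ≤ e) (x : ℝ) :
    Integrable (fun z => ((‖γ x - γ (x + z)‖ ^ 2 + e) ^ (-1 - α) *
      cross (deriv γ x) (deriv γ (x + z))) • perp (γ x - γ (x + z))) torusMeasure :=
  h.integrable_velocityDeriv_bound.mono'
    (h.measurable_velocityDeriv_integrand e x).aestronglyMeasurable (h.ae_velocityDeriv_bound he x)

lemma norm_velocityDeriv_le {e : ℝ} (he : 0 ≤ e) (x : ℝ) : ‖velocityDeriv α γ e x‖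
    ≤ ∫ z, c ^ (-1 - 2 * α) * (M ^ 2 * H) * |z| ^ (σ - 1) ∂torusMeasure := by
  rw [velocityDeriv, norm_neg]
  exact norm_integral_le_of_norm_le h.integrable_velocityDeriv_bound (h.ae_velocityDeriv_bound he x)

lemma tendsto_velocityDeriv (x : ℝ) :
    Tendsto (fun e => velocityDeriv α γ e x) (𝓝[>] 0) (𝓝 (velocityDeriv α γ 0 x)) := by
  refine (tendsto_integral_filter_of_dominated_convergence
    (fun z => c ^ (-1 - 2 * α) * (M ^ 2 * H) * |z| ^ (σ - 1)) ?_ ?_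
    h.integrable_velocityDeriv_bound ?_).neg
  · exact Eventually.of_forall fun e =>
      (h.measurable_velocityDeriv_integrand e x).aestronglyMeasurable
  · filter_upwards [self_mem_nhdsWithin] with e he
    exact h.ae_velocityDeriv_bound (le_of_lt he) x
  · filter_upwards [ae_torus_mem] with z hz
    have h1 : 0 < ‖γ x - γ (x + z)‖ :=
      lt_of_lt_of_le (mul_pos h.c_pos (abs_pos.2 hz.1)) (h.chord_add hz.2)
    refine Tendsto.smul_const (Tendsto.mul_const _ ?_) _
    refine tendsto_nhdsWithin_of_tendsto_nhds ?_
    refine Tendsto.rpow_const ?_ (Or.inl (by positivity))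
    exact (continuous_const.add continuous_id).tendsto 0

/-- The direction of a vector v moving with velocity V turns at the rate cross(v/|v|, V)/|v|. The
definition of ω is this rate with the rotation in `velocityDeriv` absorbed into an inner product. -/
lemma angularVelocity_eq {e : ℝ} (he : 0 ≤ e) (x : ℝ) : angularVelocity α γ e x
    = ‖deriv γ x‖⁻¹ * cross (tangent γ x) (velocityDeriv α γ e x) := by
  have h1 : ∀ v : Plane, cross (tangent γ x) v = innerSL ℝ (perp (tangent γ x)) v := fun v => by
    rw [innerSL_apply_apply, inner_perp]
  rw [angularVelocity, h1, velocityDeriv, map_neg, mul_neg,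
    ← (innerSL ℝ (perp (tangent γ x))).integral_comp_comm (h.integrable_velocityDeriv he x),
    ← integral_const_mul]
  congr 2
  funext z
  rw [← h1, cross_smul_right, cross_perp, h.deriv_eq x, cross_smul_left, norm_smul, norm_norm,
    h.norm_tangent, real_inner_comm]
  have := (h.speed_pos x).ne'
  field_simp

lemma abs_angularVelocity_le {e : ℝ} (he : 0 ≤ e) (x : ℝ) : |angularVelocity α γ e x|
    ≤ m⁻¹ * ∫ z, c ^ (-1 - 2 * α) * (M ^ 2 * H) * |z| ^ (σ - 1) ∂torusMeasure := by
  rw [h.angularVelocity_eq he, abs_mul, abs_of_pos (inv_pos.2 (h.speed_pos x))]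
  have h1 := h.lower x
  have h2 := h.m_pos
  gcongr
  refine (abs_cross_le _ _).trans ?_
  rw [h.norm_tangent, one_mul]
  exact h.norm_velocityDeriv_le he x

lemma tendsto_angularVelocity (x : ℝ) :
    Tendsto (fun e => angularVelocity α γ e x) (𝓝[>] 0) (𝓝 (angularVelocity α γ 0 x)) := by
  rw [h.angularVelocity_eq le_rfl]
  refine Tendsto.congr' (f₁ := fun e => ‖deriv γ x‖⁻¹ *
    cross (tangent γ x) (velocityDeriv α γ e x)) ?_ ?_
  · filter_upwards [self_mem_nhdsWithin] with e he
    rw [h.angularVelocity_eq (le_of_lt he)]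
  · have hc : Continuous fun v => ‖deriv γ x‖⁻¹ * cross (tangent γ x) v :=
      continuous_const.mul (continuous_const.cross continuous_id)
    exact (hc.tendsto _).comp (h.tendsto_velocityDeriv x)

lemma velocityDeriv_periodic (e : ℝ) :
    Function.Periodic (velocityDeriv α γ e) (2 * Real.pi) := fun x => by
  simp only [velocityDeriv, h.periodic x, h.periodic_deriv x, add_right_comm x (2 * Real.pi),
    h.periodic _, h.periodic_deriv _]

lemma angularVelocity_periodic {e : ℝ} (he : 0 ≤ e) :
    Function.Periodic (angularVelocity α γ e) (2 * Real.pi) := fun x => by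
  rw [h.angularVelocity_eq he, h.angularVelocity_eq he, h.velocityDeriv_periodic e,
    h.periodic_deriv, h.periodic_tangent]

end

section Family

variable {α m M c H σ : ℝ} {G : ℝ → ℝ → Plane} {K : ℝ → ℝ → ℝ}
  (h : ∀ t, RegularCurve α m M c H σ (G t) (K t))
  (hG' : Continuous fun w : ℝ × ℝ => deriv (G w.1) w.2)
include h hG'

lemma continuous_tangent_family : Continuous fun w : ℝ × ℝ => tangent (G w.1) w.2 :=
  (hG'.norm.inv₀ fun w => ((h w.1).speed_pos w.2).ne').smul hG'

variable (hG : Continuous fun w : ℝ × ℝ => G w.1 w.2)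
include hG

/-- The dominating function depends on the common constants only and not on the curve, so dominated
convergence applies jointly in time and label, including e = 0. -/
lemma continuous_velocityDeriv_family {e : ℝ} (he : 0 ≤ e) :
    Continuous fun w : ℝ × ℝ => velocityDeriv α (G w.1) e w.2 := by
  refine (continuous_of_dominated
    (bound := fun z => c ^ (-1 - 2 * α) * (M ^ 2 * H) * |z| ^ (σ - 1)) ?_ ?_
    (h 0).integrable_velocityDeriv_bound ?_).neg
  · exact fun w => ((h w.1).measurable_velocityDeriv_integrand e w.2).aestronglyMeasurable
  · exact fun w => (h w.1).ae_velocityDeriv_bound he w.2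
  · filter_upwards [ae_torus_mem] with z hz
    have h1 : ∀ w : ℝ × ℝ, 0 < ‖G w.1 w.2 - G w.1 (w.2 + z)‖ := fun w =>
      lt_of_lt_of_le (mul_pos (h 0).c_pos (abs_pos.2 hz.1)) ((h w.1).chord_add hz.2)
    have h2 : Continuous fun w : ℝ × ℝ => G w.1 (w.2 + z) :=
      hG.comp (f := fun w : ℝ × ℝ => (w.1, w.2 + z)) (by fun_prop)
    have h3 : Continuous fun w : ℝ × ℝ => deriv (G w.1) (w.2 + z) :=
      hG'.comp (f := fun w : ℝ × ℝ => (w.1, w.2 + z)) (by fun_prop)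
    refine Continuous.smul (Continuous.mul ?_ (hG'.cross h3)) (continuous_perp.comp (hG.sub h2))
    refine Continuous.rpow_const (by fun_prop) fun w => Or.inl ?_
    have := h1 w
    positivity

lemma continuous_angularVelocity_family {e : ℝ} (he : 0 ≤ e) :
    Continuous fun w : ℝ × ℝ => angularVelocity α (G w.1) e w.2 := by
  have : (fun w : ℝ × ℝ => angularVelocity α (G w.1) e w.2) = fun w : ℝ × ℝ =>
      ‖deriv (G w.1) w.2‖⁻¹ * cross (tangent (G w.1) w.2) (velocityDeriv α (G w.1) e w.2) :=
    funext fun w => (h w.1).angularVelocity_eq he w.2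
  rw [this]
  exact (hG'.norm.inv₀ fun w => ((h w.1).speed_pos w.2).ne').mul
    ((continuous_tangent_family h hG').cross (continuous_velocityDeriv_family h hG' hG he))

end Family

variable {α m M c H σ : ℝ} {γ : ℝ → Plane} {κ : ℝ → ℝ} (h : RegularCurve α m M c H σ γ κ)
include h

lemma continuous_velocityDeriv {e : ℝ} (he : 0 ≤ e) : Continuous (velocityDeriv α γ e) :=
  (continuous_velocityDeriv_family (G := fun _ => γ) (fun _ => h)
    (h.continuous_deriv.comp continuous_snd) (h.continuous.comp continuous_snd) he).comp (f := fun x : ℝ => (x, x)) (by fun_prop)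

lemma continuous_angularVelocity {e : ℝ} (he : 0 ≤ e) : Continuous (angularVelocity α γ e) :=
  (continuous_angularVelocity_family (G := fun _ => γ) (fun _ => h)
    (h.continuous_deriv.comp continuous_snd)
    (h.continuous.comp continuous_snd) he).comp (f := fun x : ℝ => (x, x)) (by fun_prop)

/-- The velocity is continuously differentiable along the boundary. -/
lemma velocity_sub {A : Set Plane} (hA : IsJordanDomain A) (hp : IsParam A (2 * Real.pi) γ)
    (hα' : α < 1 / 2) (a b : ℝ) :
    velocity α A (γ b) - velocity α A (γ a) = ∫ x in a..b, velocityDeriv α γ 0 x := by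
  have h1 := (tendsto_regVelocity hA h.α_pos hα' (γ b)).sub
    (tendsto_regVelocity hA h.α_pos hα' (γ a))
  refine tendsto_nhds_unique h1 ?_
  have hα := h.α_pos
  refine Tendsto.congr' (f₁ := fun e => ∫ x in a..b, velocityDeriv α γ e x) ?_ ?_
  · filter_upwards [self_mem_nhdsWithin] with e he
    have hper : ∀ p, Function.Periodic (fun y => (‖p - γ y‖ ^ 2 + e) ^ (-α) • deriv γ y)
        (2 * Real.pi) := fun p y => by simp only [hp.periodic y, hp.periodic_deriv y]
    have h2 : ∀ p, ∫ y in (0 : ℝ)..2 * Real.pi, (‖p - γ y‖ ^ 2 + e) ^ (-α) • deriv γ y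
        = ∫ y, (‖p - γ y‖ ^ 2 + e) ^ (-α) • deriv γ y ∂torusMeasure := fun p => by
      rw [← integral_torus_eq_period (hper p) 0, zero_add]
    rw [regVelocity_eq hA hp hα.ne' he, regVelocity_eq hA hp hα.ne' he, ← smul_sub, h2, h2,
      h.integral_kernel_sub he a b, smul_smul, inv_mul_cancel₀ (by positivity), one_smul]
  · refine intervalIntegral.tendsto_integral_filter_of_dominated_convergence
      (fun _ => ∫ z, c ^ (-1 - 2 * α) * (M ^ 2 * H) * |z| ^ (σ - 1) ∂torusMeasure) ?_ ?_ (by simp) ?_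
    · filter_upwards [self_mem_nhdsWithin] with e he
      exact (h.continuous_velocityDeriv (le_of_lt he)).aestronglyMeasurable
    · filter_upwards [self_mem_nhdsWithin] with e he
      exact Eventually.of_forall fun x _ => h.norm_velocityDeriv_le (le_of_lt he) x
    · exact Eventually.of_forall fun x _ => h.tendsto_velocityDeriv x

end RegularCurve

/-! ### Weak derivative of the angular velocity: Fubini and integration by parts -/

lemma integrable_torus_kernel {k : ℝ → ℝ → ℝ} (hk : Continuous fun w : ℝ × ℝ => k w.1 w.2)
    {f g : ℝ → ℝ} (hf : Integrable f torusMeasure) (hg : Integrable g torusMeasure) :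
    Integrable (fun w : ℝ × ℝ => k w.1 w.2 * (f w.1 * g w.2))
      (torusMeasure.prod torusMeasure) := by
  obtain ⟨C, hC⟩ := (isCompact_Icc.prod isCompact_Icc).exists_bound_of_continuousOn
    (s := Set.Icc (-Real.pi) Real.pi ×ˢ Set.Icc (-Real.pi) Real.pi) hk.continuousOn
  refine (hf.mul_prod hg).bdd_mul (c := C) hk.aestronglyMeasurable ?_
  unfold torusMeasure
  rw [Measure.prod_restrict]
  filter_upwards [ae_restrict_mem (measurableSet_Ioc.prod measurableSet_Ioc)] with w hw
  exact hC w ⟨Set.Ioc_subset_Icc_self hw.1, Set.Ioc_subset_Icc_self hw.2⟩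

/-- Fubini on the torus for a continuous kernel and an integrable density. -/
lemma integral_torus_swap {k : ℝ → ℝ → ℝ} (hk : Continuous fun w : ℝ × ℝ => k w.1 w.2) {f : ℝ → ℝ}
    (hf : Integrable f torusMeasure) :
    ∫ x, ∫ y, k x y * f y ∂torusMeasure ∂torusMeasure
      = ∫ y, f y * ∫ x, k x y ∂torusMeasure ∂torusMeasure := by
  have h1 := integrable_torus_kernel hk (integrable_const (1 : ℝ)) hf
  simp only [one_mul] at h1
  rw [integral_integral_swap h1]
  congr 1; funext y
  rw [← integral_const_mul]
  congr 1; funext x; ring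

lemma integrable_torus_integral {k : ℝ → ℝ → ℝ} (hk : Continuous fun w : ℝ × ℝ => k w.1 w.2)
    {f : ℝ → ℝ} (hf : Integrable f torusMeasure) :
    Integrable (fun x => ∫ y, k x y * f y ∂torusMeasure) torusMeasure := by
  have h1 := integrable_torus_kernel hk (integrable_const (1 : ℝ)) hf
  simp only [one_mul] at h1
  exact h1.integral_prod_left

lemma integrable_torus_mul_integral {k : ℝ → ℝ → ℝ} (hk : Continuous fun w : ℝ × ℝ => k w.1 w.2)
    {f g : ℝ → ℝ} (hf : Integrable f torusMeasure) (hg : Integrable g torusMeasure) :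
    Integrable (fun y => g y * ∫ x, k x y * f x ∂torusMeasure) torusMeasure := by
  refine (integrable_torus_kernel hk hf hg).integral_prod_right.congr (Eventually.of_forall ?_)
  intro y
  simp only
  rw [← integral_const_mul]
  congr 1; funext x; ring

lemma IsPrim.integral_torus_eq_zero {f f' : ℝ → ℝ} (hf : IsPrim f f')
    (h : Function.Periodic f (2 * Real.pi)) : ∫ x, f' x ∂torusMeasure = 0 := by
  rw [← hf.integral_eq_zero h (-Real.pi), ← integral_torus_eq]
  congr 1; ring

namespace RegularCurve

variable {α m M c H σ : ℝ} {γ : ℝ → Plane} {κ : ℝ → ℝ}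

/-- The kernel of the leading term of the curvature equation. -/
def mainKernel (α : ℝ) (γ : ℝ → Plane) (e x y : ℝ) : ℝ :=
  (‖γ x - γ y‖ ^ 2 + e) ^ (-1 - α) * inner ℝ (γ x - γ y) (deriv γ x)
    * inner ℝ (tangent γ x) (tangent γ y)

/-- The kernel of the error term that is quadratic in the oscillation of the tangent. -/
def oscKernel (α : ℝ) (γ : ℝ → Plane) (e x y : ℝ) : ℝ :=
  (‖γ x - γ y‖ ^ 2 + e) ^ (-1 - α) * inner ℝ (γ x - γ y) (tangent γ x - tangent γ y)
    * cross (tangent γ x) (tangent γ y)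

/-- The derivative of `oscKernel` in its first variable. -/
def oscKernelDeriv (α : ℝ) (γ : ℝ → Plane) (κ : ℝ → ℝ) (e x y : ℝ) : ℝ :=
  (2 * (-1 - α) * (‖γ x - γ y‖ ^ 2 + e) ^ (-2 - α) * inner ℝ (γ x - γ y) (deriv γ x)
      * inner ℝ (γ x - γ y) (tangent γ x - tangent γ y)
    + (‖γ x - γ y‖ ^ 2 + e) ^ (-1 - α) * (inner ℝ (deriv γ x) (tangent γ x - tangent γ y)
      + ‖deriv γ x‖ * κ x * inner ℝ (γ x - γ y) (perp (tangent γ x))))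
      * cross (tangent γ x) (tangent γ y)
    - (‖γ x - γ y‖ ^ 2 + e) ^ (-1 - α) * inner ℝ (γ x - γ y) (tangent γ x - tangent γ y)
      * (‖deriv γ x‖ * κ x * inner ℝ (tangent γ x) (tangent γ y))

section
variable (h : RegularCurve α m M c H σ γ κ)
include h

lemma integrable_speed_mul : Integrable (fun x => ‖deriv γ x‖ * κ x) torusMeasure :=
  integrable_torus_iff.2
    ((h.integrable _ _).continuousOn_mul h.continuous_deriv.norm.continuousOn)

lemma isWeakDeriv_deriv : IsWeakDeriv γ (deriv γ) :=
  IsWeakDeriv.of_hasDerivAt h.hasDerivAt h.continuous_deriv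

lemma isPrim_kernel {e : ℝ} (he : 0 < e) (a y : ℝ) :
    IsPrim (fun x => (‖γ x - γ y‖ ^ 2 + e) ^ a)
      fun x => 2 * a * (‖γ x - γ y‖ ^ 2 + e) ^ (a - 1) * inner ℝ (γ x - γ y) (deriv γ x) := by
  have h1 := h.continuous
  have h2 := h.continuous_deriv
  refine IsPrim.of_hasDerivAt (fun x => h.hasDerivAt_kernel he a x y) ?_
  have h3 : Continuous fun x => (‖γ x - γ y‖ ^ 2 + e) ^ (a - 1) :=
    Continuous.rpow_const (by fun_prop) fun x => Or.inl (by positivity)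
  exact (continuous_const.mul h3).mul (Continuous.inner (by fun_prop) h2)

lemma isPrim_oscKernel {e : ℝ} (he : 0 < e) (y : ℝ) :
    IsPrim (fun x => oscKernel α γ e x y) fun x => oscKernelDeriv α γ κ e x y := by
  have h1 := (h.isPrim_kernel he (-1 - α) y).mul
    ((h.isWeakDeriv_deriv.sub_const (γ y)).inner (h.frenet.sub_const (tangent γ y)))
  have h2 := h1.mul (h.frenet.cross (IsWeakDeriv.const (tangent γ y)))
  refine h2.congr fun x => ?_
  have e1 : cross (perp (tangent γ x)) (tangent γ y) = - inner ℝ (tangent γ x) (tangent γ y) := by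
    rw [inner_plane]; simp [cross]; ring
  have e2 : cross (tangent γ x) (0 : Plane) = 0 := by simp [cross]
  rw [oscKernelDeriv, cross_smul_left, e1, e2, real_inner_smul_right,
    show -1 - α - 1 = -2 - α by ring]
  ring

/-- Integration by parts in the second variable. -/
lemma integral_kernel_cross {e : ℝ} (he : 0 < e) (x : ℝ) :
    2 * α * ∫ y, (‖γ x - γ y‖ ^ 2 + e) ^ (-1 - α) * inner ℝ (γ x - γ y) (deriv γ y)
        * cross (tangent γ x) (tangent γ y) ∂torusMeasure
      = -∫ y, (‖γ x - γ y‖ ^ 2 + e) ^ (-α) * inner ℝ (tangent γ x) (tangent γ y)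
        * (‖deriv γ y‖ * κ y) ∂torusMeasure := by
  -- The factor ⟨γ(x)−γ(y), γ'(y)⟩ makes the kernel an exact y-derivative. When the derivative is
  -- moved to the cross product, the Frenet equation brings out g(y)κ(y).
  have h1 : IsPrim (fun y => (‖γ x - γ y‖ ^ 2 + e) ^ (-α)) fun y =>
      2 * α * ((‖γ x - γ y‖ ^ 2 + e) ^ (-1 - α) * inner ℝ (γ x - γ y) (deriv γ y)) := by
    have := h.isPrim_kernel he (-α) x
    refine (this.congr_left fun y => by rw [norm_sub_rev]).congr fun y => ?_
    rw [norm_sub_rev, show -α - 1 = -1 - α by ring, ← neg_sub (γ x) (γ y), inner_neg_left]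
    ring
  have h2 := (IsWeakDeriv.const (tangent γ x)).cross h.frenet
  have h3 := h1.mul h2
  have hper : Function.Periodic (fun y => (‖γ x - γ y‖ ^ 2 + e) ^ (-α) *
      cross (tangent γ x) (tangent γ y)) (2 * Real.pi) := fun y => by
    simp only [h.periodic y, h.periodic_tangent y]
  have h4 := h3.integral_torus_eq_zero hper
  have e0 : ∀ v, cross (0 : Plane) v = 0 := fun v => by simp [cross]
  simp only [e0, zero_add, cross_smul_right, cross_perp] at h4
  rw [integral_add] at h4
  · rw [← integral_const_mul, eq_neg_iff_add_eq_zero, ← h4]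
    congr 2 <;> funext y <;> ring
  · refine integrable_torus_iff.2 (((h1 _ _).1).mul_continuousOn h2.continuous.continuousOn)
  · refine integrable_torus_iff.2 (IntervalIntegrable.continuousOn_mul ?_ h1.continuous.continuousOn)
    have := (h2 (-Real.pi) Real.pi).1
    simpa only [e0, zero_add, cross_smul_right, cross_perp] using this

variable {φ : ℝ → ℝ} (hφ : ContDiff ℝ 1 φ) (hφp : Function.Periodic φ (2 * Real.pi))
include hφ hφp

/-- Integration by parts in the first variable. -/
lemma integral_kernel_inner {e : ℝ} (he : 0 < e) (y : ℝ) :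
    ∫ x, (‖γ x - γ y‖ ^ 2 + e) ^ (-α) * inner ℝ (tangent γ x) (tangent γ y) * deriv φ x
        ∂torusMeasure
      = 2 * α * (∫ x, mainKernel α γ e x y * (φ x - φ y) ∂torusMeasure)
        - ∫ x, (‖γ x - γ y‖ ^ 2 + e) ^ (-α) * (‖deriv γ x‖ * κ x)
          * cross (tangent γ x) (tangent γ y) * (φ x - φ y) ∂torusMeasure := by
  -- The constant φ(y) is subtracted before integrating by parts: the increment of φ is what keeps
  -- the leading term absolutely convergent when e tends to 0.
  have hφ' : IsPrim (fun x => φ x - φ y) (deriv φ) := IsPrim.of_hasDerivAt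
    (fun x => ((hφ.differentiable one_ne_zero x).hasDerivAt).sub_const _)
    (hφ.continuous_deriv le_rfl)
  have h1 := h.isPrim_kernel he (-α) y
  have h2 := h.frenet.inner (IsWeakDeriv.const (tangent γ y))
  have h3 := (h1.mul h2).mul hφ'
  have hper : Function.Periodic (fun x => (‖γ x - γ y‖ ^ 2 + e) ^ (-α) *
      inner ℝ (tangent γ x) (tangent γ y) * (φ x - φ y)) (2 * Real.pi) := fun x => by
    simp only [h.periodic x, h.periodic_tangent x, hφp x]
  have h4 := h3.integral_torus_eq_zero hper
  have i1 : Integrable (fun x => mainKernel α γ e x y * (φ x - φ y)) torusMeasure := by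
    refine integrable_torus_of_continuous (Continuous.mul ?_ hφ'.continuous)
    have c1 := (h.isPrim_kernel he (-1 - α) y).continuous
    exact (c1.mul ((h.continuous.sub continuous_const).inner h.continuous_deriv)).mul
      (h.continuous_tangent.inner continuous_const)
  have i2 : Integrable (fun x => (‖γ x - γ y‖ ^ 2 + e) ^ (-α) * (‖deriv γ x‖ * κ x)
          * cross (tangent γ x) (tangent γ y) * (φ x - φ y)) torusMeasure := by
    refine integrable_torus_iff.2 (((((h.integrable _ _).continuousOn_mul
      h.continuous_deriv.norm.continuousOn).continuousOn_mul
      h1.continuous.continuousOn).mul_continuousOn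
      (h.continuous_tangent.cross continuous_const).continuousOn).mul_continuousOn
      hφ'.continuous.continuousOn)
  have i3 : Integrable (fun x => (‖γ x - γ y‖ ^ 2 + e) ^ (-α) *
      inner ℝ (tangent γ x) (tangent γ y) * deriv φ x) torusMeasure :=
    integrable_torus_of_continuous ((h1.continuous.mul
      (h.continuous_tangent.inner continuous_const)).mul (hφ.continuous_deriv le_rfl))
  have i4 : Integrable (fun x => 2 * α * (mainKernel α γ e x y * (φ x - φ y))
      - (‖γ x - γ y‖ ^ 2 + e) ^ (-α) * (‖deriv γ x‖ * κ x)
        * cross (tangent γ x) (tangent γ y) * (φ x - φ y)) torusMeasure := (i1.const_mul _).sub i2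
  rw [← integral_const_mul, ← integral_sub (i1.const_mul _) i2, ← sub_eq_zero, ← integral_sub i3
    i4, ← h4]
  congr 1
  funext x
  rw [mainKernel, inner_zero_right, real_inner_smul_left, inner_perp,
    show -α - 1 = -1 - α by ring]
  ring

lemma integral_oscKernel {e : ℝ} (he : 0 < e) (y : ℝ) :
    ∫ x, oscKernel α γ e x y * deriv φ x ∂torusMeasure
      = -∫ x, oscKernelDeriv α γ κ e x y * φ x ∂torusMeasure := by
  have hφ' : IsPrim φ (deriv φ) := IsPrim.of_hasDerivAt
    (fun x => (hφ.differentiable one_ne_zero x).hasDerivAt) (hφ.continuous_deriv le_rfl)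
  have h1 := h.isPrim_oscKernel he y
  have hper : Function.Periodic (fun x => oscKernel α γ e x y * φ x) (2 * Real.pi) := fun x => by
    simp only [oscKernel, h.periodic x, h.periodic_tangent x, hφp x]
  have h4 := (h1.mul hφ').integral_torus_eq_zero hper
  rw [integral_add] at h4
  · linarith
  · exact integrable_torus_iff.2 ((h1 _ _).1.mul_continuousOn hφ'.continuous.continuousOn)
  · exact integrable_torus_iff.2 ((hφ' _ _).1.continuousOn_mul h1.continuous.continuousOn)

/-- The weak form of the derivative of the regularized angular velocity. -/
lemma integral_angularVelocity_mul_deriv {e : ℝ} (he : 0 < e) :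
    -∫ x, angularVelocity α γ e x * deriv φ x ∂torusMeasure
      = -(∫ y, ‖deriv γ y‖ * ∫ x, oscKernelDeriv α γ κ e x y * φ x ∂torusMeasure ∂torusMeasure)
        - (∫ y, ‖deriv γ y‖ * κ y * ∫ x, mainKernel α γ e x y * (φ x - φ y) ∂torusMeasure
          ∂torusMeasure)
        + (2 * α)⁻¹ * ∫ y, ‖deriv γ y‖ * κ y * ∫ x, (‖γ x - γ y‖ ^ 2 + e) ^ (-α) *
          (‖deriv γ x‖ * κ x) * cross (tangent γ x) (tangent γ y) * (φ x - φ y) ∂torusMeasure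
          ∂torusMeasure := by
  have hφc := hφ.continuous_deriv le_rfl
  have hγ := h.continuous
  have hγ' := h.continuous_deriv
  have hτ := h.continuous_tangent
  have hα := h.α_pos
  have hK : ∀ s : ℝ, Continuous fun w : ℝ × ℝ => (‖γ w.1 - γ w.2‖ ^ 2 + e) ^ s :=
    h.continuous_kernel he
  have hτ1 : Continuous fun w : ℝ × ℝ => tangent γ w.1 := by fun_prop
  have hτ2 : Continuous fun w : ℝ × ℝ => tangent γ w.2 := by fun_prop
  have hR : Continuous fun w : ℝ × ℝ => γ w.1 - γ w.2 := by fun_prop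
  have hφ1 : Continuous fun w : ℝ × ℝ => deriv φ w.1 := by fun_prop
  have hosc : Continuous fun w : ℝ × ℝ => oscKernel α γ e w.1 w.2 := by
    unfold oscKernel
    exact ((hK _).mul (hR.inner (hτ1.sub hτ2))).mul (hτ1.cross hτ2)
  have hBc : Continuous fun w : ℝ × ℝ => (‖γ w.1 - γ w.2‖ ^ 2 + e) ^ (-1 - α)
      * inner ℝ (γ w.1 - γ w.2) (deriv γ w.2) * cross (tangent γ w.1) (tangent γ w.2) :=
    ((hK _).mul (hR.inner (by fun_prop))).mul (hτ1.cross hτ2)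
  have hw : ∀ x, -(angularVelocity α γ e x * deriv φ x)
      = (∫ y, oscKernel α γ e x y * deriv φ x * ‖deriv γ y‖ ∂torusMeasure)
        - (2 * α)⁻¹ * ∫ y, (‖γ x - γ y‖ ^ 2 + e) ^ (-α) * inner ℝ (tangent γ x) (tangent γ y)
          * deriv φ x * (‖deriv γ y‖ * κ y) ∂torusMeasure := by
    intro x
    have h1 : angularVelocity α γ e x = -∫ y, (‖γ x - γ y‖ ^ 2 + e) ^ (-1 - α)
        * inner ℝ (γ x - γ y) (tangent γ x) * cross (tangent γ x) (deriv γ y) ∂torusMeasure := by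
      rw [angularVelocity, integral_torus_shift (f := fun y => (‖γ x - γ y‖ ^ 2 + e) ^ (-1 - α)
        * inner ℝ (γ x - γ y) (tangent γ x) * cross (tangent γ x) (deriv γ y))]
      intro y
      simp only [h.periodic y, h.periodic_deriv y]
    -- The splitting τ(x) = (τ(x)−τ(y)) + τ(y) in the inner product. The first part gives
    -- `oscKernel`, the second the exact derivative treated in `integral_kernel_cross`.
    have h2 : ∀ y, (‖γ x - γ y‖ ^ 2 + e) ^ (-1 - α)
        * inner ℝ (γ x - γ y) (tangent γ x) * cross (tangent γ x) (deriv γ y)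
        = oscKernel α γ e x y * ‖deriv γ y‖ + (‖γ x - γ y‖ ^ 2 + e) ^ (-1 - α)
          * inner ℝ (γ x - γ y) (deriv γ y) * cross (tangent γ x) (tangent γ y) := by
      intro y
      rw [oscKernel, inner_sub_right]
      conv_lhs => rw [h.deriv_eq y, cross_smul_right]
      conv_rhs => rw [h.deriv_eq y, real_inner_smul_right, norm_smul, norm_norm, h.norm_tangent]
      ring
    have h3 := h.integral_kernel_cross he x
    simp only [h1, h2]
    rw [integral_add, neg_mul, neg_neg, add_mul]
    · have h5 : ∫ y, (‖γ x - γ y‖ ^ 2 + e) ^ (-α) * inner ℝ (tangent γ x) (tangent γ y)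
          * deriv φ x * (‖deriv γ y‖ * κ y) ∂torusMeasure = deriv φ x *
          ∫ y, (‖γ x - γ y‖ ^ 2 + e) ^ (-α) * inner ℝ (tangent γ x) (tangent γ y)
          * (‖deriv γ y‖ * κ y) ∂torusMeasure := by
        rw [← integral_const_mul]; congr 1; funext y; ring
      have h6 : ∫ y, oscKernel α γ e x y * deriv φ x * ‖deriv γ y‖ ∂torusMeasure
          = (∫ y, oscKernel α γ e x y * ‖deriv γ y‖ ∂torusMeasure) * deriv φ x := by
        rw [← integral_mul_const]; congr 1; funext y; ring
      rw [h5, h6, ← neg_eq_iff_eq_neg.2 h3]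
      field_simp
      ring
    · exact integrable_torus_of_continuous ((hosc.comp (f := fun y : ℝ => (x, y))
        (by fun_prop)).mul hγ'.norm)
    · exact integrable_torus_of_continuous (hBc.comp (f := fun y : ℝ => (x, y)) (by fun_prop))
  have hk1 : Continuous fun w : ℝ × ℝ => oscKernel α γ e w.1 w.2 * deriv φ w.1 := hosc.mul hφ1
  have hk2 : Continuous fun w : ℝ × ℝ => (‖γ w.1 - γ w.2‖ ^ 2 + e) ^ (-α) *
      inner ℝ (tangent γ w.1) (tangent γ w.2) * deriv φ w.1 :=
    ((hK _).mul (hτ1.inner hτ2)).mul hφ1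
  have s1 := integral_torus_swap (k := fun x y => oscKernel α γ e x y * deriv φ x) hk1
    (integrable_torus_of_continuous hγ'.norm)
  have s2 := integral_torus_swap (k := fun x y => (‖γ x - γ y‖ ^ 2 + e) ^ (-α) *
      inner ℝ (tangent γ x) (tangent γ y) * deriv φ x) hk2 h.integrable_speed_mul
  have hφd : Continuous fun w : ℝ × ℝ => φ w.1 - φ w.2 :=
    (hφ.continuous.comp continuous_fst).sub (hφ.continuous.comp continuous_snd)
  have hm : Continuous fun w : ℝ × ℝ => mainKernel α γ e w.1 w.2 * (φ w.1 - φ w.2) := by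
    unfold mainKernel
    exact (((hK _).mul (hR.inner (by fun_prop))).mul (hτ1.inner hτ2)).mul hφd
  have hr : Continuous fun w : ℝ × ℝ => (‖γ w.1 - γ w.2‖ ^ 2 + e) ^ (-α)
      * cross (tangent γ w.1) (tangent γ w.2) * (φ w.1 - φ w.2) :=
    ((hK _).mul (hτ1.cross hτ2)).mul hφd
  have j1 := integrable_torus_mul_integral (k := fun x y => mainKernel α γ e x y * (φ x - φ y))
    hm (integrable_const (1 : ℝ)) h.integrable_speed_mul
  simp only [mul_one] at j1
  have j2 := integrable_torus_mul_integral (k := fun x y => (‖γ x - γ y‖ ^ 2 + e) ^ (-α)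
    * cross (tangent γ x) (tangent γ y) * (φ x - φ y)) hr h.integrable_speed_mul h.integrable_speed_mul
  have j2' : ∀ y, ∫ x, (‖γ x - γ y‖ ^ 2 + e) ^ (-α) * cross (tangent γ x) (tangent γ y)
        * (φ x - φ y) * (‖deriv γ x‖ * κ x) ∂torusMeasure
      = ∫ x, (‖γ x - γ y‖ ^ 2 + e) ^ (-α) * (‖deriv γ x‖ * κ x)
        * cross (tangent γ x) (tangent γ y) * (φ x - φ y) ∂torusMeasure := fun y => by
    congr 1; funext x; ring
  simp only [j2'] at j2
  have k1 := integrable_torus_integral (k := fun x y => oscKernel α γ e x y * deriv φ x) hk1 (integrable_torus_of_continuous hγ'.norm)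
  have k2 := integrable_torus_integral (k := fun x y => (‖γ x - γ y‖ ^ 2 + e) ^ (-α) *
      inner ℝ (tangent γ x) (tangent γ y) * deriv φ x) hk2 h.integrable_speed_mul
  rw [← integral_neg]
  simp only [hw]
  rw [integral_sub k1 (k2.const_mul _), integral_const_mul, s1, s2]
  simp only [h.integral_oscKernel hφ hφp he, h.integral_kernel_inner hφ hφp he]
  have e2 : ∀ g A B : ℝ, g * (2 * α * A - B) = 2 * α * (g * A) - g * B := fun g A B => by ring
  simp only [e2, mul_neg, integral_neg]
  rw [integral_sub (j1.const_mul _) j2, integral_const_mul]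
  field_simp
  ring

end

end RegularCurve

/-! ### Kernel bounds uniform in the regularization -/

namespace RegularCurve

variable {α m M c H σ : ℝ} {γ : ℝ → Plane} {κ : ℝ → ℝ} (h : RegularCurve α m M c H σ γ κ)
include h

lemma chord_add' {y z : ℝ} (hz : |z| ≤ Real.pi) : c * |z| ≤ ‖γ (y + z) - γ y‖ := by
  rw [norm_sub_rev]; exact h.chord_add hz

lemma kernel_one_le {e y z : ℝ} (he : 0 ≤ e) (hz0 : z ≠ 0) (hz : |z| ≤ Real.pi) :
    ‖γ (y + z) - γ y‖ * (‖γ (y + z) - γ y‖ ^ 2 + e) ^ (-1 - α)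
      ≤ c ^ (-1 - 2 * α) * |z| ^ (-1 - 2 * α) := by
  have h1 := pow_mul_rpow_le h.c_pos hz0 (h.chord_add' (y := y) hz) he 1 (a := 1 + α)
    (by have := h.α_pos; push_cast; linarith)
  rwa [show -(1 + α) = -1 - α by ring,
    show ((1 : ℕ) : ℝ) - 2 * (1 + α) = -1 - 2 * α by push_cast; ring, pow_one] at h1

lemma abs_mainKernel_le {e y z : ℝ} (he : 0 ≤ e) (hz0 : z ≠ 0) (hz : |z| ≤ Real.pi) :
    |mainKernel α γ e (y + z) y| ≤ c ^ (-1 - 2 * α) * M * |z| ^ (-1 - 2 * α) := by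
  have h1 := h.kernel_one_le (y := y) he hz0 hz
  have hM := h.M_pos
  have hc := h.c_pos
  have h2 : |inner ℝ (γ (y + z) - γ y) (deriv γ (y + z))| ≤ ‖γ (y + z) - γ y‖ * M :=
    (abs_real_inner_le_norm _ _).trans (mul_le_mul_of_nonneg_left (h.upper _) (norm_nonneg _))
  have h3 : |inner ℝ (tangent γ (y + z)) (tangent γ y)| ≤ 1 := by
    refine (abs_real_inner_le_norm _ _).trans ?_
    rw [h.norm_tangent, h.norm_tangent, one_mul]
  rw [mainKernel, abs_mul, abs_mul, abs_of_nonneg (by positivity :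
    (0 : ℝ) ≤ (‖γ (y + z) - γ y‖ ^ 2 + e) ^ (-1 - α))]
  calc _ ≤ (‖γ (y + z) - γ y‖ ^ 2 + e) ^ (-1 - α) * (‖γ (y + z) - γ y‖ * M) * 1 := by gcongr
    _ = (‖γ (y + z) - γ y‖ * (‖γ (y + z) - γ y‖ ^ 2 + e) ^ (-1 - α)) * M := by ring
    _ ≤ c ^ (-1 - 2 * α) * |z| ^ (-1 - 2 * α) * M := by gcongr
    _ = _ := by ring

/-- This gains a full power of |z| at the cost of an average of |κ| along the segment. The Hölder
bound would gain only |z|^(σ+2α), in general too little against the singularity |z|^(−2−2α) met in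
`abs_oscKernelDeriv_le`. -/
lemma norm_tangent_add_sub_le (y z : ℝ) :
    ‖tangent γ (y + z) - tangent γ y‖ ≤ M * |z| * ∫ s in (0 : ℝ)..1, |κ (y + s * z)| := by
  have h1 := norm_tangent_sub_le h.frenet h.norm_tangent (x := y) (y := y + z)
  refine h1.trans ?_
  have h2 : ∫ u in y..(y + z), |κ u| = z * ∫ s in (0 : ℝ)..1, |κ (y + s * z)| := by
    have := intervalIntegral.smul_integral_comp_mul_add (fun u => |κ u|) z y (a := 0) (b := 1)
    simp only [smul_eq_mul, mul_zero, zero_add, mul_one] at this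
    rw [add_comm y z, ← this]
    congr 2
    funext s; rw [add_comm, mul_comm]
  have h3 : |∫ u in y..(y + z), ‖deriv γ u‖ * ‖κ u‖| ≤ |∫ u in y..(y + z), (M * |κ u|)| := by
    have hk : ∀ a b, IntervalIntegrable (fun u => M * |κ u|) volume a b := fun a b =>
      (h.integrable a b).norm.const_mul M
    refine intervalIntegral.norm_integral_le_abs_of_norm_le (E := ℝ) (μ := volume)
      (Eventually.of_forall fun u => ?_) (hk _ _)
    rw [norm_mul, norm_norm, norm_norm]
    exact mul_le_mul_of_nonneg_right (h.upper u) (norm_nonneg _)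
  refine h3.trans ?_
  rw [intervalIntegral.integral_const_mul, h2, abs_mul, abs_mul, abs_of_pos h.M_pos, mul_assoc,
    abs_of_nonneg (intervalIntegral.integral_nonneg zero_le_one fun _ _ => abs_nonneg _)]

/-- The constant in the bound of `oscKernelDeriv`. -/
def _root_.AlphaPatch.oscConst (α M c H : ℝ) : ℝ :=
  (2 * (1 + α) + 1) * c ^ (-2 - 2 * α) * M ^ 2 * H + 2 * c ^ (-1 - 2 * α) * M * H

/-- Where the kernel or the chord is differentiated, the singularity is |z|^(−2−2α) and one tangent
increment is estimated by |z| times an average of |κ|. Where a tangent is differentiated, κ(y+z)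
appears and the singularity is only |z|^(−1−2α). In all four terms the other tangent increment
contributes |z|^(σ+2α), so that |z|^(σ−1) remains. -/
lemma abs_oscKernelDeriv_le {e y z : ℝ} (he : 0 ≤ e) (hz0 : z ≠ 0) (hz : |z| ≤ Real.pi) :
    |oscKernelDeriv α γ κ e (y + z) y|
      ≤ oscConst α M c H * |z| ^ (σ - 1) * (|κ (y + z)| + ∫ s in (0 : ℝ)..1, |κ (y + s * z)|) := by
  have hz' : 0 < |z| := abs_pos.2 hz0
  have hM := h.M_pos
  have hc := h.c_pos
  have hα := h.α_pos
  have hH := h.H_nonneg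
  have hD := h.norm_tangent_add_sub_le y z
  set I := ∫ s in (0 : ℝ)..1, |κ (y + s * z)|
  have hI : 0 ≤ I := intervalIntegral.integral_nonneg zero_le_one fun _ _ => abs_nonneg _
  have k1 := h.kernel_one_le (y := y) he hz0 hz
  have k0 := pow_mul_rpow_le h.c_pos hz0 (h.chord_add' (y := y) hz) he 0 (a := 1 + α)
    (by push_cast; linarith)
  rw [show -(1 + α) = -1 - α by ring, pow_zero, one_mul,
    show ((0 : ℕ) : ℝ) - 2 * (1 + α) = -2 - 2 * α by push_cast; ring] at k0
  have k2 := pow_mul_rpow_le h.c_pos hz0 (h.chord_add' (y := y) hz) he 2 (a := 2 + α)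
    (by push_cast; linarith)
  rw [show -(2 + α) = -2 - α by ring,
    show ((2 : ℕ) : ℝ) - 2 * (2 + α) = -2 - 2 * α by push_cast; ring] at k2
  have hcr : |cross (tangent γ (y + z)) (tangent γ y)| ≤ H * |z| ^ (σ + 2 * α) := by
    rw [cross_swap, abs_neg]; exact h.abs_cross_tangent hz
  have b1 : |inner ℝ (γ (y + z) - γ y) (deriv γ (y + z))| ≤ ‖γ (y + z) - γ y‖ * M :=
    (abs_real_inner_le_norm _ _).trans (mul_le_mul_of_nonneg_left (h.upper _) (norm_nonneg _))
  have b2 : |inner ℝ (γ (y + z) - γ y) (tangent γ (y + z) - tangent γ y)|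
      ≤ ‖γ (y + z) - γ y‖ * ‖tangent γ (y + z) - tangent γ y‖ := abs_real_inner_le_norm _ _
  have b3 : |inner ℝ (deriv γ (y + z)) (tangent γ (y + z) - tangent γ y)|
      ≤ M * ‖tangent γ (y + z) - tangent γ y‖ :=
    (abs_real_inner_le_norm _ _).trans (mul_le_mul_of_nonneg_right (h.upper _) (norm_nonneg _))
  have b4 : |inner ℝ (γ (y + z) - γ y) (perp (tangent γ (y + z)))| ≤ ‖γ (y + z) - γ y‖ := by
    refine (abs_real_inner_le_norm _ _).trans ?_
    rw [norm_perp, h.norm_tangent, mul_one]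
  have b5 : |inner ℝ (tangent γ (y + z)) (tangent γ y)| ≤ 1 := by
    refine (abs_real_inner_le_norm _ _).trans ?_
    rw [h.norm_tangent, h.norm_tangent, one_mul]
  have b6 : ‖tangent γ (y + z) - tangent γ y‖ ≤ H * |z| ^ (σ + 2 * α) := by
    rw [norm_sub_rev]; exact h.norm_tangent_sub_add hz
  have b7 : |‖deriv γ (y + z)‖ * κ (y + z)| ≤ M * |κ (y + z)| := by
    rw [abs_mul, abs_norm]; gcongr; exact h.upper _
  rw [oscKernelDeriv]
  set r := ‖γ (y + z) - γ y‖
  set D := ‖tangent γ (y + z) - tangent γ y‖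
  set q1 := (r ^ 2 + e) ^ (-1 - α)
  set q2 := (r ^ 2 + e) ^ (-2 - α)
  have hq1 : 0 ≤ q1 := by positivity
  have hq2 : 0 ≤ q2 := by positivity
  set Z := |z| ^ (σ + 2 * α)
  have hZ1 : |z| ^ (-2 - 2 * α) * (|z| * Z) = |z| ^ (σ - 1) := by
    nth_rewrite 2 [← Real.rpow_one |z|]
    rw [← Real.rpow_add hz', ← Real.rpow_add hz']; congr 1; ring
  have hZ2 : |z| ^ (-1 - 2 * α) * Z = |z| ^ (σ - 1) := by
    rw [← Real.rpow_add hz']; congr 1; ring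
  have hr : 0 ≤ r := norm_nonneg _
  have hDn : 0 ≤ D := norm_nonneg _
  have t1 : |2 * (-1 - α) * q2 * inner ℝ (γ (y + z) - γ y) (deriv γ (y + z))
      * inner ℝ (γ (y + z) - γ y) (tangent γ (y + z) - tangent γ y)
      * cross (tangent γ (y + z)) (tangent γ y)|
      ≤ 2 * (1 + α) * c ^ (-2 - 2 * α) * M ^ 2 * H * |z| ^ (σ - 1) * I := by
    rw [abs_mul, abs_mul, abs_mul, abs_mul, abs_of_nonneg hq2,
      show |2 * (-1 - α)| = 2 * (1 + α) by rw [abs_of_nonpos (by linarith)]; ring]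
    calc _ ≤ 2 * (1 + α) * q2 * (r * M) * (r * (M * |z| * I)) * (H * Z) := by
          gcongr; exact b2.trans (by gcongr)
      _ = 2 * (1 + α) * (r ^ 2 * q2) * M ^ 2 * H * (|z| * Z) * I := by ring
      _ ≤ 2 * (1 + α) * (c ^ (-2 - 2 * α) * |z| ^ (-2 - 2 * α)) * M ^ 2 * H * (|z| * Z) * I := by
          gcongr
      _ = _ := by rw [← hZ1]; ring
  have t2 : |q1 * inner ℝ (deriv γ (y + z)) (tangent γ (y + z) - tangent γ y)
      * cross (tangent γ (y + z)) (tangent γ y)|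
      ≤ c ^ (-2 - 2 * α) * M ^ 2 * H * |z| ^ (σ - 1) * I := by
    rw [abs_mul, abs_mul, abs_of_nonneg hq1]
    calc _ ≤ (c ^ (-2 - 2 * α) * |z| ^ (-2 - 2 * α)) * (M * (M * |z| * I)) * (H * Z) := by
          gcongr; exact b3.trans (by gcongr)
      _ = _ := by rw [← hZ1]; ring
  have t3 : |q1 * (‖deriv γ (y + z)‖ * κ (y + z) *
      inner ℝ (γ (y + z) - γ y) (perp (tangent γ (y + z)))) * cross (tangent γ (y + z)) (tangent γ y)|
      ≤ c ^ (-1 - 2 * α) * M * H * |z| ^ (σ - 1) * |κ (y + z)| := by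
    rw [abs_mul, abs_mul, abs_of_nonneg hq1, abs_mul _ (inner ℝ _ _)]
    calc _ ≤ q1 * (M * |κ (y + z)| * r) * (H * Z) := by gcongr
      _ = (r * q1) * (M * H * Z * |κ (y + z)|) := by ring
      _ ≤ (c ^ (-1 - 2 * α) * |z| ^ (-1 - 2 * α)) * (M * H * Z * |κ (y + z)|) := by gcongr
      _ = _ := by rw [← hZ2]; ring
  have t4 : |q1 * inner ℝ (γ (y + z) - γ y) (tangent γ (y + z) - tangent γ y)
      * (‖deriv γ (y + z)‖ * κ (y + z) * inner ℝ (tangent γ (y + z)) (tangent γ y))|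
      ≤ c ^ (-1 - 2 * α) * M * H * |z| ^ (σ - 1) * |κ (y + z)| := by
    rw [abs_mul, abs_mul, abs_of_nonneg hq1, abs_mul _ (inner ℝ (tangent γ (y + z)) _)]
    calc _ ≤ q1 * (r * (H * Z)) * (M * |κ (y + z)| * 1) := by
          gcongr; exact b2.trans (by gcongr)
      _ = (r * q1) * (M * H * Z * |κ (y + z)|) := by ring
      _ ≤ (c ^ (-1 - 2 * α) * |z| ^ (-1 - 2 * α)) * (M * H * Z * |κ (y + z)|) := by gcongr
      _ = _ := by rw [← hZ2]; ring
  have hκ := abs_nonneg (κ (y + z))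
  have hz1 : 0 ≤ |z| ^ (σ - 1) := by positivity
  have p1 : 0 ≤ (2 * (1 + α) + 1) * c ^ (-2 - 2 * α) * M ^ 2 * H * |z| ^ (σ - 1) * |κ (y + z)| := by
    positivity
  have p2 : 0 ≤ 2 * c ^ (-1 - 2 * α) * M * H * |z| ^ (σ - 1) * I := by positivity
  refine le_trans (b := 2 * (1 + α) * c ^ (-2 - 2 * α) * M ^ 2 * H * |z| ^ (σ - 1) * I
    + c ^ (-2 - 2 * α) * M ^ 2 * H * |z| ^ (σ - 1) * I
    + c ^ (-1 - 2 * α) * M * H * |z| ^ (σ - 1) * |κ (y + z)|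
    + c ^ (-1 - 2 * α) * M * H * |z| ^ (σ - 1) * |κ (y + z)|) ?_ ?_
  · refine le_trans ?_ (add_le_add (add_le_add (add_le_add t1 t2) t3) t4)
    refine le_trans (le_of_eq ?_) ((abs_sub _ _).trans (add_le_add_left ((abs_add_three _ _ _)) _))
    congr 1; ring
  · rw [oscConst]; linarith

end RegularCurve

/-! ### Terms of order zero in the test function -/

namespace RegularCurve

variable {α m M c H σ : ℝ} {γ : ℝ → Plane} {κ : ℝ → ℝ} (h : RegularCurve α m M c H σ γ κ)
  {φ : ℝ → ℝ} (hφ : Continuous φ) (hφp : Function.Periodic φ (2 * Real.pi))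
  {N : ℝ≥0∞} (hN : ∀ a, ∫⁻ y, ‖κ y‖ₑ * ‖φ (y + a)‖ₑ ∂torusMeasure ≤ N)
include h hφp hN

/-- Integrals over a period are translation invariant, so only the relative shift of κ and φ
matters. -/
lemma lintegral_pair_le (a b : ℝ) :
    ∫⁻ y, ‖κ (y + a)‖ₑ * ‖φ (y + b)‖ₑ ∂torusMeasure ≤ N := by
  refine le_trans (le_of_eq ?_) (hN (b - a))
  rw [← lintegral_torus_shift (f := fun y => ‖κ y‖ₑ * ‖φ (y + (b - a))‖ₑ) _ a]
  · congr 1; funext y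
    rw [add_comm a y]; congr 3; ring
  · intro y
    simp only [h.curvature_periodic y, add_right_comm y (2 * Real.pi), hφp _]

include hφ

/-- With norms inside and the z-integral outermost, |z|^(σ−1) is integrable. For each z, and for
each point s of the segment, what is left is a pairing of |κ| with a translate of |φ|. The pointwise
term and the segment average each contribute N, whence the factor 2. -/
lemma enorm_integral_oscKernelDeriv_le {e : ℝ} (he : 0 ≤ e) :
    ‖∫ y, ‖deriv γ y‖ * ∫ x, oscKernelDeriv α γ κ e x y * φ x ∂torusMeasure ∂torusMeasure‖ₑ
      ≤ (∫⁻ z, ENNReal.ofReal M * ENNReal.ofReal (oscConst α M c H * |z| ^ (σ - 1)) * 2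
        ∂torusMeasure) * N := by
  have hshift : ∀ y, ∫ x, oscKernelDeriv α γ κ e x y * φ x ∂torusMeasure
      = ∫ z, oscKernelDeriv α γ κ e (y + z) y * φ (y + z) ∂torusMeasure := fun y => by
    rw [integral_torus_shift (f := fun x => oscKernelDeriv α γ κ e x y * φ x)]
    intro x
    simp only [oscKernelDeriv, h.periodic x, h.periodic_deriv x, h.periodic_tangent x,
      h.curvature_periodic x, hφp x]
  set F : ℝ → ℝ → ℝ≥0∞ := fun y z => ENNReal.ofReal M *
    ENNReal.ofReal (oscConst α M c H * |z| ^ (σ - 1)) * (‖κ (y + z)‖ₑ * ‖φ (y + z)‖ₑ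
      + ∫⁻ s in Set.Ioc (0 : ℝ) 1, ‖κ (y + s * z)‖ₑ * ‖φ (y + z)‖ₑ) with hF
  have hκm := h.measurable
  have hm3 : Measurable fun w : (ℝ × ℝ) × ℝ =>
      ‖κ (w.1.1 + w.2 * w.1.2)‖ₑ * ‖φ (w.1.1 + w.1.2)‖ₑ :=
    ((hκm.comp (by fun_prop)).enorm).mul ((hφ.measurable.comp (by fun_prop)).enorm)
  have hm2 : Measurable fun w : ℝ × ℝ => ‖κ (w.1 + w.2)‖ₑ * ‖φ (w.1 + w.2)‖ₑ :=
    ((hκm.comp (by fun_prop)).enorm).mul ((hφ.measurable.comp (by fun_prop)).enorm)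
  have hmz : Measurable fun z : ℝ => ENNReal.ofReal M *
      ENNReal.ofReal (oscConst α M c H * |z| ^ (σ - 1)) := by fun_prop
  have hFm : Measurable (Function.uncurry F) :=
    (hmz.comp measurable_snd).mul (hm2.add hm3.lintegral_prod_right')
  have h1 : ‖∫ y, ‖deriv γ y‖ * ∫ x, oscKernelDeriv α γ κ e x y * φ x ∂torusMeasure
      ∂torusMeasure‖ₑ ≤ ∫⁻ y, ∫⁻ z, F y z ∂torusMeasure ∂torusMeasure := by
    refine (enorm_integral_le_lintegral_enorm _).trans (lintegral_mono fun y => ?_)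
    rw [hshift y, enorm_mul, enorm_norm]
    have hg : ‖deriv γ y‖ₑ ≤ ENNReal.ofReal M := by
      rw [← ofReal_norm]; exact ENNReal.ofReal_le_ofReal (h.upper y)
    calc _ ≤ ENNReal.ofReal M * ∫⁻ z, ‖oscKernelDeriv α γ κ e (y + z) y * φ (y + z)‖ₑ
          ∂torusMeasure := by
          gcongr; exact enorm_integral_le_lintegral_enorm _
      _ = ∫⁻ z, ENNReal.ofReal M * ‖oscKernelDeriv α γ κ e (y + z) y * φ (y + z)‖ₑ
          ∂torusMeasure := (lintegral_const_mul' _ _ ENNReal.ofReal_ne_top).symm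
      _ ≤ _ := by
          refine lintegral_mono_ae ?_
          filter_upwards [ae_torus_mem] with z hz
          have h2 := h.abs_oscKernelDeriv_le (y := y) he hz.1 hz.2
          have h3 : ‖oscKernelDeriv α γ κ e (y + z) y‖ₑ
              ≤ ENNReal.ofReal (oscConst α M c H * |z| ^ (σ - 1)) * (‖κ (y + z)‖ₑ
                + ∫⁻ s in Set.Ioc (0 : ℝ) 1, ‖κ (y + s * z)‖ₑ) := by
            have h4 : 0 ≤ oscConst α M c H * |z| ^ (σ - 1) := by
              have := h.M_pos; have := h.c_pos; have := h.H_nonneg; have := h.α_pos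
              unfold oscConst; positivity
            rw [Real.enorm_eq_ofReal_abs]
            refine (ENNReal.ofReal_le_ofReal h2).trans ?_
            rw [ENNReal.ofReal_mul h4, ENNReal.ofReal_add (abs_nonneg _)
              (intervalIntegral.integral_nonneg zero_le_one fun _ _ => abs_nonneg _),
              ← Real.enorm_eq_ofReal_abs]
            gcongr
            rw [intervalIntegral.integral_of_le zero_le_one, ← Real.enorm_eq_ofReal
              (integral_nonneg fun _ => abs_nonneg _)]
            refine (enorm_integral_le_lintegral_enorm _).trans (le_of_eq ?_)
            simp only [Real.enorm_abs]
          rw [enorm_mul, hF]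
          simp only
          rw [lintegral_mul_const' _ _ enorm_ne_top, ← add_mul, mul_assoc, ← mul_assoc
            (ENNReal.ofReal (oscConst α M c H * |z| ^ (σ - 1)))]
          gcongr
  refine h1.trans ?_
  rw [lintegral_lintegral_swap hFm.aemeasurable, ← lintegral_mul_const _ (by fun_prop)]
  refine lintegral_mono fun z => ?_
  simp only [hF]
  rw [lintegral_const_mul _ (by
    exact (hm2.comp (f := fun y : ℝ => (y, z)) (by fun_prop)).add
      (hm3.lintegral_prod_right'.comp (f := fun y : ℝ => (y, z)) (by fun_prop))), mul_assoc _ 2 N]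
  gcongr
  rw [lintegral_add_left (by exact hm2.comp (f := fun y : ℝ => (y, z)) (by fun_prop)), two_mul]
  gcongr
  · exact h.lintegral_pair_le hφp hN z z
  · rw [lintegral_lintegral_swap (by
      exact (hm3.comp (f := fun w : ℝ × ℝ => ((w.1, z), w.2)) (by fun_prop)).aemeasurable)]
    calc _ ≤ ∫⁻ s in Set.Ioc (0 : ℝ) 1, N := lintegral_mono fun s => h.lintegral_pair_le hφp hN _ _
      _ = N := by simp

/-- The singularity |z|^(−2α) is beaten by the tangent increment, leaving |z|^σ ≤ π^σ. Of the two
curvature factors one is spent on its L¹ norm, bounded by H, and the other is paired with φ, so the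
bound stays linear in N. -/
lemma enorm_integral_remainder_le {e : ℝ} (he : 0 ≤ e) :
    ‖∫ y, ‖deriv γ y‖ * κ y * ∫ x, (‖γ x - γ y‖ ^ 2 + e) ^ (-α) *
          (‖deriv γ x‖ * κ x) * cross (tangent γ x) (tangent γ y) * (φ x - φ y) ∂torusMeasure
          ∂torusMeasure‖ₑ
      ≤ ENNReal.ofReal (M ^ 2 * c ^ (-2 * α) * H * Real.pi ^ σ) * (2 * ENNReal.ofReal H) * N := by
  have hM := h.M_pos
  have hc := h.c_pos
  have hα := h.α_pos
  have hH := h.H_nonneg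
  have hκm := h.measurable
  have hshift : ∀ y, ∫ x, (‖γ x - γ y‖ ^ 2 + e) ^ (-α) *
          (‖deriv γ x‖ * κ x) * cross (tangent γ x) (tangent γ y) * (φ x - φ y) ∂torusMeasure
      = ∫ z, (‖γ (y + z) - γ y‖ ^ 2 + e) ^ (-α) * (‖deriv γ (y + z)‖ * κ (y + z))
        * cross (tangent γ (y + z)) (tangent γ y) * (φ (y + z) - φ y) ∂torusMeasure := fun y => by
    rw [integral_torus_shift (f := fun x => (‖γ x - γ y‖ ^ 2 + e) ^ (-α) *
          (‖deriv γ x‖ * κ x) * cross (tangent γ x) (tangent γ y) * (φ x - φ y))]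
    intro x
    simp only [h.periodic x, h.periodic_deriv x, h.periodic_tangent x,
      h.curvature_periodic x, hφp x]
  set C := M * c ^ (-2 * α) * H * Real.pi ^ σ with hC
  have hC0 : 0 ≤ C := by positivity
  have hpt : ∀ y, ∀ᵐ z ∂torusMeasure, ‖(‖γ (y + z) - γ y‖ ^ 2 + e) ^ (-α)
      * (‖deriv γ (y + z)‖ * κ (y + z))
      * cross (tangent γ (y + z)) (tangent γ y) * (φ (y + z) - φ y)‖ₑ
      ≤ ENNReal.ofReal C * (‖κ (y + z)‖ₑ * ‖φ (y + z)‖ₑ + ‖κ (y + z)‖ₑ * ‖φ y‖ₑ) := fun y => by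
    filter_upwards [ae_torus_mem] with z hz
    have hz' : 0 < |z| := abs_pos.2 hz.1
    have k0 := pow_mul_rpow_le h.c_pos hz.1 (h.chord_add' (y := y) hz.2) he 0 (a := α)
      (by push_cast; linarith)
    rw [pow_zero, one_mul, show ((0 : ℕ) : ℝ) - 2 * α = -2 * α by push_cast; ring] at k0
    have hcr : |cross (tangent γ (y + z)) (tangent γ y)| ≤ H * |z| ^ (σ + 2 * α) := by
      rw [cross_swap, abs_neg]; exact h.abs_cross_tangent hz.2
    have hπ : |z| ^ σ ≤ Real.pi ^ σ := Real.rpow_le_rpow (abs_nonneg z) hz.2 h.σ_pos.le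
    have h1 : |(‖γ (y + z) - γ y‖ ^ 2 + e) ^ (-α) * (‖deriv γ (y + z)‖ * κ (y + z))
      * cross (tangent γ (y + z)) (tangent γ y)| ≤ C * |κ (y + z)| := by
      rw [abs_mul, abs_mul, abs_mul, abs_norm, abs_of_nonneg (by positivity :
        (0 : ℝ) ≤ (‖γ (y + z) - γ y‖ ^ 2 + e) ^ (-α))]
      calc _ ≤ (c ^ (-2 * α) * |z| ^ (-2 * α)) * (M * |κ (y + z)|) * (H * |z| ^ (σ + 2 * α)) := by
            gcongr; exact h.upper _
        _ = M * c ^ (-2 * α) * H * (|z| ^ (-2 * α) * |z| ^ (σ + 2 * α)) * |κ (y + z)| := by ring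
        _ = M * c ^ (-2 * α) * H * |z| ^ σ * |κ (y + z)| := by
            rw [← Real.rpow_add hz']; congr 3; ring
        _ ≤ _ := by rw [hC]; gcongr
    rw [enorm_mul, ← mul_add, ← mul_assoc (ENNReal.ofReal C)]
    refine mul_le_mul' ?_ enorm_sub_le
    rw [Real.enorm_eq_ofReal_abs, Real.enorm_eq_ofReal_abs, ← ENNReal.ofReal_mul hC0]
    exact ENNReal.ofReal_le_ofReal h1
  have hK : ∀ y, ∫⁻ z, ‖κ (y + z)‖ₑ ∂torusMeasure ≤ ENNReal.ofReal H := fun y => by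
    rw [lintegral_torus_shift (f := fun x => ‖κ x‖ₑ) fun x => by simp only [h.curvature_periodic x]]
    rw [← ofReal_integral_norm_eq_lintegral_enorm (integrable_torus_iff.2 (h.integrable _ _))]
    exact ENNReal.ofReal_le_ofReal h.integral_le
  have hP : ∀ y, ∫⁻ z, ‖κ (y + z)‖ₑ * ‖φ (y + z)‖ₑ ∂torusMeasure ≤ N := fun y => by
    have := h.lintegral_pair_le hφp hN y y
    simpa only [add_comm y] using this
  have hP0 : ∫⁻ y, ‖κ y‖ₑ * ‖φ y‖ₑ ∂torusMeasure ≤ N := by simpa using hN 0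
  calc _ ≤ ∫⁻ y, ENNReal.ofReal M * ‖κ y‖ₑ * (ENNReal.ofReal C * (N + ENNReal.ofReal H * ‖φ y‖ₑ))
        ∂torusMeasure := by
        refine (enorm_integral_le_lintegral_enorm _).trans (lintegral_mono fun y => ?_)
        rw [hshift y, enorm_mul, enorm_mul, enorm_norm]
        have hg : ‖deriv γ y‖ₑ ≤ ENNReal.ofReal M := by
          rw [← ofReal_norm]; exact ENNReal.ofReal_le_ofReal (h.upper y)
        gcongr
        refine (enorm_integral_le_lintegral_enorm _).trans ((lintegral_mono_ae (hpt y)).trans ?_)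
        rw [lintegral_const_mul' _ _ ENNReal.ofReal_ne_top]
        gcongr
        rw [lintegral_add_right]
        · rw [lintegral_mul_const' _ _ enorm_ne_top]
          gcongr
          exacts [hP y, hK y]
        · exact ((hκm.comp (by fun_prop)).enorm).mul_const _
    _ = ENNReal.ofReal M * ENNReal.ofReal C * ((∫⁻ y, ‖κ y‖ₑ ∂torusMeasure) * N
        + ENNReal.ofReal H * ∫⁻ y, ‖κ y‖ₑ * ‖φ y‖ₑ ∂torusMeasure) := by
        have hm1 : Measurable fun y => ‖κ y‖ₑ := hκm.enorm
        have hm2 : Measurable fun y => ‖φ y‖ₑ := hφ.measurable.enorm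
        have hm3 : Measurable fun y => ‖κ y‖ₑ * ‖φ y‖ₑ := hm1.mul hm2
        have hm4 : Measurable fun y => ‖κ y‖ₑ * N + ENNReal.ofReal H * (‖κ y‖ₑ * ‖φ y‖ₑ) :=
          (hm1.mul_const _).add (hm3.const_mul _)
        rw [← lintegral_mul_const _ hm1, ← lintegral_const_mul _ hm3,
          ← lintegral_add_left (hm1.mul_const _), ← lintegral_const_mul _ hm4]
        congr 1; funext y; ring
    _ ≤ ENNReal.ofReal M * ENNReal.ofReal C * (ENNReal.ofReal H * N + ENNReal.ofReal H * N) := by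
        gcongr
        simpa using hK 0
    _ = _ := by
        rw [← ENNReal.ofReal_mul hM.le, hC, show M * (M * c ^ (-2 * α) * H * Real.pi ^ σ)
          = M ^ 2 * c ^ (-2 * α) * H * Real.pi ^ σ by ring]
        ring

end RegularCurve

/-! ### The leading term and the limit of vanishing regularization -/

lemma exists_lipschitz_of_periodic {φ : ℝ → ℝ} (hφ : ContDiff ℝ 1 φ) {P : ℝ} (hP : P ≠ 0)
    (hφp : Function.Periodic φ P) : ∃ L, 0 ≤ L ∧ ∀ x y, |φ x - φ y| ≤ L * |x - y| := by
  have hper : Function.Periodic (deriv φ) P := fun x => by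
    have h1 : (fun y => φ (y + P)) = φ := funext hφp
    rw [← deriv_comp_add_const, h1]
  obtain ⟨L, hL⟩ := (hper.isBounded_of_continuous hP
    (hφ.continuous_deriv le_rfl)).exists_norm_le
  have hL' : ∀ x, ‖deriv φ x‖ ≤ L := fun x => hL _ (Set.mem_range_self x)
  exact ⟨L, (norm_nonneg _).trans (hL' 0), fun x y =>
    Convex.norm_image_sub_le_of_norm_hasDerivWithin_le (s := Set.univ)
      (fun x _ => ((hφ.differentiable one_ne_zero x).hasDerivAt).hasDerivWithinAt)
      (fun x _ => hL' x) convex_univ (Set.mem_univ y) (Set.mem_univ x)⟩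

/-- The odd kernel of homogeneity `-1 - 2 α`. -/
def oddKernel (α z : ℝ) : ℝ := z * |z| ^ (-2 - 2 * α)

lemma abs_oddKernel {α z : ℝ} (hz : z ≠ 0) : |oddKernel α z| = |z| ^ (-1 - 2 * α) := by
  rw [oddKernel, abs_mul, abs_of_nonneg (by positivity : 0 ≤ |z| ^ (-2 - 2 * α))]
  nth_rewrite 1 [← Real.rpow_one |z|]
  rw [← Real.rpow_add (abs_pos.2 hz)]; congr 1; ring

lemma measurable_oddKernel (α : ℝ) : Measurable (oddKernel α) := by
  unfold oddKernel; fun_prop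

/-- The leading term of the curvature equation, tested with `φ`. -/
def mainTerm (α : ℝ) (γ : ℝ → Plane) (κ φ : ℝ → ℝ) (e : ℝ) : ℝ :=
  ∫ y, ‖deriv γ y‖ * κ y * ∫ z, RegularCurve.mainKernel α γ e (y + z) y * (φ (y + z) - φ y)
    ∂torusMeasure ∂torusMeasure

/-- The homogeneous model of the leading term. -/
def modelTerm (α : ℝ) (γ : ℝ → Plane) (κ φ : ℝ → ℝ) : ℝ :=
  ∫ y, ‖deriv γ y‖ ^ (1 - 2 * α) * κ y * ∫ z, oddKernel α z * (φ (y + z) - φ y)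
    ∂torusMeasure ∂torusMeasure

namespace RegularCurve

variable {α m M c H σ : ℝ} {γ : ℝ → Plane} {κ : ℝ → ℝ} (h : RegularCurve α m M c H σ γ κ)
  {φ : ℝ → ℝ} (hφ : ContDiff ℝ 1 φ) (hφp : Function.Periodic φ (2 * Real.pi))
include h

lemma measurable_mainKernel (e : ℝ) :
    Measurable fun w : ℝ × ℝ => mainKernel α γ e (w.1 + w.2) w.1 := by
  have h1 := h.continuous
  have h2 := h.continuous_deriv
  have h4 := h.continuous_tangent
  unfold mainKernel
  have h3 : Continuous fun w : ℝ × ℝ => ‖γ (w.1 + w.2) - γ w.1‖ ^ 2 + e := by fun_prop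
  refine ((h3.measurable.pow_const _).mul ?_).mul ?_
  · exact (Continuous.inner (by fun_prop) (by fun_prop)).measurable
  · exact (Continuous.inner (by fun_prop) (by fun_prop)).measurable

/-- Serves absolute convergence and the limit e → 0 only; the Lipschitz constant of φ does not enter
any final estimate. -/
lemma abs_main_integrand_le {L : ℝ} (hL : ∀ x y, |φ x - φ y| ≤ L * |x - y|) {e : ℝ}
    (he : 0 ≤ e) (y : ℝ) : ∀ᵐ z ∂torusMeasure,
    ‖mainKernel α γ e (y + z) y * (φ (y + z) - φ y)‖
      ≤ c ^ (-1 - 2 * α) * M * L * |z| ^ (-(2 * α)) := by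
  filter_upwards [ae_torus_mem] with z hz
  have h1 := h.abs_mainKernel_le (y := y) he hz.1 hz.2
  have h2 := hL (y + z) y
  rw [add_sub_cancel_left] at h2
  have := h.c_pos
  have := h.M_pos
  rw [norm_mul, Real.norm_eq_abs, Real.norm_eq_abs]
  calc _ ≤ c ^ (-1 - 2 * α) * M * |z| ^ (-1 - 2 * α) * (L * |z|) := by gcongr
    _ = c ^ (-1 - 2 * α) * M * L * (|z| ^ (-1 - 2 * α) * |z| ^ (1 : ℝ)) := by
      rw [Real.rpow_one]; ring
    _ = _ := by rw [← Real.rpow_add (abs_pos.2 hz.1)]; congr 2; ring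

lemma mainTerm_eq (hφp : Function.Periodic φ (2 * Real.pi)) (e : ℝ) :
    ∫ y, ‖deriv γ y‖ * κ y * ∫ x, mainKernel α γ e x y * (φ x - φ y)
    ∂torusMeasure ∂torusMeasure = mainTerm α γ κ φ e := by
  rw [mainTerm]
  congr 1
  funext y
  rw [integral_torus_shift (f := fun x => mainKernel α γ e x y * (φ x - φ y))]
  intro x
  simp only [mainKernel, h.periodic x, h.periodic_deriv x, h.periodic_tangent x, hφp x]

include hφ

lemma stronglyMeasurable_main (e : ℝ) : StronglyMeasurable fun y =>
    ∫ z, mainKernel α γ e (y + z) y * (φ (y + z) - φ y) ∂torusMeasure := by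
  have hφc := hφ.continuous
  have : Measurable fun w : ℝ × ℝ => mainKernel α γ e (w.1 + w.2) w.1 * (φ (w.1 + w.2) - φ w.1) :=
    (h.measurable_mainKernel e).mul (Continuous.measurable (by fun_prop))
  exact this.stronglyMeasurable.integral_prod_right'

lemma tendsto_integral_angularVelocity :
    Tendsto (fun e => ∫ x, angularVelocity α γ e x * deriv φ x ∂torusMeasure) (𝓝[>] 0)
      (𝓝 (∫ x, angularVelocity α γ 0 x * deriv φ x ∂torusMeasure)) := by
  have hφ' := hφ.continuous_deriv le_rfl
  refine tendsto_integral_filter_of_dominated_convergence (fun x =>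
    (m⁻¹ * ∫ z, c ^ (-1 - 2 * α) * (M ^ 2 * H) * |z| ^ (σ - 1) ∂torusMeasure) * ‖deriv φ x‖)
    ?_ ?_ ((integrable_torus_of_continuous hφ'.norm).const_mul _) ?_
  · filter_upwards [self_mem_nhdsWithin] with e he
    exact ((h.continuous_angularVelocity (le_of_lt he)).mul hφ').aestronglyMeasurable
  · filter_upwards [self_mem_nhdsWithin] with e he
    refine Eventually.of_forall fun x => ?_
    rw [norm_mul]
    gcongr
    exact h.abs_angularVelocity_le (le_of_lt he) x
  · exact Eventually.of_forall fun x => (h.tendsto_angularVelocity x).mul_const _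

include hφp

lemma tendsto_mainTerm (hα' : α < 1 / 2) :
    Tendsto (mainTerm α γ κ φ) (𝓝[>] 0) (𝓝 (mainTerm α γ κ φ 0)) := by
  obtain ⟨L, hL0, hL⟩ := exists_lipschitz_of_periodic hφ (by positivity) hφp
  have hint : Integrable (fun z : ℝ => c ^ (-1 - 2 * α) * M * L * |z| ^ (-(2 * α)))
      torusMeasure := (integrable_torus_rpow (by linarith)).const_mul _
  refine tendsto_integral_filter_of_dominated_convergence (fun y => ‖‖deriv γ y‖ * κ y‖ *
    ∫ z, c ^ (-1 - 2 * α) * M * L * |z| ^ (-(2 * α)) ∂torusMeasure) ?_ ?_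
    (h.integrable_speed_mul.norm.mul_const _) ?_
  · exact Eventually.of_forall fun e => h.integrable_speed_mul.aestronglyMeasurable.mul
      (h.stronglyMeasurable_main hφ e).aestronglyMeasurable
  · filter_upwards [self_mem_nhdsWithin] with e he
    refine Eventually.of_forall fun y => ?_
    rw [norm_mul]
    gcongr
    exact norm_integral_le_of_norm_le hint (h.abs_main_integrand_le hL (le_of_lt he) y)
  · refine Eventually.of_forall fun y => Tendsto.const_mul _ ?_
    refine tendsto_integral_filter_of_dominated_convergence _ ?_ ?_ hint ?_
    · refine Eventually.of_forall fun e => Measurable.aestronglyMeasurable ?_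
      have hφc := hφ.continuous
      exact ((h.measurable_mainKernel e).comp (f := fun z : ℝ => (y, z)) (by fun_prop)).mul
        (Continuous.measurable (by fun_prop))
    · filter_upwards [self_mem_nhdsWithin] with e he
      exact h.abs_main_integrand_le hL (le_of_lt he) y
    · filter_upwards [ae_torus_mem] with z hz
      have h1 : 0 < ‖γ (y + z) - γ y‖ :=
        lt_of_lt_of_le (mul_pos h.c_pos (abs_pos.2 hz.1)) (h.chord_add' hz.2)
      refine Tendsto.mul_const _ (Tendsto.mul_const _ (Tendsto.mul_const _ ?_))
      refine tendsto_nhdsWithin_of_tendsto_nhds ?_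
      refine Tendsto.rpow_const ?_ (Or.inl (by positivity))
      exact (continuous_const.add continuous_id).tendsto 0

/-- The angular velocity is the sum of the leading term and a term of order zero. -/
lemma enorm_angularVelocity_add_mainTerm_le (hα' : α < 1 / 2) {N : ℝ≥0∞}
    (hN : ∀ a, ∫⁻ y, ‖κ y‖ₑ * ‖φ (y + a)‖ₑ ∂torusMeasure ≤ N) :
    ‖-(∫ x, angularVelocity α γ 0 x * deriv φ x ∂torusMeasure) + mainTerm α γ κ φ 0‖ₑ
      ≤ ((∫⁻ z, ENNReal.ofReal M * ENNReal.ofReal (oscConst α M c H * |z| ^ (σ - 1)) * 2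
        ∂torusMeasure) + ENNReal.ofReal (2 * α)⁻¹ *
          (ENNReal.ofReal (M ^ 2 * c ^ (-2 * α) * H * Real.pi ^ σ) * (2 * ENNReal.ofReal H))) * N := by
  have hlim := ((h.tendsto_integral_angularVelocity hφ).neg.add
    (h.tendsto_mainTerm hφ hφp hα')).enorm
  -- The integration by parts is available for e > 0 only. There the leading term cancels exactly
  -- and the rest is bounded uniformly in e, so the bound survives the limit.
  refine le_of_tendsto hlim ?_
  filter_upwards [self_mem_nhdsWithin] with e he
  have hα := h.α_pos
  have hid := h.integral_angularVelocity_mul_deriv hφ hφp he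
  rw [h.mainTerm_eq hφp] at hid
  rw [hid, sub_add_eq_add_sub, sub_add_cancel, add_mul]
  refine (enorm_add_le _ _).trans (add_le_add ?_ ?_)
  · rw [enorm_neg]
    exact h.enorm_integral_oscKernelDeriv_le hφ.continuous hφp hN (le_of_lt he)
  · rw [enorm_mul, Real.enorm_eq_ofReal (by positivity), mul_assoc]
    gcongr
    exact h.enorm_integral_remainder_le hφ.continuous hφp hN (le_of_lt he)

end RegularCurve

/-! ### Comparison of the leading kernel with the homogeneous kernel -/

lemma abs_rpow_sub_rpow_le {k a b s : ℝ} (hk : 0 < k) (ha : k ≤ a) (hb : k ≤ b) (hs : 0 ≤ s) :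
    |a ^ (-s) - b ^ (-s)| ≤ s * k ^ (-s - 1) * |a - b| := by
  have hd : ∀ x ∈ Set.Ici k, HasDerivWithinAt (fun x : ℝ => x ^ (-s)) (-s * x ^ (-s - 1))
      (Set.Ici k) x := fun x hx =>
    (Real.hasDerivAt_rpow_const (Or.inl (hk.trans_le hx).ne')).hasDerivWithinAt
  refine Convex.norm_image_sub_le_of_norm_hasDerivWithin_le hd (fun x hx => ?_) (convex_Ici k)
    hb ha
  have hx0 : 0 < x := hk.trans_le hx
  rw [norm_mul, norm_neg, Real.norm_eq_abs, Real.norm_eq_abs, abs_of_nonneg hs,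
    abs_of_pos (Real.rpow_pos_of_pos hx0 _)]
  exact mul_le_mul_of_nonneg_left (Real.rpow_le_rpow_of_nonpos hk hx (by linarith)) hs

/-- The constant comparing `mainKernel` with the homogeneous kernel. -/
def modelConst (α m M c H : ℝ) : ℝ :=
  (2 + 2 * α) * min c m ^ (-(2 + 2 * α) - 1) * M * (M * M)
    + m ^ (-(2 + 2 * α)) * (2 * M ^ 2) + m ^ (-(2 + 2 * α)) * M ^ 2 * (H * Real.pi ^ (2 * α))

namespace RegularCurve

variable {α m M c H σ : ℝ} {γ : ℝ → Plane} {κ : ℝ → ℝ} (h : RegularCurve α m M c H σ γ κ)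
  {φ : ℝ → ℝ} (hφ : ContDiff ℝ 1 φ) (hφp : Function.Periodic φ (2 * Real.pi))
include h

lemma norm_chord_sub_le (y z : ℝ) :
    ‖γ (y + z) - γ y - z • deriv γ y‖ ≤ M * |z| ^ σ * |z| := by
  have hd : ∀ u ∈ Set.uIcc y (y + z), HasDerivWithinAt (fun u => γ u - (u - y) • deriv γ y)
      (deriv γ u - deriv γ y) (Set.uIcc y (y + z)) u := fun u _ => by
    have h1 := ((hasDerivAt_id u).sub_const y).smul_const (deriv γ y)
    have h2 := ((h.hasDerivAt u).sub h1).hasDerivWithinAt (s := Set.uIcc y (y + z))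
    rw [one_smul] at h2
    exact h2
  have hb : ∀ u ∈ Set.uIcc y (y + z), ‖deriv γ u - deriv γ y‖ ≤ M * |z| ^ σ := fun u hu => by
    refine (h.holder u y).trans ?_
    have h2 : |u - y| ≤ |z| := by
      have := Set.abs_sub_left_of_mem_uIcc hu
      simpa using this
    have := h.M_pos
    gcongr
    exact h.σ_pos.le
  have := Convex.norm_image_sub_le_of_norm_hasDerivWithin_le hd hb (convex_uIcc _ _)
    Set.left_mem_uIcc Set.right_mem_uIcc
  simpa [sub_right_comm] using this

/-- With the chord written as z·v, the odd kernel factors out exactly, and what is left is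
|v|^(−2−2α) ⟨v, γ'(y+z)⟩ ⟨τ(y+z), τ(y)⟩. If v and γ'(y+z) are replaced by γ'(y) and the last factor
by 1, this is |γ'(y)|^(−2α); each replacement costs a multiple of |z|^σ. -/
lemma abs_mainKernel_sub_le {y z : ℝ} (hz0 : z ≠ 0) (hz : |z| ≤ Real.pi) :
    |mainKernel α γ 0 (y + z) y - ‖deriv γ y‖ ^ (-(2 * α)) * oddKernel α z|
      ≤ modelConst α m M c H * |z| ^ (σ - 1 - 2 * α) := by
  have hz' : 0 < |z| := abs_pos.2 hz0
  have hM := h.M_pos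
  have hc := h.c_pos
  have hm := h.m_pos
  have hα := h.α_pos
  have hH := h.H_nonneg
  have hg := h.speed_pos y
  set a := deriv γ y with ha
  set b := deriv γ (y + z) with hb
  set v := z⁻¹ • (γ (y + z) - γ y) with hv
  have hR : γ (y + z) - γ y = z • v := by rw [hv, smul_smul, mul_inv_cancel₀ hz0, one_smul]
  have hva : ‖v - a‖ ≤ M * |z| ^ σ := by
    have h1 := h.norm_chord_sub_le y z
    rw [hR, ← smul_sub, norm_smul, Real.norm_eq_abs, mul_comm] at h1
    exact le_of_mul_le_mul_right h1 hz'
  have hba : ‖b - a‖ ≤ M * |z| ^ σ := by simpa using h.holder (y + z) y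
  have hvc : c ≤ ‖v‖ := by
    have h1 := h.chord_add' (y := y) hz
    rw [hR, norm_smul, Real.norm_eq_abs, mul_comm] at h1
    exact le_of_mul_le_mul_left h1 hz'
  have hvM : ‖v‖ ≤ M := by
    have h1 := h.norm_sub_le (y + z) y
    rw [hR, norm_smul, Real.norm_eq_abs, add_sub_cancel_left, mul_comm] at h1
    exact le_of_mul_le_mul_right h1 hz'
  have hv0 : 0 < ‖v‖ := hc.trans_le hvc
  set T := inner ℝ (tangent γ (y + z)) (tangent γ y) with hT
  have hT1 : |T| ≤ 1 := by
    refine (abs_real_inner_le_norm _ _).trans ?_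
    rw [h.norm_tangent, h.norm_tangent, one_mul]
  have hT2 : |T - 1| ≤ H * Real.pi ^ (2 * α) * |z| ^ σ := by
    have h1 : T - 1 = inner ℝ (tangent γ (y + z) - tangent γ y) (tangent γ y) := by
      rw [inner_sub_left, real_inner_self_eq_norm_sq, h.norm_tangent, one_pow]
    rw [h1]
    refine (abs_real_inner_le_norm _ _).trans ?_
    rw [h.norm_tangent, mul_one, norm_sub_rev]
    refine (h.norm_tangent_sub_add hz).trans ?_
    rw [Real.rpow_add hz', mul_assoc, mul_comm (|z| ^ σ)]
    gcongr
  set s := 2 + 2 * α with hs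
  have hmain : mainKernel α γ 0 (y + z) y
      = oddKernel α z * (‖v‖ ^ (-s) * inner ℝ v b * T) := by
    rw [mainKernel, hR, norm_smul, Real.norm_eq_abs, add_zero, oddKernel, real_inner_smul_left,
      ← Real.rpow_natCast, ← Real.rpow_mul (by positivity), Real.mul_rpow hz'.le hv0.le,
      show ((2 : ℕ) : ℝ) * (-1 - α) = -s by rw [hs]; push_cast; ring,
      show -2 - 2 * α = -s by rw [hs]; ring]
    ring
  have hg2 : ‖a‖ ^ (-(2 * α)) = ‖a‖ ^ (-s) * inner ℝ a a := by
    rw [real_inner_self_eq_norm_sq, ← Real.rpow_natCast, ← Real.rpow_add hg]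
    congr 1; rw [hs]; push_cast; ring
  have hk : 0 < min c m := lt_min hc hm
  have d1 : |‖v‖ ^ (-s) - ‖a‖ ^ (-s)| ≤ s * min c m ^ (-s - 1) * (M * |z| ^ σ) := by
    refine (abs_rpow_sub_rpow_le hk ((min_le_left _ _).trans hvc)
      ((min_le_right _ _).trans (h.lower y)) (by positivity)).trans ?_
    gcongr
    exact (abs_norm_sub_norm_le v a).trans hva
  have d2 : |inner ℝ v b - inner ℝ a a| ≤ 2 * M ^ 2 * |z| ^ σ := by
    have h1 : inner ℝ v b - inner ℝ a a = inner ℝ (v - a) b + inner ℝ a (b - a) := by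
      rw [inner_sub_left, inner_sub_right]; ring
    rw [h1]
    refine (abs_add_le _ _).trans ?_
    have e1 : |inner ℝ (v - a) b| ≤ (M * |z| ^ σ) * M :=
      (abs_real_inner_le_norm _ _).trans (mul_le_mul hva (h.upper _) (norm_nonneg _) (by positivity))
    have e2 : |inner ℝ a (b - a)| ≤ M * (M * |z| ^ σ) :=
      (abs_real_inner_le_norm _ _).trans (mul_le_mul (h.upper _) hba (norm_nonneg _) hM.le)
    linarith
  have d3 : |inner ℝ v b| ≤ M * M :=
    (abs_real_inner_le_norm _ _).trans (mul_le_mul hvM (h.upper _) (norm_nonneg _) hM.le)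
  have d4 : ‖a‖ ^ (-s) ≤ m ^ (-s) :=
    Real.rpow_le_rpow_of_nonpos hm (h.lower y) (by rw [hs]; linarith)
  have d5 : |inner ℝ a a| ≤ M ^ 2 := by
    rw [real_inner_self_eq_norm_sq, abs_of_nonneg (by positivity)]
    gcongr
    exact h.upper y
  have hga : 0 ≤ ‖a‖ ^ (-s) := by positivity
  have htel : ‖v‖ ^ (-s) * inner ℝ v b * T - ‖a‖ ^ (-s) * inner ℝ a a
      = (‖v‖ ^ (-s) - ‖a‖ ^ (-s)) * inner ℝ v b * T
        + ‖a‖ ^ (-s) * (inner ℝ v b - inner ℝ a a) * T + ‖a‖ ^ (-s) * inner ℝ a a * (T - 1) := by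
    ring
  rw [hmain, hg2, mul_comm (‖a‖ ^ (-s) * inner ℝ a a), ← mul_sub, abs_mul, abs_oddKernel hz0, htel]
  have hsum : |(‖v‖ ^ (-s) - ‖a‖ ^ (-s)) * inner ℝ v b * T
        + ‖a‖ ^ (-s) * (inner ℝ v b - inner ℝ a a) * T + ‖a‖ ^ (-s) * inner ℝ a a * (T - 1)|
      ≤ modelConst α m M c H * |z| ^ σ := by
    refine (abs_add_three _ _ _).trans ?_
    simp only [abs_mul, abs_of_nonneg hga]
    calc _ ≤ (s * min c m ^ (-s - 1) * (M * |z| ^ σ)) * (M * M) * 1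
          + m ^ (-s) * (2 * M ^ 2 * |z| ^ σ) * 1
          + m ^ (-s) * M ^ 2 * (H * Real.pi ^ (2 * α) * |z| ^ σ) := by gcongr
      _ = _ := by rw [modelConst]; ring
  calc _ ≤ |z| ^ (-1 - 2 * α) * (modelConst α m M c H * |z| ^ σ) := by gcongr
    _ = modelConst α m M c H * (|z| ^ (-1 - 2 * α) * |z| ^ σ) := by ring
    _ = _ := by rw [← Real.rpow_add hz']; congr 2; ring

include hφ hφp

/-- The difference of the kernels has size |z|^(σ−1−2α), which is not integrable when σ ≤ 2α. The
increments of φ are therefore kept inside the integral; this is the term that requires s ≥ 2α − σ.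
-/
lemma enorm_mainTerm_sub_modelTerm_le (hα' : α < 1 / 2) :
    ‖mainTerm α γ κ φ 0 - modelTerm α γ κ φ‖ₑ
      ≤ ENNReal.ofReal M * ENNReal.ofReal (modelConst α m M c H) *
        ∫⁻ z, ENNReal.ofReal (|z| ^ (σ - 1 - 2 * α)) *
          ∫⁻ y, ‖κ y‖ₑ * ‖φ (y + z) - φ y‖ₑ ∂torusMeasure ∂torusMeasure := by
  obtain ⟨L, hL0, hL⟩ := exists_lipschitz_of_periodic hφ (by positivity) hφp
  have hφc := hφ.continuous
  have hα := h.α_pos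
  have hm := h.m_pos
  have hM := h.M_pos
  have hc := h.c_pos
  have hH := h.H_nonneg
  have hint : Integrable (fun z : ℝ => c ^ (-1 - 2 * α) * M * L * |z| ^ (-(2 * α)))
      torusMeasure := (integrable_torus_rpow (by linarith)).const_mul _
  have hint' : Integrable (fun z : ℝ => L * |z| ^ (-(2 * α))) torusMeasure :=
    (integrable_torus_rpow (by linarith)).const_mul _
  have hb' : ∀ y, ∀ᵐ z ∂torusMeasure, ‖oddKernel α z * (φ (y + z) - φ y)‖ ≤ L * |z| ^ (-(2 * α)) := by
    intro y
    filter_upwards [ae_torus_mem] with z hz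
    have h2 := hL (y + z) y
    rw [add_sub_cancel_left] at h2
    rw [norm_mul, Real.norm_eq_abs, Real.norm_eq_abs, abs_oddKernel hz.1]
    calc _ ≤ |z| ^ (-1 - 2 * α) * (L * |z|) := by gcongr
      _ = L * (|z| ^ (-1 - 2 * α) * |z| ^ (1 : ℝ)) := by rw [Real.rpow_one]; ring
      _ = _ := by rw [← Real.rpow_add (abs_pos.2 hz.1)]; congr 2; ring
  have hm1 : ∀ y, Measurable fun z => φ (y + z) - φ y := fun y =>
    Continuous.measurable (by fun_prop)
  have i1 : ∀ y, Integrable (fun z => mainKernel α γ 0 (y + z) y * (φ (y + z) - φ y))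
      torusMeasure := fun y => hint.mono'
    (((h.measurable_mainKernel 0).comp (f := fun z : ℝ => (y, z)) (by fun_prop)).mul
      (hm1 y)).aestronglyMeasurable (h.abs_main_integrand_le hL le_rfl y)
  have i2 : ∀ y, Integrable (fun z => oddKernel α z * (φ (y + z) - φ y)) torusMeasure := fun y =>
    hint'.mono' ((measurable_oddKernel α).mul (hm1 y)).aestronglyMeasurable (hb' y)
  have j1 : Integrable (fun y => ‖deriv γ y‖ * κ y * ∫ z, mainKernel α γ 0 (y + z) y *
      (φ (y + z) - φ y) ∂torusMeasure) torusMeasure :=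
    h.integrable_speed_mul.mul_bdd
      (c := ∫ z, c ^ (-1 - 2 * α) * M * L * |z| ^ (-(2 * α)) ∂torusMeasure)
      (h.stronglyMeasurable_main hφ 0).aestronglyMeasurable
      (Eventually.of_forall fun y => norm_integral_le_of_norm_le hint
        (h.abs_main_integrand_le hL le_rfl y))
  have hmeas2 : Measurable fun w : ℝ × ℝ => oddKernel α w.2 * (φ (w.1 + w.2) - φ w.1) :=
    ((measurable_oddKernel α).comp measurable_snd).mul (Continuous.measurable (by fun_prop))
  have hspeed : Integrable (fun y => ‖deriv γ y‖ ^ (1 - 2 * α) * κ y) torusMeasure :=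
    integrable_torus_iff.2 ((h.integrable _ _).continuousOn_mul
      (h.continuous_deriv.norm.rpow_const fun y => Or.inl (h.speed_pos y).ne').continuousOn)
  have j2 : Integrable (fun y => ‖deriv γ y‖ ^ (1 - 2 * α) * κ y * ∫ z, oddKernel α z *
      (φ (y + z) - φ y) ∂torusMeasure) torusMeasure :=
    hspeed.mul_bdd (c := ∫ z, L * |z| ^ (-(2 * α)) ∂torusMeasure)
      (hmeas2.stronglyMeasurable.integral_prod_right').aestronglyMeasurable
      (Eventually.of_forall fun y => norm_integral_le_of_norm_le hint' (hb' y))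
  have hdiff : mainTerm α γ κ φ 0 - modelTerm α γ κ φ = ∫ y, ‖deriv γ y‖ * κ y *
      ∫ z, (mainKernel α γ 0 (y + z) y - ‖deriv γ y‖ ^ (-(2 * α)) * oddKernel α z)
        * (φ (y + z) - φ y) ∂torusMeasure ∂torusMeasure := by
    rw [mainTerm, modelTerm, ← integral_sub j1 j2]
    congr 1
    funext y
    have e1 : ∫ z, (mainKernel α γ 0 (y + z) y - ‖deriv γ y‖ ^ (-(2 * α)) * oddKernel α z)
        * (φ (y + z) - φ y) ∂torusMeasure
        = (∫ z, mainKernel α γ 0 (y + z) y * (φ (y + z) - φ y) ∂torusMeasure)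
          - ‖deriv γ y‖ ^ (-(2 * α)) * ∫ z, oddKernel α z * (φ (y + z) - φ y) ∂torusMeasure := by
      rw [← integral_const_mul, ← integral_sub (i1 y) ((i2 y).const_mul _)]
      congr 1; funext z; ring
    rw [e1, show (1 : ℝ) - 2 * α = 1 + -(2 * α) by ring, Real.rpow_add (h.speed_pos y),
      Real.rpow_one]
    ring
  have hC0 : 0 ≤ modelConst α m M c H := by
    have : 0 < min c m := lt_min hc hm
    unfold modelConst; positivity
  have hF : Measurable fun w : ℝ × ℝ => ENNReal.ofReal (|w.2| ^ (σ - 1 - 2 * α)) *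
      (‖κ w.1‖ₑ * ‖φ (w.1 + w.2) - φ w.1‖ₑ) := by
    have h1 : Measurable fun w : ℝ × ℝ => ENNReal.ofReal (|w.2| ^ (σ - 1 - 2 * α)) := by fun_prop
    have h2 : Measurable fun w : ℝ × ℝ => ‖κ w.1‖ₑ := (h.measurable.comp measurable_fst).enorm
    have h3 : Measurable fun w : ℝ × ℝ => φ (w.1 + w.2) - φ w.1 :=
      Continuous.measurable (by fun_prop)
    exact h1.mul (h2.mul h3.enorm)
  rw [hdiff]
  calc _ ≤ ∫⁻ y, ENNReal.ofReal M * ENNReal.ofReal (modelConst α m M c H) *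
        ∫⁻ z, ENNReal.ofReal (|z| ^ (σ - 1 - 2 * α)) * (‖κ y‖ₑ * ‖φ (y + z) - φ y‖ₑ)
          ∂torusMeasure ∂torusMeasure := by
        refine (enorm_integral_le_lintegral_enorm _).trans (lintegral_mono fun y => ?_)
        rw [enorm_mul, enorm_mul, enorm_norm]
        have hg : ‖deriv γ y‖ₑ ≤ ENNReal.ofReal M := by
          rw [← ofReal_norm]; exact ENNReal.ofReal_le_ofReal (h.upper y)
        rw [mul_assoc, mul_assoc, ← lintegral_const_mul' _ _ ENNReal.ofReal_ne_top]
        refine mul_le_mul' hg ?_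
        refine (mul_le_mul' le_rfl (enorm_integral_le_lintegral_enorm _)).trans ?_
        rw [← lintegral_const_mul' _ _ enorm_ne_top]
        refine lintegral_mono_ae ?_
        filter_upwards [ae_torus_mem] with z hz
        have h5 := h.abs_mainKernel_sub_le (y := y) hz.1 hz.2
        have h6 : ‖mainKernel α γ 0 (y + z) y - ‖deriv γ y‖ ^ (-(2 * α)) * oddKernel α z‖ₑ
            ≤ ENNReal.ofReal (modelConst α m M c H) * ENNReal.ofReal (|z| ^ (σ - 1 - 2 * α)) := by
          rw [Real.enorm_eq_ofReal_abs, ← ENNReal.ofReal_mul hC0]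
          exact ENNReal.ofReal_le_ofReal h5
        rw [enorm_mul]
        calc _ ≤ ‖κ y‖ₑ * (ENNReal.ofReal (modelConst α m M c H) *
              ENNReal.ofReal (|z| ^ (σ - 1 - 2 * α)) * ‖φ (y + z) - φ y‖ₑ) := by gcongr
          _ = _ := by ring
    _ = _ := by
        rw [lintegral_const_mul' _ _ (by finiteness)]
        congr 1
        rw [lintegral_lintegral_swap hF.aemeasurable]
        congr 1
        funext z
        rw [lintegral_const_mul' _ _ ENNReal.ofReal_ne_top]

end RegularCurve

/-! ### Evolution of the tangent angle -/

/-- The vector rotated back by the accumulated angle has zero derivative on [0,T] and so stays equal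
to its initial value. -/
lemma eq_rotation_of_hasDerivWithinAt {T : ℝ} {τ : ℝ → Plane} {w : ℝ → ℝ} (hw : Continuous w)
    (hτ : ∀ t ∈ Set.Icc 0 T, HasDerivWithinAt τ (w t • perp (τ t)) (Set.Icc 0 T) t) {t : ℝ}
    (ht : t ∈ Set.Icc 0 T) :
    τ t = Real.cos (∫ s in (0 : ℝ)..t, w s) • τ 0 + Real.sin (∫ s in (0 : ℝ)..t, w s) • perp (τ 0) := by
  set W : ℝ → ℝ := fun t => ∫ s in (0 : ℝ)..t, w s with hW
  have hWd : ∀ t, HasDerivAt W (w t) t := fun t =>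
    intervalIntegral.integral_hasDerivAt_right (hw.intervalIntegrable _ _)
      hw.stronglyMeasurable.stronglyMeasurableAtFilter hw.continuousAt
  have hd : ∀ t ∈ Set.Icc 0 T, HasDerivWithinAt
      (fun t => Real.cos (W t) • τ t - Real.sin (W t) • perp (τ t)) 0 (Set.Icc 0 T) t := by
    intro t ht
    have h1 := ((hWd t).cos).hasDerivWithinAt (s := Set.Icc 0 T)
    have h2 := ((hWd t).sin).hasDerivWithinAt (s := Set.Icc 0 T)
    have h3 : HasDerivWithinAt (fun t => perp (τ t)) (perp (w t • perp (τ t))) (Set.Icc 0 T) t :=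
      (perpL.hasFDerivAt.comp_hasDerivWithinAt t (hτ t ht))
    refine ((h1.smul (hτ t ht)).sub (h2.smul h3)).congr_deriv ?_
    rw [perp_smul, perp_perp]
    module
  have h0 : (0 : ℝ) ∈ Set.Icc 0 T := ⟨le_rfl, ht.1.trans ht.2⟩
  have hc := Convex.norm_image_sub_le_of_norm_hasDerivWithin_le (C := 0) hd (fun _ _ => by simp)
    (convex_Icc 0 T) h0 ht
  rw [zero_mul, norm_le_zero_iff, sub_eq_zero] at hc
  have hW0 : W 0 = 0 := intervalIntegral.integral_same
  simp only [hW0, Real.cos_zero, Real.sin_zero, one_smul, zero_smul, sub_zero] at hc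
  have hcs := Real.sin_sq_add_cos_sq (W t)
  rw [← hc, perp_sub, perp_smul, perp_smul, perp_perp]
  have e1 : τ t = (Real.sin (W t) ^ 2 + Real.cos (W t) ^ 2) • τ t := by rw [hcs, one_smul]
  conv_lhs => rw [e1]
  module

/-- The derivative of the direction of a moving vector. -/
lemma hasDerivWithinAt_direction {y : ℝ → Plane} {v : Plane} {s : Set ℝ} {t : ℝ}
    (hy : HasDerivWithinAt y v s t) (h0 : y t ≠ 0) :
    HasDerivWithinAt (fun t => ‖y t‖⁻¹ • y t)
      ((‖y t‖⁻¹ * cross (‖y t‖⁻¹ • y t) v) • perp (‖y t‖⁻¹ • y t)) s t := by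
  have hn : ‖y t‖ ≠ 0 := norm_ne_zero_iff.2 h0
  have h1 : HasDerivWithinAt (fun t => ‖y t‖) (inner ℝ (y t) v / ‖y t‖) s t := by
    have h2 := (hy.norm_sq).sqrt (by positivity)
    simp only [Real.sqrt_sq (norm_nonneg _)] at h2
    refine h2.congr_deriv ?_
    field_simp
  refine ((h1.inv hn).smul hy).congr_deriv ?_
  have h3 : ‖y t‖ ^ 2 = y t 0 ^ 2 + y t 1 ^ 2 := norm_sq_plane _
  refine plane_ext ?_ ?_
  · simp only [cross, inner_plane, PiLp.smul_apply, PiLp.add_apply, smul_eq_mul, perp_zero_apply,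
      Pi.inv_apply]
    field_simp
    rw [h3]; ring
  · simp only [cross, inner_plane, PiLp.smul_apply, PiLp.add_apply, smul_eq_mul, perp_one_apply,
      Pi.inv_apply]
    field_simp
    rw [h3]; ring

section Evolution

variable {α m M c H σ T : ℝ} {Ω : ℝ → Set Plane} {γ : ℝ → ℝ → Plane} {κ : ℝ → ℝ → ℝ}

/-- The derivative of the velocity along the boundary at time `t`, extended to all times. -/
def spaceTimeDeriv (α T : ℝ) (γ : ℝ → ℝ → Plane) (t x : ℝ) : Plane :=
  velocityDeriv α (γ (clamp T t)) 0 x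

/-- The angular velocity of the tangent at time `t`, extended to all times. -/
def spaceTimeAngular (α T : ℝ) (γ : ℝ → ℝ → Plane) (t x : ℝ) : ℝ :=
  angularVelocity α (γ (clamp T t)) 0 x

/-- The primitive in time of the angular velocity. -/
def turning (α T : ℝ) (γ : ℝ → ℝ → Plane) (t x : ℝ) : ℝ :=
  ∫ s in (0 : ℝ)..t, spaceTimeAngular α T γ s x

/-- A regular evolution: a flow of Jordan domains with uniformly regular boundaries. -/
structure RegularFlow (α m M c H σ T : ℝ) (Ω : ℝ → Set Plane) (γ : ℝ → ℝ → Plane)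
    (κ : ℝ → ℝ → ℝ) : Prop where
  T_nonneg : 0 ≤ T
  α_lt : α < 1 / 2
  domain : ∀ t ∈ Set.Icc 0 T, IsJordanDomain (Ω t)
  flow : IsFlow α T Ω γ
  regular : ∀ t ∈ Set.Icc 0 T, RegularCurve α m M c H σ (γ t) (κ t)
  continuous : Continuous fun z : ℝ × ℝ => γ (clamp T z.1) z.2
  continuous_deriv : Continuous fun z : ℝ × ℝ => deriv (γ (clamp T z.1)) z.2

namespace RegularFlow

variable (h : RegularFlow α m M c H σ T Ω γ κ)
include h

lemma regular_clamp (t : ℝ) : RegularCurve α m M c H σ (γ (clamp T t)) (κ (clamp T t)) :=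
  h.regular _ (clamp_mem h.T_nonneg t)

lemma continuous_spaceTimeDeriv : Continuous fun w : ℝ × ℝ => spaceTimeDeriv α T γ w.1 w.2 :=
  RegularCurve.continuous_velocityDeriv_family (G := fun t => γ (clamp T t)) h.regular_clamp
    h.continuous_deriv h.continuous le_rfl

lemma continuous_spaceTimeAngular : Continuous fun w : ℝ × ℝ => spaceTimeAngular α T γ w.1 w.2 :=
  RegularCurve.continuous_angularVelocity_family (G := fun t => γ (clamp T t)) h.regular_clamp
    h.continuous_deriv h.continuous le_rfl

lemma continuous_turning : Continuous fun w : ℝ × ℝ => turning α T γ w.1 w.2 := by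
  unfold turning
  have h1 : Continuous (Function.uncurry fun (w : ℝ × ℝ) s => spaceTimeAngular α T γ s w.2) :=
    h.continuous_spaceTimeAngular.comp (f := fun z : (ℝ × ℝ) × ℝ => (z.2, z.1.2)) (by fun_prop)
  exact intervalIntegral.continuous_parametric_intervalIntegral_of_continuous h1 continuous_fst

lemma hasDerivAt_turning (t x : ℝ) :
    HasDerivAt (fun t => turning α T γ t x) (spaceTimeAngular α T γ t x) t := by
  have hc : Continuous fun s => spaceTimeAngular α T γ s x :=
    h.continuous_spaceTimeAngular.comp (f := fun s : ℝ => (s, x)) (by fun_prop)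
  exact intervalIntegral.integral_hasDerivAt_right (hc.intervalIntegrable _ _)
      hc.stronglyMeasurable.stronglyMeasurableAtFilter hc.continuousAt

/-- Differentiating the flow in the label and in time. -/
lemma deriv_sub {t : ℝ} (ht : t ∈ Set.Icc 0 T) (x : ℝ) :
    deriv (γ t) x - deriv (γ 0) x = ∫ s in (0 : ℝ)..t, spaceTimeDeriv α T γ s x := by
  have h0 : (0 : ℝ) ∈ Set.Icc 0 T := ⟨le_rfl, h.T_nonneg⟩
  have hU := h.continuous_spaceTimeDeriv
  have hUs : ∀ s, Continuous fun x => spaceTimeDeriv α T γ s x := fun s =>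
    hU.comp (f := fun x : ℝ => (s, x)) (by fun_prop)
  -- The flow is differentiated in time for a fixed pair of labels, with the velocity increment
  -- written as an integral over the arc. After exchanging the two integrals one may differentiate
  -- in the label, so no mixed derivative of γ has to be assumed.
  have hinc : ∀ a b : ℝ, (γ t b - γ t a) - (γ 0 b - γ 0 a)
      = ∫ s in (0 : ℝ)..t, ∫ x in a..b, spaceTimeDeriv α T γ s x := by
    intro a b
    have hcont : Continuous fun s => ∫ x in a..b, spaceTimeDeriv α T γ s x :=
      intervalIntegral.continuous_parametric_intervalIntegral_of_continuous'
        (f := fun s x => spaceTimeDeriv α T γ s x) hU a b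
    have hd : ∀ s ∈ Set.Icc 0 T, HasDerivWithinAt (fun s => γ s b - γ s a)
        (∫ x in a..b, spaceTimeDeriv α T γ s x) (Set.Icc 0 T) s := by
      intro s hs
      have h1 := (h.flow.flow b s hs).sub (h.flow.flow a s hs)
      rw [(h.regular s hs).velocity_sub (h.domain s hs) (h.flow.param s hs) h.α_lt a b] at h1
      simp only [spaceTimeDeriv, clamp_of_mem hs]
      exact h1
    rw [intervalIntegral.integral_eq_sub_of_hasDeriv_right (f := fun s => γ s b - γ s a)]
    · rw [Set.uIcc_of_le ht.1]
      intro s hs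
      exact ((hd s ⟨hs.1, hs.2.trans ht.2⟩).continuousWithinAt).mono (Set.Icc_subset_Icc_right ht.2)
    · rw [min_eq_left ht.1, max_eq_right ht.1]
      intro s hs
      exact ((hd s ⟨hs.1.le, hs.2.le.trans ht.2⟩).hasDerivAt (Icc_mem_nhds hs.1
        (hs.2.trans_le ht.2))).hasDerivWithinAt
    · exact hcont.intervalIntegrable _ _
  have hswap : ∀ b : ℝ, (γ t b - γ t 0) - (γ 0 b - γ 0 0)
      = ∫ x in (0 : ℝ)..b, ∫ s in (0 : ℝ)..t, spaceTimeDeriv α T γ s x := by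
    intro b
    rw [hinc 0 b]
    refine intervalIntegral_intervalIntegral_swap (F := fun s x => spaceTimeDeriv α T γ s x) ?_
    exact (hU.continuousOn.integrableOn_compact (isCompact_uIcc.prod isCompact_uIcc)).mono_set
      (Set.prod_mono Set.uIoc_subset_uIcc Set.uIoc_subset_uIcc)
  have hcV : Continuous fun x => ∫ s in (0 : ℝ)..t, spaceTimeDeriv α T γ s x := by
    have h1 : Continuous fun w : ℝ × ℝ => spaceTimeDeriv α T γ w.2 w.1 :=
      hU.comp (f := fun w : ℝ × ℝ => (w.2, w.1)) (by fun_prop)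
    exact intervalIntegral.continuous_parametric_intervalIntegral_of_continuous'
      (f := fun x s => spaceTimeDeriv α T γ s x) h1 0 t
  have a1 : HasDerivAt (fun b => γ t b - γ t 0) (deriv (γ t) x) x :=
    ((h.regular t ht).hasDerivAt x).sub_const _
  have a2 : HasDerivAt (fun b => γ 0 b - γ 0 0) (deriv (γ 0) x) x :=
    ((h.regular 0 h0).hasDerivAt x).sub_const _
  have d1 : HasDerivAt (fun b => (γ t b - γ t 0) - (γ 0 b - γ 0 0))
      (deriv (γ t) x - deriv (γ 0) x) x := a1.fun_sub a2
  have d2 : HasDerivAt (fun b => (γ t b - γ t 0) - (γ 0 b - γ 0 0))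
      (∫ s in (0 : ℝ)..t, spaceTimeDeriv α T γ s x) x := by
    simp only [hswap]
    exact intervalIntegral.integral_hasDerivAt_right (hcV.intervalIntegrable _ _)
      hcV.stronglyMeasurable.stronglyMeasurableAtFilter hcV.continuousAt
  exact d1.unique d2

lemma hasDerivWithinAt_tangent {t : ℝ} (ht : t ∈ Set.Icc 0 T) (x : ℝ) :
    HasDerivWithinAt (fun t => tangent (γ t) x)
      (spaceTimeAngular α T γ t x • perp (tangent (γ t) x)) (Set.Icc 0 T) t := by
  have hc : Continuous fun s => spaceTimeDeriv α T γ s x :=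
    h.continuous_spaceTimeDeriv.comp (f := fun s : ℝ => (s, x)) (by fun_prop)
  have h1 : HasDerivWithinAt (fun t => deriv (γ t) x) (spaceTimeDeriv α T γ t x) (Set.Icc 0 T) t := by
    have h2 : HasDerivAt (fun t => (∫ s in (0 : ℝ)..t, spaceTimeDeriv α T γ s x) + deriv (γ 0) x)
        (spaceTimeDeriv α T γ t x) t :=
      (intervalIntegral.integral_hasDerivAt_right (hc.intervalIntegrable _ _)
        hc.stronglyMeasurable.stronglyMeasurableAtFilter hc.continuousAt).add_const _
    refine h2.hasDerivWithinAt.congr (fun s hs => ?_) ?_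
    · rw [← h.deriv_sub hs x, sub_add_cancel]
    · rw [← h.deriv_sub ht x, sub_add_cancel]
  have h3 := hasDerivWithinAt_direction h1 (norm_pos_iff.1 ((h.regular t ht).speed_pos x))
  have h4 : spaceTimeAngular α T γ t x
      = ‖deriv (γ t) x‖⁻¹ * cross (tangent (γ t) x) (spaceTimeDeriv α T γ t x) := by
    rw [spaceTimeAngular, spaceTimeDeriv, clamp_of_mem ht,
      (h.regular t ht).angularVelocity_eq le_rfl]
  rw [h4]
  exact h3

/-- The total curvature of an arc changes by the difference of the angles by which its end
tangents turn. -/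
lemma integral_curvature_eq {t : ℝ} (ht : t ∈ Set.Icc 0 T) (y : ℝ) :
    ∫ x in (0 : ℝ)..y, ‖deriv (γ t) x‖ * κ t x
      = (∫ x in (0 : ℝ)..y, ‖deriv (γ 0) x‖ * κ 0 x) + turning α T γ t y - turning α T γ t 0 := by
  have h0 : (0 : ℝ) ∈ Set.Icc 0 T := ⟨le_rfl, h.T_nonneg⟩
  have hμ : ∀ t ∈ Set.Icc 0 T, ∀ a b, IntervalIntegrable (fun x => ‖deriv (γ t) x‖ * κ t x)
      volume a b := fun t ht a b => ((h.regular t ht).integrable a b).continuousOn_mul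
        (h.regular t ht).continuous_deriv.norm.continuousOn
  set f : ℝ → ℝ := fun y => (∫ x in (0 : ℝ)..y, ‖deriv (γ t) x‖ * κ t x)
      - ((∫ x in (0 : ℝ)..y, ‖deriv (γ 0) x‖ * κ 0 x) + turning α T γ t y - turning α T γ t 0)
    with hf
  have hfc : Continuous f := by
    have h1 := intervalIntegral.continuous_primitive (hμ t ht) 0
    have h2 := intervalIntegral.continuous_primitive (hμ 0 h0) 0
    have h3 : Continuous fun y => turning α T γ t y :=
      h.continuous_turning.comp (f := fun y : ℝ => (t, y)) (by fun_prop)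
    exact h1.sub ((h2.add h3).sub continuous_const)
  have hf0 : f 0 = 0 := by simp [hf]
  -- The tangent at (t,y) is obtained from that at (0,0) by going first in time or first along the
  -- boundary. Both angles describe the same unit vector, so the cosine of their difference is 1.
  have hcos : ∀ y, Real.cos (f y) = 1 := by
    intro y
    have hω : ∀ x, Continuous fun s => spaceTimeAngular α T γ s x := fun x =>
      h.continuous_spaceTimeAngular.comp (f := fun s : ℝ => (s, x)) (by fun_prop)
    have r1 := (h.regular t ht).frenet.eq_rotation (hμ t ht) 0 y
    have r2 := (h.regular 0 h0).frenet.eq_rotation (hμ 0 h0) 0 y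
    have r3 := eq_rotation_of_hasDerivWithinAt (hω y)
      (fun t ht => h.hasDerivWithinAt_tangent ht y) ht
    have r4 := eq_rotation_of_hasDerivWithinAt (hω 0)
      (fun t ht => h.hasDerivWithinAt_tangent ht 0) ht
    rw [← turning] at r3 r4
    set A := ∫ x in (0 : ℝ)..y, ‖deriv (γ t) x‖ * κ t x
    set B := ∫ x in (0 : ℝ)..y, ‖deriv (γ 0) x‖ * κ 0 x
    have hn := (h.regular 0 h0).norm_tangent 0
    have hn2 : (tangent (γ 0) 0) 0 ^ 2 + (tangent (γ 0) 0) 1 ^ 2 = 1 := by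
      rw [← norm_sq_plane, hn, one_pow]
    set v := tangent (γ 0) 0
    have e1 : tangent (γ t) y = Real.cos (A + turning α T γ t 0) • v
        + Real.sin (A + turning α T γ t 0) • perp v := by
      rw [r1, r4, perp_add, perp_smul, perp_smul, perp_perp, Real.cos_add, Real.sin_add]
      module
    have e2 : tangent (γ t) y = Real.cos (B + turning α T γ t y) • v
        + Real.sin (B + turning α T γ t y) • perp v := by
      rw [r3, r2, perp_add, perp_smul, perp_smul, perp_perp, Real.cos_add, Real.sin_add]
      module
    have e3 : inner ℝ (tangent (γ t) y) (tangent (γ t) y) = (1 : ℝ) := by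
      rw [real_inner_self_eq_norm_sq, (h.regular t ht).norm_tangent, one_pow]
    nth_rewrite 1 [e1] at e3
    rw [e2, inner_plane] at e3
    simp only [PiLp.add_apply, PiLp.smul_apply, smul_eq_mul, perp_zero_apply, perp_one_apply] at e3
    have e4 : f y = (A + turning α T γ t 0) - (B + turning α T γ t y) := by simp only [hf]; ring
    rw [e4, Real.cos_sub, ← e3]
    linear_combination -(Real.cos (A + turning α T γ t 0) * Real.cos (B + turning α T γ t y)
      + Real.sin (A + turning α T γ t 0) * Real.sin (B + turning α T γ t y)) * hn2
  -- The function f is continuous, vanishes at 0 and has values in 2πℤ. A nonzero value would give,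
  -- by the intermediate value theorem, a point with |f| strictly between 0 and 2π.
  have hzero : ∀ y, f y = 0 := by
    intro y
    by_contra hne
    have hpi := Real.pi_pos
    obtain ⟨z, hz⟩ : ∃ z, |f z| ∈ Set.Ioo 0 (2 * Real.pi) := by
      rcases lt_or_ge |f y| (2 * Real.pi) with hlt | hge
      · exact ⟨y, abs_pos.2 hne, hlt⟩
      · have := mem_range_of_exists_le_of_exists_ge hfc.abs (c := Real.pi)
          ⟨0, by rw [hf0, abs_zero]; exact hpi.le⟩ ⟨y, by linarith⟩
        obtain ⟨z, hz⟩ := this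
        have hz' : |f z| = Real.pi := hz
        exact ⟨z, by rw [hz']; constructor <;> linarith⟩
    have := (Real.cos_eq_one_iff_of_lt_of_lt (x := |f z|) (by linarith [hz.1]) hz.2).1
      (by rw [Real.cos_abs]; exact hcos z)
    linarith [hz.1]
  have := hzero y
  simp only [hf] at this
  linarith

end RegularFlow

end Evolution

/-! ### The tested evolution equation and measurability in time -/

lemma continuous_integral_torus {X : Type*} [TopologicalSpace X] {f : X → ℝ → ℝ}
    (hf : Continuous fun w : X × ℝ => f w.1 w.2) : Continuous fun t => ∫ x, f t x ∂torusMeasure := by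
  simp only [← integral_torus_eq]
  exact intervalIntegral.continuous_parametric_intervalIntegral_of_continuous' (f := f) hf _ _

/-- The average of `F t` over the interval from `x` to `x + δ`. -/
def average (F : ℝ → ℝ → ℝ) (δ t x : ℝ) : ℝ := ∫ u in (0 : ℝ)..1, F t (x + δ * u)

lemma continuous_average {F : ℝ → ℝ → ℝ} (hF : Continuous fun w : ℝ × ℝ => F w.1 w.2) :
    Continuous fun w : ℝ × ℝ × ℝ => average F w.1 w.2.1 w.2.2 := by
  refine intervalIntegral.continuous_parametric_intervalIntegral_of_continuous'
    (f := fun (w : ℝ × ℝ × ℝ) u => F w.2.1 (w.2.2 + w.1 * u)) ?_ 0 1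
  exact hF.comp (f := fun z : (ℝ × ℝ × ℝ) × ℝ => (z.1.2.1, z.1.2.2 + z.1.1 * z.2)) (by fun_prop)

lemma hasDerivAt_average {F : ℝ → ℝ → ℝ} (hF : Continuous fun w : ℝ × ℝ => F w.1 w.2) {δ : ℝ}
    (hδ : δ ≠ 0) (t x : ℝ) : HasDerivAt (average F δ t) (δ⁻¹ * (F t (x + δ) - F t x)) x := by
  have hc : Continuous (F t) := hF.comp (f := fun x : ℝ => (t, x)) (by fun_prop)
  have hp : ∀ x, HasDerivAt (fun y => ∫ u in (0 : ℝ)..y, F t u) (F t x) x := fun x =>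
    intervalIntegral.integral_hasDerivAt_right (hc.intervalIntegrable _ _)
        hc.stronglyMeasurable.stronglyMeasurableAtFilter hc.continuousAt
  have h1 : average F δ t = fun x => δ⁻¹ *
      ((∫ u in (0 : ℝ)..(x + δ), F t u) - ∫ u in (0 : ℝ)..x, F t u) := by
    funext x
    rw [average, intervalIntegral.integral_interval_sub_left (hc.intervalIntegrable _ _)
      (hc.intervalIntegrable _ _), intervalIntegral.integral_comp_add_mul _ hδ, smul_eq_mul]
    simp
  rw [h1]
  exact (((hp (x + δ)).comp_add_const x δ).sub (hp x)).const_mul _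

namespace RegularFlow

variable {α m M c H σ T : ℝ} {Ω : ℝ → Set Plane} {γ : ℝ → ℝ → Plane} {κ : ℝ → ℝ → ℝ}
  (h : RegularFlow α m M c H σ T Ω γ κ)

/-- The angle of the tangent at time `t`, up to a constant. -/
def angle (α T : ℝ) (γ : ℝ → ℝ → Plane) (κ : ℝ → ℝ → ℝ) (t y : ℝ) : ℝ :=
  (∫ x in (0 : ℝ)..y, ‖deriv (γ 0) x‖ * κ 0 x) + turning α T γ t y - turning α T γ t 0

include h

lemma zero_mem : (0 : ℝ) ∈ Set.Icc 0 T := ⟨le_rfl, h.T_nonneg⟩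

lemma intervalIntegrable {t : ℝ} (ht : t ∈ Set.Icc 0 T) (a b : ℝ) :
    IntervalIntegrable (fun x => ‖deriv (γ t) x‖ * κ t x) volume a b :=
  ((h.regular t ht).integrable a b).continuousOn_mul
        (h.regular t ht).continuous_deriv.norm.continuousOn

/-- The angle is built from the initial curvature and the turning, so it is continuous in time by
construction; the identity of `integral_curvature_eq` makes it a primitive of gκ at every time. -/
lemma isPrim_angle {t : ℝ} (ht : t ∈ Set.Icc 0 T) :
    IsPrim (angle α T γ κ t) fun x => ‖deriv (γ t) x‖ * κ t x :=
  (IsPrim.of_intervalIntegrable (h.intervalIntegrable ht) 0).congr_left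
    fun y => h.integral_curvature_eq ht y

lemma continuous_angle : Continuous fun w : ℝ × ℝ => angle α T γ κ w.1 w.2 := by
  have h1 := (intervalIntegral.continuous_primitive (h.intervalIntegrable h.zero_mem) 0).comp
    (continuous_snd (X := ℝ) (Y := ℝ))
  have h2 := h.continuous_turning
  have h3 : Continuous fun w : ℝ × ℝ => turning α T γ w.1 0 :=
    h2.comp (f := fun w : ℝ × ℝ => (w.1, (0 : ℝ))) (by fun_prop)
  exact (h1.add h2).sub h3

lemma turning_periodic (t : ℝ) : Function.Periodic (turning α T γ t) (2 * Real.pi) := fun x => by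
  simp only [turning, spaceTimeAngular]
  congr 1; funext s
  exact (h.regular_clamp s).angularVelocity_periodic le_rfl x

/-- Conservation of the total curvature: the turning is periodic in the label and drops out. -/
lemma angle_sub (t : ℝ) : angle α T γ κ t Real.pi - angle α T γ κ t (-Real.pi)
    = angle α T γ κ 0 Real.pi - angle α T γ κ 0 (-Real.pi) := by
  have h1 : ∀ t, turning α T γ t Real.pi = turning α T γ t (-Real.pi) := fun t => by
    rw [← h.turning_periodic t (-Real.pi)]; congr 1; ring
  simp only [angle, h1]; ring

/-- Moves the pairing from κ, about whose dependence on time nothing is known, to the angle, which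
is jointly continuous. The boundary term appears because the angle is not periodic. -/
lemma integral_curvature_mul {t : ℝ} (ht : t ∈ Set.Icc 0 T) {f f' : ℝ → ℝ}
    (hf : ∀ x, HasDerivAt f (f' x) x) (hf' : Continuous f')
    (hp : Function.Periodic f (2 * Real.pi)) :
    ∫ x, ‖deriv (γ t) x‖ * κ t x * f x ∂torusMeasure
      = (angle α T γ κ 0 Real.pi - angle α T γ κ 0 (-Real.pi)) * f Real.pi
        - ∫ x, angle α T γ κ t x * f' x ∂torusMeasure := by
  have h1 := h.isPrim_angle ht
  have h2 := IsPrim.of_hasDerivAt hf hf'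
  have h3 := ((h1.mul h2) (-Real.pi) Real.pi).2
  have h4 : f (-Real.pi) = f Real.pi := by rw [← hp (-Real.pi)]; congr 1; ring
  rw [integral_torus_eq, integral_add] at h3
  · rw [← h.angle_sub t]
    simp only [h4] at h3
    linarith
  · exact integrable_torus_iff.2 ((h1 _ _).1.mul_continuousOn h2.continuous.continuousOn)
  · exact integrable_torus_iff.2 ((h2 _ _).1.continuousOn_mul h1.continuous.continuousOn)

/-- The evolution of the curvature, tested with a smooth function. -/
lemma integral_curvature_sub {f : ℝ × ℝ → ℝ} (hf : ContDiff ℝ ∞ f)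
    (hp : ∀ t x, f (t, x + 2 * Real.pi) = f (t, x)) :
    (∫ x, ‖deriv (γ T) x‖ * κ T x * f (T, x) ∂torusMeasure)
      - ∫ x, ‖deriv (γ 0) x‖ * κ 0 x * f (0, x) ∂torusMeasure
      = (∫ t in (0 : ℝ)..T, ∫ x, ‖deriv (γ t) x‖ * κ t x * deriv (fun τ => f (τ, x)) t
          ∂torusMeasure)
        - ∫ t in (0 : ℝ)..T, ∫ x, spaceTimeAngular α T γ t x * deriv (fun y => f (t, y)) x
          ∂torusMeasure := by
  have hTm : T ∈ Set.Icc 0 T := ⟨h.T_nonneg, le_rfl⟩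
  set fx : ℝ × ℝ → ℝ := fun w => fderiv ℝ f w (0, 1) with hfx
  set ft : ℝ × ℝ → ℝ := fun w => fderiv ℝ f w (1, 0) with hft
  have hfd : ContDiff ℝ ∞ (fderiv ℝ f) := hf.fderiv_right (by simp)
  have hfxs : ContDiff ℝ ∞ fx := hfd.clm_apply contDiff_const
  have hfts : ContDiff ℝ ∞ ft := hfd.clm_apply contDiff_const
  set fxt : ℝ × ℝ → ℝ := fun w => fderiv ℝ fx w (1, 0) with hfxt
  have hfxtc : Continuous fxt :=
    ((hfxs.fderiv_right (m := 0) (by simp)).clm_apply contDiff_const).continuous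
  have hdx : ∀ (g : ℝ × ℝ → ℝ), ContDiff ℝ ∞ g → ∀ t x,
      HasDerivAt (fun y => g (t, y)) (fderiv ℝ g (t, x) (0, 1)) x := fun g hg t x =>
    ((hg.differentiable (by simp)) (t, x)).hasFDerivAt.comp_hasDerivAt x
      ((hasDerivAt_const x t).prodMk (hasDerivAt_id x))
  have hdt : ∀ (g : ℝ × ℝ → ℝ), ContDiff ℝ ∞ g → ∀ t x,
      HasDerivAt (fun τ => g (τ, x)) (fderiv ℝ g (t, x) (1, 0)) t := fun g hg t x =>
    ((hg.differentiable (by simp)) (t, x)).hasFDerivAt.comp_hasDerivAt t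
      ((hasDerivAt_id t).prodMk (hasDerivAt_const t x))
  -- Symmetry of second derivatives: the same mixed derivative arises from differentiating the angle
  -- pairing in time and from integrating ∂ₜf by parts in the label.
  have hsymm : ∀ w, fderiv ℝ ft w (0, 1) = fxt w := by
    intro w
    have hd : DifferentiableAt ℝ (fderiv ℝ f) w := hfd.differentiable (by simp) w
    have hs : IsSymmSndFDerivAt ℝ f w := hf.contDiffAt.isSymmSndFDerivAt (by
      rw [minSmoothness_of_isRCLikeNormedField]; exact WithTop.coe_le_coe.2 le_top)
    simp only [hfxt, hfx, hft]
    rw [fderiv_clm_apply hd (differentiableAt_const _),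
      fderiv_clm_apply hd (differentiableAt_const _)]
    simpa using hs.eq (0, 1) (1, 0)
  have hptx : ∀ t x, ft (t, x + 2 * Real.pi) = ft (t, x) := by
    intro t x
    have e1 := (hdt f hf t (x + 2 * Real.pi))
    simp only [hp] at e1
    exact e1.unique (hdt f hf t x)
  have hc : ∀ {g : ℝ × ℝ → ℝ}, Continuous g → ∀ t, Continuous fun x => g (t, x) :=
    fun hg t => hg.comp (f := fun x : ℝ => (t, x)) (by fun_prop)
  set D := angle α T γ κ 0 Real.pi - angle α T γ κ 0 (-Real.pi) with hD
  have hQ : ∀ t ∈ Set.Icc 0 T, ∫ x, ‖deriv (γ t) x‖ * κ t x * f (t, x) ∂torusMeasure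
      = D * f (t, Real.pi) - ∫ x, angle α T γ κ t x * fx (t, x) ∂torusMeasure := fun t ht =>
    h.integral_curvature_mul ht (hdx f hf t) (hc hfxs.continuous t) (hp t)
  have hQt : ∀ t ∈ Set.Icc 0 T, ∫ x, ‖deriv (γ t) x‖ * κ t x * ft (t, x) ∂torusMeasure
      = D * ft (t, Real.pi) - ∫ x, angle α T γ κ t x * fxt (t, x) ∂torusMeasure := fun t ht =>
    h.integral_curvature_mul ht (fun x => by rw [← hsymm]; exact hdx ft hfts t x) (hc hfxtc t)
      (hptx t)
  have hΘ := h.continuous_angle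
  have hω := h.continuous_spaceTimeAngular
  have hω0 : Continuous fun w : ℝ × ℝ => spaceTimeAngular α T γ w.1 0 :=
    hω.comp (f := fun w : ℝ × ℝ => (w.1, (0 : ℝ))) (by fun_prop)
  -- The time derivative of the angle times ∂ₓf. The angle is normalized to vanish at label 0, which
  -- subtracts ω(t,0); this constant disappears after integration because ∂ₓf has zero mean.
  set w1 : ℝ → ℝ → ℝ := fun t x =>
    (spaceTimeAngular α T γ t x - spaceTimeAngular α T γ t 0) * fx (t, x)
      + angle α T γ κ t x * fxt (t, x) with hw1
  have hw1c : Continuous fun w : ℝ × ℝ => w1 w.1 w.2 :=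
    ((hω.sub hω0).mul hfxs.continuous).add (hΘ.mul hfxtc)
  have hΘd : ∀ t x, HasDerivAt (fun t => angle α T γ κ t x * fx (t, x)) (w1 t x) t := fun t x =>
    (((h.hasDerivAt_turning t x).const_add _).sub (h.hasDerivAt_turning t 0)).mul
      (hdt fx hfxs t x)
  have hinc : ∀ x, angle α T γ κ T x * fx (T, x) - angle α T γ κ 0 x * fx (0, x)
      = ∫ t in (0 : ℝ)..T, w1 t x := fun x => by
    have hcx : Continuous fun t => w1 t x :=
      hw1c.comp (f := fun t : ℝ => (t, x)) (by fun_prop)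
    exact (intervalIntegral.integral_eq_sub_of_hasDerivAt (fun t _ => hΘd t x)
      (hcx.intervalIntegrable _ _)).symm
  have hincD : f (T, Real.pi) - f (0, Real.pi) = ∫ t in (0 : ℝ)..T, ft (t, Real.pi) := by
    have hcx : Continuous fun t => ft (t, Real.pi) :=
      hfts.continuous.comp (f := fun t : ℝ => (t, Real.pi)) (by fun_prop)
    exact (intervalIntegral.integral_eq_sub_of_hasDerivAt (fun t _ => hdt f hf t _)
      (hcx.intervalIntegrable _ _)).symm
  have hint : ∀ (t : ℝ), Integrable (fun x => angle α T γ κ t x * fx (t, x)) torusMeasure :=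
    fun t => integrable_torus_of_continuous ((hΘ.comp (f := fun x : ℝ => (t, x))
      (by fun_prop)).mul (hc hfxs.continuous t))
  have hswap : ∫ x, (angle α T γ κ T x * fx (T, x) - angle α T γ κ 0 x * fx (0, x)) ∂torusMeasure
      = ∫ t in (0 : ℝ)..T, ∫ x, w1 t x ∂torusMeasure := by
    simp only [hinc]
    rw [← integral_torus_eq]
    simp only [← integral_torus_eq]
    refine (intervalIntegral_intervalIntegral_swap (F := w1) ?_).symm
    exact (hw1c.continuousOn.integrableOn_compact (isCompact_uIcc.prod isCompact_uIcc)).mono_set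
      (Set.prod_mono Set.uIoc_subset_uIcc Set.uIoc_subset_uIcc)
  have hwt : ∀ t, ∫ x, w1 t x ∂torusMeasure
      = (∫ x, spaceTimeAngular α T γ t x * fx (t, x) ∂torusMeasure)
        + ∫ x, angle α T γ κ t x * fxt (t, x) ∂torusMeasure := by
    intro t
    have c1 : Continuous fun x => spaceTimeAngular α T γ t x :=
      hω.comp (f := fun x : ℝ => (t, x)) (by fun_prop)
    have c2 : Continuous fun x => angle α T γ κ t x :=
      hΘ.comp (f := fun x : ℝ => (t, x)) (by fun_prop)
    have c3 := hc hfxs.continuous t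
    have z1 : ∫ x, fx (t, x) ∂torusMeasure = 0 :=
      (IsPrim.of_hasDerivAt (hdx f hf t) c3).integral_torus_eq_zero (hp t)
    simp only [hw1, sub_mul]
    rw [integral_add, integral_sub, integral_const_mul, z1, mul_zero, sub_zero]
    · exact integrable_torus_of_continuous (c1.mul c3)
    · exact (integrable_torus_of_continuous c3).const_mul _
    · exact (integrable_torus_of_continuous (c1.mul c3)).sub
        ((integrable_torus_of_continuous c3).const_mul _)
    · exact integrable_torus_of_continuous (c2.mul (hc hfxtc t))
  have hderx : ∀ t x, deriv (fun y => f (t, y)) x = fx (t, x) := fun t x => (hdx f hf t x).deriv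
  have hdert : ∀ t x, deriv (fun τ => f (τ, x)) t = ft (t, x) := fun t x => (hdt f hf t x).deriv
  simp only [hderx, hdert]
  have e1 : ∫ t in (0 : ℝ)..T, ∫ x, ‖deriv (γ t) x‖ * κ t x * ft (t, x) ∂torusMeasure
      = ∫ t in (0 : ℝ)..T, (D * ft (t, Real.pi) - ∫ x, angle α T γ κ t x * fxt (t, x)
        ∂torusMeasure) := by
    refine intervalIntegral.integral_congr fun t ht => ?_
    rw [Set.uIcc_of_le h.T_nonneg] at ht
    exact hQt t ht
  have k1 : Continuous fun t => D * ft (t, Real.pi) := continuous_const.mul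
    (hfts.continuous.comp (f := fun t : ℝ => (t, Real.pi)) (by fun_prop))
  have k2 : Continuous fun t => ∫ x, angle α T γ κ t x * fxt (t, x) ∂torusMeasure :=
    continuous_integral_torus (f := fun t x => angle α T γ κ t x * fxt (t, x)) (hΘ.mul hfxtc)
  have k3 : Continuous fun t => ∫ x, spaceTimeAngular α T γ t x * fx (t, x) ∂torusMeasure :=
    continuous_integral_torus (f := fun t x => spaceTimeAngular α T γ t x * fx (t, x))
      (hω.mul hfxs.continuous)
  rw [e1, hQ T hTm, hQ 0 h.zero_mem, intervalIntegral.integral_sub (k1.intervalIntegrable _ _)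
    (k2.intervalIntegrable _ _), intervalIntegral.integral_const_mul, ← hincD]
  have e2 := hswap
  simp only [hwt] at e2
  rw [integral_sub (hint T) (hint 0), intervalIntegral.integral_add (k3.intervalIntegrable _ _)
    (k2.intervalIntegrable _ _)] at e2
  linarith

/-- Pairings of the curvature with continuous functions are integrable in time. -/
lemma intervalIntegrable_integral_curvature_mul {F : ℝ → ℝ → ℝ}
    (hF : Continuous fun w : ℝ × ℝ => F w.1 w.2)
    (hp : ∀ t, Function.Periodic (F t) (2 * Real.pi)) :
    IntervalIntegrable (fun t => ∫ x, ‖deriv (γ t) x‖ * κ t x * F t x ∂torusMeasure) volume 0 T := by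
  have hT := h.T_nonneg
  have hFt : ∀ t, Continuous (F t) := fun t => hF.comp (f := fun x : ℝ => (t, x)) (by fun_prop)
  have hav := continuous_average hF
  set D := angle α T γ κ 0 Real.pi - angle α T γ κ 0 (-Real.pi) with hD
  have hδ : ∀ n : ℕ, (0 : ℝ) < 1 / ((n : ℝ) + 1) := fun n => Nat.one_div_pos_of_nat
  rw [intervalIntegrable_iff_integrableOn_Ioc_of_le hT]
  -- No measurability of κ in time is assumed. Averages of F over short label intervals are
  -- continuously differentiable in the label, so their pairings with gκ are continuous in time by
  -- `integral_curvature_mul`; the pairing with F is their pointwise limit.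
  have hmeas : AEStronglyMeasurable (fun t => ∫ x, ‖deriv (γ t) x‖ * κ t x * F t x ∂torusMeasure)
      (volume.restrict (Set.Ioc 0 T)) := by
    refine aestronglyMeasurable_of_tendsto_ae (u := atTop)
      (f := fun (n : ℕ) t => D * average F (1 / ((n : ℝ) + 1)) t Real.pi
        - ∫ x, angle α T γ κ t x * ((1 / ((n : ℝ) + 1))⁻¹ * (F t (x + 1 / ((n : ℝ) + 1)) - F t x))
          ∂torusMeasure) (fun n => ?_) ?_
    · refine Continuous.aestronglyMeasurable (Continuous.sub (continuous_const.mul ?_) ?_)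
      · exact hav.comp (f := fun t : ℝ => (1 / ((n : ℝ) + 1), t, Real.pi)) (by fun_prop)
      · refine continuous_integral_torus (f := fun t x => angle α T γ κ t x *
          ((1 / ((n : ℝ) + 1))⁻¹ * (F t (x + 1 / ((n : ℝ) + 1)) - F t x)))
          (h.continuous_angle.mul (continuous_const.mul (Continuous.sub ?_ hF)))
        exact hF.comp (f := fun w : ℝ × ℝ => (w.1, w.2 + 1 / ((n : ℝ) + 1))) (by fun_prop)
    · filter_upwards [ae_restrict_mem measurableSet_Ioc] with t ht
      have htm : t ∈ Set.Icc 0 T := ⟨ht.1.le, ht.2⟩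
      have heq : ∀ n : ℕ, D * average F (1 / ((n : ℝ) + 1)) t Real.pi
          - ∫ x, angle α T γ κ t x * ((1 / ((n : ℝ) + 1))⁻¹ *
            (F t (x + 1 / ((n : ℝ) + 1)) - F t x)) ∂torusMeasure
          = ∫ x, ‖deriv (γ t) x‖ * κ t x * average F (1 / ((n : ℝ) + 1)) t x ∂torusMeasure := by
        intro n
        refine (h.integral_curvature_mul htm (hasDerivAt_average hF (hδ n).ne' t) ?_ ?_).symm
        · have := hFt t
          fun_prop
        · intro x
          simp only [average, add_right_comm x (2 * Real.pi), hp t _]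
      simp only [heq]
      obtain ⟨B, hB⟩ := ((hp t).isBounded_of_continuous (by positivity) (hFt t)).exists_norm_le
      have hB' : ∀ x, ‖F t x‖ ≤ B := fun x => hB _ (Set.mem_range_self x)
      have hμ := (h.regular t htm).integrable_speed_mul
      have havx : ∀ δ, Continuous fun x => average F δ t x := fun δ =>
        hav.comp (f := fun x : ℝ => (δ, t, x)) (by fun_prop)
      refine tendsto_integral_filter_of_dominated_convergence
        (fun x => ‖‖deriv (γ t) x‖ * κ t x‖ * B) ?_ ?_ (hμ.norm.mul_const _) ?_
      · exact Eventually.of_forall fun n => hμ.aestronglyMeasurable.mul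
          (havx _).aestronglyMeasurable
      · refine Eventually.of_forall fun n => Eventually.of_forall fun x => ?_
        rw [norm_mul]
        gcongr
        refine (intervalIntegral.norm_integral_le_of_norm_le_const fun u _ => hB' _).trans ?_
        simp
      · refine Eventually.of_forall fun x => Tendsto.const_mul _ ?_
        have h1 : Tendsto (fun δ => average F δ t x) (𝓝 0) (𝓝 (average F 0 t x)) :=
          (hav.comp (f := fun δ : ℝ => (δ, t, x)) (by fun_prop)).tendsto 0
        have h2 : average F 0 t x = F t x := by simp [average]
        rw [h2] at h1
        exact h1.comp tendsto_one_div_add_atTop_nhds_zero_nat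
  obtain ⟨B, hB⟩ := (isCompact_Icc.prod isCompact_Icc).exists_bound_of_continuousOn
    (s := Set.Icc 0 T ×ˢ Set.Icc (-Real.pi) Real.pi) hF.continuousOn
  refine Integrable.mono' (g := fun _ => M * H * |B|) (integrable_const _) hmeas ?_
  filter_upwards [ae_restrict_mem measurableSet_Ioc] with t ht
  have htm : t ∈ Set.Icc 0 T := ⟨ht.1.le, ht.2⟩
  have hr := h.regular t htm
  have hκ : Integrable (fun x => |κ t x|) torusMeasure :=
    (integrable_torus_iff.2 (hr.integrable _ _)).norm
  calc _ ≤ ∫ x, M * |B| * |κ t x| ∂torusMeasure := by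
        refine norm_integral_le_of_norm_le (hκ.const_mul _) ?_
        unfold torusMeasure
        filter_upwards [ae_restrict_mem measurableSet_Ioc] with x hx
        rw [norm_mul, norm_mul, norm_norm, Real.norm_eq_abs]
        have h1 : ‖F t x‖ ≤ |B| :=
          (hB (t, x) ⟨htm, Set.Ioc_subset_Icc_self hx⟩).trans (le_abs_self B)
        have h2 := hr.upper x
        have h3 := hr.M_pos
        calc _ ≤ M * |κ t x| * |B| := by gcongr
          _ = _ := by ring
    _ = M * |B| * ∫ x, |κ t x| ∂torusMeasure := integral_const_mul _ _
    _ ≤ M * |B| * H := by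
        have h3 := hr.M_pos
        have := hr.integral_le
        gcongr
    _ = _ := by ring

end RegularFlow

/-! ### The odd kernel and its Fourier symbol -/

lemma integrable_of_even {f : ℝ → ℝ} (he : ∀ z, f (-z) = f z) (hf : IntegrableOn f (Set.Ioi 0)) :
    Integrable f := by
  have h1 : IntegrableOn f (Set.Iio 0) := by
    have := (Measure.measurePreserving_neg (volume : Measure ℝ)).integrableOn_comp_preimage
      (Homeomorph.neg ℝ).measurableEmbedding (f := f) (s := Set.Ioi 0)
    rw [← this] at hf
    simpa [Function.comp_def, he] using hf
  have h2 : IntegrableOn f (Set.Iic 0) := (integrableOn_Iic_iff_integrableOn_Iio (by simp)).2 h1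
  rw [← integrableOn_univ, ← Set.Iic_union_Ioi (a := (0 : ℝ))]
  exact h2.union hf

/-- The function is |z|^(−s) near 0 and |z|^(−1−s) at infinity, so the two ends require s < 1 and s
> 0 respectively. -/
lemma integrable_rpow_mul_min {s : ℝ} (hs : 0 < s) (hs' : s < 1) :
    Integrable fun z : ℝ => |z| ^ (-1 - s) * min 1 |z| := by
  refine integrable_of_even (fun z => by simp) ?_
  rw [← Set.Ioc_union_Ioi_eq_Ioi (zero_le_one (α := ℝ))]
  refine IntegrableOn.union ?_ ?_
  · have h1 : IntegrableOn (fun z : ℝ => z ^ (-s)) (Set.Ioc 0 1) := by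
      rw [← intervalIntegrable_iff_integrableOn_Ioc_of_le zero_le_one]
      exact intervalIntegral.intervalIntegrable_rpow' (by linarith)
    refine h1.congr_fun (fun z hz => ?_) measurableSet_Ioc
    simp only [abs_of_pos hz.1, min_eq_right hz.2]
    rw [← Real.rpow_add_one hz.1.ne']; congr 1; ring
  · refine (integrableOn_Ioi_rpow_of_lt (a := -1 - s) (by linarith) one_pos).congr_fun
      (fun z hz => ?_) measurableSet_Ioi
    have hz' : (1 : ℝ) < z := hz
    simp only [abs_of_pos (one_pos.trans hz'), min_eq_left hz'.le, mul_one]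

lemma oddKernel_neg (α z : ℝ) : oddKernel α (-z) = -oddKernel α z := by simp [oddKernel]

lemma abs_oddKernel_mul_le {α z u A : ℝ} (hu : |u| ≤ A * min 1 |z|) :
    |oddKernel α z * u| ≤ A * (|z| ^ (-1 - 2 * α) * min 1 |z|) := by
  rcases eq_or_ne z 0 with rfl | hz
  · simp [oddKernel]
  · rw [abs_mul, abs_oddKernel hz]
    calc _ ≤ |z| ^ (-1 - 2 * α) * (A * min 1 |z|) := by gcongr
      _ = _ := by ring

section

variable {α : ℝ} (hα : 0 < α) (hα' : α < 1 / 2)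
include hα hα'

lemma integrable_oddKernel_mul {E : Type*} [NormedAddCommGroup E] [NormedSpace ℝ E] {u : ℝ → E}
    (hum : AEStronglyMeasurable u) {A : ℝ} (hu : ∀ z, ‖u z‖ ≤ A * min 1 |z|) :
    Integrable fun z => oddKernel α z • u z := by
  refine ((integrable_rpow_mul_min (s := 2 * α) (by linarith) (by linarith)).const_mul A).mono'
    ((measurable_oddKernel α).aestronglyMeasurable.smul hum) (ae_of_all _ fun z => ?_)
  rw [norm_smul, ← Real.norm_of_nonneg (norm_nonneg (u z)), ← norm_smul, Real.norm_eq_abs,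
    smul_eq_mul]
  exact abs_oddKernel_mul_le (by simpa using hu z)

end

lemma abs_sin_mul_le (k z : ℝ) : |Real.sin (k * z)| ≤ max 1 |k| * min 1 |z| := by
  rcases le_total 1 |z| with hz | hz
  · rw [min_eq_left hz]
    exact (Real.abs_sin_le_one _).trans (by simp)
  · rw [min_eq_right hz]
    refine Real.abs_sin_le_abs.trans ?_
    rw [abs_mul]
    gcongr
    exact le_max_right _ _

/-- The symbol of the convolution with the odd kernel at frequency `1`, divided by `i`. -/
def symbolConst (α : ℝ) : ℝ := ∫ z, oddKernel α z * Real.sin z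

lemma oddKernel_mul (α k z : ℝ) :
    oddKernel α (k * z) = k * |k| ^ (-2 - 2 * α) * oddKernel α z := by
  rw [oddKernel, oddKernel, abs_mul, Real.mul_rpow (abs_nonneg _) (abs_nonneg _)]; ring

/-- The substitution z ↦ kz and the homogeneity of the kernel. No integrability is needed, as the
change of variables holds for every function. -/
lemma integral_oddKernel_mul_sin (α k : ℝ) :
    ∫ z, oddKernel α z * Real.sin (k * z) = k * |k| ^ (2 * α - 1) * symbolConst α := by
  rcases eq_or_ne k 0 with rfl | hk
  · simp
  have h1 := Measure.integral_comp_mul_left (fun z => oddKernel α z * Real.sin z) k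
  simp only [oddKernel_mul, smul_eq_mul, mul_assoc] at h1
  rw [integral_const_mul, integral_const_mul] at h1
  have hk' : 0 < |k| := abs_pos.2 hk
  rw [abs_inv] at h1
  change _ = |k|⁻¹ * symbolConst α at h1
  have e1 : |k| ^ (-2 - 2 * α) ≠ 0 := (Real.rpow_pos_of_pos hk' _).ne'
  have e2 : |k| ^ (2 * α - 1) * |k| ^ (-2 - 2 * α) * (|k| * k ^ 2) = 1 := by
    rw [← sq_abs k, ← pow_succ', ← Real.rpow_natCast, ← Real.rpow_add hk', ← Real.rpow_add hk',
      show 2 * α - 1 + (-2 - 2 * α) + ((2 + 1 : ℕ) : ℝ) = 0 by push_cast; ring, Real.rpow_zero]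
  have e3 : (k * |k| ^ (-2 - 2 * α)) ≠ 0 := mul_ne_zero hk e1
  apply mul_left_cancel₀ e3
  have e4 : |k|⁻¹ = k ^ 2 * (|k| ^ (2 * α - 1) * |k| ^ (-2 - 2 * α)) :=
    inv_eq_of_mul_eq_one_right (by linear_combination e2)
  rw [mul_assoc, h1, e4]
  ring

/-- Integrating the sine transform over `(0, 1)` leaves a positive kernel. -/
lemma symbolConst_pos {α : ℝ} (hα : 0 < α) (hα' : α < 1 / 2) : 0 < symbolConst α := by
  have hbd : ∀ k ∈ Set.Ioc (0 : ℝ) 1, ∀ z : ℝ, ‖oddKernel α z * Real.sin (k * z)‖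
      ≤ 1 * (|z| ^ (-1 - 2 * α) * min 1 |z|) := fun k hk z => by
    refine abs_oddKernel_mul_le ((abs_sin_mul_le k z).trans_eq ?_)
    rw [abs_of_pos hk.1, max_eq_left hk.2]
  have hw := (integrable_rpow_mul_min (s := 2 * α) (by linarith) (by linarith)).const_mul 1
  have hmeas : Measurable fun w : ℝ × ℝ => oddKernel α w.2 * Real.sin (w.1 * w.2) :=
    ((measurable_oddKernel α).comp measurable_snd).mul (by fun_prop)
  have hint : Integrable (Function.uncurry fun k z : ℝ => oddKernel α z * Real.sin (k * z))
      ((volume.restrict (Set.uIoc (0 : ℝ) 1)).prod volume) := by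
    rw [Set.uIoc_of_le zero_le_one]
    have h1 : Integrable (fun w : ℝ × ℝ => (1 : ℝ) * (1 * (|w.2| ^ (-1 - 2 * α) * min 1 |w.2|)))
        ((volume.restrict (Set.Ioc (0 : ℝ) 1)).prod volume) :=
      (integrable_const (1 : ℝ)).mul_prod hw
    refine h1.mono' hmeas.aestronglyMeasurable ?_
    rw [show (volume.restrict (Set.Ioc (0 : ℝ) 1)).prod (volume : Measure ℝ)
      = (volume.prod volume).restrict (Set.Ioc (0 : ℝ) 1 ×ˢ Set.univ) by
        rw [← Measure.prod_restrict, Measure.restrict_univ]]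
    refine (ae_restrict_iff' (measurableSet_Ioc.prod MeasurableSet.univ)).2
      (ae_of_all _ fun w hw' => ?_)
    rw [one_mul]
    exact hbd w.1 hw'.1 w.2
  have hswap := intervalIntegral_integral_swap hint
  have e1 : ∫ k in (0 : ℝ)..1, ∫ z, oddKernel α z * Real.sin (k * z)
      = (2 * α + 1)⁻¹ * symbolConst α := by
    have : Set.EqOn (fun k => ∫ z, oddKernel α z * Real.sin (k * z))
        (fun k => k ^ (2 * α) * symbolConst α) (Set.uIcc 0 1) := fun k hk => by
      rw [Set.uIcc_of_le zero_le_one] at hk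
      rcases eq_or_lt_of_le hk.1 with rfl | hk0
      · simp [Real.zero_rpow (by linarith : 2 * α ≠ 0)]
      · simp only [integral_oddKernel_mul_sin, abs_of_pos hk0]
        congr 1
        rw [← Real.rpow_one_add' hk0.le (by linarith)]; congr 1; ring
    rw [intervalIntegral.integral_congr this, intervalIntegral.integral_mul_const,
      integral_rpow (Or.inl (by linarith))]
    simp [Real.zero_rpow (by linarith : 2 * α + 1 ≠ 0)]
  have e2 : ∀ z : ℝ, ∫ k in (0 : ℝ)..1, oddKernel α z * Real.sin (k * z)
      = |z| ^ (-2 - 2 * α) * (1 - Real.cos z) := fun z => by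
    rcases eq_or_ne z 0 with rfl | hz
    · simp
    · rw [intervalIntegral.integral_const_mul, intervalIntegral.integral_comp_mul_right _ hz,
        integral_sin, oddKernel]
      simp only [zero_mul, one_mul, Real.cos_zero, smul_eq_mul]
      field_simp
  simp only [e2] at hswap
  have hpos : 0 < ∫ z : ℝ, |z| ^ (-2 - 2 * α) * (1 - Real.cos z) := by
    have hnn : ∀ z : ℝ, 0 ≤ |z| ^ (-2 - 2 * α) * (1 - Real.cos z) := fun z =>
      mul_nonneg (by positivity) (by linarith [Real.cos_le_one z])
    have hi : Integrable fun z : ℝ => |z| ^ (-2 - 2 * α) * (1 - Real.cos z) := by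
      have := hint.integral_prod_right
      simp only [Function.uncurry_apply_pair] at this
      refine this.congr (ae_of_all _ fun z => ?_)
      simp only
      rw [← e2 z, intervalIntegral.integral_of_le zero_le_one, Set.uIoc_of_le zero_le_one]
    rw [integral_pos_iff_support_of_nonneg hnn hi]
    refine lt_of_lt_of_le ?_ (measure_mono (s := Set.Ioo 1 2) fun z hz => ?_)
    · simp
    · have hz0 : 0 < z := one_pos.trans hz.1
      refine (mul_pos (Real.rpow_pos_of_pos (abs_pos.2 hz0.ne') _) ?_).ne'
      have : Real.cos z < Real.cos 0 := Real.cos_lt_cos_of_nonneg_of_le_pi le_rfl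
        (by linarith [hz.2, Real.pi_gt_three]) hz0
      rw [Real.cos_zero] at this; linarith
  rw [← hswap, e1] at hpos
  exact (pos_iff_pos_of_mul_pos hpos).1 (by positivity)

/-- Convolution with the odd kernel. -/
def nonlocal (α : ℝ) (φ : ℝ → ℝ) (x : ℝ) : ℝ := ∫ z, oddKernel α z * (φ (x + z) - φ x)

lemma exists_bound_of_periodic {F : ℝ → ℝ → ℝ} (hF : Continuous fun w : ℝ × ℝ => F w.1 w.2)
    (hp : ∀ t, Function.Periodic (F t) (2 * Real.pi)) (a b : ℝ) :
    ∃ A, 0 ≤ A ∧ ∀ t ∈ Set.Icc a b, ∀ x, |F t x| ≤ A := by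
  obtain ⟨A, hA⟩ := (isCompact_Icc.prod isCompact_Icc).exists_bound_of_continuousOn
    (s := Set.Icc a b ×ˢ Set.Icc 0 (2 * Real.pi)) hF.continuousOn
  refine ⟨max A 0, le_max_right _ _, fun t ht x => ?_⟩
  obtain ⟨y, hy, hxy⟩ := (hp t).exists_mem_Ico₀ Real.two_pi_pos x
  rw [hxy]
  exact (hA (t, y) ⟨ht, hy.1, hy.2.le⟩).trans (le_max_left _ _)

/-- Boundedness serves large z and the Lipschitz bound small z; the resulting `min 1 |z|` is what
the odd kernel integrates over the whole line. -/
lemma exists_increment_bound {F : ℝ → ℝ → ℝ} (hF : ContDiff ℝ 1 fun w : ℝ × ℝ => F w.1 w.2)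
    (hp : ∀ t, Function.Periodic (F t) (2 * Real.pi)) (a b : ℝ) :
    ∃ A, 0 ≤ A ∧ ∀ t ∈ Set.Icc a b, ∀ x z, |F t (x + z) - F t x| ≤ A * min 1 |z| := by
  have hd : ∀ t x, HasDerivAt (F t) (fderiv ℝ (fun w : ℝ × ℝ => F w.1 w.2) (t, x) (0, 1)) x :=
    fun t x => by
      have := ((hF.differentiable one_ne_zero) (t, x)).hasFDerivAt.comp_hasDerivAt x
        ((hasDerivAt_const x t).prodMk (hasDerivAt_id x))
      exact this
  have hper : ∀ t, Function.Periodic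
      (fun x => fderiv ℝ (fun w : ℝ × ℝ => F w.1 w.2) (t, x) (0, 1)) (2 * Real.pi) := fun t x => by
    have h1 := (hd t (x + 2 * Real.pi)).comp_add_const x (2 * Real.pi)
    rw [show (fun y => F t (y + 2 * Real.pi)) = F t from funext (hp t)] at h1
    exact h1.unique (hd t x)
  obtain ⟨A, hA0, hA⟩ := exists_bound_of_periodic hF.continuous hp a b
  obtain ⟨L, hL0, hL⟩ := exists_bound_of_periodic (F := fun t x =>
    fderiv ℝ (fun w : ℝ × ℝ => F w.1 w.2) (t, x) (0, 1))
    ((hF.continuous_fderiv one_ne_zero).clm_apply continuous_const) hper a b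
  refine ⟨max (2 * A) L, by positivity, fun t ht x z => ?_⟩
  rcases le_total 1 |z| with hz | hz
  · rw [min_eq_left hz, mul_one]
    refine ((abs_sub _ _).trans ?_).trans (le_max_left _ _)
    linarith [hA t ht (x + z), hA t ht x]
  · rw [min_eq_right hz]
    have h2 : ‖F t (x + z) - F t x‖ ≤ L * ‖x + z - x‖ :=
      Convex.norm_image_sub_le_of_norm_hasDerivWithin_le (s := Set.univ)
        (fun y _ => (hd t y).hasDerivWithinAt) (fun y _ => hL t ht y) convex_univ
        (Set.mem_univ _) (Set.mem_univ _)
    rw [add_sub_cancel_left] at h2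
    exact h2.trans (mul_le_mul_of_nonneg_right (le_max_right _ _) (abs_nonneg z))

lemma exists_increment_bound' {f : ℝ → ℝ} (hf : ContDiff ℝ 1 f)
    (hp : Function.Periodic f (2 * Real.pi)) :
    ∃ A, 0 ≤ A ∧ ∀ x z, |f (x + z) - f x| ≤ A * min 1 |z| := by
  obtain ⟨A, hA0, hA⟩ := exists_increment_bound (F := fun _ => f) (hf.comp contDiff_snd)
    (fun _ => hp) 0 0
  exact ⟨A, hA0, hA 0 ⟨le_rfl, le_rfl⟩⟩

section

variable {α : ℝ} (hα : 0 < α) (hα' : α < 1 / 2)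
include hα hα'

lemma integrable_nonlocal {f : ℝ → ℝ} (hf : ContDiff ℝ 1 f)
    (hp : Function.Periodic f (2 * Real.pi)) (x : ℝ) :
    Integrable fun z => oddKernel α z * (f (x + z) - f x) := by
  obtain ⟨A, _, hA⟩ := exists_increment_bound' hf hp
  have hc := hf.continuous
  exact integrable_oddKernel_mul hα hα' (u := fun z => f (x + z) - f x)
    (Continuous.aestronglyMeasurable (by fun_prop)) (hA x)

lemma nonlocal_add {f g : ℝ → ℝ} (hf : ContDiff ℝ 1 f) (hp : Function.Periodic f (2 * Real.pi))
    (hg : ContDiff ℝ 1 g) (hq : Function.Periodic g (2 * Real.pi)) (x : ℝ) :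
    nonlocal α (f + g) x = nonlocal α f x + nonlocal α g x := by
  rw [nonlocal, nonlocal, nonlocal, ← integral_add (integrable_nonlocal hα hα' hf hp x)
    (integrable_nonlocal hα hα' hg hq x)]
  congr 1; funext z; simp only [Pi.add_apply]; ring

lemma continuous_nonlocal {F : ℝ → ℝ → ℝ} (hF : ContDiff ℝ 1 fun w : ℝ × ℝ => F w.1 w.2)
    (hp : ∀ t, Function.Periodic (F t) (2 * Real.pi)) {T : ℝ} (hT : 0 ≤ T) :
    Continuous fun w : ℝ × ℝ => nonlocal α (F (clamp T w.1)) w.2 := by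
  obtain ⟨A, hA0, hA⟩ := exists_increment_bound hF hp 0 T
  have hc := hF.continuous
  have hcl := continuous_clamp (T := T)
  refine continuous_of_dominated (bound := fun z => A * (|z| ^ (-1 - 2 * α) * min 1 |z|))
    (fun w => ?_) (fun w => ae_of_all _ fun z => ?_)
    ((integrable_rpow_mul_min (s := 2 * α) (by linarith) (by linarith)).const_mul A)
    (ae_of_all _ fun z => ?_)
  · refine (measurable_oddKernel α).aestronglyMeasurable.mul (Continuous.aestronglyMeasurable ?_)
    exact (hc.comp (f := fun z : ℝ => (clamp T w.1, w.2 + z)) (by fun_prop)).sub continuous_const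
  · exact abs_oddKernel_mul_le (hA _ (clamp_mem hT _) _ _)
  · refine continuous_const.mul (Continuous.sub ?_ ?_)
    · exact hc.comp (f := fun w : ℝ × ℝ => (clamp T w.1, w.2 + z)) (by fun_prop)
    · exact hc.comp (f := fun w : ℝ × ℝ => (clamp T w.1, w.2)) (by fun_prop)

end

lemma nonlocal_smul (α c : ℝ) (f : ℝ → ℝ) (x : ℝ) :
    nonlocal α (c • f) x = c * nonlocal α f x := by
  rw [nonlocal, nonlocal, ← integral_const_mul]
  congr 1; funext z; simp only [Pi.smul_apply, smul_eq_mul]; ring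

lemma nonlocal_periodic (α : ℝ) {f : ℝ → ℝ} (hp : Function.Periodic f (2 * Real.pi)) :
    Function.Periodic (nonlocal α f) (2 * Real.pi) := fun x => by
  simp only [nonlocal, hp x, show ∀ z, x + 2 * Real.pi + z = x + z + 2 * Real.pi by intro z; ring,
    hp _]

/-! ### Fourier series -/

lemma exp_pi_symm (k : ℤ) : Complex.exp (-(Complex.I * k * (-Real.pi : ℝ)))
    = Complex.exp (-(Complex.I * k * (Real.pi : ℝ))) := by
  rw [Complex.exp_eq_exp_iff_exists_int]
  exact ⟨k, by push_cast; ring⟩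

lemma norm_exp_I_mul (k : ℤ) (x : ℝ) : ‖Complex.exp (Complex.I * k * x)‖ = 1 := by
  rw [show Complex.I * k * x = ((k * x : ℝ) : ℂ) * Complex.I by push_cast; ring]
  exact Complex.norm_exp_ofReal_mul_I _

lemma fourierHat_deriv {f : ℝ → ℝ} (hf : ContDiff ℝ 1 f) (hp : Function.Periodic f (2 * Real.pi))
    (k : ℤ) : fourierHat (deriv f) k = Complex.I * k * fourierHat f k := by
  have hu : ∀ x : ℝ, HasDerivAt (fun x : ℝ => Complex.exp (-(Complex.I * k * x)))
      (-(Complex.I * k) * Complex.exp (-(Complex.I * k * x))) x := fun x => by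
    have h1 : HasDerivAt (fun x : ℂ => -(Complex.I * k * x)) (-(Complex.I * k)) (x : ℂ) := by
      have := ((hasDerivAt_id (x : ℂ)).const_mul (Complex.I * k)).neg
      rw [mul_one] at this
      exact this
    have := (h1.cexp).comp_ofReal
    rwa [mul_comm (Complex.exp _)] at this
  have hv : ∀ x : ℝ, HasDerivAt (fun x : ℝ => (f x : ℂ)) ((deriv f x : ℝ) : ℂ) x := fun x =>
    ((hf.differentiable one_ne_zero x).hasDerivAt).ofReal_comp
  have hc := hf.continuous_deriv le_rfl
  have h1 := intervalIntegral.integral_mul_deriv_eq_deriv_mul (a := -Real.pi) (b := Real.pi)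
    (fun x _ => hu x) (fun x _ => hv x) (Continuous.intervalIntegrable (by fun_prop) _ _)
    (Continuous.intervalIntegrable (Complex.continuous_ofReal.comp hc) _ _)
  have hpi : f (-Real.pi) = f Real.pi := by rw [← hp (-Real.pi)]; congr 1; ring
  rw [exp_pi_symm, hpi, sub_self, zero_sub, ← intervalIntegral.integral_neg] at h1
  have h2 : ∫ x in (-Real.pi)..Real.pi, ((deriv f x : ℝ) : ℂ) *
      Complex.exp (-(Complex.I * k * x)) = (Complex.I * k) *
        ∫ x in (-Real.pi)..Real.pi, (f x : ℂ) * Complex.exp (-(Complex.I * k * x)) := by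
    rw [← intervalIntegral.integral_const_mul]
    simp only [mul_comm ((deriv f _ : ℝ) : ℂ)]
    rw [h1]
    congr 1; funext x; ring
  rw [fourierHat, fourierHat, h2]; ring

lemma norm_fourierHat_le (f : ℝ → ℝ) :
    ∃ C, ∀ k, ‖fourierHat f k‖ ≤ C := by
  refine ⟨‖(2 * Real.pi : ℂ)⁻¹‖ * |∫ x in (-Real.pi)..Real.pi, ‖f x‖|, fun k => ?_⟩
  rw [fourierHat, norm_mul]
  gcongr
  refine (intervalIntegral.norm_integral_le_abs_integral_norm).trans_eq ?_
  congr 2; funext x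
  have := norm_exp_I_mul k (-x)
  rw [norm_mul, show -(Complex.I * k * x) = Complex.I * k * ((-x : ℝ) : ℂ) by push_cast; ring, this,
    mul_one, Complex.norm_real]

lemma periodic_deriv {f : ℝ → ℝ} {P : ℝ} (hp : Function.Periodic f P) :
    Function.Periodic (deriv f) P := fun x => by
  rw [← deriv_comp_add_const, funext hp]

/-- Three derivatives make |k|³ times the coefficient bounded. The weight of order |k| is there to
exchange the Fourier sum with the singular integral. -/
lemma summable_fourierHat {f : ℝ → ℝ} (hf : ContDiff ℝ ∞ f)
    (hp : Function.Periodic f (2 * Real.pi)) :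
    Summable fun k : ℤ => max 1 |(k : ℝ)| * ‖fourierHat f k‖ := by
  have h1 : ContDiff ℝ ∞ (deriv f) := (contDiff_infty_iff_deriv.1 hf).2
  have h2 : ContDiff ℝ ∞ (deriv (deriv f)) := (contDiff_infty_iff_deriv.1 h1).2
  obtain ⟨C, hC⟩ := norm_fourierHat_le (deriv (deriv (deriv f)))
  have hk : ∀ k : ℤ, |(k : ℝ)| ^ 3 * ‖fourierHat f k‖ ≤ C := fun k => by
    have := hC k
    rw [fourierHat_deriv (h2.of_le (by simp)) (periodic_deriv (periodic_deriv hp)),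
      fourierHat_deriv (h1.of_le (by simp)) (periodic_deriv hp),
      fourierHat_deriv (hf.of_le (by simp)) hp] at this
    simp only [norm_mul, Complex.norm_I, one_mul, Complex.norm_intCast] at this
    linarith
  refine Summable.of_norm_bounded_eventually
    (g := fun k : ℤ => C * (1 / (k : ℝ) ^ 2))
    ((Real.summable_one_div_int_pow (p := 2).2 (by norm_num)).mul_left C) ?_
  filter_upwards [(Set.finite_singleton (0 : ℤ)).compl_mem_cofinite] with k hk0
  have hk1 : (1 : ℝ) ≤ |(k : ℝ)| := by
    have : (1 : ℤ) ≤ |k| := Int.one_le_abs hk0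
    exact_mod_cast this
  rw [Real.norm_of_nonneg (by positivity), max_eq_right hk1, mul_one_div, ← sq_abs,
    le_div_iff₀ (by positivity)]
  linarith [hk k]

lemma summable_norm_fourierHat {f : ℝ → ℝ} (hf : ContDiff ℝ ∞ f)
    (hp : Function.Periodic f (2 * Real.pi)) : Summable fun k : ℤ => ‖fourierHat f k‖ :=
  (summable_fourierHat hf hp).of_nonneg_of_le (fun _ => norm_nonneg _) fun _ =>
    le_mul_of_one_le_left (norm_nonneg _) (le_max_left _ _)

lemma hasSum_fourierHat {f : ℝ → ℝ} (hf : ContDiff ℝ ∞ f)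
    (hp : Function.Periodic f (2 * Real.pi)) (x : ℝ) :
    HasSum (fun k : ℤ => fourierHat f k * Complex.exp (Complex.I * k * x)) (f x : ℂ) := by
  have : Fact (0 < 2 * Real.pi) := ⟨Real.two_pi_pos⟩
  have hp' : Function.Periodic (fun x => (f x : ℂ)) (2 * Real.pi) := fun x => by simp only [hp x]
  have hcont : Continuous hp'.lift := by
    refine continuous_coinduced_dom.2 ?_
    exact Complex.continuous_ofReal.comp hf.continuous
  let F : C(AddCircle (2 * Real.pi), ℂ) := ⟨hp'.lift, hcont⟩
  have hF : ∀ y : ℝ, F (y : AddCircle (2 * Real.pi)) = f y := fun y =>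
    Function.Periodic.lift_coe hp' y
  have hexp : ∀ (n : ℤ) (y : ℝ), fourier n (y : AddCircle (2 * Real.pi))
      = Complex.exp (Complex.I * n * y) := fun n y => by
    rw [fourier_coe_apply]
    congr 1
    have : (Real.pi : ℂ) ≠ 0 := by exact_mod_cast Real.pi_ne_zero
    push_cast
    field_simp
  have hcoef : ∀ k, fourierCoeff F k = fourierHat f k := fun k => by
    rw [fourierCoeff_eq_intervalIntegral _ _ (-Real.pi), fourierHat,
      show -Real.pi + 2 * Real.pi = Real.pi by ring]
    simp only [hF, hexp, smul_eq_mul, Complex.real_smul]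
    congr 1
    · push_cast; ring
    · congr 1; funext y; rw [mul_comm]; congr 2; push_cast; ring
  have hs : Summable (fourierCoeff F) := by
    rw [funext hcoef]
    exact (summable_norm_fourierHat hf hp).of_norm
  have := has_pointwise_sum_fourier_series_of_summable hs (x : AddCircle (2 * Real.pi))
  simpa only [hcoef, hexp, hF, smul_eq_mul] using this

lemma norm_exp_sub_one_le (k z : ℝ) :
    ‖Complex.exp (Complex.I * k * z) - 1‖ ≤ 2 * max 1 |k| * min 1 |z| := by
  have e : Complex.I * k * z = Complex.I * ((k * z : ℝ) : ℂ) := by push_cast; ring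
  rcases le_total 1 |z| with hz | hz
  · rw [min_eq_left hz, mul_one]
    refine (norm_sub_le _ _).trans ?_
    rw [e, mul_comm, Complex.norm_exp_ofReal_mul_I, norm_one]
    linarith [le_max_left 1 |k|]
  · rw [min_eq_right hz, e]
    refine Real.norm_exp_I_mul_ofReal_sub_one_le.trans ?_
    rw [Real.norm_eq_abs, abs_mul]
    gcongr
    linarith [le_max_right 1 |k|, le_max_left 1 |k|]

section

variable {α : ℝ} (hα : 0 < α) (hα' : α < 1 / 2)
include hα hα'

lemma integrable_oddKernel_exp (k : ℝ) :
    Integrable fun z : ℝ => oddKernel α z • (Complex.exp (Complex.I * k * z) - 1) :=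
  integrable_oddKernel_mul hα hα' (u := fun z : ℝ => Complex.exp (Complex.I * k * z) - 1)
    (Continuous.aestronglyMeasurable (by fun_prop)) (norm_exp_sub_one_le k)

/-- The real part vanishes by oddness, and the imaginary part is the sine transform of the kernel.
-/
lemma integral_oddKernel_exp (k : ℝ) :
    ∫ z : ℝ, oddKernel α z • (Complex.exp (Complex.I * k * z) - 1)
      = Complex.I * ((k * |k| ^ (2 * α - 1) * symbolConst α : ℝ) : ℂ) := by
  have hint := integrable_oddKernel_exp hα hα' k
  have hform : ∀ z : ℝ, oddKernel α z • (Complex.exp (Complex.I * k * z) - 1)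
      = ((oddKernel α z * (Real.cos (k * z) - 1) : ℝ) : ℂ)
        + Complex.I * ((oddKernel α z * Real.sin (k * z) : ℝ) : ℂ) := fun z => by
    rw [show Complex.I * k * z = ((k * z : ℝ) : ℂ) * Complex.I by push_cast; ring,
      Complex.exp_mul_I, ← Complex.ofReal_cos, ← Complex.ofReal_sin, Complex.real_smul]
    push_cast; ring
  have hre : ∫ z : ℝ, oddKernel α z * (Real.cos (k * z) - 1) = 0 := by
    have h1 := integral_neg_eq_self (fun z => oddKernel α z * (Real.cos (k * z) - 1)) volume
    simp only [oddKernel_neg, mul_neg, Real.cos_neg, neg_mul, integral_neg] at h1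
    linarith
  apply Complex.ext
  · have := integral_re (𝕜 := ℂ) hint
    simp only [RCLike.re_eq_complex_re] at this
    rw [← this, Complex.I_mul_re, Complex.ofReal_im, neg_zero, ← hre]
    congr 1; funext z
    rw [hform, Complex.add_re, Complex.I_mul_re, Complex.ofReal_re, Complex.ofReal_im]; ring
  · have := integral_im (𝕜 := ℂ) hint
    simp only [RCLike.im_eq_complex_im] at this
    rw [← this, Complex.I_mul_im, Complex.ofReal_re, ← integral_oddKernel_mul_sin]
    congr 1; funext z
    rw [hform, Complex.add_im, Complex.I_mul_im, Complex.ofReal_re, Complex.ofReal_im]; ring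

/-- The operator `ℒ_α` is, up to a positive constant, the convolution with the odd kernel. -/
lemma symbolConst_mul_dispersive {f : ℝ → ℝ} (hf : ContDiff ℝ ∞ f)
    (hp : Function.Periodic f (2 * Real.pi)) (x : ℝ) :
    symbolConst α * dispersive α f x = nonlocal α f x := by
  -- The nonlocal operator is applied term by term to the Fourier series. Each frequency costs at
  -- most a factor 2 max(1,|k|) against an integrable function of z, so sum and integral may be
  -- exchanged.
  set F : ℤ → ℝ → ℂ := fun k z => fourierHat f k * Complex.exp (Complex.I * k * x) *
    (oddKernel α z • (Complex.exp (Complex.I * (k : ℝ) * z) - 1)) with hF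
  have hFi : ∀ k, Integrable (F k) := fun k => (integrable_oddKernel_exp hα hα' k).const_mul _
  have hw := integrable_rpow_mul_min (s := 2 * α) (by linarith) (by linarith)
  have hsum : Summable fun k => ∫ z, ‖F k z‖ := by
    refine ((summable_fourierHat hf hp).mul_right
      (2 * ∫ z : ℝ, |z| ^ (-1 - 2 * α) * min 1 |z|)).of_nonneg_of_le
      (fun k => integral_nonneg fun z => norm_nonneg _) fun k => ?_
    have hle : ∀ z, ‖F k z‖ ≤ (‖fourierHat f k‖ * (2 * max 1 |(k : ℝ)|)) *
        (|z| ^ (-1 - 2 * α) * min 1 |z|) := fun z => by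
      rw [hF]
      simp only [norm_mul, norm_exp_I_mul, mul_one]
      rw [mul_assoc ‖fourierHat f k‖]
      refine mul_le_mul_of_nonneg_left ?_ (norm_nonneg (fourierHat f k))
      have := abs_oddKernel_mul_le (α := α)
        ((abs_norm (Complex.exp (Complex.I * (k : ℝ) * z) - 1)).trans_le (norm_exp_sub_one_le k z))
      rwa [abs_mul, abs_norm, ← Real.norm_eq_abs, ← norm_smul] at this
    refine (integral_mono (hFi k).norm (hw.const_mul _) hle).trans_eq ?_
    rw [integral_const_mul]; ring
  have hmain := hasSum_integral_of_summable_integral_norm hFi hsum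
  have h1 : ∀ k : ℤ, ∫ z, F k z = symbolConst α * (Complex.I * k *
      ((|(k : ℝ)| ^ (2 * α - 1) : ℝ) : ℂ) * fourierHat f k * Complex.exp (Complex.I * k * x)) :=
    fun k => by
      rw [hF]
      simp only
      rw [integral_const_mul, integral_oddKernel_exp hα hα']
      push_cast; ring
  have h2 : ∀ z : ℝ, ∑' k, F k z = ((oddKernel α z * (f (x + z) - f x) : ℝ) : ℂ) := fun z => by
    have s1 := ((hasSum_fourierHat hf hp (x + z)).sub (hasSum_fourierHat hf hp x)).mul_left
      (oddKernel α z : ℂ)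
    rw [show ((oddKernel α z * (f (x + z) - f x) : ℝ) : ℂ)
      = oddKernel α z * ((f (x + z) : ℂ) - f x) by push_cast; ring, ← s1.tsum_eq]
    congr 1; funext k
    rw [hF]
    simp only [Complex.real_smul]
    rw [show Complex.I * (k : ℂ) * ((x + z : ℝ) : ℂ) = Complex.I * k * x
      + Complex.I * ((k : ℝ) : ℂ) * z by push_cast; ring, Complex.exp_add]
    ring
  simp only [h1, h2] at hmain
  rw [integral_complex_ofReal] at hmain
  have h3 := hmain.tsum_eq
  rw [tsum_mul_left] at h3
  have h4 := congrArg Complex.re h3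
  rw [Complex.re_ofReal_mul, Complex.ofReal_re] at h4
  exact h4

end

/-! ### Littlewood-Paley decomposition -/

lemma sum_dyadicCutoff (ψ : ℝ → ℝ) (m : ℕ) (ξ : ℝ) :
    ∑ n ∈ Finset.range (m + 1), dyadicCutoff ψ n ξ = ψ (ξ / 2 ^ m) := by
  induction m with
  | zero => simp [dyadicCutoff]
  | succ m ih => rw [Finset.sum_range_succ, ih, dyadicCutoff]; ring

namespace IsLPCutoff

variable {ψ : ℝ → ℝ} (hψ : IsLPCutoff ψ)
include hψ

lemma eq_zero {ξ : ℝ} (h : 1 ≤ |ξ|) : ψ ξ = 0 := by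
  by_contra h0
  have h1 := hψ.support (subset_tsupport _ (Function.mem_support.2 h0))
  exact absurd (abs_lt.2 h1) (not_lt.2 h)

lemma eq_zero_of_le {n : ℕ} {ξ : ℝ} (h : 2 ^ n ≤ |ξ|) : ψ (ξ / 2 ^ n) = 0 := by
  apply hψ.eq_zero
  rw [abs_div, abs_of_pos (by positivity : (0 : ℝ) < 2 ^ n), le_div_iff₀ (by positivity)]
  linarith

lemma dyadicCutoff_eq_zero {n : ℕ} {ξ : ℝ} (h : 2 ^ n ≤ |ξ|) : dyadicCutoff ψ n ξ = 0 := by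
  cases n with
  | zero => exact hψ.eq_zero (by simpa using h)
  | succ n =>
    rw [dyadicCutoff, hψ.eq_zero_of_le h, hψ.eq_zero_of_le, sub_zero]
    exact le_trans (by gcongr <;> norm_num) h

lemma exists_bound : ∃ A, ∀ ξ, |ψ ξ| ≤ A := by
  have hs : HasCompactSupport ψ :=
    (isCompact_Icc (a := (-1 : ℝ)) (b := 1)).of_isClosed_subset (isClosed_tsupport _)
      (hψ.support.trans Set.Ioo_subset_Icc_self)
  exact hs.exists_bound_of_continuous hψ.smooth.continuous

lemma summable_lpBlock (f : ℝ → ℝ) (n : ℕ) (x : ℝ) :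
    Summable fun k : ℤ => (dyadicCutoff ψ n k : ℂ) * fourierHat f k *
      Complex.exp (Complex.I * k * x) := by
  refine summable_of_hasFiniteSupport ?_
  refine (Set.finite_Icc (-2 ^ n : ℤ) (2 ^ n)).subset fun k hk => ?_
  by_contra h
  apply hk
  have : (2 : ℝ) ^ n ≤ |(k : ℝ)| := by
    have : (2 : ℤ) ^ n ≤ |k| := by
      by_contra h'
      exact h (Set.mem_Icc.2 (abs_le.1 (not_le.1 h').le))
    exact_mod_cast this
  simp [hψ.dyadicCutoff_eq_zero this]

/-- The partial sums telescope to the multiplier ψ(k/2^m), which is 1 for fixed k and large m and is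
bounded uniformly in m and k. -/
lemma tendsto_sum_lpBlock {f : ℝ → ℝ} (hf : ContDiff ℝ ∞ f)
    (hp : Function.Periodic f (2 * Real.pi)) (x : ℝ) :
    Tendsto (fun m => ∑ n ∈ Finset.range (m + 1), lpBlock ψ n f x) atTop (𝓝 (f x : ℂ)) := by
  have h1 : ∀ m, ∑ n ∈ Finset.range (m + 1), lpBlock ψ n f x
      = ∑' k : ℤ, (ψ (k / 2 ^ m) : ℂ) * fourierHat f k * Complex.exp (Complex.I * k * x) := by
    intro m
    simp only [lpBlock]
    rw [← Summable.tsum_finsetSum fun n _ => hψ.summable_lpBlock f n x]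
    congr 1; funext k
    rw [← sum_dyadicCutoff ψ]
    push_cast
    rw [Finset.sum_mul, Finset.sum_mul]
  simp only [h1]
  rw [← (hasSum_fourierHat hf hp x).tsum_eq]
  obtain ⟨A, hA⟩ := hψ.exists_bound
  refine tendsto_tsum_of_dominated_convergence
    ((summable_norm_fourierHat hf hp).mul_left A) (fun k => ?_)
    (Eventually.of_forall fun m k => ?_)
  · refine tendsto_const_nhds.congr' ?_
    have h0 : Tendsto (fun m : ℕ => |(k : ℝ)| * ((2 : ℝ)⁻¹ ^ m)) atTop (𝓝 (|(k : ℝ)| * 0)) :=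
      (tendsto_pow_atTop_nhds_zero_of_lt_one (by norm_num) (by norm_num)).const_mul _
    rw [mul_zero] at h0
    filter_upwards [h0.eventually (gt_mem_nhds (by norm_num : (0 : ℝ) < 3 / 4))] with m hm
    rw [hψ.eq_one, Complex.ofReal_one, one_mul]
    rwa [abs_div, abs_of_pos (by positivity : (0 : ℝ) < 2 ^ m), div_eq_mul_inv, ← inv_pow]
  · rw [norm_mul, norm_mul, norm_exp_I_mul, mul_one, Complex.norm_real]
    gcongr
    exact hA _

lemma enorm_le_tsum {f : ℝ → ℝ} (hf : ContDiff ℝ ∞ f)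
    (hp : Function.Periodic f (2 * Real.pi)) (x : ℝ) :
    ‖f x‖ₑ ≤ ∑' n, ‖lpBlock ψ n f x‖ₑ := by
  have h1 := (hψ.tendsto_sum_lpBlock hf hp x).enorm
  rw [show ‖(f x : ℂ)‖ₑ = ‖f x‖ₑ by rw [← ofReal_norm, ← ofReal_norm, Complex.norm_real]] at h1
  exact le_of_tendsto' h1 fun m => (enorm_sum_le _ _).trans (ENNReal.sum_le_tsum _)

lemma enorm_sub_le_tsum {f : ℝ → ℝ} (hf : ContDiff ℝ ∞ f)
    (hp : Function.Periodic f (2 * Real.pi)) (x y : ℝ) :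
    ‖f x - f y‖ₑ ≤ ∑' n, ‖lpBlock ψ n f x - lpBlock ψ n f y‖ₑ := by
  have h1 := ((hψ.tendsto_sum_lpBlock hf hp x).sub (hψ.tendsto_sum_lpBlock hf hp y)).enorm
  rw [← Complex.ofReal_sub, show ‖((f x - f y : ℝ) : ℂ)‖ₑ = ‖f x - f y‖ₑ by
    rw [← ofReal_norm, ← ofReal_norm, Complex.norm_real]] at h1
  refine le_of_tendsto' h1 fun m => ?_
  rw [← Finset.sum_sub_distrib]
  exact (enorm_sum_le _ _).trans (ENNReal.sum_le_tsum _)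

end IsLPCutoff

/-! ### Bernstein's inequality -/

lemma integral_exp_torus (k : ℤ) :
    ∫ t : ℝ, Complex.exp (Complex.I * k * t) ∂torusMeasure = if k = 0 then (2 * Real.pi : ℂ) else 0 := by
  rw [torusMeasure, ← intervalIntegral.integral_of_le (by linarith [Real.pi_pos])]
  split_ifs with hk
  · simp [hk]; ring
  · have hk' : Complex.I * (k : ℂ) ≠ 0 := mul_ne_zero Complex.I_ne_zero (by exact_mod_cast hk)
    rw [integral_exp_mul_complex hk']
    have h1 := exp_pi_symm (-k)
    rw [show Complex.I * (k : ℂ) * (Real.pi : ℝ) = -(Complex.I * ((-k : ℤ) : ℂ) * (Real.pi : ℝ)) by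
      push_cast; ring, show Complex.I * (k : ℂ) * ((-Real.pi : ℝ) : ℂ)
        = -(Complex.I * ((-k : ℤ) : ℂ) * ((-Real.pi : ℝ) : ℂ)) by push_cast; ring, h1, sub_self,
      zero_div]

/-- The Fejér kernel. -/
def fejer (N : ℕ) (t : ℝ) : ℝ :=
  (N : ℝ)⁻¹ * ‖∑ j ∈ Finset.range N, Complex.exp (Complex.I * (j : ℤ) * t)‖ ^ 2

lemma fejer_nonneg (N : ℕ) (t : ℝ) : 0 ≤ fejer N t := by unfold fejer; positivity

lemma continuous_fejer (N : ℕ) : Continuous (fejer N) := by unfold fejer; fun_prop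

lemma fejer_eq (N : ℕ) (t : ℝ) : (fejer N t : ℂ) = (N : ℂ)⁻¹ * ∑ j ∈ Finset.range N,
    ∑ l ∈ Finset.range N, Complex.exp (Complex.I * ((j - l : ℤ) : ℂ) * t) := by
  rw [fejer]
  push_cast
  congr 1
  rw [← Complex.mul_conj', Finset.sum_mul, Finset.sum_congr rfl]
  intro j _
  rw [map_sum, Finset.mul_sum, Finset.sum_congr rfl]
  intro l _
  rw [← Complex.exp_conj, ← Complex.exp_add]
  congr 1
  simp only [map_mul, Complex.conj_I, Complex.conj_ofReal, map_natCast]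
  ring

lemma integral_exp_mul_fejer {N : ℕ} (m : ℤ) :
    ∫ t : ℝ, Complex.exp (Complex.I * m * t) * fejer N t ∂torusMeasure
      = (N : ℂ)⁻¹ * (2 * Real.pi) * ∑ j ∈ Finset.range N, ∑ l ∈ Finset.range N,
        if m + (j - l : ℤ) = 0 then 1 else 0 := by
  simp only [fejer_eq]
  have h1 : ∀ t : ℝ, Complex.exp (Complex.I * m * t) * ((N : ℂ)⁻¹ * ∑ j ∈ Finset.range N,
      ∑ l ∈ Finset.range N, Complex.exp (Complex.I * ((j - l : ℤ) : ℂ) * t))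
      = (N : ℂ)⁻¹ * ∑ j ∈ Finset.range N, ∑ l ∈ Finset.range N,
        Complex.exp (Complex.I * ((m + (j - l) : ℤ) : ℂ) * t) := fun t => by
    rw [mul_left_comm, Finset.mul_sum]
    congr 1
    refine Finset.sum_congr rfl fun j _ => ?_
    rw [Finset.mul_sum]
    refine Finset.sum_congr rfl fun l _ => ?_
    rw [← Complex.exp_add]
    congr 1
    push_cast; ring
  have hi : ∀ k : ℤ, Integrable (fun t : ℝ => Complex.exp (Complex.I * k * t)) torusMeasure :=
    fun k => integrable_torus_of_continuous (by fun_prop)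
  simp only [h1]
  rw [integral_const_mul, integral_finsetSum _ fun j _ => integrable_finsetSum _ fun l _ => hi _,
    mul_assoc (N : ℂ)⁻¹]
  congr 1
  rw [Finset.mul_sum]
  refine Finset.sum_congr rfl fun j _ => ?_
  rw [integral_finsetSum _ fun l _ => hi _, Finset.mul_sum]
  refine Finset.sum_congr rfl fun l _ => ?_
  rw [integral_exp_torus]
  split_ifs <;> simp

lemma integral_fejer {N : ℕ} (hN : N ≠ 0) : ∫ t, fejer N t ∂torusMeasure = 2 * Real.pi := by
  have h := integral_exp_mul_fejer (N := N) 0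
  simp only [Int.cast_zero, mul_zero, zero_mul, Complex.exp_zero, one_mul, zero_add,
    sub_eq_zero, Nat.cast_inj, Finset.sum_ite_eq, Finset.sum_ite_mem,
    Finset.inter_self, Finset.sum_const, Finset.card_range, nsmul_eq_mul, mul_one] at h
  rw [integral_complex_ofReal] at h
  have hN' : (N : ℂ) ≠ 0 := by exact_mod_cast hN
  field_simp at h
  exact_mod_cast h

/-- The kernel of the derivative on trigonometric polynomials of degree at most `N`. -/
def bernstein (N : ℕ) (t : ℝ) : ℂ :=
  Complex.I * N * (Complex.exp (Complex.I * (N : ℤ) * t) - Complex.exp (Complex.I * (-N : ℤ) * t))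
    * fejer N t

lemma continuous_bernstein (N : ℕ) : Continuous (bernstein N) := by
  have := continuous_fejer N
  unfold bernstein; fun_prop

lemma norm_bernstein_le (N : ℕ) (t : ℝ) : ‖bernstein N t‖ ≤ 2 * N * fejer N t := by
  rw [bernstein, norm_mul, norm_mul, norm_mul, Complex.norm_I, one_mul, Complex.norm_real,
    Real.norm_of_nonneg (fejer_nonneg N t), Complex.norm_natCast, mul_comm 2 (N : ℝ)]
  gcongr
  · exact fejer_nonneg N t
  · refine (norm_sub_le _ _).trans ?_
    rw [norm_exp_I_mul, norm_exp_I_mul]; norm_num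

/-- Counts the pairs with l = N + j − k: the condition l < N leaves exactly j < k, so up to
normalization this is the Fejér coefficient at the frequency N − k, a tent shifted to N. -/
lemma sum_indicator_shift {N : ℕ} {k : ℤ} (hk : |k| ≤ N) :
    (∑ j ∈ Finset.range N, ∑ l ∈ Finset.range N, if N - k + (j - l : ℤ) = 0 then (1 : ℂ) else 0)
      = (k.toNat : ℂ) := by
  have hk1 := abs_le.1 hk
  have h1 : ∀ j ∈ Finset.range N, (∑ l ∈ Finset.range N,
      if N - k + (j - l : ℤ) = 0 then (1 : ℂ) else 0) = if j < k.toNat then 1 else 0 := by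
    intro j hj
    rw [Finset.mem_range] at hj
    split_ifs with hjk
    · rw [Finset.sum_eq_single (N + j - k).toNat]
      · rw [if_pos (by omega)]
      · intro l _ hl
        rw [if_neg (by omega)]
      · intro hl
        rw [Finset.mem_range] at hl
        omega
    · refine Finset.sum_eq_zero fun l hl => ?_
      rw [Finset.mem_range] at hl
      rw [if_neg (by omega)]
  rw [Finset.sum_congr rfl h1, Finset.sum_boole]
  congr 1
  rw [show (Finset.range N).filter (fun j => j < k.toNat) = Finset.range k.toNat by
    ext j; simp only [Finset.mem_filter, Finset.mem_range]; omega, Finset.card_range]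

/-- The modulations by e^(±iNt) shift the Fejér tents to ±N, and on |k| ≤ N their difference is
max(k,0) − max(−k,0) = k. The kernel therefore reproduces the derivative there, while positivity of
the Fejér kernel keeps its L¹ norm of order N. -/
lemma integral_exp_mul_bernstein {N : ℕ} (hN : N ≠ 0) {k : ℤ} (hk : |k| ≤ N) :
    ∫ t : ℝ, Complex.exp (-(Complex.I * k * t)) * bernstein N t ∂torusMeasure
      = 2 * Real.pi * (Complex.I * k) := by
  have hN' : (N : ℂ) ≠ 0 := by exact_mod_cast hN
  have hc := continuous_fejer N
  have h1 : ∀ t : ℝ, Complex.exp (-(Complex.I * k * t)) * bernstein N t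
      = Complex.I * N * (Complex.exp (Complex.I * ((N - k : ℤ) : ℂ) * t) * fejer N t)
        - Complex.I * N * (Complex.exp (Complex.I * ((-N - k : ℤ) : ℂ) * t) * fejer N t) :=
    fun t => by
      rw [bernstein, show Complex.I * ((N - k : ℤ) : ℂ) * t
        = -(Complex.I * k * t) + Complex.I * (N : ℤ) * t by push_cast; ring,
        show Complex.I * ((-N - k : ℤ) : ℂ) * t
        = -(Complex.I * k * t) + Complex.I * (-N : ℤ) * t by push_cast; ring, Complex.exp_add,
        Complex.exp_add]
      ring
  have hi : ∀ m : ℤ, Integrable (fun t : ℝ => Complex.I * N *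
      (Complex.exp (Complex.I * m * t) * fejer N t)) torusMeasure :=
    fun k => integrable_torus_of_continuous (by fun_prop)
  simp only [h1]
  rw [integral_sub (hi _) (hi _), integral_const_mul, integral_const_mul, integral_exp_mul_fejer,
    integral_exp_mul_fejer, sum_indicator_shift hk]
  have h2 : (∑ j ∈ Finset.range N, ∑ l ∈ Finset.range N,
      if -N - k + (j - l : ℤ) = 0 then (1 : ℂ) else 0) = ((-k).toNat : ℂ) := by
    rw [← sum_indicator_shift (N := N) (k := -k) (by rwa [abs_neg]), Finset.sum_comm]
    refine Finset.sum_congr rfl fun j _ => Finset.sum_congr rfl fun l _ => ?_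
    congr 1
    rw [eq_iff_iff]
    constructor <;> intro h <;> omega
  rw [h2]
  have h3 : ((k.toNat : ℂ) - ((-k).toNat : ℂ)) = k := by
    have : (k.toNat : ℤ) - ((-k).toNat : ℤ) = k := by omega
    exact_mod_cast congrArg (Int.cast (R := ℂ)) this
  field_simp
  linear_combination h3

/-- If g is dominated by a superposition of translates of |P|, a pairing bound for all translates
passes to g with the total weight as factor. Bernstein's inequality uses this twice: for the
derivative, with the Fejér weight, and for the increment, with the uniform weight on a segment. -/
lemma lintegral_enorm_mul_le {ν : Measure ℝ} [SFinite ν] {P : ℝ → ℂ} (hP : Continuous P)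
    {κ : ℝ → ℝ} (hκ : Measurable κ) {w : ℝ → ℝ≥0∞} (hw : Measurable w) {s : ℝ → ℝ}
    (hs : Measurable s) {g : ℝ → ℝ≥0∞} (hg : ∀ y, g y ≤ ∫⁻ t, w t * ‖P (y + s t)‖ₑ ∂ν)
    {A : ℝ≥0∞} (hA : ∀ b, ∫⁻ y, ‖κ y‖ₑ * ‖P (y + b)‖ₑ ∂torusMeasure ≤ A) :
    ∫⁻ y, ‖κ y‖ₑ * g y ∂torusMeasure ≤ (∫⁻ t, w t ∂ν) * A := by
  have hPm := hP.measurable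
  calc ∫⁻ y, ‖κ y‖ₑ * g y ∂torusMeasure
      ≤ ∫⁻ y, ∫⁻ t, ‖κ y‖ₑ * (w t * ‖P (y + s t)‖ₑ) ∂ν ∂torusMeasure := by
        refine lintegral_mono fun y => ?_
        rw [lintegral_const_mul _ (by fun_prop)]
        gcongr
        exact hg y
    _ = ∫⁻ t, ∫⁻ y, ‖κ y‖ₑ * (w t * ‖P (y + s t)‖ₑ) ∂torusMeasure ∂ν :=
        lintegral_lintegral_swap (Measurable.aemeasurable (by fun_prop))
    _ = ∫⁻ t, w t * ∫⁻ y, ‖κ y‖ₑ * ‖P (y + s t)‖ₑ ∂torusMeasure ∂ν := by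
        congr 1; funext t
        rw [← lintegral_const_mul _ (by fun_prop)]
        congr 1; funext y
        ring
    _ ≤ ∫⁻ t, w t * A ∂ν := by gcongr with t; exact hA _
    _ = _ := lintegral_mul_const _ hw

/-- A trigonometric polynomial of degree at most `N`. -/
def trigSum (N : ℕ) (a : ℤ → ℂ) (x : ℝ) : ℂ :=
  ∑ k ∈ Finset.Icc (-(N : ℤ)) N, a k * Complex.exp (Complex.I * k * x)

lemma continuous_trigSum (N : ℕ) (a : ℤ → ℂ) : Continuous (trigSum N a) := by
  unfold trigSum; fun_prop

lemma hasDerivAt_trigSum (N : ℕ) (a : ℤ → ℂ) (x : ℝ) :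
    HasDerivAt (trigSum N a) (trigSum N (fun k => a k * (Complex.I * k)) x) x := by
  unfold trigSum
  refine HasDerivAt.fun_sum fun k _ => ?_
  have h1 : HasDerivAt (fun x : ℂ => Complex.I * k * x) (Complex.I * k) (x : ℂ) := by
    simpa using (hasDerivAt_id (x : ℂ)).const_mul (Complex.I * k)
  refine (((h1.cexp).comp_ofReal).const_mul (a k)).congr_deriv ?_
  ring

lemma trigSum_deriv_eq {N : ℕ} (hN : N ≠ 0) (a : ℤ → ℂ) (x : ℝ) :
    trigSum N (fun k => a k * (Complex.I * k)) x
      = (2 * Real.pi : ℂ)⁻¹ * ∫ t, trigSum N a (x - t) * bernstein N t ∂torusMeasure := by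
  have hb := continuous_bernstein N
  have h1 : ∀ t : ℝ, trigSum N a (x - t) * bernstein N t = ∑ k ∈ Finset.Icc (-(N : ℤ)) N,
      a k * Complex.exp (Complex.I * k * x) *
        (Complex.exp (-(Complex.I * k * t)) * bernstein N t) := fun t => by
    rw [trigSum, Finset.sum_mul]
    refine Finset.sum_congr rfl fun k _ => ?_
    rw [show Complex.I * k * ((x - t : ℝ) : ℂ) = Complex.I * k * x + -(Complex.I * k * t) by
      push_cast; ring, Complex.exp_add]
    ring
  simp only [h1]
  rw [integral_finsetSum _ fun k _ => integrable_torus_of_continuous (by fun_prop), Finset.mul_sum,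
    trigSum]
  refine Finset.sum_congr rfl fun k hk => ?_
  rw [integral_const_mul, integral_exp_mul_bernstein hN (abs_le.2 (Finset.mem_Icc.1 hk))]
  have : (Real.pi : ℂ) ≠ 0 := by exact_mod_cast Real.pi_ne_zero
  field_simp

lemma enorm_trigSum_deriv_le {N : ℕ} (hN : N ≠ 0) (a : ℤ → ℂ) (x : ℝ) :
    ‖trigSum N (fun k => a k * (Complex.I * k)) x‖ₑ
      ≤ ∫⁻ t, ENNReal.ofReal ((2 * Real.pi)⁻¹ * (2 * N * fejer N t)) * ‖trigSum N a (x + -t)‖ₑ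
        ∂torusMeasure := by
  have hP := (continuous_trigSum N a).measurable
  have hF := (continuous_fejer N).measurable
  rw [trigSum_deriv_eq hN, ← integral_const_mul]
  refine (enorm_integral_le_lintegral_enorm _).trans (lintegral_mono fun t => ?_)
  rw [mul_comm (trigSum N a _), ← mul_assoc, enorm_mul, ← sub_eq_add_neg]
  gcongr
  rw [← ofReal_norm, norm_mul, norm_inv]
  refine ENNReal.ofReal_le_ofReal ?_
  rw [show ‖(2 * Real.pi : ℂ)‖ = 2 * Real.pi by
    rw [norm_mul, Complex.norm_real, Real.norm_of_nonneg Real.pi_pos.le]; simp]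
  gcongr
  exact norm_bernstein_le N t

/-- Bernstein's inequality, in the form of a bound for a pairing. -/
lemma lintegral_mul_trigSum_sub_le {κ : ℝ → ℝ} (hκ : Measurable κ) {N : ℕ} (hN : N ≠ 0)
    (a : ℤ → ℂ) {A : ℝ≥0∞}
    (hA : ∀ b, ∫⁻ y, ‖κ y‖ₑ * ‖trigSum N a (y + b)‖ₑ ∂torusMeasure ≤ A) (z : ℝ) :
    ∫⁻ y, ‖κ y‖ₑ * ‖trigSum N a (y + z) - trigSum N a y‖ₑ ∂torusMeasure
      ≤ ENNReal.ofReal (2 * N * |z|) * A := by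
  have hF := (continuous_fejer N).measurable
  have hpi := Real.pi_pos
  have hA' : ∀ b, ∫⁻ y, ‖κ y‖ₑ * ‖trigSum N (fun k => a k * (Complex.I * k)) (y + b)‖ₑ
      ∂torusMeasure ≤ ENNReal.ofReal (2 * N) * A := fun b => by
    -- The weight has total mass (2π)⁻¹ · 2N · 2π = 2N, the price of one derivative.
    refine (lintegral_enorm_mul_le (ν := torusMeasure) (continuous_trigSum N a) hκ
      (w := fun t => ENNReal.ofReal ((2 * Real.pi)⁻¹ * (2 * N * fejer N t))) (by fun_prop)
      (s := fun t => b - t) (by fun_prop) (fun y => ?_) hA).trans_eq ?_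
    · refine (enorm_trigSum_deriv_le hN a (y + b)).trans_eq ?_
      simp only [sub_eq_add_neg, add_assoc]
    · congr 1
      rw [← ofReal_integral_eq_lintegral_ofReal]
      · rw [integral_const_mul, integral_const_mul, integral_fejer hN]
        congr 1; field_simp
      · exact ((integrable_torus_of_continuous (continuous_fejer N)).const_mul _).const_mul _
      · exact ae_of_all _ fun t => by have := fejer_nonneg N t; positivity
  refine (lintegral_enorm_mul_le (continuous_trigSum N _) hκ
      (ν := volume.restrict (Set.Ioc (0 : ℝ) 1))
      (w := fun _ => ENNReal.ofReal |z|) (by fun_prop)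
      (s := fun t => z * t) (by fun_prop) (fun y => ?_) hA').trans_eq ?_
  · have hd : ∀ t ∈ Set.uIcc (0 : ℝ) 1, HasDerivAt (fun t => trigSum N a (y + z * t))
        (z • trigSum N (fun k => a k * (Complex.I * k)) (y + z * t)) t := fun t _ => by
      have h1 : HasDerivAt (fun t : ℝ => y + z * t) z t := by
        simpa using ((hasDerivAt_id t).const_mul z).const_add y
      exact (hasDerivAt_trigSum N a (y + z * t)).scomp t h1
    have hcd := continuous_trigSum N (fun k => a k * (Complex.I * k))
    have h2 := intervalIntegral.integral_eq_sub_of_hasDerivAt hd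
      (Continuous.intervalIntegrable (by fun_prop) _ _)
    simp only [mul_one, mul_zero, add_zero] at h2
    rw [← h2, intervalIntegral.integral_of_le zero_le_one]
    refine (enorm_integral_le_lintegral_enorm _).trans_eq ?_
    simp only [enorm_smul, Real.enorm_eq_ofReal_abs]
  · simp only [lintegral_const, Measure.restrict_apply_univ, Real.volume_Ioc, sub_zero,
      ENNReal.ofReal_one, mul_one]
    rw [← mul_assoc, ← ENNReal.ofReal_mul (abs_nonneg z), mul_comm |z|]

namespace IsLPCutoff

variable {ψ : ℝ → ℝ} (hψ : IsLPCutoff ψ)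
include hψ

lemma exists_lpBlock_eq (f : ℝ → ℝ) (n : ℕ) : ∃ a, lpBlock ψ n f = trigSum (2 ^ n) a := by
  refine ⟨fun k => (dyadicCutoff ψ n k : ℂ) * fourierHat f k, funext fun x => ?_⟩
  rw [lpBlock, trigSum, tsum_eq_sum]
  intro k hk
  have : (2 : ℝ) ^ n ≤ |(k : ℝ)| := by
    have : (2 : ℤ) ^ n ≤ |k| := by
      by_contra h'
      refine hk (Finset.mem_Icc.2 ?_)
      push_cast
      exact abs_le.1 (not_le.1 h').le
    exact_mod_cast this
  simp [hψ.dyadicCutoff_eq_zero this]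

end IsLPCutoff

/-! ### Pairings of L^p functions with Littlewood-Paley blocks -/

lemma lpBlock_periodic (ψ : ℝ → ℝ) (n : ℕ) (f : ℝ → ℝ) :
    Function.Periodic (lpBlock ψ n f) (2 * Real.pi) := fun x => by
  rw [lpBlock, lpBlock]
  congr 1; funext k
  congr 1
  rw [Complex.exp_eq_exp_iff_exists_int]
  exact ⟨k, by push_cast; ring⟩

lemma eLpNorm_torus_comp_add {E : Type*} [NormedAddCommGroup E] {P : ℝ → E} (hc : Continuous P)
    (hp : Function.Periodic P (2 * Real.pi)) (q : ℝ≥0∞) (b : ℝ) :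
    eLpNorm (fun y => P (y + b)) q torusMeasure = eLpNorm P q torusMeasure := by
  have h1 : torusMeasure.map (fun y => y + b)
      = volume.restrict (Set.Ioc (-Real.pi + b) (-Real.pi + b + 2 * Real.pi)) := by
    have := (measurePreserving_add_right (volume : Measure ℝ) b).restrict_preimage
      (s := Set.Ioc (-Real.pi + b) (-Real.pi + b + 2 * Real.pi)) measurableSet_Ioc
    rw [← this.map_eq, torusMeasure]
    congr 2
    ext x
    simp only [Set.mem_Ioc, Set.mem_preimage]
    constructor <;> rintro ⟨h, h'⟩ <;> constructor <;> linarith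
  have h2 := eLpNorm_map_measure (p := q) (μ := torusMeasure) (f := fun y => y + b) (g := P)
    hc.aestronglyMeasurable (by fun_prop)
  rw [h1] at h2
  change _ = eLpNorm (fun y => P (y + b)) q torusMeasure at h2
  rw [← h2, eLpNorm_restrict_period Real.two_pi_pos hp q _ (-Real.pi), torusMeasure]
  congr 3; ring

lemma lintegral_enorm_mul_comp_add_le {κ : ℝ → ℝ} (hκ : Measurable κ) {P : ℝ → ℂ}
    (hc : Continuous P) (hp : Function.Periodic P (2 * Real.pi)) {p p' : ℝ≥0∞}
    (hpp : ENNReal.HolderConjugate p p') (b : ℝ) :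
    ∫⁻ y, ‖κ y‖ₑ * ‖P (y + b)‖ₑ ∂torusMeasure
      ≤ eLpNorm κ p torusMeasure * eLpNorm P p' torusMeasure := by
  have h1 : ENNReal.HolderTriple p p' 1 := hpp
  have h2 := eLpNorm_smul_le_mul_eLpNorm (p := p) (q := p') (r := 1) (μ := torusMeasure)
    (f := fun y => P (y + b)) (φ := κ) (Continuous.aestronglyMeasurable (by fun_prop))
    hκ.aestronglyMeasurable
  rw [eLpNorm_torus_comp_add hc hp, eLpNorm_one_eq_lintegral_enorm] at h2
  simpa only [Pi.smul_apply', enorm_smul] using h2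

lemma measurable_enorm_mul_comp_add {κ : ℝ → ℝ} (hκ : Measurable κ) {P : ℝ → ℂ}
    (hc : Continuous P) (b : ℝ) : Measurable fun y => ‖κ y‖ₑ * ‖P (y + b)‖ₑ := by
  have := hc.measurable
  fun_prop

lemma measurable_enorm_mul_sub {κ : ℝ → ℝ} (hκ : Measurable κ) {P : ℝ → ℂ}
    (hc : Continuous P) (b : ℝ) : Measurable fun y => ‖κ y‖ₑ * ‖P (y + b) - P y‖ₑ := by
  have := hc.measurable
  fun_prop

/-- Integrals of the singular kernel against the oscillation of a function of frequency `2 ^ n`. -/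
lemma exists_lintegral_kernel_le {α σ s : ℝ} (hα : 0 < α) (hα' : α < 1 / 2) (hσ : 0 < σ)
    (hs : max (2 * α - σ) 0 ≤ s) (hs' : s = 0 → 2 * α < σ) :
    ∃ C : ℝ≥0, ∀ n : ℕ, ∫⁻ z, ENNReal.ofReal (|z| ^ (σ - 1 - 2 * α)) *
      ENNReal.ofReal (2 * min 1 (2 ^ n * |z|)) ∂torusMeasure
        ≤ C * ENNReal.ofReal (2 ^ (((n : ℝ) - 1) * s)) := by
  have hs0 : 0 ≤ s := (le_max_right _ _).trans hs
  have hs1 : 2 * α - σ ≤ s := (le_max_left _ _).trans hs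
  have hpi := Real.pi_pos
  suffices h : ∃ D : ℝ, 0 ≤ D ∧ ∀ n : ℕ, ∫⁻ z, ENNReal.ofReal (|z| ^ (σ - 1 - 2 * α)) *
      ENNReal.ofReal (2 * min 1 (2 ^ n * |z|)) ∂torusMeasure
        ≤ ENNReal.ofReal (D * 2 ^ ((n : ℝ) * s)) by
    obtain ⟨D, hD0, hD⟩ := h
    -- The block with index n has frequency exponent q = n − 1; the shift is a constant factor 2^s.
    refine ⟨(D * 2 ^ s).toNNReal, fun n => (hD n).trans_eq ?_⟩
    change _ = ENNReal.ofReal _ * _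
    rw [← ENNReal.ofReal_mul (by positivity), mul_assoc, ← Real.rpow_add (by norm_num)]
    congr 3; ring
  rcases lt_or_ge (2 * α) σ with hlt | hge
  -- For 2α < σ the kernel itself is integrable, so the oscillation is not used and every s ≥ 0 is
  -- admitted.
  · have hint : Integrable (fun z : ℝ => |z| ^ (σ - 1 - 2 * α) * 2) torusMeasure :=
      (integrable_torus_rpow (by linarith)).mul_const 2
    refine ⟨∫ z, |z| ^ (σ - 1 - 2 * α) * 2 ∂torusMeasure,
      integral_nonneg fun z => by positivity, fun n => ?_⟩
    calc _ ≤ ∫⁻ z, ENNReal.ofReal (|z| ^ (σ - 1 - 2 * α) * 2) ∂torusMeasure := by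
          refine lintegral_mono fun z => ?_
          rw [← ENNReal.ofReal_mul (by positivity)]
          gcongr
          linarith [min_le_left 1 ((2 : ℝ) ^ n * |z|)]
      _ = ENNReal.ofReal (∫ z, |z| ^ (σ - 1 - 2 * α) * 2 ∂torusMeasure) :=
          (ofReal_integral_eq_lintegral_ofReal hint (ae_of_all _ fun z => by positivity)).symm
      _ ≤ _ := by
          refine ENNReal.ofReal_le_ofReal
            (le_mul_of_one_le_right (integral_nonneg fun z => by positivity) ?_)
          exact Real.one_le_rpow (by norm_num) (by positivity)
  · have hspos : 0 < s := lt_of_le_of_ne hs0 fun h => absurd (hs' h.symm) (not_lt.2 hge)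
    -- An exponent with 2α−σ ≤ r ≤ s and 0 < r < 1. The term min(s,1/2) keeps r positive in the
    -- borderline case σ = 2α, where r = 0 would produce a logarithm in 2^n.
    obtain ⟨r, hr0, hr1, hrs, hr⟩ : ∃ r, 0 < r ∧ r < 1 ∧ r ≤ s ∧ 2 * α - σ ≤ r :=
      ⟨max (2 * α - σ) (min s (1 / 2)), lt_max_of_lt_right (lt_min hspos (by norm_num)),
        max_lt (by linarith) (by linarith [min_le_right s (1 / 2)]),
        max_le hs1 (min_le_left _ _), le_max_left _ _⟩
    have hw := integrable_rpow_mul_min hr0 hr1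
    set W := ∫ z : ℝ, |z| ^ (-1 - r) * min 1 |z| with hW
    have hW0 : 0 ≤ W := integral_nonneg fun z => by positivity
    set D := Real.pi ^ (r - (2 * α - σ)) * 2 with hD
    refine ⟨D * W, by positivity, fun n => ?_⟩
    have h2n : (0 : ℝ) < 2 ^ n := by positivity
    -- Rescaling by 2^n gives exactly 2^(nr) times a convergent integral over the line; restricting
    -- to one period only lowers it.
    have hscale : ∀ z : ℝ, |z| ^ (-1 - r) * min 1 (2 ^ n * |z|)
        = (2 ^ n) ^ (1 + r) * (|2 ^ n * z| ^ (-1 - r) * min 1 |2 ^ n * z|) := fun z => by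
      rw [abs_mul, abs_of_pos h2n, Real.mul_rpow h2n.le (abs_nonneg z), ← mul_assoc, ← mul_assoc,
        ← Real.rpow_add h2n, show 1 + r + (-1 - r) = 0 by ring, Real.rpow_zero, one_mul]
    have hint : Integrable fun z : ℝ => |z| ^ (-1 - r) * min 1 (2 ^ n * |z|) := by
      simp only [hscale]
      exact (hw.comp_mul_left' h2n.ne').const_mul _
    have hval : ∫ z : ℝ, |z| ^ (-1 - r) * min 1 (2 ^ n * |z|) = 2 ^ ((n : ℝ) * r) * W := by
      simp only [hscale]
      rw [integral_const_mul, Measure.integral_comp_mul_left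
        (fun w : ℝ => |w| ^ (-1 - r) * min 1 |w|), abs_inv, abs_of_pos h2n, smul_eq_mul,
        Real.rpow_add h2n, Real.rpow_one, Real.rpow_mul (by norm_num), Real.rpow_natCast]
      field_simp
      rfl
    calc _ ≤ ∫⁻ z, ENNReal.ofReal (D * (|z| ^ (-1 - r) * min 1 (2 ^ n * |z|))) ∂torusMeasure := by
          refine lintegral_mono_ae ?_
          filter_upwards [ae_torus_mem] with z hz
          have hz0 : 0 < |z| := abs_pos.2 hz.1
          rw [← ENNReal.ofReal_mul (by positivity)]
          refine ENNReal.ofReal_le_ofReal ?_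
          have h3 : |z| ^ (σ - 1 - 2 * α) ≤ Real.pi ^ (r - (2 * α - σ)) * |z| ^ (-1 - r) := by
            rw [show σ - 1 - 2 * α = (r - (2 * α - σ)) + (-1 - r) by ring, Real.rpow_add hz0]
            gcongr
            exact hz.2
          calc _ ≤ (Real.pi ^ (r - (2 * α - σ)) * |z| ^ (-1 - r)) * (2 * min 1 (2 ^ n * |z|)) := by
                gcongr
            _ = _ := by rw [hD]; ring
      _ ≤ ∫⁻ z, ENNReal.ofReal (D * (|z| ^ (-1 - r) * min 1 (2 ^ n * |z|))) :=
          setLIntegral_le_lintegral _ _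
      _ = ENNReal.ofReal (D * (2 ^ ((n : ℝ) * r) * W)) := by
          rw [← ofReal_integral_eq_lintegral_ofReal (hint.const_mul _)
            (ae_of_all _ fun z => by positivity), integral_const_mul, hval]
      _ ≤ _ := by
          refine ENNReal.ofReal_le_ofReal ?_
          rw [mul_comm _ W, ← mul_assoc]
          gcongr
          norm_num

namespace IsLPCutoff

variable {ψ : ℝ → ℝ} (hψ : IsLPCutoff ψ) {κ : ℝ → ℝ} (hκ : Measurable κ) {p p' : ℝ≥0∞}
  (hpp : ENNReal.HolderConjugate p p') {φ : ℝ → ℝ} (hφ : ContDiff ℝ ∞ φ)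
  (hφp : Function.Periodic φ (2 * Real.pi))
include hψ

lemma continuous_lpBlock (f : ℝ → ℝ) (n : ℕ) : Continuous (lpBlock ψ n f) := by
  obtain ⟨a, ha⟩ := hψ.exists_lpBlock_eq f n
  rw [ha]; exact continuous_trigSum _ _

include hκ hpp

lemma lintegral_mul_lpBlock_le (f : ℝ → ℝ) (n : ℕ) (b : ℝ) :
    ∫⁻ y, ‖κ y‖ₑ * ‖lpBlock ψ n f (y + b)‖ₑ ∂torusMeasure
      ≤ eLpNorm κ p torusMeasure * eLpNorm (lpBlock ψ n f) p' torusMeasure :=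
  lintegral_enorm_mul_comp_add_le hκ (hψ.continuous_lpBlock f n) (lpBlock_periodic ψ n f) hpp b

/-- The better of two bounds: the triangle inequality for shifts longer than the wavelength, and
Bernstein's inequality in degree 2^n for shorter ones. -/
lemma lintegral_mul_lpBlock_sub_le (f : ℝ → ℝ) (n : ℕ) (z : ℝ) :
    ∫⁻ y, ‖κ y‖ₑ * ‖lpBlock ψ n f (y + z) - lpBlock ψ n f y‖ₑ ∂torusMeasure
      ≤ ENNReal.ofReal (2 * min 1 (2 ^ n * |z|)) *
        (eLpNorm κ p torusMeasure * eLpNorm (lpBlock ψ n f) p' torusMeasure) := by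
  have hb := hψ.lintegral_mul_lpBlock_le hκ hpp f n
  have hc := hψ.continuous_lpBlock f n
  rcases le_total 1 (2 ^ n * |z|) with hz | hz
  · rw [min_eq_left hz, mul_one, ENNReal.ofReal_ofNat, two_mul]
    refine le_trans ?_ (add_le_add (hb z) (hb 0))
    rw [← lintegral_add_left (measurable_enorm_mul_comp_add hκ hc z)]
    refine lintegral_mono fun y => ?_
    rw [← mul_add, add_zero]
    gcongr
    exact enorm_sub_le
  · rw [min_eq_right hz]
    obtain ⟨a, ha⟩ := hψ.exists_lpBlock_eq f n
    rw [ha] at hb ⊢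
    refine (lintegral_mul_trigSum_sub_le hκ (by positivity) a hb z).trans_eq ?_
    congr 2; push_cast; ring

include hφ hφp

/-- Pairing of an `L^p` function with a function in a Besov space of nonnegative order. -/
lemma lintegral_mul_le {s : ℝ} (hs : 0 ≤ s) (b : ℝ) :
    ∫⁻ y, ‖κ y‖ₑ * ‖φ (y + b)‖ₑ ∂torusMeasure
      ≤ eLpNorm κ p torusMeasure * (ENNReal.ofReal (2 ^ s) * besovNorm ψ s p' φ) := by
  have hc := hψ.continuous_lpBlock φ
  calc _ ≤ ∫⁻ y, ∑' n, ‖κ y‖ₑ * ‖lpBlock ψ n φ (y + b)‖ₑ ∂torusMeasure := by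
        refine lintegral_mono fun y => ?_
        rw [ENNReal.tsum_mul_left]
        gcongr
        exact hψ.enorm_le_tsum hφ hφp _
    _ = ∑' n, ∫⁻ y, ‖κ y‖ₑ * ‖lpBlock ψ n φ (y + b)‖ₑ ∂torusMeasure :=
        lintegral_tsum fun n => (measurable_enorm_mul_comp_add hκ (hc n) b).aemeasurable
    _ ≤ ∑' n : ℕ, eLpNorm κ p torusMeasure * (ENNReal.ofReal (2 ^ s) *
          (ENNReal.ofReal (2 ^ (((n : ℝ) - 1) * s)) *
            eLpNorm (lpBlock ψ n φ) p' torusMeasure)) := by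
        refine ENNReal.tsum_le_tsum fun n => (hψ.lintegral_mul_lpBlock_le hκ hpp φ n b).trans ?_
        gcongr
        rw [← mul_assoc, ← ENNReal.ofReal_mul (by positivity), ← Real.rpow_add (by norm_num)]
        refine le_mul_of_one_le_left zero_le ?_
        rw [ENNReal.one_le_ofReal]
        refine Real.one_le_rpow (by norm_num) ?_
        rw [show s + ((n : ℝ) - 1) * s = n * s by ring]
        positivity
    _ = _ := by rw [ENNReal.tsum_mul_left, ENNReal.tsum_mul_left, besovNorm]

/-- Pairing of an `L^p` function with the oscillation of a function in a Besov space. -/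
lemma lintegral_kernel_mul_le {α σ s : ℝ} {C : ℝ≥0}
    (hC : ∀ n : ℕ, ∫⁻ z, ENNReal.ofReal (|z| ^ (σ - 1 - 2 * α)) *
      ENNReal.ofReal (2 * min 1 (2 ^ n * |z|)) ∂torusMeasure
        ≤ C * ENNReal.ofReal (2 ^ (((n : ℝ) - 1) * s))) :
    ∫⁻ z, ENNReal.ofReal (|z| ^ (σ - 1 - 2 * α)) *
      ∫⁻ y, ‖κ y‖ₑ * ‖φ (y + z) - φ y‖ₑ ∂torusMeasure ∂torusMeasure
      ≤ C * eLpNorm κ p torusMeasure * besovNorm ψ s p' φ := by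
  have hc := hψ.continuous_lpBlock φ
  set K := eLpNorm κ p torusMeasure
  set B := fun n => eLpNorm (lpBlock ψ n φ) p' torusMeasure
  calc _ ≤ ∫⁻ z, ∑' n, ENNReal.ofReal (|z| ^ (σ - 1 - 2 * α)) *
          (ENNReal.ofReal (2 * min 1 (2 ^ n * |z|)) * (K * B n)) ∂torusMeasure := by
        refine lintegral_mono fun z => ?_
        rw [ENNReal.tsum_mul_left]
        gcongr
        calc _ ≤ ∫⁻ y, ∑' n, ‖κ y‖ₑ * ‖lpBlock ψ n φ (y + z) - lpBlock ψ n φ y‖ₑ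
              ∂torusMeasure := by
              refine lintegral_mono fun y => ?_
              rw [ENNReal.tsum_mul_left]
              gcongr
              exact hψ.enorm_sub_le_tsum hφ hφp _ _
          _ = ∑' n, ∫⁻ y, ‖κ y‖ₑ * ‖lpBlock ψ n φ (y + z) - lpBlock ψ n φ y‖ₑ ∂torusMeasure :=
              lintegral_tsum fun n => Measurable.aemeasurable
                (measurable_enorm_mul_sub hκ (hc n) z)
          _ ≤ _ := ENNReal.tsum_le_tsum fun n => hψ.lintegral_mul_lpBlock_sub_le hκ hpp φ n z
    _ = ∑' n, (∫⁻ z, ENNReal.ofReal (|z| ^ (σ - 1 - 2 * α)) *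
          ENNReal.ofReal (2 * min 1 (2 ^ n * |z|)) ∂torusMeasure) * (K * B n) := by
        rw [lintegral_tsum fun n => Measurable.aemeasurable (by fun_prop)]
        congr 1; funext n
        rw [← lintegral_mul_const _ (by fun_prop)]
        congr 1; funext z; ring
    _ ≤ ∑' n : ℕ, C * K * (ENNReal.ofReal (2 ^ (((n : ℝ) - 1) * s)) * B n) := by
        refine ENNReal.tsum_le_tsum fun n => (mul_le_mul_left (hC n) _).trans_eq ?_
        ring
    _ = _ := by rw [ENNReal.tsum_mul_left, besovNorm]

end IsLPCutoff

/-! ### The error functional -/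

/-- The error functional in the evolution of the curvature. -/
def errorTerm (α : ℝ) (γ : ℝ → Plane) (κ φ : ℝ → ℝ) : ℝ :=
  -(∫ x, angularVelocity α γ 0 x * deriv φ x ∂torusMeasure)
    + ∫ y, ‖deriv γ y‖ ^ (1 - 2 * α) * κ y * nonlocal α φ y ∂torusMeasure

/-- Off the period one has |z| ≥ 1, so the minimum in `integrable_rpow_mul_min` equals 1 there. -/
lemma lintegral_compl_rpow_lt_top {α : ℝ} (hα : 0 < α) (hα' : α < 1 / 2) :
    ∫⁻ z in (Set.Ioc (-Real.pi) Real.pi)ᶜ, ENNReal.ofReal (|z| ^ (-1 - 2 * α)) < ⊤ := by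
  have hw := (integrable_rpow_mul_min (s := 2 * α) (by linarith) (by linarith)).lintegral_lt_top
  refine lt_of_le_of_lt ?_ hw
  refine le_trans ?_ (setLIntegral_le_lintegral (Set.Ioc (-Real.pi) Real.pi)ᶜ _)
  refine setLIntegral_mono (by fun_prop) fun z hz => ENNReal.ofReal_le_ofReal ?_
  rw [min_eq_left, mul_one]
  have h3 := Real.pi_gt_three
  by_contra! h
  have h' := abs_lt.1 h
  exact hz ⟨by linarith, by linarith⟩

namespace RegularCurve

variable {α m M c H σ : ℝ} {γ : ℝ → Plane} {κ : ℝ → ℝ} (h : RegularCurve α m M c H σ γ κ)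
include h

lemma continuous_speed_rpow (s : ℝ) : Continuous fun y => ‖deriv γ y‖ ^ s :=
  h.continuous_deriv.norm.rpow_const fun y => Or.inl (h.speed_pos y).ne'

lemma integrable_rpow_mul {u : ℝ → ℝ} (hu : Continuous u) :
    Integrable (fun y => ‖deriv γ y‖ ^ (1 - 2 * α) * κ y * u y) torusMeasure :=
  integrable_torus_iff.2 ((((h.integrable _ _).continuousOn_mul
    (h.continuous_speed_rpow _).continuousOn)).mul_continuousOn hu.continuousOn)

variable (hα' : α < 1 / 2) {φ : ℝ → ℝ} (hφ : ContDiff ℝ 1 φ)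
  (hφp : Function.Periodic φ (2 * Real.pi))
include hα' hφ hφp

lemma continuous_nonlocal : Continuous (nonlocal α φ) := by
  have h1 := AlphaPatch.continuous_nonlocal h.α_pos hα' (F := fun _ => φ) (hφ.comp contDiff_snd)
    (fun _ => hφp) (le_refl 0)
  exact h1.comp (f := fun x : ℝ => ((0 : ℝ), x)) (by fun_prop)

lemma errorTerm_add {f : ℝ → ℝ} (hf : ContDiff ℝ 1 f) (hfp : Function.Periodic f (2 * Real.pi)) :
    errorTerm α γ κ (φ + f) = errorTerm α γ κ φ + errorTerm α γ κ f := by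
  have hω := h.continuous_angularVelocity le_rfl
  have h1 : ∀ x, deriv (φ + f) x = deriv φ x + deriv f x := fun x =>
    deriv_add (hφ.differentiable one_ne_zero x) (hf.differentiable one_ne_zero x)
  simp only [errorTerm, h1, nonlocal_add h.α_pos hα' hφ hφp hf hfp, mul_add]
  have hi : ∀ {f : ℝ → ℝ}, ContDiff ℝ 1 f →
      Integrable (fun x => angularVelocity α γ 0 x * deriv f x) torusMeasure := fun hf =>
    integrable_torus_of_continuous (hω.mul (hf.continuous_deriv le_rfl))
  rw [integral_add (hi hφ) (hi hf),
    integral_add (h.integrable_rpow_mul (h.continuous_nonlocal hα' hφ hφp))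
      (h.integrable_rpow_mul (h.continuous_nonlocal hα' hf hfp))]
  ring

/-- The contribution of distant points to the nonlocal term. -/
lemma enorm_tail_le {N : ℝ≥0∞} (hN : ∀ a, ∫⁻ y, ‖κ y‖ₑ * ‖φ (y + a)‖ₑ ∂torusMeasure ≤ N) :
    ‖(∫ y, ‖deriv γ y‖ ^ (1 - 2 * α) * κ y * nonlocal α φ y ∂torusMeasure) - modelTerm α γ κ φ‖ₑ
      ≤ ENNReal.ofReal (M ^ (1 - 2 * α)) *
        ((∫⁻ z in (Set.Ioc (-Real.pi) Real.pi)ᶜ, ENNReal.ofReal (|z| ^ (-1 - 2 * α))) * (2 * N)) := by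
  have hφc := hφ.continuous
  have hm := h.measurable
  have hi := fun y => integrable_nonlocal h.α_pos hα' hφ hφp y
  set μ : Measure ℝ := volume.restrict (Set.Ioc (-Real.pi) Real.pi)ᶜ with hμ
  have hsplit : ∀ y, nonlocal α φ y - ∫ z, oddKernel α z * (φ (y + z) - φ y) ∂torusMeasure
      = ∫ z, oddKernel α z * (φ (y + z) - φ y) ∂μ := fun y => by
    rw [nonlocal, torusMeasure, ← integral_add_compl measurableSet_Ioc (hi y)]; ring
  have hcont : Continuous fun y => ∫ z, oddKernel α z * (φ (y + z) - φ y) ∂torusMeasure := by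
    obtain ⟨A, hA0, hA⟩ := exists_increment_bound' hφ hφp
    refine continuous_of_dominated (bound := fun z => A * (|z| ^ (-1 - 2 * α) * min 1 |z|))
      (fun y => ?_) (fun y => ae_of_all _ fun z => abs_oddKernel_mul_le (hA y z))
      (((integrable_rpow_mul_min (s := 2 * α) (by linarith [h.α_pos])
        (by linarith)).const_mul A).restrict) (ae_of_all _ fun z => by fun_prop)
    exact (measurable_oddKernel α).aestronglyMeasurable.mul
      (Continuous.aestronglyMeasurable (by fun_prop))
  rw [modelTerm, ← integral_sub (h.integrable_rpow_mul (h.continuous_nonlocal hα' hφ hφp))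
    (h.integrable_rpow_mul hcont)]
  simp only [← mul_sub, hsplit]
  have hmeas : Measurable fun w : ℝ × ℝ => ‖κ w.1‖ₑ *
      (ENNReal.ofReal (|w.2| ^ (-1 - 2 * α)) * ‖φ (w.1 + w.2) - φ w.1‖ₑ) := by
    have := hφc.measurable
    fun_prop
  calc _ ≤ ∫⁻ y, ENNReal.ofReal (M ^ (1 - 2 * α)) * ∫⁻ z, ‖κ y‖ₑ *
          (ENNReal.ofReal (|z| ^ (-1 - 2 * α)) * ‖φ (y + z) - φ y‖ₑ) ∂μ ∂torusMeasure := by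
        refine (enorm_integral_le_lintegral_enorm _).trans (lintegral_mono fun y => ?_)
        rw [enorm_mul, enorm_mul, mul_assoc, Real.enorm_of_nonneg (by positivity)]
        gcongr
        · linarith
        · exact h.upper y
        · rw [lintegral_const_mul _ (by have := hφc.measurable; fun_prop)]
          gcongr
          refine (enorm_integral_le_lintegral_enorm _).trans (lintegral_mono fun z => ?_)
          rw [enorm_mul]
          gcongr
          rcases eq_or_ne z 0 with rfl | hz
          · simp [oddKernel]
          · rw [Real.enorm_eq_ofReal_abs, abs_oddKernel hz]
    _ = ENNReal.ofReal (M ^ (1 - 2 * α)) * ∫⁻ z, ENNReal.ofReal (|z| ^ (-1 - 2 * α)) *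
          ∫⁻ y, ‖κ y‖ₑ * ‖φ (y + z) - φ y‖ₑ ∂torusMeasure ∂μ := by
        rw [lintegral_const_mul _ hmeas.lintegral_prod_right',
          lintegral_lintegral_swap hmeas.aemeasurable]
        congr 2; funext z
        rw [← lintegral_const_mul _ (by have := hφc.measurable; fun_prop)]
        congr 1; funext y; ring
    _ ≤ ENNReal.ofReal (M ^ (1 - 2 * α)) * ∫⁻ z, ENNReal.ofReal (|z| ^ (-1 - 2 * α)) *
          (2 * N) ∂μ := by
        gcongr with z
        rw [two_mul]
        refine le_trans ?_ (add_le_add (hN z) (hN 0))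
        rw [← lintegral_add_left (by have := hφc.measurable; fun_prop)]
        refine lintegral_mono fun y => ?_
        rw [← mul_add, add_zero]
        gcongr
        exact enorm_sub_le
    _ = _ := by rw [lintegral_mul_const _ (by fun_prop)]

end RegularCurve

lemma errorTerm_smul (α : ℝ) (γ : ℝ → Plane) (κ : ℝ → ℝ) (a : ℝ) (φ : ℝ → ℝ) :
    errorTerm α γ κ (a • φ) = a * errorTerm α γ κ φ := by
  simp only [errorTerm, deriv_const_smul_field, nonlocal_smul, mul_left_comm _ a,
    smul_eq_mul]
  rw [integral_const_mul, integral_const_mul]; ring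

/-- The error functional is of lower order. -/
lemma exists_errorTerm_bound {α σ s : ℝ} (m M c H : ℝ) (hα : 0 < α) (hα' : α < 1 / 2) (hσ : 0 < σ)
    (hs : max (2 * α - σ) 0 ≤ s) (hs' : s = 0 → 2 * α < σ) :
    ∃ C : ℝ≥0, ∀ {γ : ℝ → Plane} {κ : ℝ → ℝ}, RegularCurve α m M c H σ γ κ →
      ∀ {ψ : ℝ → ℝ}, IsLPCutoff ψ → ∀ {p p' : ℝ≥0∞}, ENNReal.HolderConjugate p p' →
      ∀ {φ : ℝ → ℝ}, ContDiff ℝ ∞ φ → Function.Periodic φ (2 * Real.pi) →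
        ‖errorTerm α γ κ φ‖ₑ ≤ C * eLpNorm κ p torusMeasure * besovNorm ψ s p' φ := by
  obtain ⟨C₀, hC₀⟩ := exists_lintegral_kernel_le hα hα' hσ hs hs'
  set C₁ : ℝ≥0∞ := (∫⁻ z, ENNReal.ofReal M * ENNReal.ofReal (oscConst α M c H * |z| ^ (σ - 1)) * 2
        ∂torusMeasure) + ENNReal.ofReal (2 * α)⁻¹ *
          (ENNReal.ofReal (M ^ 2 * c ^ (-2 * α) * H * Real.pi ^ σ) * (2 * ENNReal.ofReal H)) with hC₁
  set W := ∫⁻ z in (Set.Ioc (-Real.pi) Real.pi)ᶜ, ENNReal.ofReal (|z| ^ (-1 - 2 * α)) with hW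
  set C : ℝ≥0∞ := C₁ * ENNReal.ofReal (2 ^ s)
    + ENNReal.ofReal M * ENNReal.ofReal (modelConst α m M c H) * C₀
    + ENNReal.ofReal (M ^ (1 - 2 * α)) * (W * (2 * ENNReal.ofReal (2 ^ s))) with hC
  have hW' : W ≠ ⊤ := (lintegral_compl_rpow_lt_top hα hα').ne
  have hC₁' : C₁ ≠ ⊤ := by
    refine ENNReal.add_ne_top.2 ⟨?_, by finiteness⟩
    rw [lintegral_mul_const _ (by fun_prop), lintegral_const_mul _ (by fun_prop)]
    have := ((integrable_torus_rpow (s := σ - 1) (by linarith)).const_mul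
      (oscConst α M c H)).lintegral_lt_top.ne
    finiteness
  refine ⟨C.toNNReal, fun {γ κ} h {ψ} hψ {p p'} hpp {φ} hφ hφp => ?_⟩
  have hCt : C ≠ ⊤ := by rw [hC]; finiteness
  rw [ENNReal.coe_toNNReal hCt]
  have hs0 : 0 ≤ s := (le_max_right _ _).trans hs
  have hφ1 : ContDiff ℝ 1 φ := hφ.of_le (by simp)
  have hN := hψ.lintegral_mul_le h.measurable hpp hφ hφp hs0
  set K := eLpNorm κ p torusMeasure
  set B := besovNorm ψ s p' φ
  have e1 := h.enorm_angularVelocity_add_mainTerm_le hφ1 hφp hα' hN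
  have e2 := (h.enorm_mainTerm_sub_modelTerm_le hφ1 hφp hα').trans
    (mul_le_mul_right (hψ.lintegral_kernel_mul_le h.measurable hpp hφ hφp hC₀) _)
  have e3 := h.enorm_tail_le hα' hφ1 hφp hN
  -- Three comparisons: the angular velocity with the leading term, the leading term with its
  -- homogeneous model on one period, and that model with the convolution over the whole line. Only
  -- the second one uses the smoothness of φ beyond s ≥ 0.
  rw [show errorTerm α γ κ φ =
    ((-(∫ x, angularVelocity α γ 0 x * deriv φ x ∂torusMeasure) + mainTerm α γ κ φ 0)
      - (mainTerm α γ κ φ 0 - modelTerm α γ κ φ))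
    + ((∫ y, ‖deriv γ y‖ ^ (1 - 2 * α) * κ y * nonlocal α φ y ∂torusMeasure)
      - modelTerm α γ κ φ) by rw [errorTerm]; ring]
  refine (enorm_add_le _ _).trans ((add_le_add (enorm_sub_le.trans (add_le_add e1 e2)) e3).trans_eq ?_)
  rw [hC]; ring

/-! ### Regularity of the boundary parametrizations of a Sobolev domain -/

/-- A measurable representative on one period is repeated; countably many translates of a null set
are null. Measurability everywhere and exact periodicity are both required by the later uses of
Fubini and of shifts. -/
lemma exists_measurable_periodic {κ : ℝ → ℝ} (hp : Function.Periodic κ (2 * Real.pi))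
    (hm : AEStronglyMeasurable κ torusMeasure) :
    ∃ κ' : ℝ → ℝ, Measurable κ' ∧ Function.Periodic κ' (2 * Real.pi) ∧ κ' =ᵐ[volume] κ := by
  have hpi := Real.two_pi_pos
  refine ⟨fun x => hm.mk κ (toIocMod hpi (-Real.pi) x), ?_, fun x => ?_, ?_⟩
  · refine hm.stronglyMeasurable_mk.measurable.comp ?_
    rw [funext (toIocMod_eq_sub_fract_mul hpi (-Real.pi))]
    exact measurable_const.sub (((measurable_const.sub measurable_id).div_const _).fract.mul_const _)
  · exact congrArg (hm.mk κ) (toIocMod_add_right hpi _ x)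
  · have h1 : ∀ᵐ x, x ∈ Set.Ioc (-Real.pi) Real.pi → κ x = hm.mk κ x :=
      (ae_restrict_iff' measurableSet_Ioc).1 hm.ae_eq_mk
    have h2 : ∀ᵐ x : ℝ, ∀ k : ℤ, x - k • (2 * Real.pi) ∈ Set.Ioc (-Real.pi) Real.pi →
        κ (x - k • (2 * Real.pi)) = hm.mk κ (x - k • (2 * Real.pi)) := ae_all_iff.2 fun k =>
      (measurePreserving_sub_right (volume : Measure ℝ)
        (k • (2 * Real.pi))).quasiMeasurePreserving.ae h1
    filter_upwards [h2] with x hx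
    have h3 := hx (toIocDiv hpi (-Real.pi) x)
    rw [self_sub_toIocDiv_zsmul] at h3
    have h4 := toIocMod_mem_Ioc hpi (-Real.pi) x
    rw [show -Real.pi + 2 * Real.pi = Real.pi by ring] at h4
    rw [← h3 h4, toIocMod]
    exact hp.sub_zsmul_eq _

lemma IsWeakDeriv.congr_ae {f w w' : ℝ → Plane} (h : IsWeakDeriv f w) (hw : w =ᵐ[volume] w') :
    IsWeakDeriv f w' := fun a b => by
  refine ⟨(h a b).1.congr_ae (hw.filter_mono (ae_mono Measure.restrict_le_self)), ?_⟩
  rw [(h a b).2]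
  exact intervalIntegral.integral_congr_ae (hw.mono fun x hx _ => hx)

section HolderNorm

variable {σ : ℝ} {f : ℝ → Plane} {M : ℝ≥0} (h : holderNorm σ f ≤ M)
include h

lemma norm_deriv_le_of_holderNorm_le (x : ℝ) : ‖deriv f x‖ ≤ M := by
  have h1 : ‖deriv f x‖ₑ ≤ M :=
    ((le_iSup (fun x => ‖deriv f x‖ₑ) x).trans (le_add_right le_add_self)).trans h
  rw [← ofReal_norm, ENNReal.ofReal_le_iff_le_toReal ENNReal.coe_ne_top] at h1
  exact h1

lemma norm_deriv_sub_le_of_holderNorm_le (x y : ℝ) :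
    ‖deriv f x - deriv f y‖ ≤ M * |x - y| ^ σ := by
  rcases eq_or_ne x y with rfl | hxy
  · rw [sub_self, norm_zero]; positivity
  have hpos : 0 < |x - y| := abs_pos.2 (sub_ne_zero.2 hxy)
  have h1 : ‖deriv f x - deriv f y‖ₑ / ‖x - y‖ₑ ^ σ ≤ M :=
    ((le_iSup₂ (f := fun x y => ‖deriv f x - deriv f y‖ₑ / ‖x - y‖ₑ ^ σ) x y).trans
      le_add_self).trans h
  rw [Real.enorm_eq_ofReal_abs, ENNReal.ofReal_rpow_of_pos hpos] at h1
  have hpos' : 0 < |x - y| ^ σ := Real.rpow_pos_of_pos hpos _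
  rw [ENNReal.div_le_iff (by simpa using hpos') ENNReal.ofReal_ne_top, ← ofReal_norm,
    show (M : ℝ≥0∞) = ENNReal.ofReal (M : ℝ) by simp, ← ENNReal.ofReal_mul (by positivity)] at h1
  exact (ENNReal.ofReal_le_ofReal_iff (by positivity)).1 h1

end HolderNorm

/-- The parametrizations of the boundary of a `W^{2,p}` domain are regular. -/
lemma IsParam.exists_regularCurve {A : Set Plane} {γ : ℝ → Plane} {κ : ℝ → ℝ} {α σ m c : ℝ}
    {p : ℝ≥0∞} {M B : ℝ≥0} (hA : IsJordanDomain A) (h : IsParam A (2 * Real.pi) γ)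
    (hκ : IsCurvatureAlong A γ κ) (hα : 0 < α) (hp : 1 ≤ p) (hσ : σ = 1 - (p⁻¹).toReal - 2 * α)
    (hσ0 : 0 < σ) (hm : 0 < m) (hc : 0 < c) (hM : holderNorm σ γ ≤ M) (hg : ∀ x, m ≤ ‖deriv γ x‖)
    (hB : eLpNorm κ p torusMeasure ≤ B)
    (hch : ∀ x y, |x - y| ≤ Real.pi → c * |x - y| ≤ ‖γ x - γ y‖) :
    ∃ κ' : ℝ → ℝ, κ' =ᵐ[volume] κ ∧
      RegularCurve α m M c (max (M * B) (2 * (B * Real.pi ^ (σ + 2 * α)))) σ γ κ' := by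
  have hpi := Real.pi_pos
  have hper := hκ.periodic h
  have hint := hκ.intervalIntegrable_self hA h
  have hwd := hκ.isWeakDeriv hA h
  have hβ : σ + 2 * α = 1 - (p⁻¹).toReal := by rw [hσ]; ring
  obtain ⟨κ', hκm, hκp, hκe⟩ := exists_measurable_periodic hper
    (integrable_torus_iff.2 (hint _ _)).aestronglyMeasurable
  refine ⟨κ', hκe, ?_⟩
  have hMg := norm_deriv_le_of_holderNorm_le hM
  have hH := fun x y hxy => abs_integral_abs_le_rpow hp hper hint hB (x := x) (y := y) hxy
  rw [← hβ] at hH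
  exact
    { m_pos := hm
      c_pos := hc
      α_pos := hα
      σ_pos := hσ0
      contDiff := h.contDiff
      periodic := h.periodic
      lower := hg
      upper := hMg
      chord := hch
      holder := norm_deriv_sub_le_of_holderNorm_le hM
      tangent_holder := fun x y hxy => by
        rw [norm_sub_rev]
        refine (norm_tangent_sub_le hwd h.norm_tangent).trans ?_
        have h1 : |∫ u in x..y, ‖deriv γ u‖ * ‖κ u‖| ≤ M * |∫ u in x..y, ‖κ u‖| := by
          rw [intervalIntegral.abs_intervalIntegral_eq, intervalIntegral.abs_intervalIntegral_eq,
            abs_of_nonneg (integral_nonneg fun u => by positivity),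
            abs_of_nonneg (integral_nonneg fun u => by positivity), ← integral_const_mul]
          have hi := (hint x y).norm
          refine integral_mono
            (intervalIntegrable_iff.1 (hi.continuousOn_mul h.continuous_deriv.norm.continuousOn))
            ((intervalIntegrable_iff.1 hi).const_mul _) fun u => ?_
          exact mul_le_mul_of_nonneg_right (hMg u) (norm_nonneg _)
        refine h1.trans ((mul_le_mul_of_nonneg_left (hH x y hxy) M.2).trans ?_)
        rw [← mul_assoc]
        gcongr
        exact le_max_left _ _
      measurable := hκm
      curvature_periodic := hκp
      integrable := fun a b => (hint a b).congr_ae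
        (hκe.symm.filter_mono (ae_mono Measure.restrict_le_self))
      frenet := hwd.congr_ae (hκe.symm.mono fun x hx => by simp only [hx])
      integral_le := by
        have h1 : ∫ x, |κ' x| ∂torusMeasure = ∫ x, |κ x| ∂torusMeasure :=
          integral_congr_ae ((hκe.filter_mono (ae_mono Measure.restrict_le_self)).mono
            fun x hx => by simp only [hx])
        -- Hölder's inequality was set up for intervals of length at most π, so the period is
        -- halved; this is the origin of the factor 2 in the constant.
        rw [h1, ← integral_torus_eq, ← intervalIntegral.integral_add_adjacent_intervals
          (hint (-Real.pi) 0).abs (hint 0 Real.pi).abs, two_mul]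
        refine le_trans (add_le_add ?_ ?_) (le_max_right _ _)
        · have := hH (-Real.pi) 0 (by simp [abs_of_pos hpi])
          rw [show |-Real.pi - 0| = Real.pi by simp [abs_of_pos hpi]] at this
          exact (le_abs_self _).trans this
        · have := hH 0 Real.pi (by simp [abs_of_pos hpi])
          rw [show |0 - Real.pi| = Real.pi by simp [abs_of_pos hpi]] at this
          exact (le_abs_self _).trans this }

/-! ### Assembling the curvature equation -/

namespace RegularFlow

variable {α m M c H σ T : ℝ} {Ω : ℝ → Set Plane} {γ : ℝ → ℝ → Plane} {κ : ℝ → ℝ → ℝ}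
  (h : RegularFlow α m M c H σ T Ω γ κ)
include h

/-- The error functional as a family of linear functionals. -/
def error : ℝ → TestFun →ₗ[ℝ] ℝ := fun t =>
  { toFun := fun φ => errorTerm α (γ (clamp T t)) (κ (clamp T t)) φ.1
    map_add' := fun φ f => (h.regular_clamp t).errorTerm_add h.α_lt (φ.2.1.of_le (by simp)) φ.2.2
      (f.2.1.of_le (by simp)) f.2.2
    map_smul' := fun a φ => errorTerm_smul α _ _ a φ.1 }

lemma error_apply {t : ℝ} (ht : t ∈ Set.Icc 0 T) (φ : TestFun) :
    h.error t φ = errorTerm α (γ t) (κ t) φ.1 := by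
  change errorTerm α (γ (clamp T t)) (κ (clamp T t)) φ.1 = _
  rw [clamp_of_mem ht]

/-- Replaces the convolution by the Fourier multiplier. In this form the error is visibly the
angular velocity term minus the dispersive term of the equation, so adding it back makes the
evolution an identity. -/
lemma error_eq {t : ℝ} (ht : t ∈ Set.Icc 0 T) (φ : TestFun) :
    h.error t φ = -(∫ x, spaceTimeAngular α T γ t x * deriv φ.1 x ∂torusMeasure)
      + symbolConst α * ∫ x, ‖deriv (γ t) x‖ ^ (1 - 2 * α) * κ t x * dispersive α φ.1 x
        ∂torusMeasure := by
  rw [h.error_apply ht, errorTerm, ← integral_const_mul]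
  simp only [spaceTimeAngular, clamp_of_mem ht]
  congr 2; funext x
  rw [← symbolConst_mul_dispersive (h.regular t ht).α_pos h.α_lt φ.2.1 φ.2.2]; ring

variable {φ : ℝ → TestFun} (hφ : ContDiff ℝ ∞ fun z : ℝ × ℝ => (φ z.1).1 z.2)
include hφ

lemma intervalIntegrable_time_deriv : IntervalIntegrable (fun t =>
    ∫ x, ‖deriv (γ t) x‖ * κ t x * deriv (fun τ => (φ τ).1 x) t ∂torusMeasure) volume 0 T := by
  have hd : ∀ t x, HasDerivAt (fun τ => (φ τ).1 x)
      (fderiv ℝ (fun z : ℝ × ℝ => (φ z.1).1 z.2) (t, x) (1, 0)) t := fun t x => by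
    have := ((hφ.differentiable (by simp)) (t, x)).hasFDerivAt.comp_hasDerivAt t
      ((hasDerivAt_id t).prodMk (hasDerivAt_const t x))
    exact this
  refine h.intervalIntegrable_integral_curvature_mul
    (F := fun t x => deriv (fun τ => (φ τ).1 x) t) ?_ fun t x => ?_
  · simp only [(hd _ _).deriv]
    exact ((hφ.fderiv_right (m := 0) (by simp)).clm_apply contDiff_const).continuous
  · simp only [(φ _).2.2 x]

lemma intervalIntegrable_dispersive : IntervalIntegrable (fun t =>
    ∫ x, ‖deriv (γ t) x‖ ^ (1 - 2 * α) * κ t x * dispersive α (φ t).1 x ∂torusMeasure)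
    volume 0 T := by
  have hT := h.T_nonneg
  have hα := (h.regular 0 h.zero_mem).α_pos
  have hS := symbolConst_pos hα h.α_lt
  have h1 := AlphaPatch.continuous_nonlocal hα h.α_lt (F := fun t => (φ t).1)
    (hφ.of_le (by simp)) (fun t => (φ t).2.2) hT
  -- The weight g^(1−2α) κ is gκ times the continuous factor g^(−2α), which is moved into the test
  -- function so that the integrability result for pairings with gκ applies.
  have h2 : Continuous fun w : ℝ × ℝ => ‖deriv (γ (clamp T w.1)) w.2‖ ^ (-(2 * α)) :=
    h.continuous_deriv.norm.rpow_const fun w => Or.inl ((h.regular_clamp w.1).speed_pos w.2).ne'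
  refine (h.intervalIntegrable_integral_curvature_mul
    (F := fun t x => ‖deriv (γ (clamp T t)) x‖ ^ (-(2 * α)) *
      ((symbolConst α)⁻¹ * nonlocal α (φ (clamp T t)).1 x))
    (h2.mul (continuous_const.mul h1)) fun t x => ?_).congr fun t ht => ?_
  · simp only [(h.regular_clamp t).periodic_deriv x, nonlocal_periodic α (φ _).2.2 x]
  · rw [Set.uIoc_of_le hT] at ht
    have ht' : t ∈ Set.Icc 0 T := ⟨ht.1.le, ht.2⟩
    simp only [clamp_of_mem ht']
    congr 1; funext x
    rw [← symbolConst_mul_dispersive hα h.α_lt (φ t).2.1 (φ t).2.2, inv_mul_cancel_left₀ hS.ne',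
      show 1 - 2 * α = 1 + -(2 * α) by ring,
      Real.rpow_add ((h.regular t ht').speed_pos x), Real.rpow_one]
    ring

lemma intervalIntegrable_angular : IntervalIntegrable (fun t =>
    ∫ x, spaceTimeAngular α T γ t x * deriv (φ t).1 x ∂torusMeasure) volume 0 T := by
  have hd : ∀ t x, HasDerivAt (φ t).1
      (fderiv ℝ (fun z : ℝ × ℝ => (φ z.1).1 z.2) (t, x) (0, 1)) x := fun t x =>
    ((hφ.differentiable (by simp)) (t, x)).hasFDerivAt.comp_hasDerivAt x
      ((hasDerivAt_const x t).prodMk (hasDerivAt_id x))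
  refine Continuous.intervalIntegrable (continuous_integral_torus
    (f := fun t x => spaceTimeAngular α T γ t x * deriv (φ t).1 x) ?_) _ _
  simp only [(hd _ _).deriv]
  exact h.continuous_spaceTimeAngular.mul
    ((hφ.fderiv_right (m := 0) (by simp)).clm_apply contDiff_const).continuous

lemma intervalIntegrable_error : IntervalIntegrable (fun t => h.error t (φ t)) volume 0 T := by
  refine ((h.intervalIntegrable_angular hφ).neg.add
    ((h.intervalIntegrable_dispersive hφ).const_mul (symbolConst α))).congr fun t ht => ?_
  rw [Set.uIoc_of_le h.T_nonneg] at ht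
  exact (h.error_eq ⟨ht.1.le, ht.2⟩ (φ t)).symm

/-- The evolution equation of the curvature, in weak form. -/
lemma integral_curvature_sub_eq :
    (∫ x, ‖deriv (γ T) x‖ * κ T x * (φ T).1 x ∂torusMeasure)
      - ∫ x, ‖deriv (γ 0) x‖ * κ 0 x * (φ 0).1 x ∂torusMeasure
      = (∫ t in (0 : ℝ)..T, ∫ x, ‖deriv (γ t) x‖ * κ t x * deriv (fun τ => (φ τ).1 x) t
          ∂torusMeasure)
        - symbolConst α * (∫ t in (0 : ℝ)..T, ∫ x, ‖deriv (γ t) x‖ ^ (1 - 2 * α) * κ t x *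
          dispersive α (φ t).1 x ∂torusMeasure)
        + ∫ t in (0 : ℝ)..T, h.error t (φ t) := by
  have h1 := h.integral_curvature_sub hφ fun t x => (φ t).2.2 x
  simp only at h1
  have i1 : IntervalIntegrable (fun t => -∫ x, spaceTimeAngular α T γ t x * deriv (φ t).1 x
    ∂torusMeasure) volume 0 T := (h.intervalIntegrable_angular hφ).neg
  have h2 : ∫ t in (0 : ℝ)..T, h.error t (φ t) = ∫ t in (0 : ℝ)..T,
      (-(∫ x, spaceTimeAngular α T γ t x * deriv (φ t).1 x ∂torusMeasure)
      + symbolConst α * ∫ x, ‖deriv (γ t) x‖ ^ (1 - 2 * α) * κ t x * dispersive α (φ t).1 x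
        ∂torusMeasure) := by
    refine intervalIntegral.integral_congr fun t ht => ?_
    rw [Set.uIcc_of_le h.T_nonneg] at ht
    exact h.error_eq ht (φ t)
  rw [h1, h2, intervalIntegral.integral_add i1
    ((h.intervalIntegrable_dispersive hφ).const_mul (symbolConst α)),
    intervalIntegral.integral_neg, intervalIntegral.integral_const_mul]
  ring

end RegularFlow

/-- A chord-arc constant for all flows of a patch. -/
lemma exists_chord_of_flow {α σ T : ℝ} {Ω : ℝ → Set Plane} (hT : 0 ≤ T)
    (hΩ : ∀ t ∈ Set.Icc 0 T, IsJordanDomain (Ω t)) {m : ℝ} (hm : 0 < m) :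
    ∃ c > 0, ∀ γ : ℝ → ℝ → Plane, IsFlow α T Ω γ → ContinuousInHolder σ T γ →
      (∀ t ∈ Set.Icc 0 T, ∀ x, m ≤ ‖deriv (γ t) x‖) →
      ∀ t ∈ Set.Icc 0 T, ∀ x y, |x - y| ≤ Real.pi → c * |x - y| ≤ ‖γ t x - γ t y‖ := by
  -- One flow is fixed as a reference and every other flow is compared with it through
  -- `chord_of_reparam`, so the constant depends on the patch and on m, not on the flow. Without any
  -- flow there is nothing to prove.
  by_cases hex : ∃ γ₀ : ℝ → ℝ → Plane, IsFlow α T Ω γ₀ ∧ ContinuousInHolder σ T γ₀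
  · obtain ⟨γ₀, h₀, hc₀⟩ := hex
    obtain ⟨c, hc, M, hM, hcM⟩ := exists_uniform_chord (γ := fun t => γ₀ (clamp T t))
      (Ω := fun t => Ω (clamp T t)) (fun t => h₀.param _ (clamp_mem hT t))
      (continuous_flow hT h₀ hc₀).2 T
    refine ⟨c * (m / M), by positivity, fun γ hγ _ hg t ht => ?_⟩
    have h1 := hcM t ht
    simp only [clamp_of_mem ht] at h1
    exact chord_of_reparam (hΩ t ht) (hγ.param t ht) (h₀.param t ht) hm hM hc (hg t ht) h1.1 h1.2
  · exact ⟨1, one_pos, fun γ hγ hc => absurd ⟨γ, hγ, hc⟩ hex⟩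

lemma integral_torus_congr {f f' : ℝ → ℝ} (h : f =ᵐ[volume] f') :
    ∫ x in (-Real.pi)..Real.pi, f x = ∫ x, f' x ∂torusMeasure := by
  rw [integral_torus_eq]
  exact integral_congr_ae (h.filter_mono (ae_mono Measure.restrict_le_self))

end AlphaPatch

end

theorem theorem4p5 (α : ℝ) (hα : 0 < α) (hα' : α < 1 / 2) :
    ∃ c : ℝ, 0 < c ∧
      ∀ (ψ : ℝ → ℝ), AlphaPatch.IsLPCutoff ψ →
      ∀ (p p' : ℝ≥0∞), ENNReal.ofReal (1 / (1 - 2 * α)) < p → ENNReal.HolderConjugate p p' →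
      ∀ (σ : ℝ), σ = 1 - (p⁻¹).toReal - 2 * α →
      ∀ (s : ℝ), max (2 * α - σ) 0 ≤ s → (s = 0 → 2 * α < σ) →
      ∀ (T : ℝ), 0 < T →
      ∀ (Ω : ℝ → Set AlphaPatch.Plane), AlphaPatch.IsSobolevAlphaPatch α p T Ω →
      ∀ (M : ℝ≥0) (m : ℝ), 0 < m →
      ∃ C : ℝ≥0,
        ∀ (γ : ℝ → ℝ → AlphaPatch.Plane), AlphaPatch.IsFlow α T Ω γ →
        AlphaPatch.ContinuousInHolder σ T γ →
        (∀ t ∈ Set.Icc 0 T, AlphaPatch.holderNorm σ (γ t) ≤ M) →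
        (∀ t ∈ Set.Icc 0 T, ∀ x, m ≤ AlphaPatch.metric γ t x) →
        ∀ (κ : ℝ → ℝ → ℝ),
        (∀ t ∈ Set.Icc 0 T, AlphaPatch.IsCurvatureAlong (Ω t) (γ t) (κ t)) →
        ∃ E : ℝ → (AlphaPatch.TestFun →ₗ[ℝ] ℝ),
          (∀ t ∈ Set.Icc 0 T, ∀ φ : AlphaPatch.TestFun,
            ‖E t φ‖ₑ ≤ C * eLpNorm (κ t) p AlphaPatch.torusMeasure
              * AlphaPatch.besovNorm ψ s p' φ.1) ∧
          ∀ φ : ℝ → AlphaPatch.TestFun,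
            ContDiff ℝ ∞ (fun z : ℝ × ℝ => (φ z.1).1 z.2) →
            IntervalIntegrable (fun t => ∫ x in (-Real.pi)..Real.pi,
              AlphaPatch.metric γ t x * κ t x * deriv (fun τ => (φ τ).1 x) t) volume 0 T ∧
            IntervalIntegrable (fun t => ∫ x in (-Real.pi)..Real.pi,
              AlphaPatch.metric γ t x ^ (1 - 2 * α) * κ t x
                * AlphaPatch.dispersive α (φ t).1 x) volume 0 T ∧
            IntervalIntegrable (fun t => E t (φ t)) volume 0 T ∧
            (∫ x in (-Real.pi)..Real.pi, κ T x * (φ T).1 x * AlphaPatch.metric γ T x)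
              - (∫ x in (-Real.pi)..Real.pi, κ 0 x * (φ 0).1 x * AlphaPatch.metric γ 0 x)
              = (∫ t in (0 : ℝ)..T, ∫ x in (-Real.pi)..Real.pi,
                    AlphaPatch.metric γ t x * κ t x * deriv (fun τ => (φ τ).1 x) t)
                - c * (∫ t in (0 : ℝ)..T, ∫ x in (-Real.pi)..Real.pi,
                    AlphaPatch.metric γ t x ^ (1 - 2 * α) * κ t x
                      * AlphaPatch.dispersive α (φ t).1 x)
                + ∫ t in (0 : ℝ)..T, E t (φ t) := by
  refine ⟨AlphaPatch.symbolConst α, AlphaPatch.symbolConst_pos hα hα', ?_⟩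
  intro ψ hψ p p' hp hpp σ hσ s hs hs' T hT Ω hΩ M m hm
  have h2α : 0 < 1 - 2 * α := by linarith
  have hp1 : 1 ≤ p := by
    refine le_trans ?_ hp.le
    rw [ENNReal.one_le_ofReal, le_div_iff₀ h2α]
    linarith
  -- The lower bound on p is exactly the positivity of σ, the source of every integrable singularity
  -- |z|^(σ−1).
  have hσ0 : 0 < σ := by
    have h1 : p⁻¹ < ENNReal.ofReal (1 - 2 * α) := by
      rw [ENNReal.inv_lt_iff_inv_lt, ← ENNReal.ofReal_inv_of_pos h2α, ← one_div]
      exact hp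
    have h2 := (ENNReal.lt_ofReal_iff_toReal_lt h1.ne_top).1 h1
    rw [hσ]
    linarith
  obtain ⟨B, hB⟩ := hΩ.bounded
  obtain ⟨c, hc, hch⟩ := AlphaPatch.exists_chord_of_flow (α := α) (σ := σ) hT.le hΩ.domain hm
  -- A bound for the L^p norm of κ in the label variable, uniform in time and over all flows with
  -- speed at least m. It enters the constants as a fixed number, so the final estimate can still be
  -- linear in the actual norm of κ.
  set B' : ℝ≥0 := (ENNReal.ofReal m⁻¹ ^ (1 / p).toReal * B).toNNReal with hB'
  have hB't : ENNReal.ofReal m⁻¹ ^ (1 / p).toReal * B ≠ ⊤ := by finiteness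
  obtain ⟨C, hC⟩ := AlphaPatch.exists_errorTerm_bound m M c
    (max (M * B') (2 * (B' * Real.pi ^ (σ + 2 * α)))) hα hα' hσ0 hs hs'
  refine ⟨C, fun γ hγ hγc hM hg κ hκ => ?_⟩
  have hreg := fun t (ht : t ∈ Set.Icc 0 T) =>
    (hγ.param t ht).exists_regularCurve (hΩ.domain t ht) (hκ t ht) hα hp1 hσ hσ0 hm hc (hM t ht)
      (hg t ht) (B := B') (by
        rw [hB', ENNReal.coe_toNNReal hB't]
        exact AlphaPatch.eLpNorm_curvature_le (hΩ.domain t ht) (hγ.param t ht) (hκ t ht) (hB t ht)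
          hm (hg t ht)) (hch γ hγ hγc hg t ht)
  -- The given curvature is replaced at each time by a measurable periodic representative; the
  -- integrals and norms in the statement do not see the difference.
  choose! κ' hκe hκr using hreg
  have hcont := AlphaPatch.continuous_flow hT.le hγ hγc
  have h : AlphaPatch.RegularFlow α m M c (max (M * B') (2 * (B' * Real.pi ^ (σ + 2 * α)))) σ T Ω
      γ κ' :=
    { T_nonneg := hT.le
      α_lt := hα'
      domain := hΩ.domain
      flow := hγ
      regular := hκr
      continuous := hcont.1
      continuous_deriv := hcont.2 }
  have hcongr : ∀ t ∈ Set.Icc 0 T, ∀ u v : ℝ → ℝ,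
      ∫ x in (-Real.pi)..Real.pi, u x * κ t x * v x
        = ∫ x, u x * κ' t x * v x ∂AlphaPatch.torusMeasure := fun t ht u v =>
    AlphaPatch.integral_torus_congr ((hκe t ht).mono fun x hx => by simp only [hx])
  have hcongr' : ∀ t ∈ Set.Icc 0 T, ∀ v : ℝ → ℝ,
      ∫ x in (-Real.pi)..Real.pi, κ t x * v x * AlphaPatch.metric γ t x
        = ∫ x, ‖deriv (γ t) x‖ * κ' t x * v x ∂AlphaPatch.torusMeasure := fun t ht v =>
    AlphaPatch.integral_torus_congr ((hκe t ht).mono fun x hx => by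
      simp only [hx, AlphaPatch.metric]; ring)
  have hIoc : ∀ t ∈ Set.uIoc 0 T, t ∈ Set.Icc 0 T := fun t ht => by
    rw [Set.uIoc_of_le hT.le] at ht
    exact ⟨ht.1.le, ht.2⟩
  have hIcc : ∀ t ∈ Set.uIcc 0 T, t ∈ Set.Icc 0 T := fun t ht => by
    rwa [Set.uIcc_of_le hT.le] at ht
  refine ⟨h.error, fun t ht φ => ?_, fun φ hφ => ⟨?_, ?_, h.intervalIntegrable_error hφ, ?_⟩⟩
  · rw [h.error_apply ht]
    refine (hC (hκr t ht) hψ hpp φ.2.1 φ.2.2).trans_eq ?_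
    have he : κ' t =ᵐ[AlphaPatch.torusMeasure] κ t :=
      (hκe t ht).filter_mono (ae_mono Measure.restrict_le_self)
    rw [eLpNorm_congr_ae he]
  · exact (h.intervalIntegrable_time_deriv hφ).congr fun t ht =>
      (hcongr t (hIoc t ht) (fun x => ‖deriv (γ t) x‖) _).symm
  · exact (h.intervalIntegrable_dispersive hφ).congr fun t ht =>
      (hcongr t (hIoc t ht) (fun x => ‖deriv (γ t) x‖ ^ (1 - 2 * α)) _).symm
  · rw [hcongr' T ⟨hT.le, le_rfl⟩, hcongr' 0 ⟨le_rfl, hT.le⟩, h.integral_curvature_sub_eq hφ]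
    congr 2
    · exact intervalIntegral.integral_congr fun t ht =>
        (hcongr t (hIcc t ht) (fun x => ‖deriv (γ t) x‖) _).symm
    · congr 1
      exact intervalIntegral.integral_congr fun t ht =>
        (hcongr t (hIcc t ht) (fun x => ‖deriv (γ t) x‖ ^ (1 - 2 * α)) _).symm
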